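/- Let $R\subset\mathbb R^n$ be an irreducible reduced (crystallographic) root system with simple roots $\alpha_i$, positive roots $R_+$, Weyl group $W$, weight lattice $P$ with fundamental weights $\omega_i$, the $W$-invariant form $(\cdot,\cdot)$ normalized by $(\alpha,\alpha)=2$ for the short roots, and Coxeter number $h=1+(\rho,\vartheta)$, where $\rho$ is half the sum of the positive roots and $\vartheta$ is the maximal coroot. Assume that $1+h=p$ is prime and put $k=-(1+1/h)$. For a commutative ring $A$ in which $h$ and the denominators of $(P,P)$ are invertible, the rational double affine Hecke algebra $H''_A$ is the $A$-algebra generated by $W$ and by elements $x_b$, $D_b$ ($b\in P$), additive in $b$, with the relations $[x_b,x_c]=0=[D_b,D_c]$, $wx_bw^{-1}=x_{w(b)}$, $wD_bw^{-1}=D_{w(b)}$ and $$D_bx_c-x_cD_b=(b,c)+k\sum_{\alpha\in R_+}(b,\alpha)(c,\alpha^\vee)s_\alpha .$$ It acts on $A[x]=A[x_{\omega_1},\dots,x_{\omega_n}]$: $x_b$ by multiplication, $W$ naturally, and $D_b$ by the Dunkl operator $d_b+k\sum_{\alpha\in R_+}\frac{(b,\alpha)}{x_\alpha}(1-s_\alpha)$,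 where $d_b(x_c)=(b,c)$. For a domain $A$ let $J_A\subset A[x]$ be the largest $H''_A$-submodule containing no nonzero constants, and $V''_A=A[x]/J_A$. Put $\delta=\prod_{\alpha\in R_+}x_\alpha$, let $I_o$ be the set of elements of $(H''_A)^W$ that kill the image of $\delta$ in $V''_A$, and $\tilde V''_A=H''_A\delta/H''_AI_o\delta$, where $H''_A\delta\subset A[x]$. 1. (Gordon's theorem for such $h$.) Let $K$ be a field of characteristic $0$. Then $V''_K$ is irreducible, it is the unique irreducible quotient of $K[x]$, and $\dim_KV''_K=p^n$. The image of $\delta$ in $V''_K$ is nonzero and spans the subspace on which $W$ acts by $\mathrm{sgn}$. The module $\tilde V''_K$ is irreducible and the natural map $\tilde V''_K\to V''_K$ is an isomorphism. Also, the quotient of the $H''_K$-module induced from the sign character of $W$ by the submodule generated by the image of $I_o$ is isomorphic to $V''_K$, with the generator going to the image of $\delta$. 2. (Modular reduction.) Over $\mathbb Z_p$, the ideal $J_{\mathbb Z_p}$ is the intersection of $\mathbb Z_p[x]$ with $J_{\mathbb Q_p}$. One has $k=0$ in $\mathbb F_p$. The algebra $\mathbb F_p\otimes_{\mathbb Z_p}H''_{\mathbb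 Z_p}$ is naturally isomorphic to $H''_{\mathbb F_p}$, which is the semidirect product (smash product) of $W$ with the algebra $\mathcal D$ of differential operators in $x$ over $\mathbb F_p$, that is, the algebra with generators $x_i,\partial_i$ ($1\le i\le n$) and relations $[x_i,x_j]=0=[\partial_i,\partial_j]$, $[\partial_i,x_j]=\delta_{ij}$; here $x_i=x_{\omega_i}$ and $D_b=\sum_i(b,\omega_i)\partial_i$, and on $\mathbb F_p[x]$ the subalgebra $\mathcal D$ acts in the standard way. 3. The $\mathcal D$-module $\mathbb F_p[x]/(x^p)=\mathbb F_p[x]/(x_1^p,\dots,x_n^p)$ is irreducible, of dimension $p^n$, with nilpotent $x_i$ and $\partial_i$, and each irreducible $\mathcal D$-module with nilpotent $x_i$ and $\partial_i$ is isomorphic to it. 4. $(x^p)$ is an $H''_{\mathbb F_p}$-submodule of $\mathbb F_p[x]$, the module $M=\mathbb F_p[x]/(x^p)$ is irreducible of dimension $p^n$, and the subspace of $M$ on which $W$ acts by $\mathrm{sgn}$ is spanned by the image $\bar\delta\neq0$ of $\delta$. The reduction of polynomials modulo $p$ induces isomorphisms $\mathbb F_p\otimes V''_{\mathbb Z_p}\cong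 M\cong\mathbb F_p\otimes\tilde V''_{\mathbb Z_p}$ of modules over $\mathbb F_p\otimes H''_{\mathbb Z_p}$; in particular $\mathbb F_p\otimes\tilde V''_{\mathbb Z_p}$ is irreducible. 5. Let $W$ act diagonally on $\mathbb F_p[x,y]$ and let $\mathbb F_p[x,y]^W_o$ be the set of the invariants without constant term. For $f\in\mathbb F_p[x,y]$ let $f(x,D)\in H''_{\mathbb F_p}$ be the result of replacing $y$ by $D$, with $x$ placed to the left of $D$; let $F_{<d}M$ be the span of the vectors $f(x,D)\bar\delta$ for $f$ of total degree $<d$. Then the algebra of diagonal coinvariants $\mathbb F_p[x,y]/(\mathbb F_p[x,y]\,\mathbb F_p[x,y]^W_o)$ has an ideal whose elements are the classes of exactly those $f$ for which $f_d(x,D)\bar\delta\in F_{<d}M$ for every homogeneous component $f_d$ of $f$ of degree $d\geq 0$. The quotient by this ideal, i.e. the graded space of $M\cong\mathbb F_p\otimes V''_{\mathbb Z_p}$ with respect to the total $x,y$-degree, has dimension $p^n$ and is isomorphic to $M$ as a $W$-module up to a twist by $\mathrm{sgn}$. -/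

import Mathlib

open Module
open scoped TensorProduct

set_option linter.unusedSectionVars false

noncomputable section

namespace DAHA

/-! ### The weight lattice, the normalized form, the Coxeter number -/

section Lattice

variable {ι V N : Type*} [AddCommGroup V] [Module ℝ V] [AddCommGroup N] [Module ℝ N]
  (P : RootPairing ι ℝ V N)

/-- The weight lattice: all vectors whose pairings with all coroots are integers. -/
def weightLattice : AddSubgroup V where
  carrier := {v | ∀ i, ∃ z : ℤ, P.coroot' i v = z}
  zero_mem' := fun _ => ⟨0, by simp⟩
  add_mem' := by
    intro u v hu hv i
    obtain ⟨a, ha⟩ := hu i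
    obtain ⟨c, hc⟩ := hv i
    exact ⟨a + c, by rw [map_add, ha, hc]; push_cast; rfl⟩
  neg_mem' := by
    intro u hu i
    obtain ⟨a, ha⟩ := hu i
    exact ⟨-a, by rw [map_neg, ha]; push_cast; rfl⟩

/-- The integer `(v, αᵢ^∨)` for a weight `v`. -/
def corootPairing (i : ι) (v : weightLattice P) : ℤ := ⌊P.coroot' i (v : V)⌋

theorem corootPairing_cast (i : ι) (v : weightLattice P) :
    ((corootPairing P i v : ℤ) : ℝ) = P.coroot' i (v : V) := by
  obtain ⟨z, hz⟩ := v.2 i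
  rw [corootPairing, hz, Int.floor_intCast]

theorem corootPairing_add (i : ι) (u v : weightLattice P) :
    corootPairing P i (u + v) = corootPairing P i u + corootPairing P i v := by
  have : ((corootPairing P i (u + v) : ℤ) : ℝ)
      = ((corootPairing P i u + corootPairing P i v : ℤ) : ℝ) := by
    push_cast
    simp only [corootPairing_cast, AddSubgroup.coe_add, map_add]
  exact_mod_cast this

/-- The Weyl group permutes the coroots. -/
theorem coroot'_smul (g : P.weylGroup) (i : ι) (v : V) :
    P.coroot' (P.weylGroupToPerm g i) (g • v) = P.coroot' i v := by
  obtain ⟨g, hg⟩ := g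
  induction hg using RootPairing.weylGroup.induction generalizing i v with
  | mem j =>
    have h1 : (⟨RootPairing.Equiv.reflection P j, P.reflection_mem_weylGroup j⟩ : P.weylGroup) • v
        = P.reflection j v := by
      change RootPairing.Equiv.reflection P j • v = _
      simp
    have h2 : P.weylGroupToPerm
        ⟨RootPairing.Equiv.reflection P j, P.reflection_mem_weylGroup j⟩ i
        = P.reflectionPerm j i := by
      simp
    rw [h1, h2, RootPairing.coroot'_reflection, RootPairing.reflectionPerm_self]
  | one =>
    have h1 : ((⟨1, one_mem _⟩ : P.weylGroup)) = 1 := rfl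
    rw [h1, map_one, one_smul]; rfl
  | mul x y hx hy ihx ihy =>
    have h1 : (⟨x * y, mul_mem hx hy⟩ : P.weylGroup) = ⟨x, hx⟩ * ⟨y, hy⟩ := rfl
    rw [h1, mul_smul, map_mul, Equiv.Perm.mul_apply, ihx, ihy]

theorem smul_mem_weightLattice (g : P.weylGroup) {v : V} (hv : v ∈ weightLattice P) :
    g • v ∈ weightLattice P := by
  intro i
  obtain ⟨z, hz⟩ := hv (P.weylGroupToPerm g⁻¹ i)
  refine ⟨z, ?_⟩
  rw [← hz, ← coroot'_smul P g (P.weylGroupToPerm g⁻¹ i) v, ← Equiv.Perm.mul_apply, ← map_mul,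
    mul_inv_cancel, map_one, Equiv.Perm.one_apply]

/-- The action of the Weyl group on the weight lattice. -/
instance : DistribMulAction P.weylGroup (weightLattice P) where
  smul g v := ⟨g • (v : V), smul_mem_weightLattice P g v.2⟩
  one_smul v := Subtype.ext (one_smul _ (v : V))
  mul_smul g g' v := Subtype.ext (mul_smul g g' (v : V))
  smul_zero g := Subtype.ext (smul_zero g)
  smul_add g u v := Subtype.ext (smul_add g (u : V) (v : V))

theorem coe_smul (g : P.weylGroup) (v : weightLattice P) :
    ((g • v : weightLattice P) : V) = g • (v : V) := rfl

theorem corootPairing_smul (g : P.weylGroup) (i : ι) (v : weightLattice P) :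
    corootPairing P (P.weylGroupToPerm g i) (g • v) = corootPairing P i v := by
  rw [corootPairing, corootPairing, coe_smul, coroot'_smul]

/-- The root `αᵢ` as an element of the weight lattice. -/
def rootWeight [P.IsCrystallographic] (i : ι) : weightLattice P :=
  ⟨P.root i, fun j => ⟨P.pairingIn ℤ i j, by
    rw [RootPairing.root_coroot'_eq_pairing, ← P.algebraMap_pairingIn ℤ]; rfl⟩⟩

theorem smul_rootWeight [P.IsCrystallographic] (g : P.weylGroup) (i : ι) :
    g • rootWeight P i = rootWeight P (P.weylGroupToPerm g i) :=
  Subtype.ext (P.weylGroup_apply_root g i)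

theorem rootWeight_neg [P.IsCrystallographic] (i : ι) :
    rootWeight P (P.reflectionPerm i i) = -rootWeight P i :=
  Subtype.ext (by simp [rootWeight])

theorem corootPairing_neg (i : ι) (v : weightLattice P) :
    corootPairing P (P.reflectionPerm i i) v = -corootPairing P i v := by
  have : ((corootPairing P (P.reflectionPerm i i) v : ℤ) : ℝ)
      = ((-corootPairing P i v : ℤ) : ℝ) := by
    push_cast
    rw [corootPairing_cast, corootPairing_cast, ← RootPairing.coroot'_reflection,
      RootPairing.reflection_apply]
    simp
    ring
  exact_mod_cast this

/-- The formula for the reflection `s_α` on the weight lattice. -/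
theorem ofIdx_smul_eq [P.IsCrystallographic] (i : ι) (v : weightLattice P) :
    RootPairing.weylGroup.ofIdx P i • v = v - corootPairing P i v • rootWeight P i := by
  apply Subtype.ext
  rw [coe_smul, RootPairing.weylGroup.ofIdx_smul]
  have : RootPairing.Equiv.reflection P i • (v : V) = P.reflection i (v : V) := by simp
  rw [this, RootPairing.reflection_apply, ← corootPairing_cast]
  simp [rootWeight, Int.cast_smul_eq_zsmul]

end Lattice

section Form

variable {ι V N : Type*} [Fintype ι] [AddCommGroup V] [Module ℝ V] [AddCommGroup N] [Module ℝ N]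
  (P : RootPairing ι ℝ V N)

/-- The Weyl group invariant inner product, normalized by `(α, α) = 2` for the short roots:
the canonical invariant form `∑ᵢ (u, αᵢ^∨) (v, αᵢ^∨)`, rescaled. -/
def normForm : LinearMap.BilinForm ℝ V :=
  (2 / ⨅ i, P.RootForm (P.root i) (P.root i)) • P.RootForm

/-- The least natural number `m > 0` with `m (u, v) ∈ ℤ` for all weights `u, v`. -/
def latticeDenom : ℕ :=
  sInf {m : ℕ | 0 < m ∧ ∀ u v : weightLattice P, ∃ z : ℤ, (m : ℝ) * normForm P u v = z}

theorem latticeDenom_spec (u v : weightLattice P) :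
    ∃ z : ℤ, (latticeDenom P : ℝ) * normForm P u v = z := by
  rcases Set.eq_empty_or_nonempty
    {m : ℕ | 0 < m ∧ ∀ u v : weightLattice P, ∃ z : ℤ, (m : ℝ) * normForm P u v = z} with h | h
  · exact ⟨0, by rw [latticeDenom, h]; simp⟩
  · exact (Nat.sInf_mem h).2 u v

/-- The integer `m (u, v)`. -/
def intForm (u v : weightLattice P) : ℤ := ⌊(latticeDenom P : ℝ) * normForm P u v⌋

theorem intForm_cast (u v : weightLattice P) :
    ((intForm P u v : ℤ) : ℝ) = (latticeDenom P : ℝ) * normForm P u v := by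
  obtain ⟨z, hz⟩ := latticeDenom_spec P u v
  rw [intForm, hz, Int.floor_intCast]

/-- The value `(u, v) = m⁻¹ · (m (u, v))` in a commutative ring `A` in which `m` is invertible. -/
def ringForm (A : Type*) [CommRing A] (u v : weightLattice P) : A :=
  Ring.inverse (latticeDenom P : A) * (intForm P u v : A)

theorem intForm_add_left (u u' v : weightLattice P) :
    intForm P (u + u') v = intForm P u v + intForm P u' v := by
  have : ((intForm P (u + u') v : ℤ) : ℝ) = ((intForm P u v + intForm P u' v : ℤ) : ℝ) := by
    push_cast
    simp only [intForm_cast, AddSubgroup.coe_add, map_add, LinearMap.add_apply]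
    ring
  exact_mod_cast this

theorem intForm_add_right (u v v' : weightLattice P) :
    intForm P u (v + v') = intForm P u v + intForm P u v' := by
  have : ((intForm P u (v + v') : ℤ) : ℝ) = ((intForm P u v + intForm P u v' : ℤ) : ℝ) := by
    push_cast
    simp only [intForm_cast, AddSubgroup.coe_add, map_add]
    ring
  exact_mod_cast this

theorem normForm_smul [P.IsCrystallographic] (g : P.weylGroup) (u v : V) :
    normForm P (g • u) (g • v) = normForm P u v := by
  have h : P.RootForm (g • u) (g • v) = P.RootForm u v := by
    obtain ⟨g, hg⟩ := g
    induction hg using RootPairing.weylGroup.induction generalizing u v with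
    | mem j =>
      have h1 : ∀ v : V, (⟨RootPairing.Equiv.reflection P j,
          P.reflection_mem_weylGroup j⟩ : P.weylGroup) • v = P.reflection j v := by
        intro v
        change RootPairing.Equiv.reflection P j • v = _
        simp
      rw [h1, h1, RootPairing.rootForm_reflection_reflection_apply]
    | one =>
      have h1 : ((⟨1, one_mem _⟩ : P.weylGroup)) = 1 := rfl
      rw [h1, one_smul, one_smul]
    | mul x y hx hy ihx ihy =>
      have h1 : (⟨x * y, mul_mem hx hy⟩ : P.weylGroup) = ⟨x, hx⟩ * ⟨y, hy⟩ := rfl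
      rw [h1, mul_smul, mul_smul, ihx, ihy]
  simp [normForm, h]

theorem intForm_smul [P.IsCrystallographic] (g : P.weylGroup) (u v : weightLattice P) :
    intForm P (g • u) (g • v) = intForm P u v := by
  rw [intForm, intForm, coe_smul, coe_smul, normForm_smul]

/-- `2 (u, α) = (α, α) (u, α^∨)`. -/
theorem two_mul_normForm_root [P.IsCrystallographic] (i : ι) (u : V) :
    2 * normForm P u (P.root i) = normForm P (P.root i) (P.root i) * P.coroot' i u := by
  have h := P.rootForm_reflection_reflection_apply i u (P.root i)
  rw [RootPairing.reflection_apply_self, RootPairing.reflection_apply] at h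
  simp only [map_sub, map_neg, map_smul, LinearMap.sub_apply, LinearMap.smul_apply,
    smul_eq_mul] at h
  have h2 : 2 * P.RootForm u (P.root i) = P.RootForm (P.root i) (P.root i) * P.coroot' i u := by
    linarith
  simp only [normForm, LinearMap.smul_apply, smul_eq_mul]
  linear_combination (2 / ⨅ i, P.RootForm (P.root i) (P.root i)) * h2

theorem intForm_root_mul [P.IsCrystallographic] (i : ι) (u v : weightLattice P) :
    intForm P u (rootWeight P i) * corootPairing P i v
      = intForm P v (rootWeight P i) * corootPairing P i u := by
  have : ((intForm P u (rootWeight P i) * corootPairing P i v : ℤ) : ℝ)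
      = ((intForm P v (rootWeight P i) * corootPairing P i u : ℤ) : ℝ) := by
    push_cast
    rw [intForm_cast, intForm_cast, corootPairing_cast, corootPairing_cast]
    have h1 := two_mul_normForm_root P i (u : V)
    have h2 := two_mul_normForm_root P i (v : V)
    simp only [rootWeight]
    linear_combination (latticeDenom P : ℝ) / 2 * P.coroot' i (v : V) * h1
      - (latticeDenom P : ℝ) / 2 * P.coroot' i (u : V) * h2
  exact_mod_cast this

variable (A : Type*) [CommRing A]

theorem ringForm_add_left (u u' v : weightLattice P) :
    ringForm P A (u + u') v = ringForm P A u v + ringForm P A u' v := by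
  simp only [ringForm, intForm_add_left]; push_cast; ring

theorem ringForm_add_right (u v v' : weightLattice P) :
    ringForm P A u (v + v') = ringForm P A u v + ringForm P A u v' := by
  simp only [ringForm, intForm_add_right]; push_cast; ring

/-- The form as a bi-additive map. -/
def ringFormHom (u : weightLattice P) : weightLattice P →+ A :=
  AddMonoidHom.mk' (ringForm P A u) (ringForm_add_right P A u)

theorem ringForm_smul [P.IsCrystallographic] (g : P.weylGroup) (u v : weightLattice P) :
    ringForm P A (g • u) (g • v) = ringForm P A u v := by
  rw [ringForm, ringForm, intForm_smul]

theorem ringForm_root_mul [P.IsCrystallographic] (i : ι) (u v : weightLattice P) :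
    ringForm P A u (rootWeight P i) * (corootPairing P i v : A)
      = ringForm P A v (rootWeight P i) * (corootPairing P i u : A) := by
  have h := congrArg (Int.cast : ℤ → A) (intForm_root_mul P i u v)
  push_cast at h
  rw [ringForm, ringForm, mul_assoc, mul_assoc, h]

end Form

section Base

variable {ι V N : Type*} [AddCommGroup V] [Module ℝ V] [AddCommGroup N] [Module ℝ N]
  {P : RootPairing ι ℝ V N} (b : P.Base)

open Classical in
/-- The indices of the positive roots. -/
def posRoots [Fintype ι] : Finset ι := Finset.univ.filter b.IsPos

/-- `ρ`, half the sum of the positive roots. -/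
def rho [Fintype ι] : V := (1 / 2 : ℝ) • ∑ i ∈ posRoots b, P.root i

/-- The Coxeter number `h = 1 + (ρ, ϑ)`, where `ϑ` is the maximal coroot. As `ρ` is dominant and
`ϑ - α^∨` is a sum of positive coroots for each coroot `α^∨`, the number `(ρ, ϑ)` (which is
the height of `ϑ`) is the maximum of the numbers `(ρ, α^∨)`. -/
def coxeterNumber [Fintype ι] : ℕ := 1 + ⌊⨆ i, P.coroot' i (rho b)⌋₊

/-- The parameter `k = -(1 + 1/h)` in a commutative ring in which `h` is invertible. -/
def kParam [Fintype ι] (A : Type*) [CommRing A] : A :=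
  -(1 + Ring.inverse (coxeterNumber b : A))

theorem fundWeight_aux [P.IsRootSystem] (j : b.support) (i : ι) :
    ∃ z : ℤ, b.toCoweightBasis.coord j (P.coroot i) = z := by
  have h := b.coroot_mem_span_int i
  generalize P.coroot i = x at h
  induction h using Submodule.span_induction with
  | mem x hx =>
    obtain ⟨l, hl, rfl⟩ := hx
    have := b.toCoweightBasis_repr_coroot ⟨l, hl⟩
    classical
    refine ⟨if (⟨l, hl⟩ : b.support) = j then 1 else 0, ?_⟩
    rw [Basis.coord_apply, this, Finsupp.single_apply]
    push_cast
    rfl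
  | zero => exact ⟨0, by simp⟩
  | add x y _ _ hx hy =>
    obtain ⟨a, ha⟩ := hx
    obtain ⟨c, hc⟩ := hy
    exact ⟨a + c, by rw [map_add, ha, hc]; push_cast; rfl⟩
  | smul a x _ hx =>
    obtain ⟨c, hc⟩ := hx
    exact ⟨a * c, by rw [map_zsmul, hc]; push_cast; simp⟩

/-- The fundamental weight `ω_j`, defined by `(ω_j, α_l^∨) = δ_{jl}` for simple coroots. -/
def fundWeight [P.IsRootSystem] (j : b.support) : weightLattice P :=
  ⟨P.toLinearMap.toPerfPair.symm (b.toCoweightBasis.coord j), fun i => by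
    obtain ⟨z, hz⟩ := fundWeight_aux b j i
    refine ⟨z, ?_⟩
    rw [← hz]
    change P.toLinearMap (P.toLinearMap.toPerfPair.symm _) (P.coroot i) = _
    rw [LinearMap.apply_symm_toPerfPair_self]⟩

/-- Every weight `v` is `∑_j (v, α_j^∨) ω_j`. -/
theorem eq_sum_fundWeight [P.IsRootSystem] (v : weightLattice P) :
    v = ∑ j : b.support, corootPairing P j v • fundWeight b j := by
  apply Subtype.ext
  apply P.toLinearMap.toPerfPair.injective
  apply b.toCoweightBasis.ext
  intro l
  simp only [AddSubgroup.val_finsetSum, AddSubgroup.coe_zsmul, fundWeight, map_sum, map_zsmul,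
    LinearEquiv.apply_symm_apply, LinearMap.sum_apply, LinearMap.smul_apply]
  rw [Finset.sum_eq_single l]
  · rw [Basis.coord_apply, Basis.repr_self, Finsupp.single_eq_same, b.toCoweightBasis_apply,
      zsmul_eq_mul, mul_one, corootPairing_cast]
    rfl
  · intro j _ hj
    rw [Basis.coord_apply, Basis.repr_self, Finsupp.single_eq_of_ne hj, smul_zero]
  · simp

end Base

/-! ### Polynomials, the Weyl group action and the Dunkl operators -/

section Dunkl

variable {ι V N : Type*} [Fintype ι] [AddCommGroup V] [Module ℝ V] [AddCommGroup N] [Module ℝ N]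
  {P : RootPairing ι ℝ V N} [P.IsRootSystem] [P.IsCrystallographic] (b : P.Base)
  (A : Type*) [CommRing A]

open MvPolynomial

/-- The linear polynomial `x_v = ∑_j (v, α_j^∨) x_{ω_j}`; the variables are `x_{ω_j}`. -/
def xPoly (v : weightLattice P) : MvPolynomial b.support A :=
  ∑ j : b.support, (corootPairing P j v : MvPolynomial b.support A) * X j

/-- The action of `g ∈ W` on polynomials by algebra automorphisms, `g (x_v) = x_{g v}`. -/
def weylAct (g : P.weylGroup) : MvPolynomial b.support A →ₐ[A] MvPolynomial b.support A :=
  aeval fun j => xPoly b A (g • fundWeight b j)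

/-- The derivation `d_u` with `d_u (x_v) = (u, v)`. -/
def deriv (u : weightLattice P) :
    Derivation A (MvPolynomial b.support A) (MvPolynomial b.support A) :=
  mkDerivation A fun j => C (ringForm P A u (fundWeight b j))

/-- The substitution `f(x) ↦ f(x - t α^∨)` that sends `x_v` to `x_v - (v, α^∨) t`. -/
def shift (i : ι) : MvPolynomial b.support A →ₐ[A] Polynomial (MvPolynomial b.support A) :=
  aeval fun j => Polynomial.C (X j) -
    (corootPairing P i (fundWeight b j) : Polynomial (MvPolynomial b.support A)) * Polynomial.X

theorem xPoly_add (u v : weightLattice P) : xPoly b A (u + v) = xPoly b A u + xPoly b A v := by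
  simp only [xPoly, corootPairing_add, Int.cast_add, add_mul, Finset.sum_add_distrib]

/-- `v ↦ x_v` as an additive map. -/
def xHom : weightLattice P →+ MvPolynomial b.support A :=
  AddMonoidHom.mk' (xPoly b A) (xPoly_add b A)

/-- Two additive maps on the weight lattice that agree on the fundamental weights are equal. -/
theorem addHom_ext {G : Type*} [AddCommGroup G] {f f' : weightLattice P →+ G}
    (h : ∀ j, f (fundWeight b j) = f' (fundWeight b j)) (v : weightLattice P) : f v = f' v := by
  rw [eq_sum_fundWeight b v]
  simp only [map_sum, map_zsmul, h]

theorem map_eq_sum {G : Type*} [AddCommGroup G] (f : weightLattice P →+ G)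
    (v : weightLattice P) :
    f v = ∑ j : b.support, corootPairing P j v • f (fundWeight b j) := by
  conv_lhs => rw [eq_sum_fundWeight b v]
  simp only [map_sum, map_zsmul]

theorem weylAct_xPoly (g : P.weylGroup) (v : weightLattice P) :
    weylAct b A g (xPoly b A v) = xPoly b A (g • v) := by
  have h := map_eq_sum b
    ((xHom b A).comp (DistribSMul.toAddMonoidHom (weightLattice P) g)) v
  simp only [AddMonoidHom.comp_apply, DistribSMul.toAddMonoidHom_apply] at h
  change _ = xHom b A (g • v)
  rw [h, xPoly, map_sum]
  refine Finset.sum_congr rfl fun j _ => ?_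
  rw [map_mul, map_intCast, weylAct, aeval_X, zsmul_eq_mul]
  rfl

theorem deriv_xPoly (u v : weightLattice P) :
    deriv b A u (xPoly b A v) = C (ringForm P A u v) := by
  have h := map_eq_sum b (ringFormHom P A u) v
  change ringForm P A u v = _ at h
  rw [h, xPoly, map_sum, map_sum]
  refine Finset.sum_congr rfl fun j _ => ?_
  rw [← zsmul_eq_mul, map_zsmul, map_zsmul, deriv, mkDerivation_X]
  rfl

/-- `v ↦ (v, αᵢ^∨)` as an additive map. -/
def corootHom (i : ι) : weightLattice P →+ ℤ :=
  AddMonoidHom.mk' (corootPairing P i) (corootPairing_add P i)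

theorem shift_xPoly (i : ι) (v : weightLattice P) :
    shift b A i (xPoly b A v) = Polynomial.C (xPoly b A v) -
      (corootPairing P i v : Polynomial (MvPolynomial b.support A)) * Polynomial.X := by
  have h := map_eq_sum b (corootHom (P := P) i) v
  change corootPairing P i v = _ at h
  rw [h, xPoly, map_sum, map_sum, Int.cast_sum, Finset.sum_mul, ← Finset.sum_sub_distrib]
  refine Finset.sum_congr rfl fun j _ => ?_
  rw [map_mul, map_intCast, shift, aeval_X, map_mul, map_intCast, smul_eq_mul, Int.cast_mul]
  change _ = _ - (((corootPairing P j v : ℤ) : Polynomial (MvPolynomial b.support A)) *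
    (corootPairing P i (fundWeight b j) : ℤ)) * _
  ring

theorem xPoly_fundWeight (j : b.support) : xPoly b A (fundWeight b j) = X j := by
  classical
  have h : ∀ l : b.support, corootPairing P l (fundWeight b j) = if l = j then 1 else 0 := by
    intro l
    have h1 : P.coroot' l (fundWeight b j : V) = if l = j then 1 else 0 := by
      change P.toLinearMap (P.toLinearMap.toPerfPair.symm _) (P.coroot l) = _
      rw [LinearMap.apply_symm_toPerfPair_self, Basis.coord_apply,
        b.toCoweightBasis_repr_coroot l, Finsupp.single_apply]
    have h2 : ((corootPairing P l (fundWeight b j) : ℤ) : ℝ)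
        = ((if l = j then 1 else 0 : ℤ) : ℝ) := by
      rw [corootPairing_cast, h1]; split_ifs <;> simp
    exact_mod_cast h2
  rw [xPoly, Finset.sum_eq_single j]
  · rw [h, if_pos rfl, Int.cast_one, one_mul]
  · intro l _ hl
    rw [h, if_neg hl, Int.cast_zero, zero_mul]
  · simp

theorem poly_induction {p : MvPolynomial b.support A → Prop} (hC : ∀ a, p (C a))
    (hadd : ∀ f f', p f → p f' → p (f + f'))
    (hx : ∀ v f, p f → p (xPoly b A v * f)) (f : MvPolynomial b.support A) : p f := by
  induction f using MvPolynomial.induction_on with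
  | C a => exact hC a
  | add f f' h h' => exact hadd f f' h h'
  | mul_X f j h => rw [mul_comm, ← xPoly_fundWeight]; exact hx _ _ h

theorem algHom_ext {B : Type*} [CommRing B] [Algebra A B]
    {φ ψ : MvPolynomial b.support A →ₐ[A] B}
    (h : ∀ v, φ (xPoly b A v) = ψ (xPoly b A v)) : φ = ψ := by
  apply MvPolynomial.algHom_ext
  intro j
  rw [← xPoly_fundWeight]
  exact h _

/-- The divided difference `f ↦ (f - s_α f) / x_α`. Writing `f(x - t α^∨) = f - t q(x, t)`, it
is `q(x, x_α)`; see `xPoly_mul_divDiff` for the identity `x_α · divDiff f = f - s_α f`. -/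
def divDiff (i : ι) : MvPolynomial b.support A →ₗ[A] MvPolynomial b.support A where
  toFun f := -((shift b A i f).divX.eval (xPoly b A (rootWeight P i)))
  map_add' f f' := by
    rw [map_add, Polynomial.divX_add, Polynomial.eval_add, neg_add]
  map_smul' a f := by
    have h : shift b A i (a • f) = Polynomial.C (C a) * shift b A i f := by
      rw [map_smul, Algebra.smul_def]; rfl
    rw [h, Polynomial.divX_C_mul, Polynomial.eval_mul, Polynomial.eval_C, RingHom.id_apply,
      MvPolynomial.smul_eq_C_mul, mul_neg]

theorem shift_coeff_zero (i : ι) (f : MvPolynomial b.support A) :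
    (shift b A i f).coeff 0 = f := by
  have h : ((Polynomial.aeval (0 : MvPolynomial b.support A)).restrictScalars A).comp
      (shift b A i) = AlgHom.id A _ := by
    apply algHom_ext
    intro v
    rw [AlgHom.comp_apply, shift_xPoly]
    simp
  have h1 := DFunLike.congr_fun h f
  rw [AlgHom.comp_apply] at h1
  simpa [Polynomial.coeff_zero_eq_aeval_zero] using h1

theorem shift_eval (i : ι) (f : MvPolynomial b.support A) :
    (shift b A i f).eval (xPoly b A (rootWeight P i))
      = weylAct b A (RootPairing.weylGroup.ofIdx P i) f := by
  have h : ((Polynomial.aeval (xPoly b A (rootWeight P i))).restrictScalars A).comp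
      (shift b A i) = weylAct b A (RootPairing.weylGroup.ofIdx P i) := by
    apply algHom_ext
    intro v
    have h2 : xPoly b A (RootPairing.weylGroup.ofIdx P i • v)
        = xPoly b A v - corootPairing P i v • xPoly b A (rootWeight P i) := by
      rw [ofIdx_smul_eq]
      exact ((xHom b A).map_sub _ _).trans (by rw [map_zsmul]; rfl)
    rw [AlgHom.comp_apply, shift_xPoly, weylAct_xPoly, h2]
    simp
  have h1 := DFunLike.congr_fun h f
  rw [AlgHom.comp_apply] at h1
  simpa using h1

theorem xPoly_mul_divDiff (i : ι) (f : MvPolynomial b.support A) :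
    xPoly b A (rootWeight P i) * divDiff b A i f
      = f - weylAct b A (RootPairing.weylGroup.ofIdx P i) f := by
  have h := congrArg (Polynomial.eval (xPoly b A (rootWeight P i)))
    (Polynomial.divX_mul_X_add (shift b A i f))
  rw [Polynomial.eval_add, Polynomial.eval_mul, Polynomial.eval_X, Polynomial.eval_C,
    shift_coeff_zero, shift_eval] at h
  rw [← h]
  change _ * -_ = _
  ring

theorem divX_sub_mul_X {B : Type*} [CommRing B] (c d : B) (q : Polynomial B) :
    ((Polynomial.C c - Polynomial.C d * Polynomial.X) * q).divX
      = Polynomial.C c * q.divX - Polynomial.C d * q := by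
  ext n
  rw [Polynomial.coeff_divX, sub_mul, mul_assoc]
  simp [Polynomial.coeff_divX]

theorem divDiff_mul (i : ι) (v : weightLattice P) (f : MvPolynomial b.support A) :
    divDiff b A i (xPoly b A v * f) = xPoly b A v * divDiff b A i f
      + (corootPairing P i v : A) • weylAct b A (RootPairing.weylGroup.ofIdx P i) f := by
  change -_ = _ * -_ + _
  have h : (corootPairing P i v : Polynomial (MvPolynomial b.support A))
      = Polynomial.C (corootPairing P i v : MvPolynomial b.support A) := by simp
  rw [map_mul, shift_xPoly, h, divX_sub_mul_X, ← shift_eval, MvPolynomial.smul_eq_C_mul]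
  rw [Polynomial.eval_sub, Polynomial.eval_mul, Polynomial.eval_mul, Polynomial.eval_C,
    Polynomial.eval_C, map_intCast]
  ring

theorem divDiff_C (i : ι) (a : A) : divDiff b A i (C a) = 0 := by
  change -_ = _
  have h : shift b A i (C a) = Polynomial.C (C a) := by
    rw [← MvPolynomial.algebraMap_eq, AlgHom.commutes]; rfl
  rw [h, Polynomial.divX_C, Polynomial.eval_zero, neg_zero]

theorem weylAct_one : weylAct b A (1 : P.weylGroup) = AlgHom.id A _ := by
  apply algHom_ext
  intro v
  rw [weylAct_xPoly, one_smul]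
  rfl

theorem weylAct_mul (g g' : P.weylGroup) :
    weylAct b A (g * g') = (weylAct b A g).comp (weylAct b A g') := by
  apply algHom_ext
  intro v
  rw [AlgHom.comp_apply, weylAct_xPoly, weylAct_xPoly, weylAct_xPoly, mul_smul]

theorem weylAct_divDiff (g : P.weylGroup) (i : ι) (f : MvPolynomial b.support A) :
    weylAct b A g (divDiff b A i f)
      = divDiff b A (P.weylGroupToPerm g i) (weylAct b A g f) := by
  induction f using poly_induction with
  | hC a =>
    rw [divDiff_C, map_zero, ← MvPolynomial.algebraMap_eq, AlgHom.commutes,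
      MvPolynomial.algebraMap_eq, divDiff_C]
  | hadd f f' h h' => simp only [map_add, h, h']
  | hx v f h =>
    have hconj : (weylAct b A g).comp (weylAct b A (RootPairing.weylGroup.ofIdx P i))
        = (weylAct b A (RootPairing.weylGroup.ofIdx P (P.weylGroupToPerm g i))).comp
          (weylAct b A g) := by
      apply algHom_ext
      intro v
      rw [AlgHom.comp_apply, AlgHom.comp_apply, weylAct_xPoly, weylAct_xPoly, weylAct_xPoly,
        weylAct_xPoly, ofIdx_smul_eq, ofIdx_smul_eq, corootPairing_smul, smul_sub,
        ← smul_rootWeight]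
      have hz := map_zsmul (DistribSMul.toAddMonoidHom (weightLattice P) g)
        (corootPairing P i v) (rootWeight P i)
      simp only [DistribSMul.toAddMonoidHom_apply] at hz
      rw [hz]
    have hconj' := DFunLike.congr_fun hconj f
    rw [AlgHom.comp_apply, AlgHom.comp_apply] at hconj'
    rw [divDiff_mul, map_add, map_mul, map_smul, h, map_mul, weylAct_xPoly, divDiff_mul,
      corootPairing_smul, hconj']

theorem divDiff_neg (i : ι) (f : MvPolynomial b.support A) :
    divDiff b A (P.reflectionPerm i i) f = -divDiff b A i f := by
  induction f using poly_induction with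
  | hC a => rw [divDiff_C, divDiff_C, neg_zero]
  | hadd f f' h h' => rw [map_add, map_add, h, h', neg_add]
  | hx v f h =>
    have hs : weylAct b A (RootPairing.weylGroup.ofIdx P (P.reflectionPerm i i))
        = weylAct b A (RootPairing.weylGroup.ofIdx P i) := by
      apply algHom_ext
      intro v
      rw [weylAct_xPoly, weylAct_xPoly, ofIdx_smul_eq, ofIdx_smul_eq, rootWeight_neg,
        corootPairing_neg, neg_smul_neg]
    rw [divDiff_mul, divDiff_mul, h, hs, corootPairing_neg]
    push_cast
    rw [neg_smul]
    ring

variable (k : A)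

/-- The Dunkl operator
`D_u = d_u + k ∑_{α > 0} ((u, α) / x_α) (1 - s_α)` on the polynomials. -/
def dunkl (u : weightLattice P) : MvPolynomial b.support A →ₗ[A] MvPolynomial b.support A :=
  (deriv b A u : MvPolynomial b.support A →ₗ[A] MvPolynomial b.support A) +
    ∑ i ∈ posRoots b, (k * ringForm P A u (rootWeight P i)) • divDiff b A i

theorem dunkl_apply (u : weightLattice P) (f : MvPolynomial b.support A) :
    dunkl b A k u f = deriv b A u f +
      ∑ i ∈ posRoots b, (k * ringForm P A u (rootWeight P i)) • divDiff b A i f := by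
  simp [dunkl, LinearMap.sum_apply]

theorem dunkl_C (u : weightLattice P) (a : A) : dunkl b A k u (C a) = 0 := by
  have h : deriv b A u (C a) = 0 := by
    rw [← MvPolynomial.algebraMap_eq, Derivation.map_algebraMap]
  rw [dunkl_apply, h, zero_add]
  exact Finset.sum_eq_zero fun i _ => by rw [divDiff_C, smul_zero]

theorem dunkl_xPoly_mul (u v : weightLattice P) (f : MvPolynomial b.support A) :
    dunkl b A k u (xPoly b A v * f) = xPoly b A v * dunkl b A k u f + ringForm P A u v • f +
      ∑ i ∈ posRoots b, (k * ringForm P A u (rootWeight P i) * (corootPairing P i v : A)) •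
        weylAct b A (RootPairing.weylGroup.ofIdx P i) f := by
  simp only [dunkl_apply, Derivation.leibniz, deriv_xPoly, divDiff_mul, smul_add,
    Finset.sum_add_distrib, mul_add, Finset.mul_sum, smul_smul, mul_smul_comm, smul_eq_mul]
  rw [MvPolynomial.smul_eq_C_mul f (ringForm P A u v)]
  ring

theorem deriv_add (u v : weightLattice P) (f : MvPolynomial b.support A) :
    deriv b A (u + v) f = deriv b A u f + deriv b A v f := by
  induction f using poly_induction with
  | hC a => simp [deriv]
  | hadd f f' h h' => simp only [map_add, h, h']; ring
  | hx w f h =>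
    simp only [Derivation.leibniz, deriv_xPoly, h, ringForm_add_left, map_add, smul_eq_mul]
    ring

theorem dunkl_add (u v : weightLattice P) :
    dunkl b A k (u + v) = dunkl b A k u + dunkl b A k v := by
  refine LinearMap.ext fun f => ?_
  rw [LinearMap.add_apply, dunkl_apply, dunkl_apply, dunkl_apply, deriv_add]
  simp only [ringForm_add_left, mul_add, add_smul, Finset.sum_add_distrib]
  ring

theorem sum_posRoots_perm {G : Type*} [AddCommGroup G] (t : ι → G)
    (ht : ∀ i, t (P.reflectionPerm i i) = t i) (g : P.weylGroup) :
    ∑ i ∈ posRoots b, t (P.weylGroupToPerm g i) = ∑ i ∈ posRoots b, t i := by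
  classical
  let := P.indexNeg
  have hneg : ∀ (g : P.weylGroup) (i : ι),
      P.weylGroupToPerm g (-i) = -(P.weylGroupToPerm g i) := by
    intro g i
    apply P.root.injective
    have h1 : ∀ j, P.root (-j) = -P.root j := fun j => by simp
    rw [← P.weylGroup_apply_root, h1, h1, ← P.weylGroup_apply_root, smul_neg]
  let a : P.weylGroup → ι → ι := fun g i =>
    if b.IsPos (P.weylGroupToPerm g i) then P.weylGroupToPerm g i else -P.weylGroupToPerm g i
  have hmem : ∀ i, i ∈ posRoots b ↔ b.IsPos i := fun i => by simp [posRoots]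
  have hpos : ∀ g i, a g i ∈ posRoots b := by
    intro g i
    rw [hmem]
    by_cases h : b.IsPos (P.weylGroupToPerm g i)
    · simpa only [a, if_pos h] using h
    · simpa only [a, if_neg h] using (RootPairing.Base.IsPos.neg_iff_not b _).2 h
  have hinv : ∀ g i, i ∈ posRoots b → a g⁻¹ (a g i) = i := by
    intro g i hi
    rw [hmem] at hi
    have h1 : P.weylGroupToPerm g⁻¹ (P.weylGroupToPerm g i) = i := by
      rw [← Equiv.Perm.mul_apply, ← map_mul]; simp
    by_cases h : b.IsPos (P.weylGroupToPerm g i)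
    · simp only [a, if_pos h, h1, if_pos hi]
    · have h2 : ¬ b.IsPos (-i) := by
        rw [RootPairing.Base.IsPos.neg_iff_not]; exact not_not.2 hi
      simp only [a, if_neg h, hneg, h1, if_neg h2, neg_neg]
  refine Finset.sum_nbij' (a g) (a g⁻¹) (fun i _ => hpos g i) (fun i _ => hpos g⁻¹ i)
    (fun i hi => hinv g i hi) (fun i hi => ?_) (fun i hi => ?_)
  · have := hinv g⁻¹ i hi
    rwa [inv_inv] at this
  · by_cases h : b.IsPos (P.weylGroupToPerm g i)
    · simp only [a, if_pos h]
    · simp only [a, if_neg h]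
      exact (ht _).symm

theorem ringForm_neg_right (u v : weightLattice P) :
    ringForm P A u (-v) = -ringForm P A u v :=
  (ringFormHom P A u).map_neg v

theorem weylAct_deriv (g : P.weylGroup) (u : weightLattice P) (f : MvPolynomial b.support A) :
    weylAct b A g (deriv b A u f) = deriv b A (g • u) (weylAct b A g f) := by
  induction f using poly_induction with
  | hC a => simp [deriv, ← MvPolynomial.algebraMap_eq]
  | hadd f f' h h' => simp only [map_add, h, h']
  | hx w f h =>
    have hC : ∀ a : A, weylAct b A g (C a) = C a := fun a => by
      rw [← MvPolynomial.algebraMap_eq, AlgHom.commutes]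
    simp only [Derivation.leibniz, deriv_xPoly, map_add, map_mul, smul_eq_mul, weylAct_xPoly, h,
      hC, ringForm_smul]

theorem weylAct_dunkl (g : P.weylGroup) (u : weightLattice P) (f : MvPolynomial b.support A) :
    weylAct b A g (dunkl b A k u f) = dunkl b A k (g • u) (weylAct b A g f) := by
  rw [dunkl_apply, dunkl_apply, map_add, map_sum, weylAct_deriv]
  congr 1
  rw [← sum_posRoots_perm b (fun i => (k * ringForm P A (g • u) (rootWeight P i)) •
    divDiff b A i (weylAct b A g f)) _ g]
  · refine Finset.sum_congr rfl fun i _ => ?_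
    rw [map_smul, weylAct_divDiff, ← smul_rootWeight, ringForm_smul]
  · intro i
    rw [rootWeight_neg, ringForm_neg_right, divDiff_neg, mul_neg, neg_smul_neg]

/-- `u ↦ D_u` as an additive map. -/
def dunklHom : weightLattice P →+
    (MvPolynomial b.support A →ₗ[A] MvPolynomial b.support A) :=
  AddMonoidHom.mk' (dunkl b A k) (dunkl_add b A k)

theorem reflect_dunkl (i : ι) (u : weightLattice P) (f : MvPolynomial b.support A) :
    weylAct b A (RootPairing.weylGroup.ofIdx P i) (dunkl b A k u f)
      = dunkl b A k u (weylAct b A (RootPairing.weylGroup.ofIdx P i) f)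
        - (corootPairing P i u : A) • dunkl b A k (rootWeight P i)
            (weylAct b A (RootPairing.weylGroup.ofIdx P i) f) := by
  have h : dunkl b A k (u - corootPairing P i u • rootWeight P i)
      = dunkl b A k u - corootPairing P i u • dunkl b A k (rootWeight P i) := by
    change dunklHom b A k _ = _
    rw [map_sub, map_zsmul]
    rfl
  rw [weylAct_dunkl, ofIdx_smul_eq, h, LinearMap.sub_apply, LinearMap.smul_apply,
    Int.cast_smul_eq_zsmul]

theorem dunkl_comm (u v : weightLattice P) (f : MvPolynomial b.support A) :
    dunkl b A k u (dunkl b A k v f) = dunkl b A k v (dunkl b A k u f) := by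
  induction f using poly_induction with
  | hC a => simp only [dunkl_C, map_zero]
  | hadd f f' h h' => simp only [map_add, h, h']
  | hx w f h =>
    simp only [dunkl_xPoly_mul, map_add, map_smul, map_sum, h]
    have key : ∑ i ∈ posRoots b, (k * ringForm P A u (rootWeight P i) * (corootPairing P i w : A)) •
          weylAct b A (RootPairing.weylGroup.ofIdx P i) (dunkl b A k v f)
        + ∑ i ∈ posRoots b, (k * ringForm P A v (rootWeight P i) * (corootPairing P i w : A)) •
          dunkl b A k u (weylAct b A (RootPairing.weylGroup.ofIdx P i) f)
        = ∑ i ∈ posRoots b, (k * ringForm P A v (rootWeight P i) * (corootPairing P i w : A)) •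
          weylAct b A (RootPairing.weylGroup.ofIdx P i) (dunkl b A k u f)
        + ∑ i ∈ posRoots b, (k * ringForm P A u (rootWeight P i) * (corootPairing P i w : A)) •
          dunkl b A k v (weylAct b A (RootPairing.weylGroup.ofIdx P i) f) := by
      rw [← Finset.sum_add_distrib, ← Finset.sum_add_distrib]
      refine Finset.sum_congr rfl fun i _ => ?_
      rw [reflect_dunkl, reflect_dunkl]
      have hr := ringForm_root_mul P A i u v
      simp only [smul_sub, smul_smul]
      have hc : k * ringForm P A u (rootWeight P i) * (corootPairing P i w : A)
            * (corootPairing P i v : A)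
          = k * ringForm P A v (rootWeight P i) * (corootPairing P i w : A)
            * (corootPairing P i u : A) := by
        linear_combination k * (corootPairing P i w : A) * hr
      rw [hc]
      abel
    linear_combination key

end Dunkl

/-! ### The rational double affine Hecke algebra and its polynomial representation -/

section Algebra

variable {ι V N : Type*} [Fintype ι] [AddCommGroup V] [Module ℝ V] [AddCommGroup N] [Module ℝ N]
  {P : RootPairing ι ℝ V N}

/-- The generators `x_u`, `D_u` (`u` in the weight lattice) and `w` in the Weyl group. -/
inductive Gen (P : RootPairing ι ℝ V N)
  | x (u : weightLattice P)
  | y (u : weightLattice P)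
  | w (g : P.weylGroup)

variable [P.IsCrystallographic] (b : P.Base) (A : Type*) [CommRing A] (k : A)

/-- A generator in the free algebra. -/
abbrev fgen (a : Gen P) : FreeAlgebra A (Gen P) := FreeAlgebra.ι A a

/-- The defining relations of the rational double affine Hecke algebra: additivity and
commutativity of the `x_u` and of the `D_u`, the group relations of `W`, the equivariance
`g x_u = x_{g u} g`, `g D_u = D_{g u} g`, and
`D_u x_v - x_v D_u = (u, v) + k ∑_{α > 0} (u, α) (v, α^∨) s_α`. -/
inductive Rel : FreeAlgebra A (Gen P) → FreeAlgebra A (Gen P) → Prop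
  | x_add (u v : weightLattice P) : Rel (fgen A (.x (u + v))) (fgen A (.x u) + fgen A (.x v))
  | x_comm (u v : weightLattice P) :
      Rel (fgen A (.x u) * fgen A (.x v)) (fgen A (.x v) * fgen A (.x u))
  | y_add (u v : weightLattice P) : Rel (fgen A (.y (u + v))) (fgen A (.y u) + fgen A (.y v))
  | y_comm (u v : weightLattice P) :
      Rel (fgen A (.y u) * fgen A (.y v)) (fgen A (.y v) * fgen A (.y u))
  | w_one : Rel (fgen A (.w 1)) 1
  | w_mul (g g' : P.weylGroup) : Rel (fgen A (.w (g * g'))) (fgen A (.w g) * fgen A (.w g'))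
  | w_x (g : P.weylGroup) (u : weightLattice P) :
      Rel (fgen A (.w g) * fgen A (.x u)) (fgen A (.x (g • u)) * fgen A (.w g))
  | w_y (g : P.weylGroup) (u : weightLattice P) :
      Rel (fgen A (.w g) * fgen A (.y u)) (fgen A (.y (g • u)) * fgen A (.w g))
  | y_x (u v : weightLattice P) :
      Rel (fgen A (.y u) * fgen A (.x v))
        (fgen A (.x v) * fgen A (.y u) + algebraMap A _ (ringForm P A u v) +
          ∑ i ∈ posRoots b, (k * ringForm P A u (rootWeight P i) * (corootPairing P i v : A)) •
            fgen A (.w (RootPairing.weylGroup.ofIdx P i)))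

/-- The rational double affine Hecke algebra over `A` with parameter `k`
(the same for long and short roots). -/
def RatDAHA : Type _ := RingQuot (Rel b A k)

instance : Ring (RatDAHA b A k) := inferInstanceAs (Ring (RingQuot (Rel b A k)))

instance : Algebra A (RatDAHA b A k) := inferInstanceAs (Algebra A (RingQuot (Rel b A k)))

/-- The image of a generator in the rational double affine Hecke algebra. -/
def gen (a : Gen P) : RatDAHA b A k := RingQuot.mkAlgHom A (Rel b A k) (fgen A a)

/-- The subalgebra `(H'')^W` of the elements commuting with the Weyl group. -/
def invSubalgebra : Subalgebra A (RatDAHA b A k) :=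
  Subalgebra.centralizer A (Set.range fun g : P.weylGroup => gen b A k (.w g))

/-- The polynomial representation `A[x]` (the parameter `k` enters in the action). -/
def PolyRep (b : P.Base) (A : Type*) [CommRing A] (_k : A) : Type _ := MvPolynomial b.support A

instance : CommRing (PolyRep b A k) := inferInstanceAs (CommRing (MvPolynomial b.support A))

instance : Algebra A (PolyRep b A k) := inferInstanceAs (Algebra A (MvPolynomial b.support A))

/-- A polynomial as an element of the polynomial representation. -/
def PolyRep.of : MvPolynomial b.support A ≃ₐ[A] PolyRep b A k := AlgEquiv.refl

/-- Change of coefficients in the polynomial representation along a ring homomorphism. -/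
def PolyRep.map (b : P.Base) {A B : Type*} [CommRing A] [CommRing B] (φ : A →+* B)
    (k : A) (k' : B) : PolyRep b A k →+* PolyRep b B k' :=
  (MvPolynomial.map φ : MvPolynomial b.support A →+* MvPolynomial b.support B)

variable [P.IsRootSystem]

/-- The operators by which the generators act on the polynomial representation: multiplication
by `x_u`, the Dunkl operators, and the action of `W`. -/
def genEnd : Gen P → Module.End A (PolyRep b A k)
  | .x u => LinearMap.mulLeft A (xPoly b A u)
  | .y u => dunkl b A k u
  | .w g => (weylAct b A g).toLinearMap

theorem genEnd_rel (f f' : FreeAlgebra A (Gen P)) (h : Rel b A k f f') :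
    FreeAlgebra.lift A (genEnd b A k) f = FreeAlgebra.lift A (genEnd b A k) f' := by
  refine LinearMap.ext fun (q : PolyRep b A k) => ?_
  cases h with
  | x_add u v =>
    simp only [map_add, FreeAlgebra.lift_ι_apply]
    exact (congrArg (fun c => c * (show MvPolynomial b.support A from q))
      (xPoly_add b A u v)).trans (add_mul (xPoly b A u) (xPoly b A v) q)
  | x_comm u v =>
    simp only [map_mul, FreeAlgebra.lift_ι_apply]
    exact mul_left_comm (xPoly b A u) (xPoly b A v) q
  | y_add u v =>
    simp only [map_add, FreeAlgebra.lift_ι_apply]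
    change dunkl b A k (u + v) q = dunkl b A k u q + dunkl b A k v q
    rw [dunkl_add]
    rfl
  | y_comm u v =>
    simp only [map_mul, FreeAlgebra.lift_ι_apply]
    exact dunkl_comm b A k u v q
  | w_one =>
    simp only [map_one, FreeAlgebra.lift_ι_apply]
    change weylAct b A 1 q = q
    rw [weylAct_one]
    rfl
  | w_mul g g' =>
    simp only [map_mul, FreeAlgebra.lift_ι_apply]
    change weylAct b A (g * g') q = weylAct b A g (weylAct b A g' q)
    rw [weylAct_mul]
    rfl
  | w_x g u =>
    simp only [map_mul, FreeAlgebra.lift_ι_apply]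
    exact (map_mul (weylAct b A g) (xPoly b A u) q).trans
      (congrArg (fun c => c * weylAct b A g q) (weylAct_xPoly b A g u))
  | w_y g u =>
    simp only [map_mul, FreeAlgebra.lift_ι_apply]
    exact weylAct_dunkl b A k g u q
  | y_x u v =>
    simp only [map_mul, map_add, map_sum, map_smul, FreeAlgebra.lift_ι_apply, AlgHom.commutes]
    refine (dunkl_xPoly_mul b A k u v q).trans ?_
    rw [LinearMap.add_apply, LinearMap.add_apply, LinearMap.sum_apply]
    rfl

/-- The homomorphism from the rational double affine Hecke algebra to the endomorphisms of
the polynomial representation. -/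
def polyEnd : RatDAHA b A k →ₐ[A] Module.End A (PolyRep b A k) :=
  RingQuot.liftAlgHom A ⟨FreeAlgebra.lift A (genEnd b A k),
    fun f f' h => genEnd_rel b A k f f' h⟩

instance : Module (RatDAHA b A k) (PolyRep b A k) :=
  Module.compHom _ (polyEnd b A k).toRingHom

theorem smul_def (a : RatDAHA b A k) (f : PolyRep b A k) : a • f = polyEnd b A k a f := rfl

instance : IsScalarTower A (RatDAHA b A k) (PolyRep b A k) where
  smul_assoc c a f := by
    rw [smul_def, smul_def, map_smul]
    rfl

theorem gen_smul (a : Gen P) (f : PolyRep b A k) : gen b A k a • f = genEnd b A k a f := by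
  have h : polyEnd b A k (gen b A k a) = genEnd b A k a :=
    (RingQuot.liftAlgHom_mkAlgHom_apply A (FreeAlgebra.lift A (genEnd b A k)) _ _).trans
      (FreeAlgebra.lift_ι_apply _ _)
  rw [smul_def, h]

/-- The largest submodule `J` of the polynomial representation that contains no nonzero
constants. Over a field it is the largest proper submodule, as `A[x]` is generated by `1`;
over a domain `A[x] / J` is the largest quotient which is torsion free and irreducible over the
field of fractions. -/
def kernelJ : Submodule (RatDAHA b A k) (PolyRep b A k) :=
  sSup {S | ∀ c : A, algebraMap A (PolyRep b A k) c ∈ S → c = 0}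

/-- The module `V'' = A[x] / J`. -/
abbrev PerfMod : Type _ := PolyRep b A k ⧸ kernelJ b A k

/-- The discriminant `δ = ∏_{α > 0} x_α`. -/
def disc : PolyRep b A k := ∏ i ∈ posRoots b, xPoly b A (rootWeight P i)

/-- The set `I_o` of the elements of `(H'')^W` vanishing at the image of `δ` in `V''`. -/
def idealIo : Set (RatDAHA b A k) :=
  {a | a ∈ invSubalgebra b A k ∧ a • (kernelJ b A k).mkQ (disc b A k) = 0}

/-- The submodule `H''(δ)` of the polynomial representation. -/
def discSpan : Submodule (RatDAHA b A k) (PolyRep b A k) :=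
  Submodule.span _ {disc b A k}

/-- The submodule `H'' I_o (δ)` of the polynomial representation. -/
def ioDiscSpan : Submodule (RatDAHA b A k) (PolyRep b A k) :=
  Submodule.span _ ((fun a => a • disc b A k) '' idealIo b A k)

/-- The module `Ṽ'' = H''(δ) / H'' I_o (δ)`. -/
abbrev TildeMod : Type _ :=
  discSpan b A k ⧸ (ioDiscSpan b A k).comap (discSpan b A k).subtype

/-- The left ideal generated by `I_o` and the elements `s_α + 1`. The quotient by it is the
module induced from the sign character of `W`, divided by `H'' I_o (1)`. -/
def signIoIdeal : Submodule (RatDAHA b A k) (RatDAHA b A k) :=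
  Submodule.span _ (idealIo b A k ∪
    Set.range fun i => gen b A k (.w (RootPairing.weylGroup.ofIdx P i)) + 1)

/-- The rational double affine Hecke algebra `H''` over `A` at `k = -(1 + 1/h)`. -/
abbrev Hk : Type _ := RatDAHA b A (kParam b A)

/-- The polynomial representation of `H''` over `A` at `k = -(1 + 1/h)`. -/
abbrev Polk : Type _ := PolyRep b A (kParam b A)

/-- The discriminant `δ` at `k = -(1 + 1/h)`. -/
abbrev disck : Polk b A := disc b A (kParam b A)

/-- The submodule `J` at `k = -(1 + 1/h)`. -/
abbrev Jk : Submodule (Hk b A) (Polk b A) := kernelJ b A (kParam b A)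

/-- The module `V''` at `k = -(1 + 1/h)`. -/
abbrev Vk : Type _ := PerfMod b A (kParam b A)

/-- The module `Ṽ''` at `k = -(1 + 1/h)`. -/
abbrev Vtildek : Type _ := TildeMod b A (kParam b A)

/-- The generators of `H''` at `k = -(1 + 1/h)`. -/
abbrev genk (a : Gen P) : Hk b A := gen b A (kParam b A) a

end Algebra

/-! ### The algebra of differential operators -/

section Weyl

variable (σ A : Type*) [CommRing A]

open Classical in
/-- The relations of the algebra of differential operators: the `x_i` commute, the `∂_i`
commute, and `∂_i x_j - x_j ∂_i = δ_{ij}`. -/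
inductive WeylRel : FreeAlgebra A (σ ⊕ σ) → FreeAlgebra A (σ ⊕ σ) → Prop
  | x_comm (i j : σ) : WeylRel
      (FreeAlgebra.ι A (.inl i) * FreeAlgebra.ι A (.inl j))
      (FreeAlgebra.ι A (.inl j) * FreeAlgebra.ι A (.inl i))
  | d_comm (i j : σ) : WeylRel
      (FreeAlgebra.ι A (.inr i) * FreeAlgebra.ι A (.inr j))
      (FreeAlgebra.ι A (.inr j) * FreeAlgebra.ι A (.inr i))
  | d_x (i j : σ) : WeylRel
      (FreeAlgebra.ι A (.inr i) * FreeAlgebra.ι A (.inl j))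
      (FreeAlgebra.ι A (.inl j) * FreeAlgebra.ι A (.inr i) + if i = j then 1 else 0)

/-- The algebra of differential operators in the variables `x_i`, `i ∈ σ`, with polynomial
coefficients over `A` (the Weyl algebra). -/
def DiffOp : Type _ := RingQuot (WeylRel σ A)

instance : Ring (DiffOp σ A) := inferInstanceAs (Ring (RingQuot (WeylRel σ A)))

instance : Algebra A (DiffOp σ A) := inferInstanceAs (Algebra A (RingQuot (WeylRel σ A)))

variable {σ}

/-- The generator `x_i`. -/
def DiffOp.x (i : σ) : DiffOp σ A := RingQuot.mkAlgHom A (WeylRel σ A) (FreeAlgebra.ι A (.inl i))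

/-- The generator `∂_i`. -/
def DiffOp.d (i : σ) : DiffOp σ A := RingQuot.mkAlgHom A (WeylRel σ A) (FreeAlgebra.ι A (.inr i))

variable (σ)

/-- The polynomials as a module over the differential operators. -/
abbrev DiffPoly : Type _ := MvPolynomial σ A

/-- `x_i` acts by multiplication and `∂_i` by the partial derivative. -/
def diffGenEnd : σ ⊕ σ → Module.End A (DiffPoly σ A)
  | .inl i => LinearMap.mulLeft A (MvPolynomial.X i : MvPolynomial σ A)
  | .inr i => ((MvPolynomial.pderiv i : Derivation A (MvPolynomial σ A) (MvPolynomial σ A)) :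
      MvPolynomial σ A →ₗ[A] MvPolynomial σ A)

theorem pderiv_comm (i j : σ) (q : MvPolynomial σ A) :
    MvPolynomial.pderiv i (MvPolynomial.pderiv j q)
      = MvPolynomial.pderiv j (MvPolynomial.pderiv i q) := by
  classical
  have h : ⁅(MvPolynomial.pderiv i : Derivation A (MvPolynomial σ A) (MvPolynomial σ A)),
      (MvPolynomial.pderiv j : Derivation A (MvPolynomial σ A) (MvPolynomial σ A))⁆ = 0 := by
    apply MvPolynomial.derivation_ext
    intro l
    rw [Derivation.commutator_apply, MvPolynomial.pderiv_X, MvPolynomial.pderiv_X]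
    by_cases h1 : l = j <;> by_cases h2 : l = i <;>
      simp [Pi.single_apply, h1, h2, apply_ite]
  have h3 := DFunLike.congr_fun h q
  rw [Derivation.commutator_apply] at h3
  exact sub_eq_zero.1 h3

open Classical in
theorem pderiv_X_mul (i j : σ) (q : MvPolynomial σ A) :
    MvPolynomial.pderiv i (MvPolynomial.X j * q)
      = MvPolynomial.X j * MvPolynomial.pderiv i q + if i = j then q else 0 := by
  rw [Derivation.leibniz, MvPolynomial.pderiv_X, smul_eq_mul, smul_eq_mul]
  congr 1
  by_cases h : i = j
  · subst h
    rw [if_pos rfl, Pi.single_eq_same, mul_one]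
  · rw [if_neg h, Pi.single_eq_of_ne (Ne.symm h), mul_zero]

theorem diffGenEnd_rel (f f' : FreeAlgebra A (σ ⊕ σ)) (h : WeylRel σ A f f') :
    FreeAlgebra.lift A (diffGenEnd σ A) f = FreeAlgebra.lift A (diffGenEnd σ A) f' := by
  classical
  refine LinearMap.ext fun (q : DiffPoly σ A) => ?_
  cases h with
  | x_comm i j =>
    simp only [map_mul, FreeAlgebra.lift_ι_apply]
    exact mul_left_comm (MvPolynomial.X i : MvPolynomial σ A) (MvPolynomial.X j) q
  | d_comm i j =>
    simp only [map_mul, FreeAlgebra.lift_ι_apply]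
    exact pderiv_comm σ A i j q
  | d_x i j =>
    by_cases h : i = j
    · simp only [map_mul, map_add, FreeAlgebra.lift_ι_apply, if_pos h, map_one]
      have h1 := pderiv_X_mul σ A i j q
      rw [if_pos h] at h1
      exact h1
    · simp only [map_mul, FreeAlgebra.lift_ι_apply, if_neg h, add_zero]
      have h1 := pderiv_X_mul σ A i j q
      rw [if_neg h, add_zero] at h1
      exact h1

/-- The homomorphism from the differential operators to the endomorphisms of the
polynomials. -/
def diffEnd : DiffOp σ A →ₐ[A] Module.End A (DiffPoly σ A) :=
  RingQuot.liftAlgHom A ⟨FreeAlgebra.lift A (diffGenEnd σ A),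
    fun f f' h => diffGenEnd_rel σ A f f' h⟩

instance : Module (DiffOp σ A) (DiffPoly σ A) :=
  Module.compHom _ (diffEnd σ A).toRingHom

theorem diff_smul_def (a : DiffOp σ A) (f : DiffPoly σ A) : a • f = diffEnd σ A a f := rfl

instance : IsScalarTower A (DiffOp σ A) (DiffPoly σ A) where
  smul_assoc c a f := by
    rw [diff_smul_def, diff_smul_def, map_smul]
    rfl

/-- The ideal `(x^p)` generated by the `p`-th powers of the variables. -/
def frobIdeal (p : ℕ) : Ideal (MvPolynomial σ A) :=
  Ideal.span (Set.range fun i => MvPolynomial.X i ^ p)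

end Weyl

/-! ### Diagonal coinvariants and the filtration by the total degree -/

section Diagonal

variable {ι V N : Type*} [Fintype ι] [AddCommGroup V] [Module ℝ V] [AddCommGroup N] [Module ℝ N]
  {P : RootPairing ι ℝ V N} [P.IsRootSystem] [P.IsCrystallographic] (b : P.Base)
  (A : Type*) [CommRing A]

/-- The algebra `A[x, y]` of double polynomials, in the variables `x_{ω_j}` and `y_{ω_j}`. -/
abbrev DoublePoly : Type _ := MvPolynomial (b.support ⊕ b.support) A

/-- The diagonal action of the Weyl group on `A[x, y]`: `x_u ↦ x_{g u}`, `y_u ↦ y_{g u}`. -/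
def diagAct (g : P.weylGroup) : DoublePoly b A →ₐ[A] DoublePoly b A :=
  MvPolynomial.aeval (Sum.elim
    (fun j => MvPolynomial.rename Sum.inl (xPoly b A (g • fundWeight b j)))
    (fun j => MvPolynomial.rename Sum.inr (xPoly b A (g • fundWeight b j))))

/-- The ideal of `A[x, y]` generated by the diagonal invariants without constant term. The
quotient by it is the space of diagonal coinvariants. -/
def coinvIdeal : Ideal (DoublePoly b A) :=
  Ideal.span {f | (∀ g, diagAct b A g f = f) ∧ MvPolynomial.constantCoeff f = 0}

/-- The space (in fact, algebra) of diagonal coinvariants over `A`. -/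
abbrev DiagCoinv : Type _ := DoublePoly b A ⧸ coinvIdeal b A

variable (k : A)

/-- The monomial in the pairwise commuting `x_{ω_j}` times the monomial in the pairwise
commuting `D_{ω_j}`, with given exponents. -/
def orderedMonomial (m : b.support ⊕ b.support →₀ ℕ) : RatDAHA b A k :=
  (Finset.univ.toList.map fun j => gen b A k (.x (fundWeight b j)) ^ m (.inl j)).prod *
    (Finset.univ.toList.map fun j => gen b A k (.y (fundWeight b j)) ^ m (.inr j)).prod

/-- The linear map `A[x, y] → H''` that replaces `y` by `D` and puts the `x` to the left of
the `D`. -/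
def ordered : DoublePoly b A →ₗ[A] RatDAHA b A k :=
  (MvPolynomial.basisMonomials (b.support ⊕ b.support) A).constr A (orderedMonomial b A k)

/-- For a vector `v` in an `H''`-module, the span of `f(x, D) v` for the polynomials `f` of
total degree less than `d`. -/
def filtLT {M : Type*} [AddCommGroup M] [Module A M] [Module (RatDAHA b A k) M] (v : M) (d : ℕ) :
    Submodule A M :=
  Submodule.span A ((fun m => orderedMonomial b A k m • v) '' {m | m.degree < d})

end Diagonal

end DAHA

/-- The residue field `𝔽_p` as an algebra over the `p`-adic integers. -/
instance DAHA.padicIntAlgebra (p : ℕ) [Fact p.Prime] : Algebra ℤ_[p] (ZMod p) :=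
  PadicInt.toZMod.toAlgebra

end

set_option linter.unusedSectionVars false

open Module
open scoped TensorProduct

noncomputable section

namespace DAHA

/-! ### Positive roots, the vector `ρ` and the Coxeter number -/

section RootSystem

variable {ι V N : Type*} [Fintype ι] [AddCommGroup V] [Module ℝ V] [AddCommGroup N] [Module ℝ N]
  {P : RootPairing ι ℝ V N} [P.IsRootSystem] [P.IsCrystallographic]

/-! The parameter satisfies h k = -p. Hence k is divisible by p in the localization ℤ_(p) of the
integers (`Zloc p`), and modulo p the Dunkl operators are combinations of partial derivatives. There
the module 𝔽_p[x]/(x^p) is transparent. What is seen modulo p is lifted to ℤ_(p) by Nakayama's lemma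
and then carried to every ring in which the integers prime to p are invertible (`IsPLocal`): fields
of characteristic zero, ℤ_p, 𝔽_p. Such transfers are easy because, over a p-local domain of
characteristic zero, membership in J is a system of equations on constant terms after words of Dunkl
operators (`maxIdeal`, `kernelJ_eq_maxSub`). The primes to be avoided are harmless: n < h
(`card_support_lt_coxeterNumber`), so W has no element of order p = h + 1
(`not_dvd_card_weylGroup`), and the denominators of the form divide |W|.

Singular forms. The p-th powers must be lifted to polynomials killed by the Dunkl operators.
Consider W-equivariant additive maps F from the weights to the forms of degree p. The identity
Σ_{α>0} (v, α^∨) α = h v (`casimir_eq`) shows that the derivatives of F(v), contracted with the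
coordinates, give (p + h k) F(v) = 0. If all the derivatives are divisible by some q, the quotients
reduce modulo p to a closed 1-form annihilated by the Euler field. Such a form is exact
(`exists_potential`), since the obstructions x_i^{p-1} dx_i are excluded by the Euler condition.
Therefore the image of the derivative map is saturated (`saturatedTables_le`). The derivatives of
the equivariant lift of x_v^p are divisible by p, so a correction by a multiple of p removes them
(`exists_singular_form`). Consequently the monomials with exponents less than p form a basis of the
quotient by `maxIdeal`: they span it because of the singular forms, and they are independent because
their pairing with words of Dunkl operators is, modulo p, diagonal with factorials on the diagonal
(`mem_range_reducedPoly_sup_zloc`, `eq_zero_of_reducedPoly_mem`).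

The sign character. Over 𝔽_p an antiinvariant polynomial is divisible by δ. Summation of values over
𝔽_p^n pairs the degree d with n(p - 1) - d = 2|R₊| - d, which pushes the antiinvariants of degree
above |R₊| into (x^p), while δ itself stays outside because it does not vanish at ρ
(`IsAntiinvariant.mem_frobIdeal`, `rootProd_notMem_frobIdeal`). Nakayama's lemma lifts the
uniqueness of the sign vector (`exists_antisymm_sub_mem`).

The set I_o. The modules defined through I_o are controlled by a detection principle: a module on
which the D_b are nilpotent and the antisymmetrizer is zero vanishes (`eq_zero_of_antiElt_smul`).
For z killed by all D_b, antisymmetrize q(x) z and apply Dunkl operators: modulo p this yields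
combinations of the g z weighted by matrix coefficients of W on 𝔽_p[x]/(x^p). These span all
functions on W (`span_matrixCoeff`). Indeed ρ has a free orbit modulo p, and an element of the group
algebra acting by zero on 𝔽_p[x]/(x^p) is nilpotent on the functions on this orbit, so it has trace
zero there (`eq_zero_of_sum_weylAct_mem`). Thus each g z lies in p times the span of the g z, and z
= 0. Applied to J ∩ H''δ and to the annihilator of δ in V'', the principle identifies both with what
I_o generates (`ioDiscSpan_eq`, `signIoIdeal_eq`).

Modulo p. The smash product decomposition comes from an explicit action on functions W → 𝒟
(`smashMap_injective`). A simple 𝒟-module with nilpotent x and ∂ is a quotient of the polynomials by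
a maximal submodule whose radical contains (x^p) (`nonempty_equiv_of_nilpotent`). An invariant f of
positive degree sends the sign vector to a multiple of itself, so the diagonal invariants lie in the
ideal of symbols that vanish in the graded space (`coinvIdeal_le_symbolIdeal`). Equivariant
projections split the filtration and identify the graded space with the module (`exists_symbolMap`).
-/

theorem rootForm_pos {v : V} (hv : v ≠ 0) : 0 < P.RootForm v v :=
  P.rootForm_pos_of_ne_zero (by
    change v ∈ Submodule.span ℝ (Set.range P.root)
    rw [RootPairing.IsRootSystem.span_root_eq_top (P := P)]; trivial) hv

theorem nonempty_index [P.IsIrreducible] : Nonempty ι := by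
  have := RootPairing.IsIrreducible.nontrivial P
  by_contra h
  rw [not_nonempty_iff] at h
  have h1 := RootPairing.IsRootSystem.span_root_eq_top (P := P)
  rw [Set.range_eq_empty, Submodule.span_empty] at h1
  exact bot_ne_top h1

theorem iInf_rootForm_pos [P.IsIrreducible] : 0 < ⨅ i, P.RootForm (P.root i) (P.root i) := by
  have := RootPairing.IsIrreducible.nontrivial P
  have := nonempty_index (P := P)
  obtain ⟨i, hi⟩ := exists_eq_ciInf_of_finite (f := fun i => P.RootForm (P.root i) (P.root i))
  rw [← hi]
  exact rootForm_pos (P.ne_zero i)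

theorem normForm_pos [P.IsIrreducible] {v : V} (hv : v ≠ 0) : 0 < normForm P v v := by
  rw [normForm, LinearMap.smul_apply, LinearMap.smul_apply, smul_eq_mul]
  exact mul_pos (div_pos two_pos iInf_rootForm_pos) (rootForm_pos hv)

theorem normForm_symm (u v : V) : normForm P u v = normForm P v u := by
  have h := P.rootForm_symmetric.eq u v
  simp only [RingHom.id_apply] at h
  simp only [normForm, LinearMap.smul_apply, smul_eq_mul, h]

variable (b : P.Base)

theorem mem_posRoots {i : ι} : i ∈ posRoots b ↔ b.IsPos i := by simp [posRoots]

variable {b}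

/-- Coroots are not additive when simple roots are added, but the sign of (v, α^∨) is the sign of
(v, α), which is additive in α. -/
theorem coroot'_nonneg_of_isPos [P.IsIrreducible] {v : V}
    (hv : ∀ j ∈ b.support, 0 ≤ P.coroot' j v) {i : ι} (hi : b.IsPos i) : 0 ≤ P.coroot' i v := by
  have hsign : ∀ i, 0 ≤ P.coroot' i v ↔ 0 ≤ normForm P v (P.root i) := fun i => by
    have h1 := two_mul_normForm_root P i v
    have h2 : 0 < normForm P (P.root i) (P.root i) := normForm_pos (P.ne_zero i)
    rw [← mul_nonneg_iff_of_pos_left h2, ← h1]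
    constructor <;> intro h <;> linarith
  refine (hsign i).2 (hi.induction_on_add (p := fun i => 0 ≤ normForm P v (P.root i))
    (fun j hj => (hsign j).1 (hv j hj)) ?_)
  intro i j k hk h hj
  rw [hk, map_add]
  exact add_nonneg h ((hsign j).1 (hv j hj))

theorem coroot'_pos_of_isPos [P.IsIrreducible] {v : V}
    (hv : ∀ j ∈ b.support, 0 < P.coroot' j v) {i : ι} (hi : b.IsPos i) : 0 < P.coroot' i v := by
  have hsign : ∀ i, 0 < P.coroot' i v ↔ 0 < normForm P v (P.root i) := fun i => by
    have h1 := two_mul_normForm_root P i v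
    have h2 : 0 < normForm P (P.root i) (P.root i) := normForm_pos (P.ne_zero i)
    rw [← mul_pos_iff_of_pos_left h2, ← h1]
    constructor <;> intro h <;> linarith
  refine (hsign i).2 (hi.induction_on_add (p := fun i => 0 < normForm P v (P.root i))
    (fun j hj => (hsign j).1 (hv j hj)) ?_)
  intro i j k hk h hj
  rw [hk, map_add]
  exact add_pos h ((hsign j).1 (hv j hj))

theorem pairing_nonneg_of_isPos {i : ι} (hi : ∀ j ∈ b.support, 0 ≤ P.pairing j i) {k : ι}
    (hk : b.IsPos k) : 0 ≤ P.pairing k i := by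
  refine hk.induction_on_add (p := fun k => 0 ≤ P.pairing k i) hi ?_
  intro a j k hk h hj
  have : P.pairing k i = P.pairing a i + P.pairing j i := by
    rw [← P.root_coroot'_eq_pairing, hk, map_add, P.root_coroot'_eq_pairing,
      P.root_coroot'_eq_pairing]
  rw [this]
  exact add_nonneg h (hi j hj)

theorem coroot'_reflectionPerm_self (i : ι) (v : V) :
    P.coroot' (P.reflectionPerm i i) v = -P.coroot' i v := by
  rw [← RootPairing.coroot'_reflection, RootPairing.reflection_apply]
  simp
  ring

variable [P.IsReduced]

/-- A simple reflection permutes the positive roots other than its own simple root. -/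
theorem sum_erase_reflectionPerm {G : Type*} [AddCommMonoid G] {j : ι} (hj : j ∈ b.support)
    [DecidableEq ι] (f : ι → G) :
    ∑ i ∈ (posRoots b).erase j, f (P.reflectionPerm j i) = ∑ i ∈ (posRoots b).erase j, f i := by
  have hmem : ∀ i ∈ (posRoots b).erase j, P.reflectionPerm j i ∈ (posRoots b).erase j := by
    intro i hi
    rw [Finset.mem_erase, mem_posRoots] at hi ⊢
    refine ⟨fun h => ?_, hi.2.reflectionPerm hj hi.1⟩
    have h2 : i = P.reflectionPerm j j := by rw [← P.reflectionPerm_self j i, h]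
    have h3 := (RootPairing.Base.IsPos.neg_iff_not b j).not
    rw [not_not] at h3
    exact (h3.2 (b.isPos_of_mem_support hj)) (by rw [h2] at hi; exact hi.2)
  refine Finset.sum_nbij' (P.reflectionPerm j) (P.reflectionPerm j) hmem hmem ?_ ?_ ?_
  · intro i _; rw [P.reflectionPerm_self]
  · intro i _; rw [P.reflectionPerm_self]
  · intro i _; rfl

/-- The simple reflection permutes the other positive roots and reverses their pairing with the
simple coroot, so these contributions cancel and only half of (α_j, α_j^∨) = 2 remains. -/
theorem coroot'_rho {j : ι} (hj : j ∈ b.support) : P.coroot' j (rho b) = 1 := by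
  classical
  have h1 : ∑ i ∈ (posRoots b).erase j, P.coroot' j (P.root i) = 0 := by
    have h2 := sum_erase_reflectionPerm hj (fun i => P.coroot' j (P.root i))
    have h3 : ∀ i, P.coroot' j (P.root (P.reflectionPerm j i)) = -P.coroot' j (P.root i) := by
      intro i
      rw [P.root_reflectionPerm, RootPairing.coroot'_reflection, coroot'_reflectionPerm_self]
    simp only [h3, Finset.sum_neg_distrib] at h2
    linarith
  have h4 : j ∈ posRoots b := (mem_posRoots b).2 (b.isPos_of_mem_support hj)
  rw [rho, map_smul, map_sum, ← Finset.add_sum_erase _ _ h4, h1]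
  simp

theorem coroot'_rho_pos [P.IsIrreducible] {i : ι} (hi : b.IsPos i) : 0 < P.coroot' i (rho b) :=
  coroot'_pos_of_isPos (fun j hj => by rw [coroot'_rho hj]; exact one_pos) hi

theorem rho_mem_weightLattice : rho b ∈ weightLattice P := by
  intro i
  have h := b.coroot_mem_span_int i
  have h2 : ∀ x ∈ Submodule.span ℤ (P.coroot '' b.support), ∃ z : ℤ,
      P.toLinearMap (rho b) x = z := by
    intro x hx
    induction hx using Submodule.span_induction with
    | mem x hx =>
      obtain ⟨l, hl, rfl⟩ := hx
      exact ⟨1, by rw [Int.cast_one]; exact coroot'_rho hl⟩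
    | zero => exact ⟨0, by simp⟩
    | add x y _ _ hx hy =>
      obtain ⟨a, ha⟩ := hx
      obtain ⟨c, hc⟩ := hy
      exact ⟨a + c, by rw [map_add, ha, hc]; push_cast; rfl⟩
    | smul a x _ hx =>
      obtain ⟨c, hc⟩ := hx
      exact ⟨a * c, by rw [map_zsmul, hc]; push_cast; simp⟩
  exact h2 _ h

variable (b) in
/-- `ρ` as an element of the weight lattice. -/
def rhoWeight : weightLattice P := ⟨rho b, rho_mem_weightLattice⟩

theorem corootPairing_rho_pos [P.IsIrreducible] {i : ι} (hi : b.IsPos i) :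
    0 < corootPairing P i (rhoWeight b) := by
  have h := coroot'_rho_pos (b := b) hi
  have h1 := corootPairing_cast P i (rhoWeight b)
  change _ = P.coroot' i (rho b) at h1
  rw [← h1] at h
  exact_mod_cast h

theorem corootPairing_rho_support {j : ι} (hj : j ∈ b.support) :
    corootPairing P j (rhoWeight b) = 1 := by
  have h1 := corootPairing_cast P j (rhoWeight b)
  change _ = P.coroot' j (rho b) at h1
  rw [coroot'_rho hj] at h1
  exact_mod_cast h1

variable (b)

/-- The index `θ` of the maximal coroot. -/
theorem exists_maximal_coroot [P.IsIrreducible] : ∃ t : ι, b.IsPos t ∧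
    (∀ i, corootPairing P i (rhoWeight b) ≤ corootPairing P t (rhoWeight b)) ∧
    (coxeterNumber b : ℤ) = 1 + corootPairing P t (rhoWeight b) := by
  have := nonempty_index (P := P)
  -- Maximality is taken with respect to the height (ρ, α^∨); the order on coroots itself is not
  -- needed.
  obtain ⟨t, ht⟩ := Finite.exists_max fun i => corootPairing P i (rhoWeight b)
  have hc : ∀ i, P.coroot' i (rho b) = (corootPairing P i (rhoWeight b) : ℝ) :=
    fun i => (corootPairing_cast P i (rhoWeight b)).symm
  have hpos : b.IsPos t := by
    by_contra h
    have h1 := (RootPairing.Base.IsPos.neg_iff_not b t).2 h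
    have h2 := corootPairing_rho_pos h1
    have h3 := ht (P.reflectionPerm t t)
    have h4 := corootPairing_neg P t (rhoWeight b)
    change 0 < corootPairing P (P.reflectionPerm t t) (rhoWeight b) at h2
    omega
  refine ⟨t, hpos, ht, ?_⟩
  have hsup : ⨆ i, P.coroot' i (rho b) = (corootPairing P t (rhoWeight b) : ℝ) := by
    apply le_antisymm
    · exact ciSup_le fun i => by rw [hc]; exact_mod_cast ht i
    · rw [← hc]
      exact le_ciSup (f := fun i => P.coroot' i (rho b)) (Set.finite_range _).bddAbove t
  rw [coxeterNumber, hsup]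
  push_cast
  have h5 := corootPairing_rho_pos hpos
  have h6 : ⌊((corootPairing P t (rhoWeight b) : ℤ) : ℝ)⌋₊
      = (corootPairing P t (rhoWeight b)).toNat := by
    rw [← Int.floor_toNat, Int.floor_intCast]
  rw [h6]
  omega

/-- Apply maximality to a root and to its negative. As h < p, this keeps ρ regular modulo p. -/
theorem abs_corootPairing_rho_lt [P.IsIrreducible] (i : ι) :
    |corootPairing P i (rhoWeight b)| < coxeterNumber b := by
  obtain ⟨t, -, hmax, hh⟩ := exists_maximal_coroot b
  rw [hh, abs_lt]
  have h1 := hmax i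
  have h2 := hmax (P.reflectionPerm i i)
  rw [corootPairing_neg] at h2
  omega

/-- The maximal coroot is dominant, and it is the coroot of a short root. -/
theorem maximal_coroot_pairing [P.IsIrreducible] {t : ι} (ht : b.IsPos t)
    (hmax : ∀ i, corootPairing P i (rhoWeight b) ≤ corootPairing P t (rhoWeight b)) :
    (∀ i, b.IsPos i → 0 ≤ P.pairingIn ℤ i t) ∧
    ∀ i, b.IsPos i → i ≠ t → P.pairingIn ℤ t i ≤ 1 := by
  have hcast : ∀ i j, P.pairing i j = (P.pairingIn ℤ i j : ℝ) := fun i j =>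
    (P.algebraMap_pairingIn ℤ i j).symm
  have hrefl : ∀ i j, corootPairing P (P.reflectionPerm i j) (rhoWeight b)
      = corootPairing P j (rhoWeight b)
        - P.pairingIn ℤ i j * corootPairing P i (rhoWeight b) := by
    intro i j
    have : ((corootPairing P (P.reflectionPerm i j) (rhoWeight b) : ℤ) : ℝ)
        = ((corootPairing P j (rhoWeight b)
          - P.pairingIn ℤ i j * corootPairing P i (rhoWeight b) : ℤ) : ℝ) := by
      push_cast
      rw [corootPairing_cast, corootPairing_cast, corootPairing_cast, ← hcast,
        ← RootPairing.coroot'_reflection, RootPairing.reflection_apply, map_sub, map_smul,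
        P.root_coroot'_eq_pairing, smul_eq_mul, mul_comm]
    exact_mod_cast this
  have hdom : ∀ i, b.IsPos i → 0 ≤ P.pairingIn ℤ i t := by
    intro i hi
    have h := pairing_nonneg_of_isPos (b := b) (i := t) ?_ hi
    · rw [hcast] at h; exact_mod_cast h
    · intro j hj
      rw [hcast]
      -- A simple reflection lowers the height of the maximal coroot by exactly its pairing with the
      -- simple root.
      have h1 := hmax (P.reflectionPerm j t)
      rw [hrefl, corootPairing_rho_support hj] at h1
      have : 0 ≤ P.pairingIn ℤ j t := by linarith
      exact_mod_cast this
  refine ⟨hdom, fun i hi hit => ?_⟩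
  -- Suppose (θ, α^∨) ≥ 2; then (α, θ^∨) = 1. The negative of s_θ(α^∨) has height at least twice
  -- that of θ^∨ minus that of α^∨, so maximality makes the two heights equal. Then s_α(θ^∨) = θ^∨ -
  -- α^∨ has height zero, which no coroot has.
  by_contra! h2
  have hne : P.root i ≠ P.root t := fun h => hit (P.root.injective h)
  have hne' : P.root i ≠ -P.root t := by
    intro h
    have h3 : i = P.reflectionPerm t t := P.root.injective (by rw [h]; simp)
    have h4 := corootPairing_rho_pos hi
    have h5 := corootPairing_rho_pos ht
    rw [h3, corootPairing_neg] at h4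
    omega
  have hset := P.pairingIn_pairingIn_mem_set_of_isCrystal_of_isRed' _ _ hne hne'
  have h1 : P.pairingIn ℤ i t = 1 := by
    simp only [Set.mem_insert_iff, Set.mem_singleton_iff, Prod.mk.injEq] at hset
    omega
  have h3 := hmax (P.reflectionPerm t i)
  have h3' := hmax (P.reflectionPerm i i)
  have h4 := hrefl t i
  have h5 := hrefl i t
  rw [h1] at h5
  have h6 := hmax i
  have h7 := corootPairing_rho_pos ht
  have h8 := corootPairing_rho_pos hi
  have h9 : corootPairing P (P.reflectionPerm i t) (rhoWeight b) ≠ 0 := by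
    rcases RootPairing.Base.IsPos.or_neg b (P.reflectionPerm i t) with h | h
    · exact (corootPairing_rho_pos h).ne'
    · have h10 := corootPairing_rho_pos h
      change 0 < corootPairing P (P.reflectionPerm (P.reflectionPerm i t)
        (P.reflectionPerm i t)) (rhoWeight b) at h10
      rw [corootPairing_neg] at h10
      omega
  have h11 : corootPairing P (P.reflectionPerm t i) (rhoWeight b)
      = corootPairing P i (rhoWeight b)
        - P.pairingIn ℤ t i * corootPairing P t (rhoWeight b) := h4
  have h12 := hmax (P.reflectionPerm (P.reflectionPerm t i) (P.reflectionPerm t i))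
  rw [corootPairing_neg] at h12
  have h13 : 2 * corootPairing P t (rhoWeight b)
      ≤ P.pairingIn ℤ t i * corootPairing P t (rhoWeight b) := by nlinarith
  omega

end RootSystem

/-! ### The operator Σ (·, α^∨) α, the number of positive roots, and the inequality n < h -/

section Casimir

variable {ι V N : Type*} [Fintype ι] [AddCommGroup V] [Module ℝ V] [AddCommGroup N] [Module ℝ N]
  {P : RootPairing ι ℝ V N} [P.IsRootSystem] [P.IsCrystallographic]

theorem reflection_mem_weylGroup_smul (i : ι) (v : V) :
    RootPairing.weylGroup.ofIdx P i • v = P.reflection i v := by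
  rw [RootPairing.weylGroup.ofIdx_smul]
  simp

theorem weylGroup_induction {p : P.weylGroup → Prop}
    (mem : ∀ i, p (RootPairing.weylGroup.ofIdx P i)) (one : p 1)
    (mul : ∀ g g', p g → p g' → p (g * g')) (g : P.weylGroup) : p g := by
  obtain ⟨g, hg⟩ := g
  induction hg using RootPairing.weylGroup.induction with
  | mem i => exact mem i
  | one => exact one
  | mul x y hx hy ihx ihy => exact mul _ _ ihx ihy

theorem weylGroup_ext {g g' : P.weylGroup} (h : ∀ v : V, g • v = g' • v) : g = g' := by
  apply Subtype.ext
  apply RootPairing.Equiv.weightHom_injective P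
  ext v
  exact h v

theorem weylGroup_ext_support (b : P.Base) {g g' : P.weylGroup}
    (h : ∀ j ∈ b.support, g • P.root j = g' • P.root j) : g = g' := by
  apply weylGroup_ext
  intro v
  have h1 : (DistribSMul.toLinearMap ℝ V g) = DistribSMul.toLinearMap ℝ V g' := by
    apply b.toWeightBasis.ext
    intro j
    rw [b.toWeightBasis_apply]
    exact h j j.2
  exact DFunLike.congr_fun h1 v

instance : Finite P.weylGroup := by
  apply Finite.of_injective P.weylGroupToPerm
  intro g g' h
  apply weylGroup_ext
  intro v
  have hv : v ∈ Submodule.span ℝ (Set.range P.root) :=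
    RootPairing.IsRootSystem.span_root_eq_top (P := P) ▸ Submodule.mem_top
  have h1 : Set.EqOn (DistribSMul.toLinearMap ℝ V g) (DistribSMul.toLinearMap ℝ V g')
      (Set.range P.root) := by
    rintro _ ⟨i, rfl⟩
    change g • P.root i = g' • P.root i
    rw [P.weylGroup_apply_root, P.weylGroup_apply_root, h]
  exact LinearMap.eqOn_span h1 hv

instance : Fintype P.weylGroup := Fintype.ofFinite _

theorem module_finite (b : P.Base) : Module.Finite ℝ V := Module.Finite.of_basis b.toWeightBasis

theorem finrank_eq (b : P.Base) : finrank ℝ V = Fintype.card b.support :=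
  finrank_eq_card_basis b.toWeightBasis

variable (b : P.Base)

/-- The operator `v ↦ ∑_{α > 0} (v, α^∨) α`. -/
def casimir : V →ₗ[ℝ] V := ∑ i ∈ posRoots b, (P.coroot' i).smulRight (P.root i)

theorem casimir_apply (v : V) : casimir b v = ∑ i ∈ posRoots b, P.coroot' i v • P.root i := by
  simp [casimir, LinearMap.sum_apply]

theorem casimir_smul (g : P.weylGroup) (v : V) : casimir b (g • v) = g • casimir b v := by
  rw [casimir_apply, casimir_apply, Finset.smul_sum]
  rw [← sum_posRoots_perm b (fun i => P.coroot' i (g • v) • P.root i) _ g]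
  · refine Finset.sum_congr rfl fun i _ => ?_
    rw [coroot'_smul, ← P.weylGroup_apply_root, smul_comm g]
  · intro i
    rw [coroot'_reflectionPerm_self, P.root_reflectionPerm, P.reflection_apply_self, neg_smul_neg]

variable [P.IsReduced] [P.IsIrreducible]

theorem normForm_casimir (u v : V) :
    normForm P (casimir b u) v = normForm P u (casimir b v) := by
  rw [casimir_apply, casimir_apply, map_sum, map_sum, LinearMap.sum_apply]
  refine Finset.sum_congr rfl fun i _ => ?_
  rw [map_smul, map_smul, LinearMap.smul_apply, smul_eq_mul, smul_eq_mul]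
  have h1 := two_mul_normForm_root P i u
  have h2 := two_mul_normForm_root P i v
  rw [normForm_symm v] at h2
  linear_combination 1 / 2 * P.coroot' i u * h2 - 1 / 2 * P.coroot' i v * h1

/-- A self-adjoint operator on a nonzero Euclidean space has a real eigenvalue, and by equivariance
its eigenspace is stable under the reflections, so irreducibility makes it the whole space. -/
theorem exists_casimir_eq_smul : ∃ c : ℝ, ∀ v, casimir b v = c • v := by
  have hfin := module_finite b
  have hnt := RootPairing.IsIrreducible.nontrivial P
  let core : InnerProductSpace.Core ℝ V :=
    { inner := fun u v => normForm P u v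
      conj_inner_symm := fun u v => by simp [normForm_symm v u]
      re_inner_nonneg := fun u => by
        rcases eq_or_ne u 0 with rfl | h
        · simp
        · exact (normForm_pos h).le
      add_left := fun u v w => by simp
      smul_left := fun u v r => by simp
      definite := fun u h => by
        by_contra h0
        exact (normForm_pos h0).ne' h }
  let : NormedAddCommGroup V := core.toNormedAddCommGroup
  let : InnerProductSpace ℝ V := InnerProductSpace.ofCore core.toCore
  have hsymm : (casimir b).IsSymmetric := fun u v => normForm_casimir b u v
  by_cases h : ∀ c : ℝ, Module.End.eigenspace (casimir b) c = ⊥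
  · have := hsymm.subsingleton_of_no_eigenvalue_finiteDimensional h
    exact (not_subsingleton V this).elim
  · push Not at h
    obtain ⟨c, hc⟩ := h
    refine ⟨c, fun v => ?_⟩
    have htop : Module.End.eigenspace (casimir b) c = ⊤ := by
      refine RootPairing.IsIrreducible.eq_top_of_invtSubmodule_reflection (P := P) _ ?_ hc
      intro i
      rw [Module.End.mem_invtSubmodule]
      intro u hu
      rw [Submodule.mem_comap, Module.End.mem_eigenspace_iff]
      rw [Module.End.mem_eigenspace_iff] at hu
      have h1 := casimir_smul b (RootPairing.weylGroup.ofIdx P i) u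
      rw [hu, reflection_mem_weylGroup_smul, reflection_mem_weylGroup_smul, map_smul] at h1
      exact h1
    have hv : v ∈ Module.End.eigenspace (casimir b) c := htop ▸ Submodule.mem_top
    exact Module.End.mem_eigenspace_iff.1 hv

/-- The scalar is found by applying the operator to θ and pairing with θ^∨. For α ≠ θ the number (θ,
α^∨) is at most 1 and (α, θ^∨) is nonnegative, so their product is just (α, θ^∨). The total is 4 +
(2(ρ, θ^∨) - 2) = 2h. -/
theorem casimir_eq (v : V) : casimir b v = (coxeterNumber b : ℝ) • v := by
  classical
  obtain ⟨c, hc⟩ := exists_casimir_eq_smul b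
  obtain ⟨t, ht, hmax, hh⟩ := exists_maximal_coroot b
  obtain ⟨h0, h1⟩ := maximal_coroot_pairing b ht hmax
  have hcast : ∀ i j, P.pairing i j = (P.pairingIn ℤ i j : ℝ) := fun i j =>
    (P.algebraMap_pairingIn ℤ i j).symm
  have htm : t ∈ posRoots b := (mem_posRoots b).2 ht
  have hc2 : ∑ i ∈ posRoots b, P.pairing t i * P.pairing i t = 2 * c := by
    have h2 := congrArg (P.coroot' t) (hc (P.root t))
    rw [casimir_apply, map_sum, map_smul, P.root_coroot'_eq_pairing, P.pairing_same] at h2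
    rw [mul_comm 2 c, ← smul_eq_mul c, ← h2]
    refine Finset.sum_congr rfl fun i _ => ?_
    rw [map_smul, P.root_coroot'_eq_pairing, P.root_coroot'_eq_pairing, smul_eq_mul]
  have hterm : ∀ i ∈ (posRoots b).erase t, P.pairing t i * P.pairing i t = P.pairing i t := by
    intro i hi
    rw [Finset.mem_erase, mem_posRoots] at hi
    have h3 := h1 i hi.2 hi.1
    have h4 := h0 i hi.2
    have h5 := P.pairingIn_pairingIn_mem_set_of_isCrystal_of_isRed t i
    have h6 : P.pairingIn ℤ t i * P.pairingIn ℤ i t = P.pairingIn ℤ i t := by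
      generalize P.pairingIn ℤ t i = x, P.pairingIn ℤ i t = y at h3 h4 h5
      simp only [Set.mem_insert_iff, Set.mem_singleton_iff, Prod.mk.injEq] at h5
      rcases h5 with ⟨rfl, rfl⟩ | ⟨rfl, rfl⟩ | ⟨rfl, rfl⟩ | ⟨rfl, rfl⟩ | ⟨rfl, rfl⟩ | ⟨rfl, rfl⟩ |
        ⟨rfl, rfl⟩ | ⟨rfl, rfl⟩ | ⟨rfl, rfl⟩ | ⟨rfl, rfl⟩ | ⟨rfl, rfl⟩ | ⟨rfl, rfl⟩ | ⟨rfl, rfl⟩ <;>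
        omega
    rw [hcast, hcast]
    exact_mod_cast h6
  have hrho : P.coroot' t (rho b) = (corootPairing P t (rhoWeight b) : ℝ) :=
    (corootPairing_cast P t (rhoWeight b)).symm
  have hsum : 2 + ∑ i ∈ (posRoots b).erase t, P.pairing i t = 2 * P.coroot' t (rho b) := by
    rw [rho, map_smul, map_sum, ← Finset.add_sum_erase _ _ htm]
    simp only [P.root_coroot'_eq_pairing, P.pairing_same, smul_eq_mul]
    ring
  rw [← Finset.add_sum_erase _ _ htm, Finset.sum_congr rfl hterm, P.pairing_same] at hc2
  have hh' : ((coxeterNumber b : ℤ) : ℝ) = ((1 + corootPairing P t (rhoWeight b) : ℤ) : ℝ) := by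
    rw [hh]
  push_cast at hh'
  rw [hc, hh', ← hrho]
  congr 1
  linarith

/-- Take traces in `casimir_eq`: every rank one summand has trace (α, α^∨) = 2. -/
theorem two_mul_card_posRoots :
    2 * (posRoots b).card = coxeterNumber b * Fintype.card b.support := by
  have hfin := module_finite b
  have h1 : casimir b = (coxeterNumber b : ℝ) • LinearMap.id :=
    LinearMap.ext fun v => casimir_eq b v
  have h2 := congrArg (LinearMap.trace ℝ V) h1
  rw [casimir, map_sum, map_smul, LinearMap.trace_id, finrank_eq b] at h2
  have h3 : ∀ i ∈ posRoots b, LinearMap.trace ℝ V ((P.coroot' i).smulRight (P.root i)) = 2 := by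
    intro i _
    rw [LinearMap.trace_smulRight, P.root_coroot'_eq_pairing, P.pairing_same]
  rw [Finset.sum_congr rfl h3, Finset.sum_const, nsmul_eq_mul, smul_eq_mul] at h2
  have h4 : ((2 * (posRoots b).card : ℕ) : ℝ) = ((coxeterNumber b * Fintype.card b.support : ℕ) : ℝ) := by
    push_cast
    linarith
  exact_mod_cast h4

theorem corootPairing_sum_rootWeight (v : weightLattice P) :
    ∑ i ∈ posRoots b, corootPairing P i v • rootWeight P i = (coxeterNumber b) • v := by
  apply Subtype.ext
  have h := casimir_eq b (v : V)
  rw [casimir_apply] at h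
  rw [AddSubgroup.val_finsetSum, AddSubgroup.coe_nsmul, ← Nat.cast_smul_eq_nsmul ℝ, ← h]
  refine Finset.sum_congr rfl fun i _ => ?_
  rw [AddSubgroup.coe_zsmul, ← corootPairing_cast, Int.cast_smul_eq_zsmul]
  rfl

theorem corootPairing_fundWeight (l j : b.support) [DecidableEq b.support] :
    corootPairing P l (fundWeight b j) = if l = j then 1 else 0 := by
  have h1 : P.coroot' l (fundWeight b j : V) = if l = j then 1 else 0 := by
    change P.toLinearMap (P.toLinearMap.toPerfPair.symm _) (P.coroot l) = _
    rw [LinearMap.apply_symm_toPerfPair_self, Basis.coord_apply,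
      b.toCoweightBasis_repr_coroot l, Finsupp.single_apply]
  have h2 : ((corootPairing P l (fundWeight b j) : ℤ) : ℝ)
      = ((if l = j then 1 else 0 : ℤ) : ℝ) := by
    rw [corootPairing_cast, h1]; split_ifs <;> simp
  exact_mod_cast h2

theorem corootPairing_fundWeight_nonneg {i : ι} (hi : b.IsPos i) (j : b.support) :
    0 ≤ corootPairing P i (fundWeight b j) := by
  classical
  have h := coroot'_nonneg_of_isPos (b := b) (v := (fundWeight b j : V)) ?_ hi
  · rw [← corootPairing_cast] at h; exact_mod_cast h
  · intro l hl
    rw [← corootPairing_cast, corootPairing_fundWeight b ⟨l, hl⟩ j]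
    split_ifs <;> simp

/-- The coefficients of a weight with respect to a coroot, in terms of the simple coroots. -/
theorem corootPairing_eq_sum (i : ι) (v : weightLattice P) :
    corootPairing P i v
      = ∑ j : b.support, corootPairing P j v * corootPairing P i (fundWeight b j) := by
  exact (map_eq_sum b (corootHom (P := P) i) v).trans
    (Finset.sum_congr rfl fun j _ => smul_eq_mul _ _)

/-- The number h - 1 is the sum of the coefficients of θ^∨ in the simple coroots, so it suffices
that each is at least 1. Dominance of θ^∨ makes the simple roots with coefficient zero pair to zero
with the coroots of the other simple roots, so they would span a stable proper subspace. -/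
theorem card_support_lt_coxeterNumber : Fintype.card b.support < coxeterNumber b := by
  classical
  obtain ⟨t, ht, hmax, hh⟩ := exists_maximal_coroot b
  obtain ⟨h0, -⟩ := maximal_coroot_pairing b ht hmax
  have hcast : ∀ i j, corootPairing P j (rootWeight P i) = P.pairingIn ℤ i j := fun i j => by
    have : ((corootPairing P j (rootWeight P i) : ℤ) : ℝ) = ((P.pairingIn ℤ i j : ℤ) : ℝ) := by
      rw [corootPairing_cast]
      exact (P.root_coroot'_eq_pairing _ _).trans (P.algebraMap_pairingIn ℤ i j).symm
    exact_mod_cast this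
  have hsum := corootPairing_eq_sum b t (rhoWeight b)
  simp only [corootPairing_rho_support (Subtype.prop _), one_mul] at hsum
  set c : b.support → ℤ := fun j => corootPairing P t (fundWeight b j) with hcdef
  have hc0 : ∀ j, 0 ≤ c j := fun j => corootPairing_fundWeight_nonneg b ht j
  have hpos : ∀ j, 1 ≤ c j := by
    by_contra! hex
    obtain ⟨j0, hj0⟩ := hex
    have hj0' : c j0 = 0 := by have := hc0 j0; omega
    have hz : ∀ i : b.support, c i = 0 → ∀ j : b.support, c j ≠ 0 → P.pairingIn ℤ i j = 0 := by
      intro i hi j hj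
      have h1 := h0 i (b.isPos_of_mem_support i.2)
      rw [← hcast, corootPairing_eq_sum b] at h1
      have h2 : ∀ l ∈ (Finset.univ : Finset b.support), corootPairing P l (rootWeight P i) * c l ≤ 0 := by
        intro l _
        rcases eq_or_ne l i with rfl | hli
        · rw [hi, mul_zero]
        · rw [hcast]
          exact mul_nonpos_of_nonpos_of_nonneg
            (b.pairingIn_le_zero_of_ne (fun h => hli (Subtype.ext h.symm)) i.2 l.2) (hc0 l)
      have h3 := (Finset.sum_eq_zero_iff_of_nonpos h2).1 (le_antisymm (Finset.sum_nonpos h2) h1)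
        j (Finset.mem_univ j)
      rw [hcast] at h3
      exact (mul_eq_zero.1 h3).resolve_right hj
    let q : Submodule ℝ V := Submodule.span ℝ (P.root '' {i | ∃ h : i ∈ b.support, c ⟨i, h⟩ = 0})
    have hq0 : q ≠ ⊥ := by
      intro h
      have h1 : P.root j0 ∈ q := Submodule.subset_span ⟨j0, ⟨j0.2, hj0'⟩, rfl⟩
      rw [h, Submodule.mem_bot] at h1
      exact P.ne_zero _ h1
    have hqinv : ∀ i ∈ b.support, q ∈ Module.End.invtSubmodule (P.reflection i) := by
      intro i hi
      rw [Module.End.mem_invtSubmodule]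
      change Submodule.span ℝ _ ≤ _
      rw [Submodule.span_le]
      rintro _ ⟨l, ⟨hl, hcl⟩, rfl⟩
      rw [SetLike.mem_coe, Submodule.mem_comap]
      change P.reflection i (P.root l) ∈ q
      rw [RootPairing.reflection_apply_root]
      have hlq : P.root l ∈ q := Submodule.subset_span ⟨l, ⟨hl, hcl⟩, rfl⟩
      by_cases hci : c ⟨i, hi⟩ = 0
      · exact sub_mem hlq (q.smul_mem _ (Submodule.subset_span ⟨i, ⟨hi, hci⟩, rfl⟩))
      · have := hz ⟨l, hl⟩ hcl ⟨i, hi⟩ hci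
        rw [← P.algebraMap_pairingIn ℤ, this, map_zero, zero_smul, sub_zero]
        exact hlq
    have hqtop := RootPairing.IsIrreducible.eq_top_of_invtSubmodule_reflection (P := P) q
      ((b.forall_mem_support_invtSubmodule_iff q).1 hqinv) hq0
    -- The span is proper because θ^∨ vanishes on it, whereas (θ, θ^∨) = 2.
    have hker : q ≤ LinearMap.ker (P.coroot' t) ⊔ LinearMap.ker (P.coroot' t) := by
      rw [sup_idem]
      change Submodule.span ℝ _ ≤ _
      rw [Submodule.span_le]
      rintro _ ⟨l, ⟨hl, hcl⟩, rfl⟩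
      rw [SetLike.mem_coe, LinearMap.mem_ker]
      have h1 := corootPairing_cast P t (rootWeight P l)
      change _ = P.coroot' t (P.root l) at h1
      rw [← h1, corootPairing_eq_sum b]
      rw [Finset.sum_eq_zero, Int.cast_zero]
      intro m _
      by_cases hm : c m = 0
      · change _ * c m = 0
        rw [hm, mul_zero]
      · rw [hcast, hz ⟨l, hl⟩ hcl m hm, zero_mul]
    rw [sup_idem, hqtop] at hker
    have h5 : P.root t ∈ LinearMap.ker (P.coroot' t) := hker Submodule.mem_top
    rw [LinearMap.mem_ker, P.root_coroot'_eq_pairing, P.pairing_same] at h5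
    norm_num at h5
  have h6 : (Fintype.card b.support : ℤ) ≤ ∑ j, c j := by
    have := Finset.card_nsmul_le_sum Finset.univ c 1 (fun j _ => hpos j)
    simpa using this
  have h7 : (coxeterNumber b : ℤ) = 1 + ∑ j, c j := by rw [hh, hsum]
  omega

end Casimir

/-! ### Words in simple reflections, the stabilizer of ρ, the root lattice -/

section WeylGroup

variable {ι V N : Type*} [Fintype ι] [AddCommGroup V] [Module ℝ V] [AddCommGroup N] [Module ℝ N]
  {P : RootPairing ι ℝ V N} [P.IsRootSystem] [P.IsCrystallographic]

theorem ofIdx_perm (g : P.weylGroup) (i : ι) :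
    RootPairing.weylGroup.ofIdx P (P.weylGroupToPerm g i)
      = g * RootPairing.weylGroup.ofIdx P i * g⁻¹ := by
  apply weylGroup_ext
  intro v
  rw [mul_smul, mul_smul, reflection_mem_weylGroup_smul, reflection_mem_weylGroup_smul,
    RootPairing.reflection_apply, RootPairing.reflection_apply, smul_sub, smul_inv_smul,
    smul_comm g, P.weylGroup_apply_root]
  congr 2
  conv_lhs => rw [← smul_inv_smul g v, coroot'_smul]

theorem ofIdx_mul_self (i : ι) :
    RootPairing.weylGroup.ofIdx P i * RootPairing.weylGroup.ofIdx P i = 1 := by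
  apply weylGroup_ext
  intro v
  rw [mul_smul, reflection_mem_weylGroup_smul, reflection_mem_weylGroup_smul,
    RootPairing.reflection_same, one_smul]

theorem ofIdx_inv (i : ι) :
    (RootPairing.weylGroup.ofIdx P i)⁻¹ = RootPairing.weylGroup.ofIdx P i :=
  inv_eq_of_mul_eq_one_right (ofIdx_mul_self i)

theorem weylGroupToPerm_ofIdx (i j : ι) :
    P.weylGroupToPerm (RootPairing.weylGroup.ofIdx P i) j = P.reflectionPerm i j := by
  apply P.root.injective
  rw [← P.weylGroup_apply_root, reflection_mem_weylGroup_smul, P.root_reflectionPerm]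

theorem weylGroupToPerm_inv_apply (g : P.weylGroup) (i : ι) :
    P.weylGroupToPerm g⁻¹ (P.weylGroupToPerm g i) = i := by
  rw [← Equiv.Perm.mul_apply, ← map_mul, inv_mul_cancel, map_one, Equiv.Perm.one_apply]

theorem weylGroupToPerm_neg (g : P.weylGroup) (i : ι) :
    P.weylGroupToPerm g (P.reflectionPerm i i)
      = P.reflectionPerm (P.weylGroupToPerm g i) (P.weylGroupToPerm g i) := by
  apply P.root.injective
  rw [← P.weylGroup_apply_root, P.root_reflectionPerm, P.root_reflectionPerm,
    P.reflection_apply_self, P.reflection_apply_self, smul_neg, P.weylGroup_apply_root]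

theorem isPos_neg_iff (b : P.Base) (i : ι) : b.IsPos (P.reflectionPerm i i) ↔ ¬ b.IsPos i :=
  RootPairing.Base.IsPos.neg_iff_not b i

variable (b : P.Base)

/-- A product of simple reflections. -/
def simpleWord (L : List b.support) : P.weylGroup :=
  (L.map fun j => RootPairing.weylGroup.ofIdx P (j : ι)).prod

theorem simpleWord_cons (j : b.support) (L : List b.support) :
    simpleWord b (j :: L) = RootPairing.weylGroup.ofIdx P (j : ι) * simpleWord b L := by
  simp [simpleWord]

theorem simpleWord_append (L L' : List b.support) :
    simpleWord b (L ++ L') = simpleWord b L * simpleWord b L' := by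
  simp [simpleWord]

variable [P.IsReduced] [P.IsIrreducible]

theorem exists_simpleWord (g : P.weylGroup) : ∃ L, g = simpleWord b L := by
  induction g using weylGroup_induction with
  | mem i =>
    refine b.induction_reflect i (p := fun i => ∃ L, RootPairing.weylGroup.ofIdx P i
      = simpleWord b L) ?_ ?_ ?_
    · rintro i ⟨L, hL⟩
      refine ⟨L, ?_⟩
      rw [← hL, ← weylGroupToPerm_ofIdx, ofIdx_perm, ofIdx_inv, ofIdx_mul_self, one_mul]
    · intro i hi
      exact ⟨[⟨i, hi⟩], by simp [simpleWord]⟩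
    · rintro i j ⟨L, hL⟩ hj
      refine ⟨⟨j, hj⟩ :: (L ++ [⟨j, hj⟩]), ?_⟩
      rw [← weylGroupToPerm_ofIdx, ofIdx_perm, ofIdx_inv, simpleWord_cons, simpleWord_append, ← hL,
        mul_assoc]
      simp [simpleWord]
  | one => exact ⟨[], by simp [simpleWord]⟩
  | mul g g' h h' =>
    obtain ⟨L, rfl⟩ := h
    obtain ⟨L', rfl⟩ := h'
    exact ⟨L ++ L', (simpleWord_append b L L').symm⟩

/-- The exchange condition. Reading the word from the right, the image of the simple root becomes
negative at some letter, and just before that it must be the simple root of this letter, since a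
simple reflection makes no other positive root negative. That letter can be deleted. -/
theorem exists_shorter_simpleWord (L : List b.support) (j : b.support)
    (h : ¬ b.IsPos (P.weylGroupToPerm (simpleWord b L) j)) :
    ∃ L' : List b.support, L'.length + 1 = L.length ∧
      simpleWord b L * RootPairing.weylGroup.ofIdx P (j : ι) = simpleWord b L' := by
  induction L with
  | nil => exact (h (by simpa [simpleWord] using b.isPos_of_mem_support j.2)).elim
  | cons i L ih =>
    rw [simpleWord_cons, map_mul, Equiv.Perm.mul_apply, weylGroupToPerm_ofIdx] at h
    by_cases h0 : b.IsPos (P.weylGroupToPerm (simpleWord b L) j)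
    · have h1 : P.weylGroupToPerm (simpleWord b L) j = i := by
        by_contra hne
        exact h (h0.reflectionPerm i.2 hne)
      refine ⟨L, by simp, ?_⟩
      have h2 := ofIdx_perm (simpleWord b L) (j : ι)
      rw [h1] at h2
      rw [simpleWord_cons, h2, inv_mul_cancel_right, mul_assoc, ofIdx_mul_self, mul_one]
    · obtain ⟨L', hl, hL'⟩ := ih h0
      exact ⟨i :: L', by simp [hl], by rw [simpleWord_cons, simpleWord_cons, mul_assoc, hL']⟩

/-- A nonempty word of minimal length would send the simple root of its last letter to a negative
root, for otherwise the exchange condition shortens it. -/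
theorem eq_one_of_forall_isPos (g : P.weylGroup)
    (h : ∀ i, b.IsPos i → b.IsPos (P.weylGroupToPerm g i)) : g = 1 := by
  classical
  have hex : ∃ n, ∃ L : List b.support, L.length = n ∧ g = simpleWord b L := by
    obtain ⟨L, hL⟩ := exists_simpleWord b g
    exact ⟨_, L, rfl, hL⟩
  obtain ⟨L, hl, hL⟩ := Nat.find_spec hex
  rcases List.eq_nil_or_concat L with rfl | ⟨L1, j, rfl⟩
  · rw [hL]; simp [simpleWord]
  · exfalso
    rw [List.concat_eq_append, simpleWord_append] at hL
    have hj : simpleWord b [j] = RootPairing.weylGroup.ofIdx P (j : ι) := by simp [simpleWord]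
    rw [hj] at hL
    have h1 := h j (b.isPos_of_mem_support j.2)
    rw [hL, map_mul, Equiv.Perm.mul_apply, weylGroupToPerm_ofIdx, weylGroupToPerm_neg,
      isPos_neg_iff] at h1
    obtain ⟨L', hl', hL'⟩ := exists_shorter_simpleWord b L1 j h1
    refine Nat.find_min hex (m := L'.length) ?_ ⟨L', rfl, by rw [hL, hL']⟩
    rw [← hl, List.length_concat]
    omega

theorem isPos_iff_corootPairing_rho (i : ι) : b.IsPos i ↔ 0 < corootPairing P i (rhoWeight b) := by
  refine ⟨corootPairing_rho_pos, fun h => ?_⟩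
  by_contra hi
  rw [← isPos_neg_iff] at hi
  have := corootPairing_rho_pos hi
  rw [corootPairing_neg] at this
  omega

theorem eq_one_of_smul_rho (g : P.weylGroup) (h : g • rhoWeight b = rhoWeight b) : g = 1 := by
  apply eq_one_of_forall_isPos b
  intro i hi
  rw [isPos_iff_corootPairing_rho] at hi ⊢
  rwa [← h, corootPairing_smul]

/-! ### The root lattice -/

variable (P) in
/-- The root lattice inside the weight lattice. -/
def rootLattice : AddSubgroup (weightLattice P) := AddSubgroup.closure (Set.range (rootWeight P))

theorem rootWeight_mem_rootLattice (i : ι) : rootWeight P i ∈ rootLattice P :=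
  AddSubgroup.subset_closure ⟨i, rfl⟩

theorem rootWeight_eq_sum (i : ι) :
    ∃ c : b.support → ℤ, rootWeight P i = ∑ j, c j • rootWeight P j := by
  have h := b.root_mem_span_int i
  have h1 : P.root '' b.support = Set.range fun j : b.support => P.root j := by
    ext x; simp
  rw [h1, Submodule.mem_span_range_iff_exists_fun] at h
  obtain ⟨c, hc⟩ := h
  refine ⟨c, Subtype.ext ?_⟩
  rw [AddSubgroup.val_finsetSum]
  exact hc.symm

theorem mem_rootLattice_iff (v : weightLattice P) :
    v ∈ rootLattice P ↔ ∃ c : b.support → ℤ, v = ∑ j, c j • rootWeight P j := by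
  constructor
  · intro h
    induction h using AddSubgroup.closure_induction with
    | mem x hx =>
      obtain ⟨i, rfl⟩ := hx
      exact rootWeight_eq_sum b i
    | zero => exact ⟨0, by simp⟩
    | add x y _ _ hx hy =>
      obtain ⟨c, rfl⟩ := hx
      obtain ⟨d, rfl⟩ := hy
      exact ⟨c + d, by simp [add_smul, Finset.sum_add_distrib]⟩
    | neg x _ hx =>
      obtain ⟨c, rfl⟩ := hx
      exact ⟨-c, by simp⟩
  · rintro ⟨c, rfl⟩
    exact sum_mem fun j _ => zsmul_mem (rootWeight_mem_rootLattice _) _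

theorem smul_sub_mem_rootLattice (g : P.weylGroup) (v : weightLattice P) :
    g • v - v ∈ rootLattice P := by
  induction g using weylGroup_induction generalizing v with
  | mem i =>
    rw [ofIdx_smul_eq, sub_sub_cancel_left]
    exact neg_mem (zsmul_mem (rootWeight_mem_rootLattice i) _)
  | one => rw [one_smul, sub_self]; exact zero_mem _
  | mul g g' h h' =>
    rw [mul_smul, ← sub_add_sub_cancel _ (g' • v)]
    exact add_mem (h _) (h' _)

/-- The sum is fixed by every reflection, so all coroots vanish on it. -/
theorem sum_weylGroup_smul (v : weightLattice P) : ∑ g : P.weylGroup, g • v = 0 := by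
  have h : ∀ i, RootPairing.weylGroup.ofIdx P i • (∑ g : P.weylGroup, g • v)
      = ∑ g : P.weylGroup, g • v := by
    intro i
    rw [Finset.smul_sum]
    simp only [← mul_smul]
    exact Fintype.sum_equiv (Equiv.mulLeft _) _ _ fun g => rfl
  apply Subtype.ext
  rw [AddSubgroup.coe_zero]
  refine (P.eq_zero_iff_forall_coroot'_eq_zero).2 fun i => ?_
  have h1 := h i
  rw [ofIdx_smul_eq, sub_eq_self] at h1
  have h2 := congrArg (corootPairing P i) h1
  rw [← corootPairing_cast]
  have h3 := map_zsmul (corootHom (P := P) i) (corootPairing P i (∑ g : P.weylGroup, g • v))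
    (rootWeight P i)
  change corootPairing P i _ = _ • corootPairing P i (rootWeight P i) at h3
  have h4 : corootPairing P i (rootWeight P i) = 2 := by
    have : ((corootPairing P i (rootWeight P i) : ℤ) : ℝ) = ((2 : ℤ) : ℝ) := by
      rw [corootPairing_cast]
      change P.coroot' i (P.root i) = _
      simp
    exact_mod_cast this
  have h5 : corootPairing P i (0 : weightLattice P) = 0 := map_zero (corootHom (P := P) i)
  rw [h3, h4, h5, smul_eq_mul] at h2
  have h6 : corootPairing P i (∑ g : P.weylGroup, g • v) = 0 := by omega
  rw [h6, Int.cast_zero]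

/-- Subtracting Σ g v = 0 writes this multiple through the differences g v - v, each of which is in
the root lattice. -/
theorem card_smul_mem_rootLattice (v : weightLattice P) :
    Fintype.card P.weylGroup • v ∈ rootLattice P := by
  have h : Fintype.card P.weylGroup • v = -∑ g : P.weylGroup, (g • v - v) := by
    rw [Finset.sum_sub_distrib, sum_weylGroup_smul]
    simp
  rw [h]
  exact neg_mem (sum_mem fun g _ => smul_sub_mem_rootLattice g v)

theorem corootPairing_rootWeight (i j : ι) :
    corootPairing P j (rootWeight P i) = P.pairingIn ℤ i j := by
  have : ((corootPairing P j (rootWeight P i) : ℤ) : ℝ) = ((P.pairingIn ℤ i j : ℤ) : ℝ) := by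
    rw [corootPairing_cast]
    exact (P.root_coroot'_eq_pairing _ _).trans (P.algebraMap_pairingIn ℤ i j).symm
  exact_mod_cast this

theorem corootPairing_rootWeight_self (i : ι) : corootPairing P i (rootWeight P i) = 2 := by
  rw [corootPairing_rootWeight, P.pairingIn_same]

theorem corootPairing_zsmul (i : ι) (n : ℤ) (v : weightLattice P) :
    corootPairing P i (n • v) = n * corootPairing P i v :=
  (map_zsmul (corootHom (P := P) i) n v).trans (smul_eq_mul _ _)

theorem corootPairing_sub (i : ι) (u v : weightLattice P) :
    corootPairing P i (u - v) = corootPairing P i u - corootPairing P i v :=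
  map_sub (corootHom (P := P) i) u v

/-- A minuscule weight in the root lattice is zero. -/
theorem eq_zero_of_abs_corootPairing_le_one {v : weightLattice P} (hv : v ∈ rootLattice P)
    (h : ∀ i, |corootPairing P i v| ≤ 1) : v = 0 := by
  classical
  obtain ⟨b⟩ := P.nonempty_base
  obtain ⟨c, hc⟩ := (mem_rootLattice_iff b v).1 hv
  generalize hn : ∑ j, (c j).natAbs = n
  induction n using Nat.strong_induction_on generalizing v c with
  | _ n ih =>
    by_contra hne
    have hne' : (v : V) ≠ 0 := fun h0 => hne (Subtype.ext h0)
    have hpos := normForm_pos (P := P) hne'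
    have hv' : (v : V) = ∑ j, (c j : ℝ) • P.root j := by
      conv_lhs => rw [hc]
      rw [AddSubgroup.val_finsetSum]
      refine Finset.sum_congr rfl fun j _ => ?_
      rw [AddSubgroup.coe_zsmul, Int.cast_smul_eq_zsmul]
      rfl
    have hsum : normForm P (v : V) (v : V)
        = ∑ j : b.support, (c j : ℝ) * normForm P (v : V) (P.root j) := by
      conv_lhs => rw [show normForm P (v : V) (v : V) = normForm P (v : V)
        (∑ j, (c j : ℝ) • P.root j) by rw [← hv']]
      rw [map_sum]
      exact Finset.sum_congr rfl fun j _ => by rw [map_smul, smul_eq_mul]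
    rw [hsum] at hpos
    -- Since (v, v) > 0, some coefficient c_j has the same sign as (v, α_j^∨). That pairing is then
    -- ±1, and the reflection s_j decreases Σ |c_j| by one, so the induction hypothesis applies to
    -- s_j v.
    obtain ⟨j, -, hj⟩ := Finset.exists_lt_of_sum_lt (s := Finset.univ) (f := fun _ => (0 : ℝ))
      (g := fun j : b.support => (c j : ℝ) * normForm P (v : V) (P.root j)) (by simpa using hpos)
    have hj2 : 0 < c j * corootPairing P j v := by
      have h1 := two_mul_normForm_root P (j : ι) (v : V)
      have h2 : 0 < normForm P (P.root j) (P.root j) := normForm_pos (P.ne_zero _)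
      have h3 : (0 : ℝ) < (c j : ℝ) * (corootPairing P j v : ℝ) := by
        rw [corootPairing_cast]
        have h4 : 2 * ((c j : ℝ) * normForm P (v : V) (P.root j))
            = normForm P (P.root j) (P.root j) * ((c j : ℝ) * P.coroot' j (v : V)) := by
          linear_combination (c j : ℝ) * h1
        refine pos_of_mul_pos_right (a := normForm P (P.root j) (P.root j)) ?_ h2.le
        rw [← h4]
        linarith
      exact_mod_cast h3
    have habs := h j
    rw [abs_le] at habs
    let g := RootPairing.weylGroup.ofIdx P (j : ι)
    have hgv : g • v = ∑ l, (c - Pi.single j (corootPairing P j v) : b.support → ℤ) l • rootWeight P l := by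
      rw [ofIdx_smul_eq]
      simp only [Pi.sub_apply, sub_smul, Finset.sum_sub_distrib]
      rw [← hc]
      congr 1
      rw [Finset.sum_eq_single j]
      · rw [Pi.single_eq_same]
      · intro l _ hl
        rw [Pi.single_eq_of_ne hl, zero_smul]
      · simp
    have hz : g • v = 0 := by
      refine ih _ ?_ ((mem_rootLattice_iff b _).2 ⟨_, hgv⟩) ?_ _ hgv rfl
      · rw [← hn]
        apply Finset.sum_lt_sum
        · intro l _
          rcases eq_or_ne l j with rfl | hl
          · rw [Pi.sub_apply, Pi.single_eq_same]
            rcases pos_and_pos_or_neg_and_neg_of_mul_pos hj2 with h1 | h1 <;> omega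
          · rw [Pi.sub_apply, Pi.single_eq_of_ne hl, sub_zero]
        · refine ⟨j, Finset.mem_univ _, ?_⟩
          rw [Pi.sub_apply, Pi.single_eq_same]
          rcases pos_and_pos_or_neg_and_neg_of_mul_pos hj2 with h1 | h1 <;> omega
      · intro i
        have h1 := corootPairing_smul P g (P.weylGroupToPerm g⁻¹ i) v
        have h2 := weylGroupToPerm_inv_apply (P := P) g⁻¹ i
        rw [inv_inv] at h2
        rw [h2] at h1
        rw [h1]
        exact h _
    apply hne
    rw [← inv_smul_smul g v, hz, smul_zero]

end WeylGroup

/-! ### Arithmetic of the prime `p = h + 1` -/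

section Arithmetic

variable {ι V N : Type*} [Fintype ι] [AddCommGroup V] [Module ℝ V] [AddCommGroup N] [Module ℝ N]
  {P : RootPairing ι ℝ V N} [P.IsRootSystem] [P.IsCrystallographic] (b : P.Base)
  [P.IsReduced] [P.IsIrreducible]

theorem fundWeight_ext {g g' : P.weylGroup} (h : ∀ j, g • fundWeight b j = g' • fundWeight b j) :
    g = g' := by
  apply weylGroup_ext_support b
  intro i hi
  have h1 := addHom_ext b (f := DistribSMul.toAddMonoidHom (weightLattice P) g)
    (f' := DistribSMul.toAddMonoidHom (weightLattice P) g') h (rootWeight P i)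
  exact congrArg Subtype.val h1

open Classical in
/-- The matrices of the elements of the Weyl group in the basis of fundamental weights. -/
def weylMatrix : P.weylGroup →* Matrix b.support b.support ℤ where
  toFun g := Matrix.of fun l j => corootPairing P l (g • fundWeight b j)
  map_one' := by
    ext l j
    rw [Matrix.of_apply, one_smul, corootPairing_fundWeight, Matrix.one_apply]
  map_mul' g g' := by
    ext l j
    rw [Matrix.of_apply, Matrix.mul_apply, mul_smul]
    have h := map_eq_sum b ((corootHom (P := P) (l : ι)).comp
      (DistribSMul.toAddMonoidHom (weightLattice P) g)) (g' • fundWeight b j)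
    refine h.trans (Finset.sum_congr rfl fun m _ => ?_)
    rw [smul_eq_mul, mul_comm]
    rfl

theorem weylMatrix_injective : Function.Injective (weylMatrix b) := by
  intro g g' h
  apply fundWeight_ext b
  intro j
  rw [eq_sum_fundWeight b (g • fundWeight b j), eq_sum_fundWeight b (g' • fundWeight b j)]
  refine Finset.sum_congr rfl fun l _ => ?_
  have := congrFun (congrFun h l) j
  change corootPairing P l (g • fundWeight b j) = corootPairing P l (g' • fundWeight b j) at this
  rw [this]

theorem nonempty_support : Nonempty b.support := by
  have := nonempty_index (P := P)
  obtain ⟨i⟩ := this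
  obtain ⟨j, hj, -⟩ := b.exists_mem_support_pos_pairingIn_ne_zero i
  exact ⟨⟨j, hj⟩⟩

theorem two_le_coxeterNumber : 2 ≤ coxeterNumber b := by
  have h1 := card_support_lt_coxeterNumber b
  have h2 := nonempty_support b
  have h3 := Fintype.card_pos (α := b.support)
  omega

variable {p : ℕ} [hpp : Fact p.Prime] (hp : 1 + coxeterNumber b = p)
include hp

/-- An element of order p would be a nontrivial integral n × n matrix M with M^p = 1. Its minimal
polynomial would be divisible by the p-th cyclotomic polynomial, of degree p - 1 = h, whereas n < h.
-/
theorem not_dvd_card_weylGroup : ¬ p ∣ Fintype.card P.weylGroup := by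
  classical
  intro hdvd
  rw [← Nat.card_eq_fintype_card] at hdvd
  obtain ⟨g, hg⟩ := exists_prime_orderOf_dvd_card' p hdvd
  let M : Matrix b.support b.support ℚ := (weylMatrix b g).map (Int.castRingHom ℚ)
  have hMpow : ∀ k : ℕ, M ^ k = (weylMatrix b (g ^ k)).map (Int.castRingHom ℚ) := by
    intro k
    rw [map_pow]
    exact (map_pow ((Int.castRingHom ℚ).mapMatrix) (weylMatrix b g) k).symm
  have hM1 : M ^ p = 1 := by
    rw [hMpow, ← hg, pow_orderOf_eq_one, map_one]
    exact map_one ((Int.castRingHom ℚ).mapMatrix)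
  have hMne : M ≠ 1 := by
    intro h
    have h1 : weylMatrix b g = 1 := by
      have h2 : Function.Injective ((Int.castRingHom ℚ).mapMatrix :
          Matrix b.support b.support ℤ → Matrix b.support b.support ℚ) :=
        Matrix.map_injective Int.cast_injective
      apply h2
      rw [map_one]
      exact h
    have h3 : g = 1 := weylMatrix_injective b (by rw [h1, map_one])
    rw [h3, orderOf_one] at hg
    exact hpp.out.one_lt.ne hg
  have hdv : minpoly ℚ M ∣ Polynomial.cyclotomic p ℚ * (Polynomial.X - 1) := by
    apply minpoly.dvd
    rw [Polynomial.cyclotomic_prime_mul_X_sub_one]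
    simp [hM1]
  have hirr := Polynomial.cyclotomic.irreducible_rat hpp.out.pos
  by_cases h : Polynomial.cyclotomic p ℚ ∣ minpoly ℚ M
  · have h1 := Polynomial.natDegree_le_of_dvd (h.trans (Matrix.minpoly_dvd_charpoly M))
      (Matrix.charpoly_monic M).ne_zero
    rw [Polynomial.natDegree_cyclotomic, Nat.totient_prime hpp.out,
      Matrix.charpoly_natDegree_eq_dim] at h1
    have h2 := card_support_lt_coxeterNumber b
    omega
  · have h1 := (hirr.coprime_iff_not_dvd.2 h).symm.dvd_of_dvd_mul_left hdv
    refine hMne ?_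
    have h2 := Polynomial.aeval_eq_zero_of_dvd_aeval_eq_zero h1 (minpoly.aeval ℚ M)
    simpa [sub_eq_zero] using h2

theorem not_dvd_two : ¬ p ∣ 2 := by
  have := two_le_coxeterNumber b
  intro h
  have := Nat.le_of_dvd two_pos h
  omega

theorem not_dvd_coxeterNumber : ¬ p ∣ coxeterNumber b := by
  have := two_le_coxeterNumber b
  intro h
  have := Nat.le_of_dvd (by omega) h
  omega

/-- The quotient of the weight lattice by the root lattice is killed by |W|, which is prime to p. -/
theorem mem_rootLattice_of_smul {v : weightLattice P} (h : p • v ∈ rootLattice P) :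
    v ∈ rootLattice P := by
  have hc : IsCoprime (p : ℤ) (Fintype.card P.weylGroup : ℤ) := by
    rw [Nat.isCoprime_iff_coprime]
    exact (Nat.Prime.coprime_iff_not_dvd hpp.out).2 (not_dvd_card_weylGroup b hp)
  obtain ⟨x, y, hxy⟩ := hc
  have h1 : v = x • (p • v) + y • (Fintype.card P.weylGroup • v) := by
    rw [← natCast_zsmul, ← natCast_zsmul, smul_smul, smul_smul, ← add_smul, hxy, one_smul]
  rw [h1]
  exact add_mem (zsmul_mem h _) (zsmul_mem (card_smul_mem_rootLattice v) _)

/-- The stabilizer of `ρ` in the Weyl group is trivial modulo `p`. -/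
theorem eq_one_of_smul_rho_mod (g : P.weylGroup)
    (h : ∀ j : b.support, (p : ℤ) ∣ corootPairing P j (g • rhoWeight b - rhoWeight b)) :
    g = 1 := by
  choose c hc using h
  set v : weightLattice P := ∑ j, c j • fundWeight b j with hv
  have h1 : g • rhoWeight b - rhoWeight b = p • v := by
    rw [eq_sum_fundWeight b (g • rhoWeight b - rhoWeight b), hv, Finset.smul_sum]
    refine Finset.sum_congr rfl fun j _ => ?_
    rw [hc, mul_smul, natCast_zsmul]
  -- Both g ρ and ρ pair with every coroot to a number of absolute value less than h < p, so the
  -- pairings of v are at most 1 in absolute value. As v is also in the root lattice, it is zero.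
  have h2 : v = 0 := by
    apply eq_zero_of_abs_corootPairing_le_one
    · apply mem_rootLattice_of_smul b hp
      rw [← h1]
      exact smul_sub_mem_rootLattice g _
    · intro i
      have h3 : corootPairing P i (g • rhoWeight b) - corootPairing P i (rhoWeight b)
          = p * corootPairing P i v := by
        rw [← corootPairing_sub, h1, ← natCast_zsmul, corootPairing_zsmul]
      have h4 : |corootPairing P i (g • rhoWeight b)| < coxeterNumber b := by
        have h5 := corootPairing_smul P g (P.weylGroupToPerm g⁻¹ i) (rhoWeight b)
        have h6 := weylGroupToPerm_inv_apply (P := P) g⁻¹ i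
        rw [inv_inv] at h6
        rw [h6] at h5
        rw [h5]
        exact abs_corootPairing_rho_lt b _
      have h5 := abs_corootPairing_rho_lt b i
      have h6 : (p : ℤ) = 1 + coxeterNumber b := by rw [← hp]; push_cast; rfl
      rw [abs_lt] at h4 h5
      rw [abs_le]
      have h7 : (0 : ℤ) < p := by exact_mod_cast hpp.out.pos
      constructor
      · by_contra! hlt
        have : (p : ℤ) * corootPairing P i v ≤ p * (-2) :=
          mul_le_mul_of_nonneg_left (by omega) h7.le
        omega
      · by_contra! hlt
        have : (p : ℤ) * 2 ≤ p * corootPairing P i v :=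
          mul_le_mul_of_nonneg_left (by omega) h7.le
        omega
  rw [h2, smul_zero, sub_eq_zero] at h1
  exact eq_one_of_smul_rho b g h1

omit hp

/-- In an irreducible system the ratio of two squared lengths is 1, 2, 3 or an inverse of these, and
the shortest squared length is normalized to 2. Ratio 3 needs two root lengths, hence two positive
roots; this clause is what rules out p = 3 in that case. -/
theorem exists_halfNorm (i : ι) : ∃ e : ℤ, normForm P (P.root i) (P.root i) = 2 * e ∧
    (e = 1 ∨ e = 2 ∨ (e = 3 ∧ 1 < (posRoots b).card)) := by
  have := nonempty_index (P := P)
  obtain ⟨i0, hi0⟩ :=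
    exists_eq_ciInf_of_finite (f := fun i => P.RootForm (P.root i) (P.root i))
  have hle : ∀ j, P.RootForm (P.root i0) (P.root i0) ≤ P.RootForm (P.root j) (P.root j) := by
    intro j
    rw [hi0]
    exact ciInf_le (Set.finite_range _).bddBelow j
  have hpos : ∀ j, 0 < P.RootForm (P.root j) (P.root j) := fun j => rootForm_pos (P.ne_zero j)
  have hnf : normForm P (P.root i) (P.root i)
      = 2 * (P.RootForm (P.root i) (P.root i) / P.RootForm (P.root i0) (P.root i0)) := by
    rw [normForm, LinearMap.smul_apply, LinearMap.smul_apply, smul_eq_mul, ← hi0]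
    ring
  have hcard : ∀ j, P.RootForm (P.root j) (P.root j) ≠ P.RootForm (P.root i0) (P.root i0) →
      1 < (posRoots b).card := by
    intro j hj
    by_contra! hc
    have hneg : ∀ i, P.RootForm (P.root (P.reflectionPerm i i)) (P.root (P.reflectionPerm i i))
        = P.RootForm (P.root i) (P.root i) := by
      intro i
      rw [P.root_reflectionPerm, P.reflection_apply_self]
      simp
    have hex : ∀ i, ∃ k ∈ posRoots b, P.RootForm (P.root k) (P.root k)
        = P.RootForm (P.root i) (P.root i) := by
      intro i
      by_cases h : b.IsPos i
      · exact ⟨i, (mem_posRoots b).2 h, rfl⟩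
      · rw [← isPos_neg_iff] at h
        exact ⟨_, (mem_posRoots b).2 h, hneg i⟩
    obtain ⟨k, hk, hk'⟩ := hex j
    obtain ⟨l, hl, hl'⟩ := hex i0
    have := Finset.card_le_one.1 hc k hk l hl
    subst this
    exact hj (hk'.symm.trans hl')
  have h := RootPairing.InvariantForm.apply_eq_or P.toInvariantForm i i0
  simp only [RootPairing.toInvariantForm_form] at h
  have h0 := hle i
  have h1 := hpos i
  have h2 := hpos i0
  rw [hnf]
  rcases h with h | h | h | h | h
  · exact ⟨1, by rw [h, div_self h2.ne']; norm_num, Or.inl rfl⟩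
  · exact ⟨2, by rw [h, mul_div_assoc, div_self h2.ne']; norm_num, Or.inr (Or.inl rfl)⟩
  · refine ⟨3, by rw [h, mul_div_assoc, div_self h2.ne']; norm_num, Or.inr (Or.inr ⟨rfl, ?_⟩)⟩
    exact hcard i (by linarith)
  · linarith
  · linarith

/-- The integer `(αᵢ, αᵢ) / 2`. -/
def halfNorm (i : ι) : ℤ := (exists_halfNorm b i).choose

theorem normForm_root (i : ι) (u : V) :
    normForm P u (P.root i) = halfNorm b i * P.coroot' i u := by
  have h1 := two_mul_normForm_root P i u
  rw [(exists_halfNorm b i).choose_spec.1] at h1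
  change 2 * _ = 2 * (halfNorm b i : ℝ) * _ at h1
  linarith

/-- If p = 3, then h = 2, so n < 2 and the number of positive roots, which is h n / 2 = n, is at
most one. -/
theorem not_dvd_three (h : 1 < (posRoots b).card)
    (hp : 1 + coxeterNumber b = p) : ¬ p ∣ 3 := by
  intro h3
  have h4 : p = 3 := by
    have := (Nat.dvd_prime Nat.prime_three).1 h3
    exact this.resolve_left hpp.out.one_lt.ne'
  have h5 := card_support_lt_coxeterNumber b
  have h6 := two_mul_card_posRoots b
  have h7 : coxeterNumber b = 2 := by omega
  rw [h7] at h5 h6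
  omega

include hp

theorem not_dvd_halfNorm (i : ι) : ¬ (p : ℤ) ∣ halfNorm b i := by
  rcases (exists_halfNorm b i).choose_spec.2 with h | h | ⟨h, hc⟩
  · change halfNorm b i = 1 at h
    rw [h]
    intro h1
    exact hpp.out.one_lt.ne' (Nat.dvd_one.1 (by exact_mod_cast h1))
  · change halfNorm b i = 2 at h
    rw [h]
    intro h1
    exact not_dvd_two b hp (by exact_mod_cast h1)
  · change halfNorm b i = 3 at h
    rw [h]
    intro h1
    exact not_dvd_three b hc hp (by exact_mod_cast h1)

/-- Distinct positive roots are not proportional modulo `p`. -/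
theorem not_dvd_det_pairing {i j : ι} (hi : b.IsPos i) (hj : b.IsPos j) (hij : i ≠ j) :
    ¬ (p : ℤ) ∣ 4 - P.pairingIn ℤ i j * P.pairingIn ℤ j i := by
  have hne : P.root i ≠ P.root j := fun h => hij (P.root.injective h)
  have hne' : P.root i ≠ -P.root j := by
    intro h
    have h3 : i = P.reflectionPerm j j := P.root.injective (by rw [h]; simp)
    rw [h3, isPos_neg_iff] at hi
    exact hi hj
  have hset := P.pairingIn_pairingIn_mem_set_of_isCrystal_of_isRed' _ _ hne hne'
  have hcard : 1 < (posRoots b).card :=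
    Finset.one_lt_card.2 ⟨i, (mem_posRoots b).2 hi, j, (mem_posRoots b).2 hj, hij⟩
  have h3 := not_dvd_three b hcard hp
  have h2 := not_dvd_two b hp
  have h1 : ¬ p ∣ 1 := fun h => hpp.out.one_lt.ne' (Nat.dvd_one.1 h)
  have h4 : ¬ p ∣ 4 := fun h =>
    h2 ((Nat.Prime.dvd_of_dvd_pow hpp.out (m := 2) (n := 2) (by simpa using h)))
  -- This is the determinant of the Cartan matrix of the pair, one of 1, 2, 3, 4. The prime 3 is
  -- excluded because there are two positive roots.
  have key : ∃ m : ℕ, 4 - P.pairingIn ℤ i j * P.pairingIn ℤ j i = m ∧ ¬ p ∣ m := by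
    generalize P.pairingIn ℤ i j = x, P.pairingIn ℤ j i = y at hset
    simp only [Set.mem_insert_iff, Set.mem_singleton_iff, Prod.mk.injEq] at hset
    rcases hset with ⟨rfl, rfl⟩ | ⟨rfl, rfl⟩ | ⟨rfl, rfl⟩ | ⟨rfl, rfl⟩ | ⟨rfl, rfl⟩ | ⟨rfl, rfl⟩ |
      ⟨rfl, rfl⟩ | ⟨rfl, rfl⟩ | ⟨rfl, rfl⟩ | ⟨rfl, rfl⟩ | ⟨rfl, rfl⟩
    · exact ⟨4, by norm_num, h4⟩
    · exact ⟨3, by norm_num, h3⟩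
    · exact ⟨3, by norm_num, h3⟩
    · exact ⟨2, by norm_num, h2⟩
    · exact ⟨2, by norm_num, h2⟩
    · exact ⟨2, by norm_num, h2⟩
    · exact ⟨2, by norm_num, h2⟩
    · exact ⟨1, by norm_num, h1⟩
    · exact ⟨1, by norm_num, h1⟩
    · exact ⟨1, by norm_num, h1⟩
    · exact ⟨1, by norm_num, h1⟩
  obtain ⟨m, hm, hpm⟩ := key
  rw [hm]
  exact_mod_cast hpm

omit hp

theorem card_mul_normForm (b : P.Base) (u v : weightLattice P) :
    ∃ z : ℤ, (Fintype.card P.weylGroup : ℝ) * normForm P u v = z := by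
  obtain ⟨c, hc⟩ := (mem_rootLattice_iff b _).1 (card_smul_mem_rootLattice v)
  refine ⟨∑ j, c j * (halfNorm b j * corootPairing P j u), ?_⟩
  have h1 : (Fintype.card P.weylGroup : ℝ) • (v : V) = ∑ j, (c j : ℝ) • P.root j := by
    rw [Nat.cast_smul_eq_nsmul, ← AddSubgroup.coe_nsmul, hc, AddSubgroup.val_finsetSum]
    refine Finset.sum_congr rfl fun j _ => ?_
    rw [AddSubgroup.coe_zsmul, Int.cast_smul_eq_zsmul]
    rfl
  rw [← smul_eq_mul, ← map_smul, h1, map_sum]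
  push_cast
  refine Finset.sum_congr rfl fun j _ => ?_
  rw [map_smul, smul_eq_mul, normForm_root b, corootPairing_cast]

/-- The remainder of |W| modulo the least common denominator would be a smaller common denominator.
-/
theorem latticeDenom_dvd (b : P.Base) : latticeDenom P ∣ Fintype.card P.weylGroup := by
  have hne : {m : ℕ | 0 < m ∧ ∀ u v : weightLattice P, ∃ z : ℤ,
      (m : ℝ) * normForm P u v = z}.Nonempty :=
    ⟨Fintype.card P.weylGroup, Fintype.card_pos, card_mul_normForm b⟩
  have hmem := Nat.sInf_mem hne
  change latticeDenom P ∈ _ at hmem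
  by_contra hd
  have hr : 0 < Fintype.card P.weylGroup % latticeDenom P :=
    Nat.pos_of_ne_zero fun h => hd (Nat.dvd_of_mod_eq_zero h)
  have hlt := Nat.mod_lt (Fintype.card P.weylGroup) hmem.1
  refine Nat.notMem_of_lt_sInf hlt ⟨hr, fun u v => ?_⟩
  obtain ⟨x, hx⟩ := card_mul_normForm b u v
  obtain ⟨y, hy⟩ := hmem.2 u v
  refine ⟨x - (Fintype.card P.weylGroup / latticeDenom P : ℕ) * y, ?_⟩
  have h1 : (Fintype.card P.weylGroup : ℝ) = latticeDenom P *
      (Fintype.card P.weylGroup / latticeDenom P : ℕ)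
        + (Fintype.card P.weylGroup % latticeDenom P : ℕ) := by
    exact_mod_cast (Nat.div_add_mod _ _).symm
  rw [Int.cast_sub, Int.cast_mul, Int.cast_natCast]
  rw [← hx, ← hy, h1]
  ring

include hp in
theorem not_dvd_latticeDenom : ¬ p ∣ latticeDenom P :=
  fun h => not_dvd_card_weylGroup b hp (h.trans (latticeDenom_dvd b))

theorem intForm_symm (u v : weightLattice P) : intForm P u v = intForm P v u := by
  rw [intForm, intForm, normForm_symm]

theorem ringForm_symm (A : Type*) [CommRing A] (u v : weightLattice P) :
    ringForm P A u v = ringForm P A v u := by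
  rw [ringForm, ringForm, intForm_symm]

theorem intForm_rootWeight (i : ι) (u : weightLattice P) :
    intForm P u (rootWeight P i) = latticeDenom P * (halfNorm b i * corootPairing P i u) := by
  have : ((intForm P u (rootWeight P i) : ℤ) : ℝ)
      = ((latticeDenom P * (halfNorm b i * corootPairing P i u) : ℤ) : ℝ) := by
    push_cast
    rw [intForm_cast, corootPairing_cast, ← normForm_root b]
    rfl
  exact_mod_cast this

theorem ringForm_rootWeight {A : Type*} [CommRing A] (hA : IsUnit (latticeDenom P : A)) (i : ι)
    (u : weightLattice P) :
    ringForm P A u (rootWeight P i) = (halfNorm b i : A) * (corootPairing P i u : A) := by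
  rw [ringForm, intForm_rootWeight b]
  push_cast
  rw [← mul_assoc, Ring.inverse_mul_cancel _ hA, one_mul]

end Arithmetic

/-! ### Change of coefficients -/

section BaseChange

variable {ι V N : Type*} [Fintype ι] [AddCommGroup V] [Module ℝ V] [AddCommGroup N] [Module ℝ N]
  {P : RootPairing ι ℝ V N} [P.IsCrystallographic] (b : P.Base)
  {A B : Type*} [CommRing A] [CommRing B]

theorem map_inverse_of_isUnit (φ : A →+* B) {x : A} (hx : IsUnit x) :
    φ (Ring.inverse x) = Ring.inverse (φ x) := by
  obtain ⟨u, rfl⟩ := hx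
  rw [Ring.inverse_unit]
  exact (Ring.inverse_unit (Units.map (φ : A →* B) u)).symm

theorem map_ringForm (φ : A →+* B) (hA : IsUnit (latticeDenom P : A)) (u v : weightLattice P) :
    φ (ringForm P A u v) = ringForm P B u v := by
  rw [ringForm, ringForm, map_mul, map_inverse_of_isUnit φ hA, map_natCast, map_intCast]

theorem map_kParam (φ : A →+* B) (hA : IsUnit (coxeterNumber b : A)) :
    φ (kParam b A) = kParam b B := by
  rw [kParam, kParam, map_neg, map_add, map_one, map_inverse_of_isUnit φ hA, map_natCast]

variable {b} in
/-- Induction on an element of the rational double affine Hecke algebra. -/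
theorem RatDAHA.induction {k : A} {motive : RatDAHA b A k → Prop}
    (base : ∀ c : A, motive (algebraMap A _ c)) (gen : ∀ a, motive (gen b A k a))
    (add : ∀ a a', motive a → motive a' → motive (a + a'))
    (mul : ∀ a a', motive a → motive a' → motive (a * a')) (a : RatDAHA b A k) : motive a := by
  obtain ⟨f, rfl⟩ := RingQuot.mkAlgHom_surjective A (Rel b A k) a
  induction f using FreeAlgebra.induction with
  | grade0 c => rw [AlgHom.commutes]; exact base c
  | grade1 x => exact gen x
  | add f g hf hg => rw [map_add]; exact add _ _ hf hg
  | mul f g hf hg => rw [map_mul]; exact mul _ _ hf hg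

section Relations

variable (A) (k : A)

theorem gen_x_add (u v : weightLattice P) :
    gen b A k (.x (u + v)) = gen b A k (.x u) + gen b A k (.x v) :=
  (RingQuot.mkAlgHom_rel A (Rel.x_add u v)).trans (map_add _ _ _)

theorem gen_y_add (u v : weightLattice P) :
    gen b A k (.y (u + v)) = gen b A k (.y u) + gen b A k (.y v) :=
  (RingQuot.mkAlgHom_rel A (Rel.y_add u v)).trans (map_add _ _ _)

theorem gen_x_comm (u v : weightLattice P) :
    gen b A k (.x u) * gen b A k (.x v) = gen b A k (.x v) * gen b A k (.x u) :=
  ((map_mul _ _ _).symm.trans (RingQuot.mkAlgHom_rel A (Rel.x_comm u v))).trans (map_mul _ _ _)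

theorem gen_y_comm (u v : weightLattice P) :
    gen b A k (.y u) * gen b A k (.y v) = gen b A k (.y v) * gen b A k (.y u) :=
  ((map_mul _ _ _).symm.trans (RingQuot.mkAlgHom_rel A (Rel.y_comm u v))).trans (map_mul _ _ _)

theorem gen_w_one : gen b A k (.w 1) = 1 :=
  (RingQuot.mkAlgHom_rel A Rel.w_one).trans (map_one _)

theorem gen_w_mul (g g' : P.weylGroup) :
    gen b A k (.w (g * g')) = gen b A k (.w g) * gen b A k (.w g') :=
  (RingQuot.mkAlgHom_rel A (Rel.w_mul g g')).trans (map_mul _ _ _)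

theorem gen_w_x (g : P.weylGroup) (u : weightLattice P) :
    gen b A k (.w g) * gen b A k (.x u) = gen b A k (.x (g • u)) * gen b A k (.w g) :=
  ((map_mul _ _ _).symm.trans (RingQuot.mkAlgHom_rel A (Rel.w_x g u))).trans (map_mul _ _ _)

theorem gen_w_y (g : P.weylGroup) (u : weightLattice P) :
    gen b A k (.w g) * gen b A k (.y u) = gen b A k (.y (g • u)) * gen b A k (.w g) :=
  ((map_mul _ _ _).symm.trans (RingQuot.mkAlgHom_rel A (Rel.w_y g u))).trans (map_mul _ _ _)

theorem gen_y_x (u v : weightLattice P) :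
    gen b A k (.y u) * gen b A k (.x v) =
      gen b A k (.x v) * gen b A k (.y u) + algebraMap A _ (ringForm P A u v) +
        ∑ i ∈ posRoots b, (k * ringForm P A u (rootWeight P i) * (corootPairing P i v : A)) •
          gen b A k (.w (RootPairing.weylGroup.ofIdx P i)) := by
  refine ((map_mul _ _ _).symm.trans (RingQuot.mkAlgHom_rel A (Rel.y_x u v))).trans ?_
  rw [map_add, map_add, map_mul, AlgHom.commutes, map_sum]
  simp only [map_smul]
  rfl

/-- An algebra homomorphism out of the rational double affine Hecke algebra, given on the
generators. -/
def RatDAHA.lift {R : Type*} [Ring R] [Algebra A R] (t : Gen P → R)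
    (x_add : ∀ u v, t (.x (u + v)) = t (.x u) + t (.x v))
    (x_comm : ∀ u v, t (.x u) * t (.x v) = t (.x v) * t (.x u))
    (y_add : ∀ u v, t (.y (u + v)) = t (.y u) + t (.y v))
    (y_comm : ∀ u v, t (.y u) * t (.y v) = t (.y v) * t (.y u))
    (w_one : t (.w 1) = 1) (w_mul : ∀ g g', t (.w (g * g')) = t (.w g) * t (.w g'))
    (w_x : ∀ g u, t (.w g) * t (.x u) = t (.x (g • u)) * t (.w g))
    (w_y : ∀ g u, t (.w g) * t (.y u) = t (.y (g • u)) * t (.w g))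
    (y_x : ∀ u v, t (.y u) * t (.x v) = t (.x v) * t (.y u) + algebraMap A _ (ringForm P A u v) +
      ∑ i ∈ posRoots b, (k * ringForm P A u (rootWeight P i) * (corootPairing P i v : A)) •
        t (.w (RootPairing.weylGroup.ofIdx P i))) : RatDAHA b A k →ₐ[A] R :=
  RingQuot.liftAlgHom A ⟨FreeAlgebra.lift A t, fun f f' h => by
    cases h <;> simp only [map_mul, map_add, map_one, map_sum, map_smul, AlgHom.commutes,
      FreeAlgebra.lift_ι_apply, *]⟩

theorem RatDAHA.lift_gen {R : Type*} [Ring R] [Algebra A R] (t : Gen P → R)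
    (h1 h2 h3 h4 h5 h6 h7 h8 h9) (a : Gen P) :
    RatDAHA.lift b A k t h1 h2 h3 h4 h5 h6 h7 h8 h9 (gen b A k a) = t a :=
  (RingQuot.liftAlgHom_mkAlgHom_apply A (FreeAlgebra.lift A t) _ _).trans
    (FreeAlgebra.lift_ι_apply _ _)

theorem RatDAHA.algHom_ext {R : Type*} [Ring R] [Algebra A R] {F G : RatDAHA b A k →ₐ[A] R}
    (h : ∀ a, F (gen b A k a) = G (gen b A k a)) : F = G := by
  refine AlgHom.ext fun a => ?_
  induction a using RatDAHA.induction with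
  | base c => rw [AlgHom.commutes, AlgHom.commutes]
  | gen a => exact h a
  | add a a' h h' => rw [map_add, map_add, h, h']
  | mul a a' h h' => rw [map_mul, map_mul, h, h']

end Relations

variable {k : A} {k' : B} (φ : A →+* B)
  (hφ : ∀ u v, φ (ringForm P A u v) = ringForm P B u v) (hk : φ k = k')

include hφ hk in
theorem RatDAHA.exists_map : ∃ Φ : RatDAHA b A k →+* RatDAHA b B k',
    (∀ c, Φ (algebraMap A _ c) = algebraMap B _ (φ c)) ∧
      ∀ a, Φ (gen b A k a) = gen b B k' a := by
  -- The target becomes an algebra over the smaller ring through φ, so that the universal property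
  -- of the presentation over A applies.
  let _ : Algebra A (RatDAHA b B k') :=
    ((algebraMap B (RatDAHA b B k')).comp φ).toAlgebra' fun c x => Algebra.commutes (φ c) x
  have hsmul : ∀ (c : A) (x : RatDAHA b B k'), c • x = φ c • x := fun c x => by
    rw [Algebra.smul_def, Algebra.smul_def]; rfl
  refine ⟨(RatDAHA.lift b A k (gen b B k') (gen_x_add b B k') (gen_x_comm b B k')
    (gen_y_add b B k') (gen_y_comm b B k') (gen_w_one b B k') (gen_w_mul b B k')
    (gen_w_x b B k') (gen_w_y b B k') (fun u v => ?_)).toRingHom, fun c => ?_, fun a => ?_⟩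
  · rw [gen_y_x]
    simp only [hsmul, map_mul, hφ, hk, map_intCast]
    change _ = _ + algebraMap B _ (φ _) + _
    rw [hφ]
  · exact AlgHom.commutes _ c
  · exact RatDAHA.lift_gen b A k _ _ _ _ _ _ _ _ _ _ a

/-- Change of coefficients in the rational double affine Hecke algebra. -/
def RatDAHA.map : RatDAHA b A k →+* RatDAHA b B k' := (RatDAHA.exists_map b φ hφ hk).choose

theorem RatDAHA.map_algebraMap (c : A) :
    RatDAHA.map b φ hφ hk (algebraMap A _ c) = algebraMap B _ (φ c) :=
  (RatDAHA.exists_map b φ hφ hk).choose_spec.1 c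

theorem RatDAHA.map_gen (a : Gen P) : RatDAHA.map b φ hφ hk (gen b A k a) = gen b B k' a :=
  (RatDAHA.exists_map b φ hφ hk).choose_spec.2 a

variable [P.IsRootSystem]

theorem map_xPoly (v : weightLattice P) :
    MvPolynomial.map φ (xPoly b A v) = xPoly b B v := by
  simp [xPoly, map_sum]

theorem map_weylAct (g : P.weylGroup) (f : MvPolynomial b.support A) :
    MvPolynomial.map φ (weylAct b A g f) = weylAct b B g (MvPolynomial.map φ f) := by
  induction f using poly_induction with
  | hC a =>
    rw [MvPolynomial.map_C, ← MvPolynomial.algebraMap_eq, ← MvPolynomial.algebraMap_eq,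
      AlgHom.commutes, AlgHom.commutes]
    exact MvPolynomial.map_C _ _
  | hadd f f' h h' => simp only [map_add, h, h']
  | hx v f h => simp only [map_mul, weylAct_xPoly, map_xPoly, h]

theorem map_divDiff (i : ι) (f : MvPolynomial b.support A) :
    MvPolynomial.map φ (divDiff b A i f) = divDiff b B i (MvPolynomial.map φ f) := by
  induction f using poly_induction with
  | hC a => rw [divDiff_C, MvPolynomial.map_C, divDiff_C, map_zero]
  | hadd f f' h h' => simp only [map_add, h, h']
  | hx v f h =>
    rw [map_mul (MvPolynomial.map φ), map_xPoly, divDiff_mul, divDiff_mul, map_add, map_mul, map_xPoly, h,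
      MvPolynomial.smul_eq_C_mul, MvPolynomial.smul_eq_C_mul, map_mul, map_weylAct,
      MvPolynomial.map_C, map_intCast]

theorem map_pderiv (j : b.support) (f : MvPolynomial b.support A) :
    MvPolynomial.map φ (MvPolynomial.pderiv j f)
      = MvPolynomial.pderiv j (MvPolynomial.map φ f) := MvPolynomial.pderiv_map.symm

include hφ in
theorem map_deriv (u : weightLattice P) (f : MvPolynomial b.support A) :
    MvPolynomial.map φ (deriv b A u f) = deriv b B u (MvPolynomial.map φ f) := by
  induction f using poly_induction with
  | hC a => simp [deriv]
  | hadd f f' h h' => simp only [map_add, h, h']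
  | hx v f h =>
    rw [map_mul (MvPolynomial.map φ), map_xPoly, Derivation.leibniz, Derivation.leibniz, deriv_xPoly, deriv_xPoly,
      smul_eq_mul, smul_eq_mul, smul_eq_mul, smul_eq_mul, map_add, map_mul, map_mul, h,
      MvPolynomial.map_C, hφ, map_xPoly]

include hφ hk in
theorem map_dunkl (u : weightLattice P) (f : MvPolynomial b.support A) :
    MvPolynomial.map φ (dunkl b A k u f) = dunkl b B k' u (MvPolynomial.map φ f) := by
  rw [dunkl_apply, dunkl_apply, map_add, map_deriv b φ hφ, map_sum]
  congr 1
  refine Finset.sum_congr rfl fun i _ => ?_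
  rw [MvPolynomial.smul_eq_C_mul, MvPolynomial.smul_eq_C_mul, map_mul, MvPolynomial.map_C,
    map_divDiff, map_mul, hφ, hk]

theorem gen_x_smul (u : weightLattice P) (f : PolyRep b A k) :
    gen b A k (.x u) • f = PolyRep.of b A k (xPoly b A u) * f := gen_smul b A k _ f

theorem gen_y_smul (u : weightLattice P) (f : MvPolynomial b.support A) :
    gen b A k (.y u) • PolyRep.of b A k f = PolyRep.of b A k (dunkl b A k u f) :=
  gen_smul b A k _ _

theorem gen_w_smul (g : P.weylGroup) (f : MvPolynomial b.support A) :
    gen b A k (.w g) • PolyRep.of b A k f = PolyRep.of b A k (weylAct b A g f) :=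
  gen_smul b A k _ _

include hφ hk in
theorem map_gen_smul (a : Gen P) (f : PolyRep b A k) :
    PolyRep.map b φ k k' (gen b A k a • f) = gen b B k' a • PolyRep.map b φ k k' f := by
  cases a with
  | x u =>
    rw [gen_x_smul, gen_x_smul, map_mul]
    exact congrArg (· * _) (map_xPoly b φ u)
  | y u =>
    rw [gen_smul, gen_smul]
    exact map_dunkl b φ hφ hk u f
  | w g =>
    rw [gen_smul, gen_smul]
    exact map_weylAct b φ g f

theorem PolyRep.map_smul_base (c : A) (f : PolyRep b A k) :
    PolyRep.map b φ k k' (c • f) = φ c • PolyRep.map b φ k k' f := by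
  rw [Algebra.smul_def, Algebra.smul_def, map_mul]
  exact congrArg (· * _) (MvPolynomial.map_C φ c)

theorem PolyRep.map_smul (a : RatDAHA b A k) (f : PolyRep b A k) :
    PolyRep.map b φ k k' (a • f) = RatDAHA.map b φ hφ hk a • PolyRep.map b φ k k' f := by
  induction a using RatDAHA.induction generalizing f with
  | base c =>
    rw [algebraMap_smul, RatDAHA.map_algebraMap, algebraMap_smul, PolyRep.map_smul_base]
  | gen a => rw [RatDAHA.map_gen, map_gen_smul b φ hφ hk]
  | add a a' h h' => rw [add_smul, map_add, map_add, add_smul, h, h']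
  | mul a a' h h' => rw [mul_smul, map_mul, mul_smul, h, h']

end BaseChange

/-! ### The largest submodule without constants -/

section MaxSub

open MvPolynomial

variable {ι V N : Type*} [Fintype ι] [AddCommGroup V] [Module ℝ V] [AddCommGroup N] [Module ℝ N]
  {P : RootPairing ι ℝ V N} [P.IsCrystallographic] [P.IsRootSystem] (b : P.Base)
  (A : Type*) [CommRing A] (k : A)

/-- The Dunkl operators in the coordinates `x_{ω_i}`. -/
def ddl (i : b.support) : MvPolynomial b.support A →ₗ[A] MvPolynomial b.support A :=
  (pderiv i : Derivation A (MvPolynomial b.support A) (MvPolynomial b.support A)).toLinearMap +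
    ∑ l ∈ posRoots b, (k * (corootPairing P i (rootWeight P l) : A)) • divDiff b A l

theorem ddl_apply (i : b.support) (f : MvPolynomial b.support A) :
    ddl b A k i f = pderiv i f +
      ∑ l ∈ posRoots b, (k * (corootPairing P i (rootWeight P l) : A)) • divDiff b A l f := by
  simp [ddl, LinearMap.sum_apply]

theorem ringForm_eq_sum (u v : weightLattice P) :
    ringForm P A u v = ∑ j : b.support, (corootPairing P j v : A) * ringForm P A u (fundWeight b j) := by
  have h := map_eq_sum b (ringFormHom P A u) v
  simp only [zsmul_eq_mul] at h
  exact h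

theorem mkDerivation_eq_sum_pderiv {σ : Type*} [Fintype σ] {A : Type*} [CommRing A]
    (g : σ → MvPolynomial σ A) (f : MvPolynomial σ A) :
    mkDerivation A g f = ∑ i, g i * pderiv i f := by
  classical
  induction f using MvPolynomial.induction_on with
  | C a => simp
  | add f f' h h' => simp only [map_add, h, h', mul_add, Finset.sum_add_distrib]
  | mul_X f j h =>
    simp only [Derivation.leibniz, mkDerivation_X, h, pderiv_X, smul_eq_mul, mul_add,
      Finset.sum_add_distrib]
    congr 1
    · rw [Finset.sum_eq_single j]
      · rw [Pi.single_eq_same]; ring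
      · intro i _ hi
        rw [Pi.single_eq_of_ne hi.symm, mul_zero, mul_zero]
      · simp
    · rw [Finset.mul_sum]
      exact Finset.sum_congr rfl fun i _ => by ring

theorem deriv_eq_sum (u : weightLattice P) (f : MvPolynomial b.support A) :
    deriv b A u f = ∑ i : b.support, ringForm P A u (fundWeight b i) • pderiv i f := by
  rw [deriv, mkDerivation_eq_sum_pderiv]
  exact Finset.sum_congr rfl fun i _ => by rw [← smul_eq_C_mul]

/-- The invariant form enters the Dunkl operators only through these coefficients. The operators
`ddl` are free of it and reduce to partial derivatives when k vanishes. -/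
theorem dunkl_eq_sum_ddl (u : weightLattice P) (f : MvPolynomial b.support A) :
    dunkl b A k u f = ∑ i : b.support, ringForm P A u (fundWeight b i) • ddl b A k i f := by
  simp only [dunkl_apply, ddl_apply, smul_add, Finset.sum_add_distrib, deriv_eq_sum]
  congr 1
  simp only [Finset.smul_sum, smul_smul]
  rw [Finset.sum_comm]
  refine Finset.sum_congr rfl fun l _ => ?_
  rw [← Finset.sum_smul, ringForm_eq_sum b A u (rootWeight P l), Finset.mul_sum]
  congr 1
  exact Finset.sum_congr rfl fun j _ => by ring

theorem ddl_C (i : b.support) (a : A) : ddl b A k i (C a) = 0 := by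
  rw [ddl_apply, pderiv_C, zero_add]
  exact Finset.sum_eq_zero fun l _ => by rw [divDiff_C, smul_zero]

open Classical in
theorem ddl_xPoly_mul (i : b.support) (v : weightLattice P) (f : MvPolynomial b.support A) :
    ddl b A k i (xPoly b A v * f) = xPoly b A v * ddl b A k i f + ((corootPairing P i v : A) • f +
      ∑ l ∈ posRoots b, (k * (corootPairing P i (rootWeight P l) : A) * (corootPairing P l v : A)) •
        weylAct b A (RootPairing.weylGroup.ofIdx P l) f) := by
  have h : pderiv i (xPoly b A v) = C (corootPairing P i v : A) := by
    rw [xPoly, map_sum, Finset.sum_eq_single i]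
    · rw [← map_intCast (C : A →+* MvPolynomial b.support A), pderiv_C_mul, pderiv_X_self, mul_one]
    · intro j _ hj
      rw [← map_intCast (C : A →+* MvPolynomial b.support A), pderiv_C_mul, pderiv_X_of_ne hj,
        mul_zero]
    · simp
  simp only [ddl_apply, Derivation.leibniz, h, divDiff_mul, smul_add,
    Finset.sum_add_distrib, mul_add, Finset.mul_sum, smul_smul, mul_smul_comm, smul_eq_mul]
  rw [MvPolynomial.smul_eq_C_mul f]
  ring

/-- The derivation that multiplies a form of degree `d` by `d`. -/
def euler : Derivation A (MvPolynomial b.support A) (MvPolynomial b.support A) := mkDerivation A X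

theorem euler_eq_sum (f : MvPolynomial b.support A) : euler b A f = ∑ i, X i * pderiv i f := by
  rw [euler, mkDerivation_eq_sum_pderiv]

theorem euler_xPoly (v : weightLattice P) : euler b A (xPoly b A v) = xPoly b A v := by
  rw [xPoly, map_sum]
  refine Finset.sum_congr rfl fun j _ => ?_
  rw [← map_intCast (C : A →+* MvPolynomial b.support A), ← smul_eq_C_mul, Derivation.map_smul, euler,
    mkDerivation_X]

theorem euler_of_isHomogeneous {f : MvPolynomial b.support A} {d : ℕ} (h : f.IsHomogeneous d) :
    euler b A f = d • f := by rw [euler_eq_sum, h.sum_X_mul_pderiv]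

theorem coeff_euler (f : MvPolynomial b.support A) (m : b.support →₀ ℕ) :
    coeff m (euler b A f) = m.degree * coeff m f := by
  classical
  induction f using MvPolynomial.induction_on' with
  | add f g hf hg => rw [map_add, coeff_add, coeff_add, hf, hg, mul_add]
  | monomial s a =>
    rw [euler_of_isHomogeneous b A (isHomogeneous_monomial a rfl), coeff_smul, nsmul_eq_mul,
      coeff_monomial]
    split_ifs with h
    · rw [h]
    · rw [mul_zero, mul_zero]

theorem weylAct_euler (g : P.weylGroup) (f : MvPolynomial b.support A) :
    weylAct b A g (euler b A f) = euler b A (weylAct b A g f) := by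
  induction f using poly_induction with
  | hC a => simp [euler, ← MvPolynomial.algebraMap_eq]
  | hadd f f' h h' => simp only [map_add, h, h']
  | hx v f h =>
    simp only [Derivation.leibniz, euler_xPoly, map_add, map_mul, smul_eq_mul, weylAct_xPoly, h]

/-- Since Σ (α, α_i^∨) X_i = x_α, contraction turns each divided difference back into f - s_α f. For
invariant f only the Euler field remains; for equivariant families of degree p the two terms cancel.
-/
theorem sum_X_mul_ddl (f : MvPolynomial b.support A) :
    ∑ i, X i * ddl b A k i f = euler b A f +
      k • ∑ l ∈ posRoots b, (f - weylAct b A (RootPairing.weylGroup.ofIdx P l) f) := by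
  simp only [ddl_apply, mul_add, Finset.sum_add_distrib, euler_eq_sum, Finset.mul_sum,
    Finset.smul_sum]
  congr 1
  rw [Finset.sum_comm]
  refine Finset.sum_congr rfl fun l _ => ?_
  rw [← xPoly_mul_divDiff, xPoly, Finset.sum_mul, Finset.smul_sum]
  refine Finset.sum_congr rfl fun j _ => ?_
  rw [smul_eq_C_mul, smul_eq_C_mul, map_mul, map_intCast]
  ring

/-! #### Homogeneity -/

variable {b A} in
theorem isHomogeneous_xPoly (v : weightLattice P) : (xPoly b A v).IsHomogeneous 1 := by
  refine IsHomogeneous.sum _ _ _ fun j _ => ?_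
  rw [← map_intCast (C : A →+* MvPolynomial b.support A)]
  exact (isHomogeneous_X A j).C_mul _

variable {b A} in
theorem isHomogeneous_weylAct (g : P.weylGroup) {f : MvPolynomial b.support A} {d : ℕ}
    (hf : f.IsHomogeneous d) : (weylAct b A g f).IsHomogeneous d := by
  have h := hf.aeval (φ := f) (fun j => xPoly b A (g • fundWeight b j)) (n := 1)
    (fun j => isHomogeneous_xPoly _)
  rwa [one_mul] at h

/-- The common reason why `ddl` and `divDiff` lower the degree by one: they kill constants, and
their commutator with a variable preserves the degree. -/
theorem isHomogeneous_of_twisted_derivation {σ : Type*} {A : Type*} [CommRing A]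
    (T : MvPolynomial σ A →ₗ[A] MvPolynomial σ A)
    (R : σ → MvPolynomial σ A → MvPolynomial σ A) (hC : ∀ a, T (C a) = 0)
    (hX : ∀ j f, T (X j * f) = X j * T f + R j f)
    (hR : ∀ j f d, f.IsHomogeneous d → (R j f).IsHomogeneous d)
    {f : MvPolynomial σ A} {d : ℕ} (hf : f.IsHomogeneous (d + 1)) : (T f).IsHomogeneous d := by
  have key : ∀ (n : ℕ) (m : σ →₀ ℕ) (a : A), m.degree = n + 1 →
      (T (monomial m a)).IsHomogeneous n := by
    intro n
    induction n with
    | zero =>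
      intro m a hm
      obtain ⟨j, hj⟩ : ∃ j, m j ≠ 0 := by
        by_contra! h
        have : m = 0 := Finsupp.ext h
        rw [this, map_zero] at hm
        omega
      have hle : Finsupp.single j 1 ≤ m := by
        rw [Finsupp.single_le_iff]; omega
      obtain ⟨m', rfl⟩ := exists_add_of_le hle
      have hm' : m' = 0 := by
        rw [map_add, Finsupp.degree_single] at hm
        exact (Finsupp.degree_eq_zero_iff m').1 (by omega)
      have h1 : monomial (Finsupp.single j 1 + m') a = X j * C a := by
        rw [hm', add_zero, mul_comm, C_mul_X_eq_monomial]
      rw [h1, hX, hC, mul_zero, zero_add]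
      exact hR _ _ _ (isHomogeneous_C _ _)
    | succ n ih =>
      intro m a hm
      obtain ⟨j, hj⟩ : ∃ j, m j ≠ 0 := by
        by_contra! h
        have : m = 0 := Finsupp.ext h
        rw [this, map_zero] at hm
        omega
      have hle : Finsupp.single j 1 ≤ m := by
        rw [Finsupp.single_le_iff]; omega
      obtain ⟨m', rfl⟩ := exists_add_of_le hle
      have hm' : m'.degree = n + 1 := by
        rw [map_add, Finsupp.degree_single] at hm; omega
      have h1 : monomial (Finsupp.single j 1 + m') a = X j * monomial m' a := by
        rw [X, monomial_mul, one_mul]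
      rw [h1, hX]
      refine IsHomogeneous.add ?_ (hR _ _ _ (isHomogeneous_monomial a hm'))
      have := (isHomogeneous_X A j).mul (ih m' a hm')
      rwa [add_comm] at this
  rw [f.as_sum, map_sum]
  refine IsHomogeneous.sum _ _ _ fun m hm => key d m _ ?_
  exact (DFunLike.congr_fun Finsupp.degree_eq_weight_one m).trans (hf (mem_support_iff.1 hm))

variable {b A k}

theorem isHomogeneous_ddl (i : b.support) {f : MvPolynomial b.support A} {d : ℕ}
    (hf : f.IsHomogeneous (d + 1)) : (ddl b A k i f).IsHomogeneous d := by
  refine isHomogeneous_of_twisted_derivation (ddl b A k i) (fun j f =>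
    (corootPairing P i (fundWeight b j) : A) • f + ∑ l ∈ posRoots b,
      (k * (corootPairing P i (rootWeight P l) : A) * (corootPairing P l (fundWeight b j) : A)) •
        weylAct b A (RootPairing.weylGroup.ofIdx P l) f) (ddl_C b A k i) (fun j f => ?_)
    (fun j f d h => ?_) hf
  · rw [← xPoly_fundWeight, ddl_xPoly_mul]
  · refine IsHomogeneous.add ?_ (IsHomogeneous.sum _ _ _ fun l _ => ?_)
    · rw [smul_eq_C_mul]; exact h.C_mul _
    · rw [smul_eq_C_mul]; exact (isHomogeneous_weylAct _ h).C_mul _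

theorem isHomogeneous_divDiff (l : ι) {f : MvPolynomial b.support A} {d : ℕ}
    (hf : f.IsHomogeneous (d + 1)) : (divDiff b A l f).IsHomogeneous d := by
  refine isHomogeneous_of_twisted_derivation (divDiff b A l) (fun j f =>
    (corootPairing P l (fundWeight b j) : A) • weylAct b A (RootPairing.weylGroup.ofIdx P l) f)
    (divDiff_C b A l) (fun j f => ?_) (fun j f d h => ?_) hf
  · rw [← xPoly_fundWeight, divDiff_mul]
  · rw [smul_eq_C_mul]; exact (isHomogeneous_weylAct _ h).C_mul _

theorem isHomogeneous_deriv (u : weightLattice P) {f : MvPolynomial b.support A} {d : ℕ}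
    (hf : f.IsHomogeneous (d + 1)) : (deriv b A u f).IsHomogeneous d := by
  rw [deriv_eq_sum]
  refine IsHomogeneous.sum _ _ _ fun i _ => ?_
  rw [smul_eq_C_mul]
  exact (hf.pderiv (i := i)).C_mul _

theorem isHomogeneous_dunkl (u : weightLattice P) {f : MvPolynomial b.support A} {d : ℕ}
    (hf : f.IsHomogeneous (d + 1)) : (dunkl b A k u f).IsHomogeneous d := by
  rw [dunkl_eq_sum_ddl]
  refine IsHomogeneous.sum _ _ _ fun i _ => ?_
  rw [smul_eq_C_mul]
  exact (isHomogeneous_ddl i hf).C_mul _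

variable (b A k)

/-- A composition of Dunkl operators, the first entry of the list being applied first. -/
def dunklWord : List (weightLattice P) → MvPolynomial b.support A →ₗ[A] MvPolynomial b.support A
  | [] => LinearMap.id
  | u :: L => (dunklWord L).comp (dunkl b A k u)

/-- A composition of the operators `ddl`, the first entry of the list being applied first. -/
def ddlWord : List b.support → MvPolynomial b.support A →ₗ[A] MvPolynomial b.support A
  | [] => LinearMap.id
  | i :: L => (ddlWord L).comp (ddl b A k i)

theorem dunklWord_cons (u : weightLattice P) (L : List (weightLattice P))
    (f : MvPolynomial b.support A) :
    dunklWord b A k (u :: L) f = dunklWord b A k L (dunkl b A k u f) := rfl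

theorem ddlWord_cons (i : b.support) (L : List b.support) (f : MvPolynomial b.support A) :
    ddlWord b A k (i :: L) f = ddlWord b A k L (ddl b A k i f) := rfl

theorem isHomogeneous_ddlWord (L : List b.support) {f : MvPolynomial b.support A} {d : ℕ}
    (hf : f.IsHomogeneous (d + L.length)) : (ddlWord b A k L f).IsHomogeneous d := by
  induction L generalizing f with
  | nil => exact hf
  | cons i L ih =>
    rw [ddlWord_cons]
    exact ih (isHomogeneous_ddl i (by rwa [List.length_cons, ← add_assoc] at hf))

theorem weylAct_dunklWord (g : P.weylGroup) (L : List (weightLattice P))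
    (f : MvPolynomial b.support A) :
    weylAct b A g (dunklWord b A k L f)
      = dunklWord b A k (L.map (g • ·)) (weylAct b A g f) := by
  induction L generalizing f with
  | nil => rfl
  | cons u L ih => rw [dunklWord_cons, ih, List.map_cons, dunklWord_cons, weylAct_dunkl]

theorem constantCoeff_xPoly (v : weightLattice P) : constantCoeff (xPoly b A v) = 0 := by
  simp [xPoly]

theorem constantCoeff_weylAct (g : P.weylGroup) (f : MvPolynomial b.support A) :
    constantCoeff (weylAct b A g f) = constantCoeff f := by
  induction f using poly_induction with
  | hC a => simp [← MvPolynomial.algebraMap_eq]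
  | hadd f f' h h' => simp only [map_add, h, h']
  | hx v f h => simp only [map_mul, weylAct_xPoly, constantCoeff_xPoly, zero_mul]

theorem constantCoeff_dunklWord_weylAct {f : MvPolynomial b.support A}
    (hf : ∀ L, constantCoeff (dunklWord b A k L f) = 0) (g : P.weylGroup)
    (L : List (weightLattice P)) : constantCoeff (dunklWord b A k L (weylAct b A g f)) = 0 := by
  have h : L = (L.map (g⁻¹ • ·)).map (g • ·) := by
    rw [List.map_map]
    exact (List.map_id _).symm.trans (List.map_congr_left fun u _ => by simp)
  rw [h, ← weylAct_dunklWord, constantCoeff_weylAct, hf]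

/-- Moving a Dunkl operator past x_v leaves multiples of f and of the reflected s_α f, and the
vanishing condition is stable under W. This makes the condition define an ideal. -/
theorem constantCoeff_dunklWord_xPoly_mul {f : MvPolynomial b.support A}
    (hf : ∀ L, constantCoeff (dunklWord b A k L f) = 0) (v : weightLattice P)
    (L : List (weightLattice P)) : constantCoeff (dunklWord b A k L (xPoly b A v * f)) = 0 := by
  induction L generalizing f with
  | nil =>
    change constantCoeff (_ * _) = 0
    rw [map_mul, constantCoeff_xPoly, zero_mul]
  | cons u L ih =>
    rw [dunklWord_cons, dunkl_xPoly_mul, map_add, map_add, map_add, map_add, map_smul, map_sum,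
      map_sum, ih fun L => hf (u :: L), constantCoeff_smul, hf, smul_zero, zero_add, zero_add]
    refine Finset.sum_eq_zero fun i _ => ?_
    rw [map_smul, constantCoeff_smul, constantCoeff_dunklWord_weylAct b A k hf, smul_zero]

/-- The ideal of the polynomials that have no constant term after any composition of Dunkl
operators. -/
def maxIdeal : Ideal (MvPolynomial b.support A) where
  carrier := {f | ∀ L, constantCoeff (dunklWord b A k L f) = 0}
  zero_mem' := fun L => by rw [map_zero, map_zero]
  add_mem' := fun hf hg L => by rw [map_add, map_add, hf L, hg L, add_zero]
  smul_mem' := by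
    intro c f hf
    rw [smul_eq_mul]
    induction c using poly_induction with
    | hC a =>
      intro L
      rw [← smul_eq_C_mul, map_smul, constantCoeff_smul, hf, smul_zero]
    | hadd c c' h h' =>
      intro L
      rw [add_mul, map_add, map_add, h, h', add_zero]
    | hx v c h =>
      rw [mul_assoc]
      exact constantCoeff_dunklWord_xPoly_mul b A k h v

variable {b A k}

theorem constantCoeff_of_mem_maxIdeal {f : MvPolynomial b.support A} (hf : f ∈ maxIdeal b A k) :
    constantCoeff f = 0 := hf []

theorem weylAct_mem_maxIdeal (g : P.weylGroup) {f : MvPolynomial b.support A}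
    (hf : f ∈ maxIdeal b A k) : weylAct b A g f ∈ maxIdeal b A k :=
  constantCoeff_dunklWord_weylAct b A k hf g

theorem dunkl_mem_maxIdeal (u : weightLattice P) {f : MvPolynomial b.support A}
    (hf : f ∈ maxIdeal b A k) : dunkl b A k u f ∈ maxIdeal b A k := fun L => hf (u :: L)

theorem smul_mem_maxIdeal (a : A) {f : MvPolynomial b.support A}
    (hf : f ∈ maxIdeal b A k) : a • f ∈ maxIdeal b A k := by
  rw [smul_eq_C_mul]; exact Ideal.mul_mem_left _ _ hf

theorem mem_maxIdeal_of_dunkl {f : MvPolynomial b.support A} (h0 : constantCoeff f = 0)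
    (h : ∀ u, dunkl b A k u f = 0) : f ∈ maxIdeal b A k := by
  intro L
  cases L with
  | nil => exact h0
  | cons u L => rw [dunklWord_cons, h, map_zero, map_zero]

variable (b A k)

/-- The submodule of the polynomials that have no constant term after any composition of Dunkl
operators. -/
def maxSub : Submodule (RatDAHA b A k) (PolyRep b A k) where
  carrier := {f | (PolyRep.of b A k).symm f ∈ maxIdeal b A k}
  zero_mem' := (maxIdeal b A k).zero_mem
  add_mem' := fun hf hg => (maxIdeal b A k).add_mem hf hg
  smul_mem' := by
    intro a f hf
    induction a using RatDAHA.induction generalizing f with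
    | base c =>
      rw [algebraMap_smul]
      exact smul_mem_maxIdeal c hf
    | gen a =>
      cases a with
      | x u => rw [gen_x_smul]; exact (maxIdeal b A k).mul_mem_left _ hf
      | y u => rw [gen_smul]; exact dunkl_mem_maxIdeal u hf
      | w g => rw [gen_smul]; exact weylAct_mem_maxIdeal g hf
    | add a a' h h' => rw [add_smul]; exact (maxIdeal b A k).add_mem (h hf) (h' hf)
    | mul a a' h h' => rw [mul_smul]; exact h (h' hf)

variable {b A k}

theorem of_mem_maxSub {f : MvPolynomial b.support A} :
    PolyRep.of b A k f ∈ maxSub b A k ↔ f ∈ maxIdeal b A k := Iff.rfl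

theorem map_dunklWord {B : Type*} [CommRing B] {k' : B} (φ : A →+* B)
    (hφ : ∀ u v, φ (ringForm P A u v) = ringForm P B u v) (hk : φ k = k')
    (L : List (weightLattice P)) (f : MvPolynomial b.support A) :
    MvPolynomial.map φ (dunklWord b A k L f) = dunklWord b B k' L (MvPolynomial.map φ f) := by
  induction L generalizing f with
  | nil => rfl
  | cons u L ih => rw [dunklWord_cons, ih, dunklWord_cons, map_dunkl b φ hφ hk]

theorem map_ddl {B : Type*} [CommRing B] {k' : B} (φ : A →+* B) (hk : φ k = k')
    (i : b.support) (f : MvPolynomial b.support A) :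
    MvPolynomial.map φ (ddl b A k i f) = ddl b B k' i (MvPolynomial.map φ f) := by
  rw [ddl_apply, ddl_apply, map_add, map_pderiv b φ, map_sum]
  congr 1
  refine Finset.sum_congr rfl fun i _ => ?_
  rw [MvPolynomial.smul_eq_C_mul, MvPolynomial.smul_eq_C_mul, map_mul, MvPolynomial.map_C,
    map_divDiff, map_mul, hk, map_intCast]

theorem map_ddlWord {B : Type*} [CommRing B] {k' : B} (φ : A →+* B) (hk : φ k = k')
    (L : List b.support) (f : MvPolynomial b.support A) :
    MvPolynomial.map φ (ddlWord b A k L f) = ddlWord b B k' L (MvPolynomial.map φ f) := by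
  induction L generalizing f with
  | nil => rfl
  | cons u L ih => rw [ddlWord_cons, ih, ddlWord_cons, map_ddl φ hk]

theorem map_mem_maxIdeal {B : Type*} [CommRing B] {k' : B} (φ : A →+* B)
    (hφ : ∀ u v, φ (ringForm P A u v) = ringForm P B u v) (hk : φ k = k')
    {f : MvPolynomial b.support A} (hf : f ∈ maxIdeal b A k) :
    MvPolynomial.map φ f ∈ maxIdeal b B k' := by
  intro L
  rw [← map_dunklWord φ hφ hk, constantCoeff_map, hf, map_zero]

/-- Membership is a family of equations on constant terms, and an injective change of coefficients
neither creates nor destroys solutions. This is the source of the comparison between ℤ_p and ℚ_p. -/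
theorem map_mem_maxIdeal_iff {B : Type*} [CommRing B] {k' : B} (φ : A →+* B)
    (hφ : ∀ u v, φ (ringForm P A u v) = ringForm P B u v) (hk : φ k = k')
    (hinj : Function.Injective φ) {f : MvPolynomial b.support A} :
    MvPolynomial.map φ f ∈ maxIdeal b B k' ↔ f ∈ maxIdeal b A k := by
  refine ⟨fun h L => hinj ?_, map_mem_maxIdeal φ hφ hk⟩
  rw [← constantCoeff_map, map_dunklWord φ hφ hk, h, map_zero]

end MaxSub

/-! ### The submodule J in characteristic zero -/

section KernelJ

open MvPolynomial

variable {ι V N : Type*} [Fintype ι] [AddCommGroup V] [Module ℝ V] [AddCommGroup N] [Module ℝ N]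
  {P : RootPairing ι ℝ V N} [P.IsCrystallographic] [P.IsRootSystem] (b : P.Base)
  [P.IsReduced] [P.IsIrreducible] {A : Type*} [CommRing A] {k : A}
  (hA : IsUnit (latticeDenom P : A)) (hN : ∀ i, IsUnit (halfNorm b i : A))

include hA in
theorem dunkl_rootWeight (i : b.support) (f : MvPolynomial b.support A) :
    dunkl b A k (rootWeight P i) f = (halfNorm b i : A) • ddl b A k i f := by
  classical
  rw [dunkl_eq_sum_ddl, Finset.sum_eq_single i]
  · rw [ringForm_symm, ringForm_rootWeight b hA, corootPairing_fundWeight, if_pos rfl,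
      Int.cast_one, mul_one]
  · intro j _ hj
    rw [ringForm_symm, ringForm_rootWeight b hA, corootPairing_fundWeight, if_neg hj.symm,
      Int.cast_zero, mul_zero, zero_smul]
  · simp

include hA hN in
theorem ddl_eq_smul_dunkl (i : b.support) (f : MvPolynomial b.support A) :
    ddl b A k i f = Ring.inverse (halfNorm b i : A) • dunkl b A k (rootWeight P i) f := by
  rw [dunkl_rootWeight b hA, smul_smul, Ring.inverse_mul_cancel _ (hN i), one_smul]

include hA hN in
theorem ddl_mem_maxIdeal (i : b.support) {f : MvPolynomial b.support A}
    (hf : f ∈ maxIdeal b A k) : ddl b A k i f ∈ maxIdeal b A k := by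
  rw [ddl_eq_smul_dunkl b hA hN]
  exact smul_mem_maxIdeal _ (dunkl_mem_maxIdeal _ hf)

include hA hN in
theorem ddlWord_mem_maxIdeal (L : List b.support) {f : MvPolynomial b.support A}
    (hf : f ∈ maxIdeal b A k) : ddlWord b A k L f ∈ maxIdeal b A k := by
  induction L generalizing f with
  | nil => exact hf
  | cons i L ih => exact ih (ddl_mem_maxIdeal b hA hN i hf)

include hA hN in
/-- A submodule without nonzero constants is contained in `maxSub`. -/
theorem constantCoeff_eq_zero_of_mem [IsDomain A] [CharZero A]
    {S : Submodule (RatDAHA b A k) (PolyRep b A k)}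
    (hS : ∀ c : A, algebraMap A (PolyRep b A k) c ∈ S → c = 0) {f : MvPolynomial b.support A}
    (hf : PolyRep.of b A k f ∈ S) : constantCoeff f = 0 := by
  classical
  have hsm : ∀ (a : A) (q : MvPolynomial b.support A), PolyRep.of b A k q ∈ S →
      PolyRep.of b A k (a • q) ∈ S := by
    intro a q hq
    have := S.smul_mem (algebraMap A _ a) hq
    rwa [algebraMap_smul] at this
  -- On invariants the Euler field is Σ X_i ddl_i, hence it comes from the algebra and preserves S.
  have heul : ∀ q : MvPolynomial b.support A, (∀ g, weylAct b A g q = q) →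
      PolyRep.of b A k q ∈ S → PolyRep.of b A k (euler b A q) ∈ S := by
    intro q hq hqS
    have h1 : euler b A q = ∑ i, X i * ddl b A k i q := by
      rw [sum_X_mul_ddl, Finset.sum_eq_zero fun l _ => by rw [hq, sub_self], smul_zero, add_zero]
    rw [h1, map_sum]
    refine S.sum_mem fun i _ => ?_
    rw [ddl_eq_smul_dunkl b hA hN, ← xPoly_fundWeight, map_mul, ← gen_x_smul]
    refine S.smul_mem _ (hsm _ _ ?_)
    rw [← gen_y_smul]
    exact S.smul_mem _ hqS
  -- Averaging keeps the polynomial in S and multiplies its constant term by |W|.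
  set F : MvPolynomial b.support A := ∑ g : P.weylGroup, weylAct b A g f with hF
  have hFS : PolyRep.of b A k F ∈ S := by
    rw [hF, map_sum]
    refine S.sum_mem fun g _ => ?_
    rw [← gen_w_smul]
    exact S.smul_mem _ hf
  have hFinv : ∀ g, weylAct b A g F = F := by
    intro g
    rw [hF, map_sum]
    refine Fintype.sum_equiv (Equiv.mulLeft g) _ _ fun g' => ?_
    rw [Equiv.coe_mulLeft, weylAct_mul]
    rfl
  have hFc : constantCoeff F = Fintype.card P.weylGroup * constantCoeff f := by
    rw [hF, map_sum]
    simp [constantCoeff_weylAct]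
  -- The operator ∏ (E - d), for d from 1 to n and E the Euler field, kills the components of degree
  -- 1, ..., n. It multiplies the constant term by (-1)^n n!, which is nonzero in characteristic
  -- zero.
  have key : ∀ n : ℕ, ∃ q : MvPolynomial b.support A, (∀ g, weylAct b A g q = q) ∧
      PolyRep.of b A k q ∈ S ∧
      ∀ m, coeff m q = (∏ d ∈ Finset.range n, ((m.degree : A) - (d + 1))) * coeff m F := by
    intro n
    induction n with
    | zero => exact ⟨F, hFinv, hFS, fun m => by simp⟩
    | succ n ih =>
      obtain ⟨q, hq1, hq2, hq3⟩ := ih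
      refine ⟨euler b A q - ((n : A) + 1) • q, fun g => ?_, ?_, fun m => ?_⟩
      · rw [map_sub, map_smul, weylAct_euler, hq1]
      · rw [map_sub]
        exact S.sub_mem (heul q hq1 hq2) (hsm _ _ hq2)
      · rw [coeff_sub, coeff_euler, coeff_smul, smul_eq_mul, hq3, Finset.prod_range_succ]
        ring
  obtain ⟨q, -, hqS, hq⟩ := key F.totalDegree
  have hqC : q = C (coeff 0 q) := by
    ext m
    rw [coeff_C]
    split_ifs with h
    · rw [h]
    · rw [hq]
      by_cases hm : m.degree ≤ F.totalDegree
      · rw [Finset.prod_eq_zero (i := m.degree - 1), zero_mul]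
        · rw [Finset.mem_range]
          have : m.degree ≠ 0 := fun h0 => h ((Finsupp.degree_eq_zero_iff m).1 h0).symm
          omega
        · have : m.degree ≠ 0 := fun h0 => h ((Finsupp.degree_eq_zero_iff m).1 h0).symm
          obtain ⟨r, hr⟩ := Nat.exists_eq_succ_of_ne_zero this
          rw [hr]
          simp
      · rw [coeff_eq_zero_of_totalDegree_lt (f := F) (d := m), mul_zero]
        push Not at hm
        exact hm
  have h0 : coeff 0 q = 0 := by
    apply hS
    have : algebraMap A (PolyRep b A k) (coeff 0 q) = PolyRep.of b A k q := by
      conv_rhs => rw [hqC]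
      rfl
    rw [this]
    exact hqS
  rw [hq, ← constantCoeff_eq, hFc] at h0
  have h1 : (∏ d ∈ Finset.range F.totalDegree,
      (((0 : b.support →₀ ℕ).degree : A) - (d + 1))) ≠ 0 := by
    refine Finset.prod_ne_zero_iff.2 fun d _ => ?_
    rw [map_zero, Nat.cast_zero, zero_sub, neg_ne_zero]
    exact Nat.cast_add_one_ne_zero d
  have h2 : (Fintype.card P.weylGroup : A) ≠ 0 := Nat.cast_ne_zero.2 Fintype.card_ne_zero
  exact ((mul_eq_zero.1 ((mul_eq_zero.1 h0).resolve_left h1)).resolve_left h2)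

include hA hN in
-- A submodule without nonzero constants is stable under words of Dunkl operators, so the vanishing
-- of constant terms may be applied after each word.
theorem kernelJ_eq_maxSub [IsDomain A] [CharZero A] : kernelJ b A k = maxSub b A k := by
  apply le_antisymm
  · refine sSup_le fun S hS f hf L => ?_
    have key : ∀ (L : List (weightLattice P)) (q : MvPolynomial b.support A),
        PolyRep.of b A k q ∈ S → PolyRep.of b A k (dunklWord b A k L q) ∈ S := by
      intro L
      induction L with
      | nil => exact fun q hq => hq
      | cons u L ih =>
        intro q hq
        refine ih _ ?_
        rw [← gen_y_smul]
        exact S.smul_mem _ hq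
    exact constantCoeff_eq_zero_of_mem b hA hN hS (key L _ hf)
  · refine le_sSup fun c hc => ?_
    have h := constantCoeff_of_mem_maxIdeal (f := C c) hc
    rwa [constantCoeff_C] at h

end KernelJ

/-! ### The local ring of the integers at `p` -/

section PLocal

/-- A ring in which all integers prime to `p` are invertible. -/
def IsPLocal (p : ℕ) (A : Type*) [CommRing A] : Prop := ∀ n : ℤ, ¬ (p : ℤ) ∣ n → IsUnit (n : A)

theorem IsPLocal.isUnit_natCast {p : ℕ} {A : Type*} [CommRing A] (hA : IsPLocal p A) {n : ℕ}
    (hn : ¬ p ∣ n) : IsUnit (n : A) := by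
  have := hA n (by rwa [Int.natCast_dvd_natCast])
  rwa [Int.cast_natCast] at this

theorem isPLocal_of_charZero (p : ℕ) (K : Type*) [Field K] [CharZero K] : IsPLocal p K :=
  fun _ hn => isUnit_iff_ne_zero.2 (Int.cast_ne_zero.2 fun h => hn (h ▸ dvd_zero _))

variable (p : ℕ) [hpp : Fact p.Prime]

theorem isPLocal_zmod : IsPLocal p (ZMod p) := fun n hn =>
  isUnit_iff_ne_zero.2 fun h => hn ((ZMod.intCast_zmod_eq_zero_iff_dvd n p).1 h)

theorem isPLocal_padicInt : IsPLocal p ℤ_[p] := fun n hn => by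
  rw [PadicInt.isUnit_iff]
  exact le_antisymm (PadicInt.norm_le_one _)
    (not_lt.1 fun h => hn ((PadicInt.norm_int_lt_one_iff_dvd n).1 h))

instance isPrime_span_prime : (Ideal.span {(p : ℤ)}).IsPrime :=
  (Ideal.span_singleton_prime (by exact_mod_cast hpp.out.ne_zero)).2
    (Nat.prime_iff_prime_int.1 hpp.out)

/-- The localization of the integers at the prime ideal `(p)`. -/
def Zloc : Type := Localization.AtPrime (Ideal.span {(p : ℤ)})

instance : CommRing (Zloc p) :=
  inferInstanceAs (CommRing (Localization.AtPrime (Ideal.span {(p : ℤ)})))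

instance : IsLocalization.AtPrime (Zloc p) (Ideal.span {(p : ℤ)}) := by
  have h : IsLocalization.AtPrime (Localization.AtPrime (Ideal.span {(p : ℤ)}))
    (Ideal.span {(p : ℤ)}) := inferInstance
  -- An algebra structure over ℤ is unique, so the canonical one coincides with that of the
  -- localization.
  have e : (Ring.toIntAlgebra (Zloc p) : Algebra ℤ (Zloc p)) =
    inferInstanceAs (Algebra ℤ (Localization.AtPrime (Ideal.span {(p : ℤ)}))) :=
    Subsingleton.elim _ _
  rw [e]
  exact h

instance : IsLocalRing (Zloc p) :=
  IsLocalization.AtPrime.isLocalRing (Zloc p) (Ideal.span {(p : ℤ)})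

instance : IsDomain (Zloc p) :=
  IsLocalization.isDomain_of_le_nonZeroDivisors (R := ℤ) (Zloc p)
    (Ideal.primeCompl_le_nonZeroDivisors (Ideal.span {(p : ℤ)}))

theorem isPLocal_zloc : IsPLocal p (Zloc p) := fun n hn => by
  have h : n ∈ (Ideal.span {(p : ℤ)}).primeCompl := by
    change n ∉ Ideal.span {(p : ℤ)}
    rwa [Ideal.mem_span_singleton]
  have := IsLocalization.map_units (Zloc p) (⟨n, h⟩ : (Ideal.span {(p : ℤ)}).primeCompl)
  simpa using this

instance : IsNoetherianRing (Zloc p) :=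
  IsLocalization.isNoetherianRing (Ideal.span {(p : ℤ)}).primeCompl _ inferInstance

instance : CharZero (Zloc p) := by
  refine ⟨fun m n h => ?_⟩
  have hinj : Function.Injective (algebraMap ℤ (Zloc p)) :=
    IsLocalization.injective _ (Ideal.primeCompl_le_nonZeroDivisors (Ideal.span {(p : ℤ)}))
  have : algebraMap ℤ (Zloc p) m = algebraMap ℤ (Zloc p) n := by simpa using h
  exact_mod_cast hinj this

variable {p} {A : Type*} [CommRing A]

/-- The homomorphism from the localization of the integers at `p`. -/
def zlocHom (hA : IsPLocal p A) : Zloc p →+* A :=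
  IsLocalization.lift (M := (Ideal.span {(p : ℤ)}).primeCompl) (g := Int.castRingHom A)
    fun s => hA s fun h => s.2 (Ideal.mem_span_singleton.2 h)

theorem exists_eq_unit_mul (x : Zloc p) : ∃ (u : (Zloc p)ˣ) (n : ℤ), x = u * n := by
  obtain ⟨n, s, rfl⟩ := IsLocalization.exists_mk'_eq (Ideal.span {(p : ℤ)}).primeCompl x
  have hs : IsUnit ((s : ℤ) : Zloc p) :=
    isPLocal_zloc p s fun h => s.2 (Ideal.mem_span_singleton.2 h)
  refine ⟨hs.unit⁻¹, n, ?_⟩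
  rw [IsLocalization.mk'_eq_iff_eq_mul]
  simp only [eq_intCast]
  rw [mul_right_comm, hs.val_inv_mul, one_mul]

theorem isPLocal_field_quotient_aux (hA : IsPLocal p A) (x : Zloc p) :
    ∃ (u : Aˣ) (v : (Zloc p)ˣ) (n : ℤ), x = v * n ∧ zlocHom hA x = u * n := by
  obtain ⟨u, n, rfl⟩ := exists_eq_unit_mul x
  exact ⟨Units.map (zlocHom hA).toMonoidHom u, u, n, rfl, by simp⟩

variable (p) in
/-- The reduction modulo `p`. -/
def zlocRed : Zloc p →+* ZMod p := zlocHom (isPLocal_zmod p)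

theorem zlocRed_surjective : Function.Surjective (zlocRed p) := fun x => by
  obtain ⟨n, rfl⟩ := ZMod.intCast_surjective x
  exact ⟨n, map_intCast _ _⟩

theorem zlocRed_eq_zero_iff (x : Zloc p) : zlocRed p x = 0 ↔ (p : Zloc p) ∣ x := by
  constructor
  · intro hx
    obtain ⟨u, v, n, rfl, h⟩ := isPLocal_field_quotient_aux (isPLocal_zmod p) x
    change zlocRed p _ = _ at h
    rw [hx] at h
    have h1 : ((n : ℤ) : ZMod p) = 0 := (mul_eq_zero.1 h.symm).resolve_left u.ne_zero
    obtain ⟨m, rfl⟩ := (ZMod.intCast_zmod_eq_zero_iff_dvd n p).1 h1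
    push_cast
    exact Dvd.intro _ (mul_left_comm _ _ _)
  · rintro ⟨y, rfl⟩
    rw [map_mul, map_natCast, ZMod.natCast_self, zero_mul]

theorem isUnit_of_zlocRed_ne_zero {x : Zloc p} (hx : zlocRed p x ≠ 0) : IsUnit x := by
  obtain ⟨u, v, n, rfl, h⟩ := isPLocal_field_quotient_aux (isPLocal_zmod p) x
  refine (v.isUnit).mul (isPLocal_zloc p n fun hn => hx ?_)
  rw [zlocRed_eq_zero_iff]
  obtain ⟨m, rfl⟩ := hn
  push_cast
  exact Dvd.intro _ (mul_left_comm _ _ _)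

theorem natCast_prime_mem_jacobson : (Ideal.span {(p : Zloc p)}) ≤ Ideal.jacobson ⊥ := by
  rw [IsLocalRing.jacobson_eq_maximalIdeal ⊥ bot_ne_top, Ideal.span_singleton_le_iff_mem,
    IsLocalRing.mem_maximalIdeal, mem_nonunits_iff]
  intro h
  have := h.map (zlocRed p)
  rw [map_natCast, ZMod.natCast_self] at this
  exact not_isUnit_zero this

theorem natCast_prime_ne_zero : (p : Zloc p) ≠ 0 := Nat.cast_ne_zero.2 hpp.out.ne_zero

open MvPolynomial

theorem map_zlocRed_eq_zero {σ : Type*} {f : MvPolynomial σ (Zloc p)}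
    (hf : MvPolynomial.map (zlocRed p) f = 0) : ∃ g, f = (p : Zloc p) • g := by
  have h1 : RingHom.ker (zlocRed p) = Ideal.span {(p : Zloc p)} := by
    ext x
    rw [RingHom.mem_ker, zlocRed_eq_zero_iff, Ideal.mem_span_singleton]
  have h : f ∈ RingHom.ker (MvPolynomial.map (σ := σ) (zlocRed p)) := hf
  rw [ker_map, h1, Ideal.map_span, Set.image_singleton, Ideal.mem_span_singleton] at h
  obtain ⟨g, rfl⟩ := h
  exact ⟨g, (smul_eq_C_mul g _).symm⟩

theorem map_zlocRed_smul {σ : Type*} (f : MvPolynomial σ (Zloc p)) :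
    MvPolynomial.map (zlocRed p) ((p : Zloc p) • f) = 0 := by
  rw [smul_eq_C_mul, map_mul, map_C, map_natCast, ZMod.natCast_self, map_zero, zero_mul]

theorem isHomogeneous_of_smul {σ A : Type*} [CommRing A] [IsDomain A] {a : A} (ha : a ≠ 0)
    {f : MvPolynomial σ A} {d : ℕ} (hf : (a • f).IsHomogeneous d) : f.IsHomogeneous d :=
  fun m hm => hf (d := m) (by rw [coeff_smul, smul_eq_mul]; exact mul_ne_zero ha hm)

theorem exists_isHomogeneous_lift {σ : Type*} {f : MvPolynomial σ (ZMod p)} {d : ℕ}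
    (hf : f.IsHomogeneous d) :
    ∃ g : MvPolynomial σ (Zloc p), g.IsHomogeneous d ∧ MvPolynomial.map (zlocRed p) g = f := by
  obtain ⟨g, rfl⟩ := MvPolynomial.map_surjective _ zlocRed_surjective f
  refine ⟨homogeneousComponent d g, homogeneousComponent_isHomogeneous d g, ?_⟩
  ext m
  rw [coeff_map, coeff_homogeneousComponent]
  split_ifs with h
  · rw [coeff_map]
  · rw [map_zero]
    by_contra h1
    exact h ((DFunLike.congr_fun Finsupp.degree_eq_weight_one m).trans (hf (Ne.symm h1)))

theorem degree_eq_of_coeff_ne_zero {σ A : Type*} [CommSemiring A] {f : MvPolynomial σ A} {d : ℕ}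
    (hf : f.IsHomogeneous d) {m : σ →₀ ℕ} (hm : coeff m f ≠ 0) : m.degree = d :=
  (DFunLike.congr_fun Finsupp.degree_eq_weight_one m).trans (hf hm)

/-- A closed form of degree `p` that is annihilated by the Euler vector field is exact in
characteristic `p`. -/
theorem exists_potential {σ : Type*} [Fintype σ] (ω : σ → MvPolynomial σ (ZMod p))
    (hh : ∀ i, (ω i).IsHomogeneous (p - 1)) (hc : ∀ i j, pderiv j (ω i) = pderiv i (ω j))
    (he : ∑ i, X i * ω i = 0) :
    ∃ g : MvPolynomial σ (ZMod p), g.IsHomogeneous p ∧ ∀ i, pderiv i g = ω i := by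
  classical
  have hp1 := hpp.out.one_lt
  -- The coefficient of x^m in a potential is determined through any variable with 0 < m_i < p, and
  -- closedness makes the choice irrelevant. In degree p the remaining exponents are those of x_i^p,
  -- where no equation constrains the coefficient; it is set to zero.
  let c : (σ →₀ ℕ) → ZMod p := fun m =>
    if h : ∃ i, m i ≠ 0 ∧ m i < p then
      coeff (m - Finsupp.single h.choose 1) (ω h.choose) * ((m h.choose : ℕ) : ZMod p)⁻¹ else 0
  let g : MvPolynomial σ (ZMod p) := ∑ m ∈ Finset.finsuppAntidiag Finset.univ p, monomial m (c m)
  have hmem : ∀ m : σ →₀ ℕ, m ∈ Finset.finsuppAntidiag (Finset.univ : Finset σ) p ↔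
      m.degree = p := by
    intro m
    rw [Finset.mem_finsuppAntidiag]
    simp [Finsupp.degree_eq_sum]
  have hg : ∀ m, coeff m g = if m.degree = p then c m else 0 := by
    intro m
    simp only [g, coeff_sum, coeff_monomial]
    rw [Finset.sum_ite_eq']
    simp only [hmem]
  have hu : ∀ a : ℕ, a ≠ 0 → a < p → ((a : ℕ) : ZMod p) ≠ 0 := fun a h0 h1 h => by
    rw [ZMod.natCast_eq_zero_iff] at h
    exact absurd (Nat.le_of_dvd (Nat.pos_of_ne_zero h0) h) (not_le.2 h1)
  refine ⟨g, ?_, fun i => ?_⟩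
  · refine IsHomogeneous.sum _ _ _ fun m hm => isHomogeneous_monomial _ ((hmem m).1 hm)
  ext n
  rw [coeff_pderiv, hg]
  by_cases hn : n.degree = p - 1
  swap
  · rw [if_neg, zero_mul]
    · by_contra h
      exact hn (degree_eq_of_coeff_ne_zero (hh i) (Ne.symm h))
    · rw [map_add, Finsupp.degree_single]; omega
  rw [if_pos (by rw [map_add, Finsupp.degree_single]; omega)]
  by_cases hi : n i + 1 < p
  · have h : ∃ j, (n + Finsupp.single i 1 : σ →₀ ℕ) j ≠ 0 ∧ (n + Finsupp.single i 1 : σ →₀ ℕ) j < p :=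
      ⟨i, by simp, by simpa using hi⟩
    simp only [c, dif_pos h]
    obtain ⟨h0, h1⟩ := h.choose_spec
    generalize h.choose = j at h0 h1
    by_cases hij : j = i
    · subst hij
      rw [add_tsub_cancel_right]
      have := hu _ h0 h1
      simp only [Finsupp.add_apply, Finsupp.single_eq_same] at this ⊢
      push_cast at this ⊢
      rw [mul_assoc, inv_mul_cancel₀ this, mul_one]
    · have hj : (n + Finsupp.single i 1 : σ →₀ ℕ) j = n j := by
        rw [Finsupp.add_apply, Finsupp.single_eq_of_ne hij, add_zero]
      rw [hj] at h0 h1 ⊢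
      obtain ⟨n', rfl⟩ : ∃ n', n = n' + Finsupp.single j 1 :=
        ⟨n - Finsupp.single j 1, (tsub_add_cancel_of_le
          (Finsupp.single_le_iff.2 (Nat.pos_of_ne_zero h0))).symm⟩
      -- Closedness compares the values obtained through the variables i and j.
      have hcl := congrArg (coeff n') (hc i j)
      rw [coeff_pderiv, coeff_pderiv] at hcl
      rw [add_right_comm, add_tsub_cancel_right]
      have h3 := hu _ h0 h1
      simp only [Finsupp.add_apply, Finsupp.single_eq_same,
        Finsupp.single_eq_of_ne (Ne.symm hij)] at h3 hi ⊢
      push_cast at h3 ⊢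
      rw [add_zero, mul_right_comm, ← hcl, mul_assoc, mul_inv_cancel₀ h3, mul_one]
  -- Here x^n = x_i^{p-1}. The derivative of a potential has coefficient p = 0 at this monomial, and
  -- the Euler relation at x_i^p says that the corresponding coefficient of ω_i vanishes as well.
  · have hle : n i ≤ n.degree := Finsupp.le_degree i n
    have hni : n i = p - 1 := by omega
    have hnn : n = Finsupp.single i (p - 1) := by
      have h1 : Finsupp.single i (n i) ≤ n := Finsupp.single_le_iff.2 le_rfl
      obtain ⟨r, hr⟩ := exists_add_of_le h1
      have h2 := congrArg Finsupp.degree hr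
      rw [map_add, Finsupp.degree_single] at h2
      have h3 : r = 0 := (Finsupp.degree_eq_zero_iff r).1 (by omega)
      rw [h3, add_zero, hni] at hr
      exact hr
    have h0 : ((n i : ZMod p) + 1) = 0 := by
      rw [hni, Nat.cast_sub hp1.le, ZMod.natCast_self]; simp
    rw [h0, mul_zero]
    have h1 := congrArg (coeff (Finsupp.single i 1 + n)) he
    rw [coeff_sum, coeff_zero, Finset.sum_eq_single i, coeff_X_mul] at h1
    · exact h1.symm
    · intro j _ hj
      rw [coeff_X_mul', if_neg]
      rw [hnn, Finsupp.mem_support_iff, not_not, Finsupp.add_apply, Finsupp.single_eq_of_ne hj,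
        Finsupp.single_eq_of_ne hj, add_zero]
    · simp

end PLocal

/-! ### The singular polynomials of degree `p` -/

section Parameter

variable {ι V N : Type*} [Fintype ι] [AddCommGroup V] [Module ℝ V] [AddCommGroup N] [Module ℝ N]
  {P : RootPairing ι ℝ V N} [P.IsRootSystem] [P.IsCrystallographic] (b : P.Base)
  [P.IsReduced] [P.IsIrreducible] {p : ℕ} [hpp : Fact p.Prime] (hp : 1 + coxeterNumber b = p)
  {A : Type*} [CommRing A] (hA : IsPLocal p A)

include hp hA

theorem isUnit_latticeDenom : IsUnit (latticeDenom P : A) :=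
  hA.isUnit_natCast (not_dvd_latticeDenom b hp)

theorem isUnit_coxeterNumber : IsUnit (coxeterNumber b : A) :=
  hA.isUnit_natCast (not_dvd_coxeterNumber b hp)

theorem isUnit_card_weylGroup : IsUnit (Fintype.card P.weylGroup : A) :=
  hA.isUnit_natCast (not_dvd_card_weylGroup b hp)

theorem isUnit_halfNorm (i : ι) : IsUnit (halfNorm b i : A) := hA _ (not_dvd_halfNorm b hp i)

theorem coxeterNumber_mul_kParam : (coxeterNumber b : A) * kParam b A = -(p : A) := by
  rw [kParam, mul_neg, mul_add, mul_one, Ring.mul_inverse_cancel _ (isUnit_coxeterNumber b hp hA),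
    ← hp]
  push_cast
  ring

theorem map_ringForm_of_isPLocal {B : Type*} [CommRing B] (φ : A →+* B) (u v : weightLattice P) :
    φ (ringForm P A u v) = ringForm P B u v := map_ringForm φ (isUnit_latticeDenom b hp hA) u v

theorem map_kParam_of_isPLocal {B : Type*} [CommRing B] (φ : A →+* B) :
    φ (kParam b A) = kParam b B := map_kParam b φ (isUnit_coxeterNumber b hp hA)

omit hA in
theorem kParam_zmod : kParam b (ZMod p) = 0 := by
  have h := coxeterNumber_mul_kParam b hp (isPLocal_zmod p)
  rw [ZMod.natCast_self, neg_zero] at h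
  exact (isUnit_coxeterNumber b hp (isPLocal_zmod p)).mul_right_eq_zero.1 h

end Parameter

section Zero

variable {ι V N : Type*} [Fintype ι] [AddCommGroup V] [Module ℝ V] [AddCommGroup N] [Module ℝ N]
  {P : RootPairing ι ℝ V N} [P.IsRootSystem] [P.IsCrystallographic] (b : P.Base)
  {A : Type*} [CommRing A]

theorem dunkl_zero (u : weightLattice P) (f : MvPolynomial b.support A) :
    dunkl b A 0 u f = deriv b A u f := by
  rw [dunkl_apply, Finset.sum_eq_zero fun i _ => by rw [zero_mul, zero_smul], add_zero]

theorem ddl_zero (i : b.support) (f : MvPolynomial b.support A) :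
    ddl b A 0 i f = MvPolynomial.pderiv i f := by
  rw [ddl_apply, Finset.sum_eq_zero fun i _ => by rw [zero_mul, zero_smul], add_zero]

end Zero

section Singular

open MvPolynomial

variable {ι V N : Type*} [Fintype ι] [AddCommGroup V] [Module ℝ V] [AddCommGroup N] [Module ℝ N]
  {P : RootPairing ι ℝ V N} [P.IsRootSystem] [P.IsCrystallographic] (b : P.Base)
  [P.IsReduced] [P.IsIrreducible] {p : ℕ} [hpp : Fact p.Prime] (hp : 1 + coxeterNumber b = p)

variable (p) in
/-- The equivariant additive maps from the weight lattice to the forms of degree `p`. -/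
def equivariantForms : Submodule (Zloc p) (weightLattice P → MvPolynomial b.support (Zloc p)) where
  carrier := {F | (∀ u v, F (u + v) = F u + F v) ∧
    (∀ g v, F (g • v) = weylAct b (Zloc p) g (F v)) ∧ ∀ v, (F v).IsHomogeneous p}
  zero_mem' := ⟨fun _ _ => by simp, fun _ _ => by simp, fun _ => isHomogeneous_zero _ _ _⟩
  add_mem' := by
    rintro F G ⟨h1, h2, h3⟩ ⟨h1', h2', h3'⟩
    refine ⟨fun u v => ?_, fun g v => ?_, fun v => (h3 v).add (h3' v)⟩
    · simp only [Pi.add_apply, h1, h1']; ring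
    · simp only [Pi.add_apply, h2, h2', map_add]
  smul_mem' := by
    rintro c F ⟨h1, h2, h3⟩
    refine ⟨fun u v => ?_, fun g v => ?_, fun v => ?_⟩
    · simp only [Pi.smul_apply, h1, smul_add]
    · simp only [Pi.smul_apply, h2, map_smul]
    · rw [Pi.smul_apply, smul_eq_C_mul]; exact (h3 v).C_mul c

/-- The average of a map over the Weyl group. -/
def equivariantAverage (G : weightLattice P → MvPolynomial b.support (Zloc p)) :
    weightLattice P → MvPolynomial b.support (Zloc p) := fun v =>
  Ring.inverse (Fintype.card P.weylGroup : Zloc p) •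
    ∑ g : P.weylGroup, weylAct b (Zloc p) g (G (g⁻¹ • v))

theorem equivariantAverage_mem {G : weightLattice P → MvPolynomial b.support (Zloc p)}
    (hadd : ∀ u v, G (u + v) = G u + G v) (hG : ∀ v, (G v).IsHomogeneous p) :
    equivariantAverage b G ∈ equivariantForms b p := by
  refine ⟨fun u v => ?_, fun g v => ?_, fun v => ?_⟩
  · simp only [equivariantAverage, smul_add, hadd, map_add, Finset.sum_add_distrib]
  · simp only [equivariantAverage, map_smul, map_sum]
    refine congrArg (_ • ·) ?_
    refine (Fintype.sum_equiv (Equiv.mulLeft g) _ _ fun g' => ?_).symm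
    rw [Equiv.coe_mulLeft, weylAct_mul, AlgHom.comp_apply, mul_inv_rev, mul_smul,
      inv_smul_smul]
  · rw [equivariantAverage, smul_eq_C_mul]
    exact (IsHomogeneous.sum _ _ _ fun g _ => isHomogeneous_weylAct g (hG _)).C_mul _

include hp in
-- If all the summands of the average have the same reduction modulo p, the average has it too, |W|
-- being a unit. So making a lift equivariant costs nothing modulo p.
theorem map_equivariantAverage (G : weightLattice P → MvPolynomial b.support (Zloc p))
    (T : MvPolynomial b.support (Zloc p) →ₗ[Zloc p] MvPolynomial b.support (Zloc p))
    (v : weightLattice P) (H : MvPolynomial b.support (ZMod p))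
    (h : ∀ g, MvPolynomial.map (zlocRed p) (T (weylAct b (Zloc p) g (G (g⁻¹ • v)))) = H) :
    MvPolynomial.map (zlocRed p) (T (equivariantAverage b G v)) = H := by
  have hu := isUnit_card_weylGroup b hp (isPLocal_zloc p)
  have h2 : zlocRed p (Ring.inverse (Fintype.card P.weylGroup : Zloc p)) *
      (Fintype.card P.weylGroup : ZMod p) = 1 := by
    rw [← map_natCast (zlocRed p), ← map_mul, Ring.inverse_mul_cancel _ hu, map_one]
  rw [equivariantAverage, LinearMap.map_smul, map_sum T, smul_eq_C_mul, map_mul, map_sum,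
    Finset.sum_congr rfl fun g _ => h g, Finset.sum_const, Finset.card_univ, map_C,
    ← Nat.cast_smul_eq_nsmul (ZMod p), ← smul_eq_C_mul, smul_smul, h2, one_smul]

include hp in
theorem map_dunkl_zloc (u : weightLattice P) (f : MvPolynomial b.support (Zloc p)) :
    MvPolynomial.map (zlocRed p) (dunkl b (Zloc p) (kParam b (Zloc p)) u f)
      = deriv b (ZMod p) u (MvPolynomial.map (zlocRed p) f) := by
  rw [map_dunkl b (zlocRed p) (map_ringForm_of_isPLocal b hp (isPLocal_zloc p) _)
    ((map_kParam_of_isPLocal b hp (isPLocal_zloc p) _).trans (kParam_zmod b hp)), dunkl_zero]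

include hp in
theorem map_ddl_zloc (i : b.support) (f : MvPolynomial b.support (Zloc p)) :
    MvPolynomial.map (zlocRed p) (ddl b (Zloc p) (kParam b (Zloc p)) i f)
      = pderiv i (MvPolynomial.map (zlocRed p) f) := by
  rw [map_ddl (zlocRed p)
    ((map_kParam_of_isPLocal b hp (isPLocal_zloc p) _).trans (kParam_zmod b hp)), ddl_zero]

include hp in
-- Equivariance gives F(v) - s_α F(v) = (v, α^∨) F(α). The sum over the positive roots is therefore
-- h F(v), and the degree p in the Euler term cancels against h k = -p.
theorem sum_X_mul_ddl_of_mem {F : weightLattice P → MvPolynomial b.support (Zloc p)}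
    (hF : F ∈ equivariantForms b p) (v : weightLattice P) :
    ∑ i, X i * ddl b (Zloc p) (kParam b (Zloc p)) i (F v) = 0 := by
  obtain ⟨h1, h2, h3⟩ := hF
  let F' : weightLattice P →+ MvPolynomial b.support (Zloc p) := AddMonoidHom.mk' F h1
  have h4 : ∑ l ∈ posRoots b, (F v - weylAct b (Zloc p) (RootPairing.weylGroup.ofIdx P l) (F v))
      = (coxeterNumber b : Zloc p) • F v := by
    have h5 : ∀ l, F v - weylAct b (Zloc p) (RootPairing.weylGroup.ofIdx P l) (F v)
        = F' (corootPairing P l v • rootWeight P l) := by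
      intro l
      rw [← h2, ofIdx_smul_eq]
      change F' v - F' _ = _
      rw [map_sub, sub_sub_cancel]
    rw [Finset.sum_congr rfl fun l _ => h5 l, ← map_sum, corootPairing_sum_rootWeight, map_nsmul,
      Nat.cast_smul_eq_nsmul]
    rfl
  rw [sum_X_mul_ddl, h4, euler_of_isHomogeneous b _ (h3 v), smul_smul, mul_comm,
    coxeterNumber_mul_kParam b hp (isPLocal_zloc p), neg_smul, Nat.cast_smul_eq_nsmul,
    add_neg_cancel]

include hp in
theorem ddl_comm (i j : b.support) (f : MvPolynomial b.support (Zloc p)) :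
    ddl b (Zloc p) (kParam b (Zloc p)) i (ddl b (Zloc p) (kParam b (Zloc p)) j f)
      = ddl b (Zloc p) (kParam b (Zloc p)) j (ddl b (Zloc p) (kParam b (Zloc p)) i f) := by
  have hl := isUnit_latticeDenom b hp (isPLocal_zloc p)
  have hh := isUnit_halfNorm b hp (isPLocal_zloc p)
  simp only [ddl_eq_smul_dunkl b hl hh, map_smul]
  rw [dunkl_comm, smul_comm]

include hp in
/-- If the derivatives of an equivariant form are divisible by `q`, the quotients are, modulo
`p`, the derivatives of an equivariant form. -/
theorem exists_equivariant_potential {F : weightLattice P → MvPolynomial b.support (Zloc p)}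
    (hF : F ∈ equivariantForms b p) {q : Zloc p} (hq : q ≠ 0)
    (Ω : weightLattice P → weightLattice P → MvPolynomial b.support (Zloc p))
    (hΩ : ∀ u v, dunkl b (Zloc p) (kParam b (Zloc p)) u (F v) = q • Ω u v) :
    ∃ G ∈ equivariantForms b p, ∀ u v,
      MvPolynomial.map (zlocRed p) (dunkl b (Zloc p) (kParam b (Zloc p)) u (G v))
        = MvPolynomial.map (zlocRed p) (Ω u v) := by
  have hF' := hF
  obtain ⟨h1, h2, h3⟩ := hF'
  have hc : ∀ {f g : MvPolynomial b.support (Zloc p)}, q • f = q • g → f = g :=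
    fun h => smul_right_injective _ hq h
  have hl := isUnit_latticeDenom b hp (isPLocal_zloc p)
  have hh := isUnit_halfNorm b hp (isPLocal_zloc p)
  have hw : ∀ g u v, weylAct b (Zloc p) g (Ω u v) = Ω (g • u) (g • v) := fun g u v => by
    apply hc
    rw [← map_smul, ← hΩ, ← hΩ, weylAct_dunkl, h2]
  have hadd : ∀ u v v', Ω u (v + v') = Ω u v + Ω u v' := fun u v v' => by
    apply hc
    rw [smul_add, ← hΩ, ← hΩ, ← hΩ, h1, map_add]
  have hp1 : p = p - 1 + 1 := by have := hpp.out.one_lt; omega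
  let ω : b.support → weightLattice P → MvPolynomial b.support (Zloc p) := fun i v =>
    Ring.inverse (halfNorm b i : Zloc p) • Ω (rootWeight P i) v
  have hω : ∀ i v, q • ω i v = ddl b (Zloc p) (kParam b (Zloc p)) i (F v) := fun i v => by
    rw [ddl_eq_smul_dunkl b hl hh, hΩ, smul_comm]
  have hΩω : ∀ u v, Ω u v = ∑ i, ringForm P (Zloc p) u (fundWeight b i) • ω i v := fun u v => by
    apply hc
    rw [← hΩ, dunkl_eq_sum_ddl, Finset.smul_sum]
    exact Finset.sum_congr rfl fun i _ => by rw [← hω, smul_comm]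
  -- The quotients satisfy, modulo p, the conditions of `exists_potential`: the degree is p - 1,
  -- closedness holds because the operators `ddl` commute and reduce to ∂_i, and the contraction
  -- with the coordinates vanishes since it does so before division by q.
  have hpot : ∀ j : b.support, ∃ g : MvPolynomial b.support (Zloc p), g.IsHomogeneous p ∧
      ∀ i, pderiv i (MvPolynomial.map (zlocRed p) g)
        = MvPolynomial.map (zlocRed p) (ω i (fundWeight b j)) := by
    intro j
    suffices h : ∃ g : MvPolynomial b.support (ZMod p), g.IsHomogeneous p ∧
        ∀ i, pderiv i g = MvPolynomial.map (zlocRed p) (ω i (fundWeight b j)) by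
      obtain ⟨g, hg1, hg2⟩ := h
      obtain ⟨g', hg', rfl⟩ := exists_isHomogeneous_lift hg1
      exact ⟨g', hg', hg2⟩
    refine exists_potential (fun i => MvPolynomial.map (zlocRed p) (ω i (fundWeight b j)))
      (fun i => ?_) (fun i l => ?_) ?_
    · refine IsHomogeneous.map (isHomogeneous_of_smul hq ?_) _
      rw [hω]
      exact isHomogeneous_ddl i (hp1 ▸ h3 _)
    · have : ddl b (Zloc p) (kParam b (Zloc p)) l (ω i (fundWeight b j))
          = ddl b (Zloc p) (kParam b (Zloc p)) i (ω l (fundWeight b j)) := by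
        apply hc
        rw [← map_smul, ← map_smul, hω, hω, ddl_comm b hp]
      rw [← map_ddl_zloc b hp, ← map_ddl_zloc b hp, this]
    · have : ∑ i, X i * ω i (fundWeight b j) = 0 := by
        apply hc
        rw [smul_zero, ← sum_X_mul_ddl_of_mem b hp hF (fundWeight b j), Finset.smul_sum]
        exact Finset.sum_congr rfl fun i _ => by rw [← hω]; exact (mul_smul_comm _ _ _).symm
      have h := congrArg (MvPolynomial.map (zlocRed p)) this
      simpa only [map_sum, map_mul, map_X, map_zero] using h
  choose g hg1 hg2 using hpot
  let G : weightLattice P → MvPolynomial b.support (Zloc p) := fun v =>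
    ∑ j : b.support, corootPairing P j v • g j
  have hG : ∀ u v, MvPolynomial.map (zlocRed p) (dunkl b (Zloc p) (kParam b (Zloc p)) u (G v))
      = MvPolynomial.map (zlocRed p) (Ω u v) := by
    intro u v
    have h5 := map_eq_sum b (AddMonoidHom.mk' (Ω u) (hadd u)) v
    simp only [AddMonoidHom.mk'_apply] at h5
    rw [h5]
    simp only [G, map_sum, map_zsmul]
    refine Finset.sum_congr rfl fun j _ => ?_
    rw [map_dunkl_zloc b hp, deriv_eq_sum, hΩω, map_sum]
    congr 1
    refine Finset.sum_congr rfl fun i _ => ?_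
    rw [hg2, smul_eq_C_mul, smul_eq_C_mul, map_mul, map_C,
      map_ringForm_of_isPLocal b hp (isPLocal_zloc p)]
  refine ⟨equivariantAverage b G, equivariantAverage_mem b (fun u v => ?_) (fun v => ?_),
    fun u v => ?_⟩
  · simp only [G, corootPairing_add, add_smul, Finset.sum_add_distrib]
  · refine IsHomogeneous.sum _ _ _ fun j _ => ?_
    rw [← Int.cast_smul_eq_zsmul (Zloc p), smul_eq_C_mul]
    exact (hg1 j).C_mul _
  -- The potentials were chosen without regard to W. As Ω is equivariant, all the translates have
  -- the same derivatives modulo p, and averaging is harmless.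
  · refine map_equivariantAverage b hp G _ v _ fun w => ?_
    have h6 : dunkl b (Zloc p) (kParam b (Zloc p)) u (weylAct b (Zloc p) w (G (w⁻¹ • v)))
        = weylAct b (Zloc p) w
          (dunkl b (Zloc p) (kParam b (Zloc p)) (w⁻¹ • u) (G (w⁻¹ • v))) := by
      rw [weylAct_dunkl, smul_inv_smul]
    rw [h6, map_weylAct, hG, ← map_weylAct, hw, smul_inv_smul, smul_inv_smul]

/-- The table of the derivatives of the members of a family of polynomials. -/
def dunklTable : (weightLattice P → MvPolynomial b.support (Zloc p)) →ₗ[Zloc p]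
    (b.support × b.support → MvPolynomial b.support (Zloc p)) where
  toFun F ij := dunkl b (Zloc p) (kParam b (Zloc p)) (fundWeight b ij.1) (F (fundWeight b ij.2))
  map_add' F G := by ext1; simp
  map_smul' c F := by ext1; simp

theorem dunkl_eq_of_dunklTable {F : weightLattice P → MvPolynomial b.support (Zloc p)}
    (hF : F ∈ equivariantForms b p) (u v : weightLattice P) :
    dunkl b (Zloc p) (kParam b (Zloc p)) u (F v) = ∑ i : b.support, ∑ j : b.support,
      corootPairing P i u • corootPairing P j v • dunklTable b F (i, j) := by
  rw [show dunkl b (Zloc p) (kParam b (Zloc p)) u = _ from map_eq_sum b (dunklHom b _ _) u,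
    show F v = _ from map_eq_sum b (AddMonoidHom.mk' F hF.1) v, LinearMap.sum_apply]
  refine Finset.sum_congr rfl fun i _ => ?_
  rw [LinearMap.smul_apply, map_sum, Finset.smul_sum]
  refine Finset.sum_congr rfl fun j _ => ?_
  rw [map_zsmul]
  rfl

include hp in
-- One step of approximation: a quotient of a table of derivatives is again such a table up to p
-- times an error.
theorem exists_dunklTable_sub {F : weightLattice P → MvPolynomial b.support (Zloc p)}
    (hF : F ∈ equivariantForms b p) {q : Zloc p} (hq : q ≠ 0)
    {ω : b.support × b.support → MvPolynomial b.support (Zloc p)}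
    (hω : dunklTable b F = q • ω) :
    ∃ G ∈ equivariantForms b p, ∃ ω', ω = dunklTable b G + (p : Zloc p) • ω' := by
  obtain ⟨G, hG, h⟩ := exists_equivariant_potential b hp hF hq
    (fun u v => ∑ i : b.support, ∑ j : b.support,
      corootPairing P i u • corootPairing P j v • ω (i, j)) (fun u v => by
      rw [dunkl_eq_of_dunklTable b hF, hω, Finset.smul_sum]
      refine Finset.sum_congr rfl fun i _ => ?_
      rw [Finset.smul_sum]
      refine Finset.sum_congr rfl fun j _ => ?_
      rw [Pi.smul_apply, smul_comm q, smul_comm q])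
  have h1 : ∀ ij : b.support × b.support, ∃ f, ω ij - dunklTable b G ij = (p : Zloc p) • f := by
    intro ij
    apply map_zlocRed_eq_zero
    classical
    have h2 := h (fundWeight b ij.1) (fundWeight b ij.2)
    simp only [corootPairing_fundWeight, ite_smul, one_smul, zero_smul, smul_ite, smul_zero,
      Finset.sum_ite_eq', Finset.mem_univ, if_true] at h2
    rw [map_sub, ← h2, sub_eq_zero]
    rfl
  choose ω' hω' using h1
  exact ⟨G, hG, ω', funext fun ij => by rw [Pi.add_apply, Pi.smul_apply, ← hω']; ring⟩

/-- The tables of forms of degree `p - 1` with a multiple by a power of `p` among the tables of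
derivatives of equivariant forms. -/
def saturatedTables :
    Submodule (Zloc p) (b.support × b.support → MvPolynomial b.support (Zloc p)) where
  carrier := {ω | (∀ ij, (ω ij).IsHomogeneous (p - 1)) ∧
    ∃ m : ℕ, ((p : Zloc p) ^ m) • ω ∈ (equivariantForms b p).map (dunklTable b)}
  zero_mem' := ⟨fun _ => isHomogeneous_zero _ _ _, 0, by rw [smul_zero]; exact zero_mem _⟩
  add_mem' := by
    rintro ω ω' ⟨h, m, hm⟩ ⟨h', m', hm'⟩
    refine ⟨fun ij => (h ij).add (h' ij), m + m', ?_⟩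
    rw [smul_add]
    refine add_mem ?_ ?_
    · rw [add_comm, pow_add, mul_smul]; exact Submodule.smul_mem _ _ hm
    · rw [pow_add, mul_smul]; exact Submodule.smul_mem _ _ hm'
  smul_mem' := by
    rintro c ω ⟨h, m, hm⟩
    refine ⟨fun ij => ?_, m, ?_⟩
    · rw [Pi.smul_apply, smul_eq_C_mul]; exact (h ij).C_mul c
    · rw [smul_comm]; exact Submodule.smul_mem _ _ hm

theorem saturatedTables_fg : (saturatedTables (p := p) b).FG := by
  have h : (Submodule.pi (Set.univ : Set (b.support × b.support))
      fun _ => homogeneousSubmodule b.support (Zloc p) (p - 1)).FG :=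
    Submodule.fg_pi fun _ => homogeneousSubmodule_fg _ _ _
  exact Submodule.FG.of_le h fun ω hω => fun ij _ => hω.1 ij

theorem isHomogeneous_dunklTable {F : weightLattice P → MvPolynomial b.support (Zloc p)}
    (hF : F ∈ equivariantForms b p) (ij : b.support × b.support) :
    (dunklTable b F ij).IsHomogeneous (p - 1) := by
  have hp1 : p = p - 1 + 1 := by have := hpp.out.one_lt; omega
  exact isHomogeneous_dunkl _ (hp1 ▸ hF.2.2 _)

include hp in
-- By the approximation step the saturation is contained in the image plus p times itself. It is
-- finitely generated, being a submodule of the tables of forms of one degree over a Noetherian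
-- ring, so Nakayama's lemma removes the error.
theorem saturatedTables_le :
    saturatedTables (p := p) b ≤ (equivariantForms b p).map (dunklTable b) := by
  refine Submodule.le_of_le_smul_of_le_jacobson_bot (saturatedTables_fg b)
    natCast_prime_mem_jacobson ?_
  rintro ω ⟨h, m, F, hF, hm⟩
  have hq : ((p : Zloc p) ^ m) ≠ 0 := pow_ne_zero _ natCast_prime_ne_zero
  obtain ⟨G, hG, ω', h'⟩ := exists_dunklTable_sub b hp hF hq hm
  rw [h']
  refine Submodule.add_mem_sup (Submodule.mem_map_of_mem hG)
    (Submodule.smul_mem_smul (Ideal.mem_span_singleton_self _) ⟨fun ij => ?_, m + 1, ?_⟩)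
  · refine isHomogeneous_of_smul natCast_prime_ne_zero (a := (p : Zloc p)) ?_
    have : (p : Zloc p) • ω' ij = ω ij - dunklTable b G ij := by
      rw [h', Pi.add_apply, Pi.smul_apply, add_sub_cancel_left]
    rw [this]
    exact (h ij).sub (isHomogeneous_dunklTable b hG ij)
  · have : ((p : Zloc p) ^ (m + 1)) • ω' = (p : Zloc p) ^ m • ω - (p : Zloc p) ^ m •
        dunklTable b G := by
      rw [h', smul_add, add_sub_cancel_left, pow_succ, mul_smul]
    rw [this, ← hm]
    exact sub_mem (Submodule.mem_map_of_mem hF)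
      (Submodule.smul_mem _ _ (Submodule.mem_map_of_mem hG))

theorem xPoly_pow_prime (v : weightLattice P) :
    xPoly b (ZMod p) v ^ p = ∑ j : b.support, corootPairing P j v • X j ^ p := by
  rw [xPoly, sum_pow_char]
  refine Finset.sum_congr rfl fun j _ => ?_
  rw [mul_pow, zsmul_eq_mul]
  congr 1
  rw [← map_intCast (C : ZMod p →+* MvPolynomial b.support (ZMod p)), ← map_pow, ZMod.pow_card]

include hp in
/-- There are polynomials of degree `p` annihilated by the Dunkl operators that are congruent to
`x_v ^ p` modulo `p`. -/
theorem exists_singular_form (v : weightLattice P) :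
    ∃ f ∈ maxIdeal b (Zloc p) (kParam b (Zloc p)), f.IsHomogeneous p ∧
      MvPolynomial.map (zlocRed p) f = xPoly b (ZMod p) v ^ p := by
  let G : weightLattice P → MvPolynomial b.support (Zloc p) := fun v =>
    ∑ j : b.support, corootPairing P j v • X j ^ p
  have hG1 : ∀ u v, G (u + v) = G u + G v := fun u v => by
    simp only [G, corootPairing_add, add_smul, Finset.sum_add_distrib]
  have hG2 : ∀ v, (G v).IsHomogeneous p := fun v => by
    refine IsHomogeneous.sum _ _ _ fun j _ => ?_
    rw [← Int.cast_smul_eq_zsmul (Zloc p), smul_eq_C_mul]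
    exact (isHomogeneous_X_pow j p).C_mul _
  have hG3 : ∀ v, MvPolynomial.map (zlocRed p) (G v) = xPoly b (ZMod p) v ^ p := fun v => by
    simp only [G, xPoly_pow_prime, map_sum, map_zsmul, map_pow, map_X]
  have hmem := equivariantAverage_mem b hG1 hG2
  have hred : ∀ v, MvPolynomial.map (zlocRed p) (equivariantAverage b G v)
      = xPoly b (ZMod p) v ^ p := fun v =>
    map_equivariantAverage b hp G LinearMap.id v _ fun g => by
      rw [LinearMap.id_apply, map_weylAct, hG3, map_pow, weylAct_xPoly, smul_inv_smul]
  -- Modulo p these are derivatives of p-th powers.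
  have hdiv : ∀ ij, ∃ f, dunklTable b (equivariantAverage b G) ij = (p : Zloc p) • f := fun ij => by
    apply map_zlocRed_eq_zero
    change MvPolynomial.map _ (dunkl b (Zloc p) (kParam b (Zloc p)) _ _) = 0
    rw [map_dunkl_zloc b hp, hred, Derivation.leibniz_pow, ← Nat.cast_smul_eq_nsmul (ZMod p),
      ZMod.natCast_self, zero_smul]
  choose ω hω using hdiv
  have hω' : dunklTable b (equivariantAverage b G) = (p : Zloc p) • ω := funext hω
  have hsat : ω ∈ saturatedTables (p := p) b := by
    refine ⟨fun ij => isHomogeneous_of_smul (a := (p : Zloc p)) natCast_prime_ne_zero ?_, 1, ?_⟩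
    · rw [← hω]; exact isHomogeneous_dunklTable b hmem ij
    · rw [pow_one, ← hω']; exact Submodule.mem_map_of_mem hmem
  -- Saturation makes ω itself a table of derivatives. Subtracting p G' then kills all the
  -- derivatives without changing the reduction.
  obtain ⟨G', hG', hG''⟩ := saturatedTables_le b hp hsat
  have hF : equivariantAverage b G - (p : Zloc p) • G' ∈ equivariantForms b p :=
    sub_mem hmem (Submodule.smul_mem _ _ hG')
  have h0 : dunklTable b (equivariantAverage b G - (p : Zloc p) • G') = 0 := by
    rw [map_sub, map_smul, hω', hG'', sub_self]
  refine ⟨(equivariantAverage b G - (p : Zloc p) • G') v, mem_maxIdeal_of_dunkl ?_ fun u => ?_,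
    hF.2.2 v, ?_⟩
  · exact (hF.2.2 v).coeff_eq_zero (by rw [map_zero]; exact hpp.out.ne_zero.symm)
  · rw [dunkl_eq_of_dunklTable b hF, h0]
    simp
  · rw [Pi.sub_apply, map_sub, hred, Pi.smul_apply, map_zlocRed_smul, sub_zero]

end Singular

/-! ### The basis of reduced monomials -/

section Reduced

open MvPolynomial

variable {σ : Type*} {A : Type*} [CommRing A]

theorem mem_frobIdeal_iff (p : ℕ) (f : MvPolynomial σ A) :
    f ∈ frobIdeal σ A p ↔ ∀ m : σ →₀ ℕ, (∀ i, m i < p) → coeff m f = 0 := by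
  have h : frobIdeal σ A p = Ideal.span ((fun s => monomial s (1 : A)) ''
      Set.range fun i : σ => Finsupp.single i p) := by
    rw [frobIdeal, ← Set.range_comp]
    congr 1
    ext f
    simp only [Set.mem_range, Function.comp_apply, X_pow_eq_monomial]
  rw [h, mem_ideal_span_monomial_image]
  constructor
  · intro hf m hm
    by_contra h0
    obtain ⟨_, ⟨i, rfl⟩, hi⟩ := hf m (mem_support_iff.2 h0)
    exact absurd (hm i) (not_lt.2 (Finsupp.single_le_iff.1 hi))
  · intro hf m hm
    by_contra! h0
    refine mem_support_iff.1 hm (hf m fun i => ?_)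
    by_contra hi
    exact h0 _ ⟨i, rfl⟩ (Finsupp.single_le_iff.2 (not_lt.1 hi))

/-- The exponent of the monomial in which the operators of a word are dual to the variables. -/
def wordExp : List σ → (σ →₀ ℕ)
  | [] => 0
  | i :: L => wordExp L + Finsupp.single i 1

theorem exists_wordExp (m : σ →₀ ℕ) : ∃ L, wordExp L = m := by
  classical
  induction m using Finsupp.induction with
  | zero => exact ⟨[], rfl⟩
  | single_add i n m _ _ ih =>
    obtain ⟨L, rfl⟩ := ih
    clear * -
    induction n with
    | zero => exact ⟨L, by simp⟩
    | succ n ih =>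
      obtain ⟨L', h⟩ := ih
      exact ⟨i :: L', by rw [wordExp, h, Finsupp.single_add]; abel⟩

theorem prod_factorial_add_single [Fintype σ] (m : σ →₀ ℕ) (i : σ) :
    ∏ j, ((m + Finsupp.single i 1 : σ →₀ ℕ) j).factorial = (m i + 1) * ∏ j, (m j).factorial := by
  classical
  rw [Finset.prod_congr rfl (g := fun j => (if j = i then m i + 1 else 1) * (m j).factorial),
    Finset.prod_mul_distrib, Finset.prod_ite_eq' Finset.univ i, if_pos (Finset.mem_univ i)]
  intro j _
  by_cases h : j = i
  · subst h
    rw [if_pos rfl, Finsupp.add_apply, Finsupp.single_eq_same, Nat.factorial_succ]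
  · rw [if_neg h, Finsupp.add_apply, Finsupp.single_eq_of_ne h, add_zero, one_mul]

/-- The exponents less than `p` as finitely supported functions. -/
def reducedExp [Finite σ] {p : ℕ} (m : σ → Fin p) : σ →₀ ℕ :=
  Finsupp.equivFunOnFinite.symm fun i => (m i : ℕ)

theorem reducedExp_injective [Finite σ] {p : ℕ} :
    Function.Injective (reducedExp : (σ → Fin p) → _) := fun _ _ h =>
  funext fun i => Fin.ext (DFunLike.congr_fun h i)

theorem exists_reducedExp [Finite σ] {p : ℕ} {m : σ →₀ ℕ} (hm : ∀ i, m i < p) :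
    ∃ m' : σ → Fin p, reducedExp m' = m := ⟨fun i => ⟨m i, hm i⟩, Finsupp.ext fun _ => rfl⟩

variable (σ A) in
/-- The linear combinations of reduced monomials. -/
def reducedPoly [Fintype σ] (p : ℕ) [DecidableEq σ] : ((σ → Fin p) → A) →ₗ[A] MvPolynomial σ A :=
  Fintype.linearCombination A fun m => monomial (reducedExp m) (1 : A)

theorem reducedPoly_apply [Fintype σ] [DecidableEq σ] (p : ℕ) (c : (σ → Fin p) → A) :
    reducedPoly σ A p c = ∑ m, monomial (reducedExp m) (c m) := by
  rw [reducedPoly, Fintype.linearCombination_apply]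
  simp only [smul_monomial, smul_eq_mul, mul_one]

theorem prod_factorial_ne_zero [Fintype σ] {p : ℕ} [hpp : Fact p.Prime] {m : σ →₀ ℕ}
    (hm : ∀ i, m i < p) : ((∏ i, (m i).factorial : ℕ) : ZMod p) ≠ 0 := by
  rw [Ne, ZMod.natCast_eq_zero_iff, hpp.out.prime.dvd_finsetProd_iff]
  rintro ⟨i, -, hi⟩
  exact absurd ((hpp.out.dvd_factorial).1 hi) (not_le.2 (hm i))

end Reduced

/-! ### Duality between reduced monomials and words of Dunkl operators -/

section ReducedBasis

open MvPolynomial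

variable {ι V N : Type*} [Fintype ι] [AddCommGroup V] [Module ℝ V] [AddCommGroup N] [Module ℝ N]
  {P : RootPairing ι ℝ V N} [P.IsRootSystem] [P.IsCrystallographic] (b : P.Base)

theorem constantCoeff_ddlWord_zero {A : Type*} [CommRing A] (L : List b.support)
    (f : MvPolynomial b.support A) : constantCoeff (ddlWord b A 0 L f)
      = ((∏ i, (wordExp L i).factorial : ℕ) : A) * coeff (wordExp L) f := by
  induction L generalizing f with
  | nil => simp [wordExp, ddlWord, constantCoeff_eq]
  | cons i L ih =>
    rw [ddlWord_cons, ih, ddl_zero, coeff_pderiv, wordExp, prod_factorial_add_single]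
    push_cast
    ring

variable [P.IsReduced] [P.IsIrreducible] {p : ℕ} [hpp : Fact p.Prime]
  (hp : 1 + coxeterNumber b = p) {A : Type*} [CommRing A] (hA : IsPLocal p A)

include hp

/-- At k = 0 the word dual to a reduced monomial reads off its coefficient times a product of
factorials of numbers less than p, which is invertible. Conversely, a p-th power has zero
derivatives. -/
theorem maxIdeal_zmod :
    maxIdeal b (ZMod p) (kParam b (ZMod p)) = frobIdeal b.support (ZMod p) p := by
  rw [kParam_zmod b hp]
  have hF := isPLocal_zmod p
  apply le_antisymm
  · intro f hf
    rw [mem_frobIdeal_iff]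
    intro m hm
    obtain ⟨L, rfl⟩ := exists_wordExp m
    have h := constantCoeff_of_mem_maxIdeal (ddlWord_mem_maxIdeal b
      (isUnit_latticeDenom b hp hF) (isUnit_halfNorm b hp hF) L hf)
    rw [constantCoeff_ddlWord_zero] at h
    exact (mul_eq_zero.1 h).resolve_left (prod_factorial_ne_zero hm)
  · rw [frobIdeal, Ideal.span_le]
    rintro _ ⟨i, rfl⟩
    refine mem_maxIdeal_of_dunkl ?_ fun u => ?_
    · rw [map_pow, constantCoeff_X, zero_pow hpp.out.ne_zero]
    · rw [dunkl_zero, Derivation.leibniz_pow, ← Nat.cast_smul_eq_nsmul (ZMod p),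
        ZMod.natCast_self, zero_smul]

/-- The coefficients of a combination of reduced monomials in `maxIdeal` vanish. -/
theorem eq_zero_of_reducedPoly_mem [DecidableEq b.support] (hA : IsPLocal p A)
    {c : (b.support → Fin p) → A}
    (hc : reducedPoly b.support A p c ∈ maxIdeal b A (kParam b A)) : c = 0 := by
  choose w hw using fun m : b.support → Fin p => exists_wordExp (reducedExp m)
  -- The pairing of words with reduced monomials is a matrix over ℤ_(p). Modulo p it is diagonal
  -- with nonzero entries, so its determinant is a unit and remains one in A.
  let T : Matrix (b.support → Fin p) (b.support → Fin p) (Zloc p) := Matrix.of fun m m' =>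
    constantCoeff (ddlWord b (Zloc p) (kParam b (Zloc p)) (w m) (monomial (reducedExp m') 1))
  have hT' : ∀ m m', T m m' = constantCoeff
      (ddlWord b (Zloc p) (kParam b (Zloc p)) (w m) (monomial (reducedExp m') 1)) :=
    fun _ _ => rfl
  have hT : T.map (zlocRed p) = Matrix.diagonal fun m =>
      ((∏ i, (reducedExp m i).factorial : ℕ) : ZMod p) := by
    ext m m'
    rw [Matrix.map_apply, hT', ← constantCoeff_map, map_ddlWord (zlocRed p)
      ((map_kParam_of_isPLocal b hp (isPLocal_zloc p) _).trans (kParam_zmod b hp)),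
      constantCoeff_ddlWord_zero, hw, map_monomial, map_one, coeff_monomial,
      Matrix.diagonal_apply]
    by_cases h : m = m'
    · subst h
      rw [if_pos rfl, if_pos rfl, mul_one]
    · rw [if_neg h, if_neg fun h' => h (reducedExp_injective h').symm, mul_zero]
  have hdet : IsUnit T.det := by
    apply isUnit_of_zlocRed_ne_zero
    rw [RingHom.map_det, RingHom.mapMatrix_apply, hT, Matrix.det_diagonal]
    exact Finset.prod_ne_zero_iff.2 fun m _ => prod_factorial_ne_zero fun i => (m i).2
  have hdet' : IsUnit (T.map (zlocHom hA)).det := by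
    rw [← RingHom.mapMatrix_apply, ← RingHom.map_det]
    exact hdet.map _
  have h0 : (T.map (zlocHom hA)).mulVec c = 0 := by
    ext m
    have h1 := constantCoeff_of_mem_maxIdeal (ddlWord_mem_maxIdeal b
      (isUnit_latticeDenom b hp hA) (isUnit_halfNorm b hp hA) (w m) hc)
    rw [reducedPoly, Fintype.linearCombination_apply, map_sum, map_sum] at h1
    rw [Pi.zero_apply, ← h1, Matrix.mulVec, dotProduct]
    refine Finset.sum_congr rfl fun m' _ => ?_
    rw [map_smul, constantCoeff_smul, smul_eq_mul, mul_comm, Matrix.map_apply, hT',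
      ← constantCoeff_map, map_ddlWord (zlocHom hA)
      (map_kParam_of_isPLocal b hp (isPLocal_zloc p) _), map_monomial, map_one]
  have h2 := Matrix.mulVec_injective_of_isUnit ((Matrix.isUnit_iff_isUnit_det _).2 hdet')
  exact h2 (by rw [h0, Matrix.mulVec_zero])

/-- A monomial that is not reduced contains some x_i^p, which is a singular form plus p times a form
of the same degree. So in each degree the forms lie in the given sum plus p times the forms of that
degree, and Nakayama's lemma applies degree by degree, where everything is finitely generated. -/
theorem mem_range_reducedPoly_sup_zloc [DecidableEq b.support]
    (f : MvPolynomial b.support (Zloc p)) :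
    f ∈ LinearMap.range (reducedPoly b.support (Zloc p) p) ⊔
      (maxIdeal b (Zloc p) (kParam b (Zloc p))).restrictScalars (Zloc p) := by
  set Q := LinearMap.range (reducedPoly b.support (Zloc p) p) ⊔
      (maxIdeal b (Zloc p) (kParam b (Zloc p))).restrictScalars (Zloc p) with hQ
  have key : ∀ d, homogeneousSubmodule b.support (Zloc p) d ≤ Q := by
    intro d
    refine Submodule.le_of_le_smul_of_le_jacobson_bot (homogeneousSubmodule_fg _ _ _)
      natCast_prime_mem_jacobson ?_
    intro f hf
    rw [f.as_sum]
    refine sum_mem fun m hm => ?_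
    have hd : m.degree = d := degree_eq_of_coeff_ne_zero hf (mem_support_iff.1 hm)
    generalize coeff m f = a
    by_cases h : ∀ i, m i < p
    · refine Submodule.mem_sup_left (Submodule.mem_sup_left ?_)
      obtain ⟨m', rfl⟩ := exists_reducedExp h
      refine ⟨Pi.single m' a, ?_⟩
      rw [reducedPoly_apply, Finset.sum_eq_single m']
      · rw [Pi.single_eq_same]
      · intro m _ h
        rw [Pi.single_eq_of_ne h, map_zero]
      · simp
    · push Not at h
      obtain ⟨i, hi⟩ := h
      obtain ⟨m', rfl⟩ := exists_add_of_le (Finsupp.single_le_iff.2 hi)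
      obtain ⟨F, hF, hFh, hFr⟩ := exists_singular_form b hp (fundWeight b i)
      rw [xPoly_fundWeight] at hFr
      obtain ⟨r, hr⟩ := map_zlocRed_eq_zero (f := X i ^ p - F) (by
        rw [map_sub, hFr, map_pow, map_X, sub_self])
      have hrh : r.IsHomogeneous p := by
        refine isHomogeneous_of_smul (a := (p : Zloc p)) natCast_prime_ne_zero ?_
        rw [← hr]
        exact (isHomogeneous_X_pow i p).sub hFh
      have h1 : monomial (Finsupp.single i p + m') a
          = monomial m' a * F + (p : Zloc p) • (monomial m' a * r) := by
        have h2 : monomial (Finsupp.single i p + m') a = monomial m' a * X i ^ p := by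
          rw [X_pow_eq_monomial, monomial_mul, mul_one, add_comm]
        rw [h2, ← mul_smul_comm, ← hr]
        ring
      rw [h1]
      refine Submodule.add_mem_sup (Submodule.mem_sup_right (Ideal.mul_mem_left _ _ hF))
        (Submodule.smul_mem_smul (Ideal.mem_span_singleton_self _) ?_)
      rw [mem_homogeneousSubmodule]
      have := (isHomogeneous_monomial a (rfl : m'.degree = _)).mul hrh
      rw [map_add, Finsupp.degree_single] at hd
      rwa [← hd, add_comm]
  rw [← sum_homogeneousComponent f]
  exact sum_mem fun d _ => key d (homogeneousComponent_isHomogeneous d f)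

include hA in
/-- Every polynomial is congruent to a combination of reduced monomials. -/
theorem exists_reducedPoly_sub_mem [DecidableEq b.support] (f : MvPolynomial b.support A) :
    ∃ c, f - reducedPoly b.support A p c ∈ maxIdeal b A (kParam b A) := by
  induction f using MvPolynomial.induction_on' with
  | add f g hf hg =>
    obtain ⟨c, hc⟩ := hf
    obtain ⟨d, hd⟩ := hg
    refine ⟨c + d, ?_⟩
    rw [map_add, add_sub_add_comm]
    exact add_mem hc hd
  | monomial m a =>
    obtain ⟨_, ⟨c, rfl⟩, g, hg, h⟩ := Submodule.mem_sup.1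
      (mem_range_reducedPoly_sup_zloc b hp (monomial m (1 : Zloc p)))
    refine ⟨fun m => a * zlocHom hA (c m), ?_⟩
    have h1 := congrArg (MvPolynomial.map (zlocHom hA)) h
    rw [map_add, map_monomial, map_one] at h1
    have h2 : monomial m a - reducedPoly b.support A p (fun m => a * zlocHom hA (c m))
        = C a * MvPolynomial.map (zlocHom hA) g := by
      have h3 : reducedPoly b.support A p (fun m => a * zlocHom hA (c m))
          = C a * MvPolynomial.map (zlocHom hA) (reducedPoly b.support (Zloc p) p c) := by
        simp only [reducedPoly_apply, map_sum, map_monomial, Finset.mul_sum, C_mul_monomial]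
      rw [h3, ← mul_one a, ← C_mul_monomial, mul_one, ← h1]
      ring
    rw [h2]
    exact Ideal.mul_mem_left _ _ (map_mem_maxIdeal _
      (map_ringForm_of_isPLocal b hp (isPLocal_zloc p) _)
      (map_kParam_of_isPLocal b hp (isPLocal_zloc p) _) hg)

/-- The reduced monomials form a basis of the quotient by `maxSub`. -/
def reducedEquiv [DecidableEq b.support] (hA : IsPLocal p A) : ((b.support → Fin p) → A) ≃ₗ[A]
    (PolyRep b A (kParam b A) ⧸ maxSub b A (kParam b A)) :=
  LinearEquiv.ofBijective (((maxSub b A (kParam b A)).mkQ.restrictScalars A).comp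
    ((PolyRep.of b A (kParam b A)).toLinearMap.comp (reducedPoly b.support A p))) <| by
    constructor
    · rw [← LinearMap.ker_eq_bot, LinearMap.ker_eq_bot']
      intro c hc
      refine eq_zero_of_reducedPoly_mem b hp hA ?_
      exact (Submodule.Quotient.mk_eq_zero (maxSub b A (kParam b A))).1 hc
    · intro u
      obtain ⟨f, rfl⟩ := Submodule.Quotient.mk_surjective _ u
      obtain ⟨c, hc⟩ := exists_reducedPoly_sub_mem b hp hA ((PolyRep.of b A (kParam b A)).symm f)
      refine ⟨c, ((Submodule.Quotient.eq _).2 ?_).symm⟩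
      exact hc

include hA in
theorem free_quotient_maxSub :
    Module.Free A (PolyRep b A (kParam b A) ⧸ maxSub b A (kParam b A)) := by
  classical
  exact Module.Free.of_equiv (reducedEquiv b hp hA)

include hA in
theorem finite_quotient_maxSub :
    Module.Finite A (PolyRep b A (kParam b A) ⧸ maxSub b A (kParam b A)) := by
  classical
  exact Module.Finite.equiv (reducedEquiv b hp hA)

include hA in
theorem finrank_quotient_maxSub [Nontrivial A] :
    finrank A (PolyRep b A (kParam b A) ⧸ maxSub b A (kParam b A)) = p ^ finrank ℝ V := by
  classical
  rw [← (reducedEquiv b hp hA).finrank_eq, Module.finrank_fintype_fun_eq_card, Fintype.card_fun,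
    Fintype.card_fin, finrank_eq b]

end ReducedBasis

/-! ### The sign character and the discriminant -/

section Sign

open MvPolynomial

variable {ι V N : Type*} [Fintype ι] [AddCommGroup V] [Module ℝ V] [AddCommGroup N] [Module ℝ N]
  {P : RootPairing ι ℝ V N} [P.IsRootSystem] [P.IsCrystallographic] (b : P.Base)
  [P.IsReduced] [P.IsIrreducible]

open Classical in
/-- The sign character of the Weyl group. -/
def weylSign : P.weylGroup →* ℤ := Matrix.detMonoidHom.comp (weylMatrix b)

/-- The reflection differs from the identity by a rank one matrix, so its determinant is 1 - (α,
α^∨) = -1. -/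
theorem weylSign_ofIdx (i : ι) : weylSign b (RootPairing.weylGroup.ofIdx P i) = -1 := by
  classical
  have h : weylMatrix b (RootPairing.weylGroup.ofIdx P i) = 1 +
      Matrix.replicateCol Unit (fun l : b.support => -corootPairing P l (rootWeight P i)) *
        Matrix.replicateRow Unit (fun j : b.support => corootPairing P i (fundWeight b j)) := by
    ext l j
    have h1 : weylMatrix b (RootPairing.weylGroup.ofIdx P i) l j
        = corootPairing P l (RootPairing.weylGroup.ofIdx P i • fundWeight b j) := rfl
    rw [h1, ofIdx_smul_eq, corootPairing_sub, corootPairing_zsmul, corootPairing_fundWeight,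
      Matrix.add_apply, Matrix.one_apply, Matrix.mul_apply]
    simp only [Finset.univ_unique, Finset.sum_singleton, Matrix.replicateCol_apply,
      Matrix.replicateRow_apply]
    ring
  change (weylMatrix b _).det = -1
  rw [h, Matrix.det_one_add_replicateCol_mul_replicateRow]
  have h2 := map_eq_sum b (corootHom (P := P) i) (rootWeight P i)
  change corootPairing P i _ = _ at h2
  rw [corootPairing_rootWeight_self] at h2
  have h3 : (fun j : b.support => corootPairing P i (fundWeight b j)) ⬝ᵥ
      (fun l : b.support => -corootPairing P l (rootWeight P i)) = -2 := by
    rw [h2, dotProduct, ← Finset.sum_neg_distrib]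
    refine Finset.sum_congr rfl fun j _ => ?_
    rw [smul_eq_mul, mul_neg, mul_comm]
    rfl
  rw [h3]
  rfl

theorem weylSign_mul_self (g : P.weylGroup) : weylSign b g * weylSign b g = 1 := by
  induction g using weylGroup_induction with
  | mem i => rw [weylSign_ofIdx]; rfl
  | one => rw [map_one, mul_one]
  | mul g g' h h' => rw [map_mul, mul_mul_mul_comm, h, h', mul_one]

theorem weylSign_inv (g : P.weylGroup) : weylSign b g⁻¹ = weylSign b g := by
  have h : weylSign b g * weylSign b g⁻¹ = 1 := by rw [← map_mul, mul_inv_cancel, map_one]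
  rw [← one_mul (weylSign b g⁻¹), ← weylSign_mul_self b g, mul_assoc, h, mul_one]

variable (A : Type*) [CommRing A]

/-- The product of the positive roots. -/
def rootProd : MvPolynomial b.support A := ∏ i ∈ posRoots b, xPoly b A (rootWeight P i)

theorem weylAct_simple_rootProd (j : b.support) :
    weylAct b A (RootPairing.weylGroup.ofIdx P (j : ι)) (rootProd b A) = -rootProd b A := by
  classical
  have hj : (j : ι) ∈ posRoots b := (mem_posRoots b).2 (b.isPos_of_mem_support j.2)
  have h1 : ∀ i, weylAct b A (RootPairing.weylGroup.ofIdx P (j : ι)) (xPoly b A (rootWeight P i))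
      = xPoly b A (rootWeight P (P.reflectionPerm j i)) := fun i => by
    rw [weylAct_xPoly, smul_rootWeight, weylGroupToPerm_ofIdx]
  -- The permutation statement for sums, used in the additive copy of the multiplicative monoid.
  have h2 : ∏ i ∈ (posRoots b).erase j, xPoly b A (rootWeight P (P.reflectionPerm j i))
      = ∏ i ∈ (posRoots b).erase j, xPoly b A (rootWeight P i) :=
    sum_erase_reflectionPerm (G := Additive (MvPolynomial b.support A)) j.2
      fun i => Additive.ofMul (xPoly b A (rootWeight P i))
  have h3 : xPoly b A (-rootWeight P (j : ι)) = -xPoly b A (rootWeight P (j : ι)) :=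
    map_neg (xHom b A) _
  rw [rootProd, ← Finset.mul_prod_erase _ _ hj, map_mul, map_prod,
    Finset.prod_congr rfl fun i _ => h1 i, h2, h1, rootWeight_neg, h3, neg_mul]

/-- The polynomial on which the Weyl group acts by the sign character. -/
def IsAntiinvariant (f : MvPolynomial b.support A) : Prop :=
  ∀ g, weylAct b A g f = (weylSign b g : A) • f

variable {A}

theorem isAntiinvariant_of_simple {f : MvPolynomial b.support A}
    (h : ∀ j : b.support, weylAct b A (RootPairing.weylGroup.ofIdx P (j : ι)) f = -f) :
    IsAntiinvariant b A f := by
  intro g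
  obtain ⟨L, rfl⟩ := exists_simpleWord b g
  induction L with
  | nil =>
    have : simpleWord b [] = 1 := by simp [simpleWord]
    rw [this, weylAct_one, map_one, Int.cast_one, one_smul, AlgHom.id_apply]
  | cons j L ih =>
    rw [simpleWord_cons, weylAct_mul, AlgHom.comp_apply, ih, map_smul, h, map_mul, weylSign_ofIdx]
    push_cast
    rw [neg_one_mul, neg_smul, smul_neg]

theorem isAntiinvariant_rootProd : IsAntiinvariant b A (rootProd b A) :=
  isAntiinvariant_of_simple b (weylAct_simple_rootProd b A)

theorem IsAntiinvariant.ofIdx {f : MvPolynomial b.support A} (hf : IsAntiinvariant b A f) (i : ι) :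
    weylAct b A (RootPairing.weylGroup.ofIdx P i) f = -f := by
  rw [hf, weylSign_ofIdx]
  push_cast
  rw [neg_one_smul]

variable (A)

/-- The antisymmetrization of a polynomial. -/
def antisymm : MvPolynomial b.support A →ₗ[A] MvPolynomial b.support A :=
  ∑ g : P.weylGroup, (weylSign b g : A) • (weylAct b A g).toLinearMap

variable {A}

theorem antisymm_apply (f : MvPolynomial b.support A) :
    antisymm b A f = ∑ g : P.weylGroup, (weylSign b g : A) • weylAct b A g f := by
  simp [antisymm, LinearMap.sum_apply]

theorem weylSign_cast_mul_self (g : P.weylGroup) : (weylSign b g : A) * weylSign b g = 1 := by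
  rw [← Int.cast_mul, weylSign_mul_self, Int.cast_one]

theorem isAntiinvariant_antisymm (f : MvPolynomial b.support A) :
    IsAntiinvariant b A (antisymm b A f) := by
  intro g
  rw [antisymm_apply, map_sum, Finset.smul_sum]
  refine Fintype.sum_equiv (Equiv.mulLeft g) _ _ fun g' => ?_
  rw [map_smul, Equiv.coe_mulLeft, weylAct_mul, AlgHom.comp_apply, smul_smul, map_mul,
    Int.cast_mul, ← mul_assoc, weylSign_cast_mul_self, one_mul]

theorem IsAntiinvariant.antisymm_eq {f : MvPolynomial b.support A} (hf : IsAntiinvariant b A f) :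
    antisymm b A f = (Fintype.card P.weylGroup : A) • f := by
  rw [antisymm_apply, Finset.sum_congr rfl fun g _ => by
    rw [hf g, smul_smul, weylSign_cast_mul_self, one_smul], Finset.sum_const, Finset.card_univ,
    Nat.cast_smul_eq_nsmul]

theorem isHomogeneous_antisymm {f : MvPolynomial b.support A} {d : ℕ} (hf : f.IsHomogeneous d) :
    (antisymm b A f).IsHomogeneous d := by
  rw [antisymm_apply]
  refine IsHomogeneous.sum _ _ _ fun g _ => ?_
  rw [smul_eq_C_mul]
  exact (isHomogeneous_weylAct g hf).C_mul _

theorem map_antisymm {B : Type*} [CommRing B] (φ : A →+* B) (f : MvPolynomial b.support A) :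
    MvPolynomial.map φ (antisymm b A f) = antisymm b B (MvPolynomial.map φ f) := by
  rw [antisymm_apply, antisymm_apply, map_sum]
  refine Finset.sum_congr rfl fun g _ => ?_
  rw [smul_eq_C_mul, smul_eq_C_mul, map_mul, map_C, map_weylAct, map_intCast]

theorem map_rootProd {B : Type*} [CommRing B] (φ : A →+* B) :
    MvPolynomial.map φ (rootProd b A) = rootProd b B := by
  rw [rootProd, rootProd, map_prod]
  exact Finset.prod_congr rfl fun i _ => map_xPoly b φ _

theorem antisymm_mem_maxIdeal {k : A} {f : MvPolynomial b.support A} (hf : f ∈ maxIdeal b A k) :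
    antisymm b A f ∈ maxIdeal b A k := by
  rw [antisymm_apply]
  exact sum_mem fun g _ => smul_mem_maxIdeal _ (weylAct_mem_maxIdeal g hf)

theorem isHomogeneous_rootProd : (rootProd b A).IsHomogeneous (posRoots b).card := by
  have h := IsHomogeneous.prod (posRoots b) (fun i => xPoly b A (rootWeight P i)) (fun _ => 1)
    fun i _ => isHomogeneous_xPoly _
  rwa [Finset.sum_const, smul_eq_mul, mul_one] at h

/-! #### Evaluation at points -/

/-- The evaluation of polynomials at a weight, by means of the invariant form. -/
def evalWeight (v : weightLattice P) (f : MvPolynomial b.support A) : A :=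
  eval (fun j => ringForm P A (fundWeight b j) v) f

theorem evalWeight_xPoly (u v : weightLattice P) :
    evalWeight b v (xPoly b A u) = ringForm P A u v := by
  rw [ringForm_symm, ringForm_eq_sum b A v u, evalWeight, xPoly, map_sum]
  refine Finset.sum_congr rfl fun j _ => ?_
  rw [map_mul, map_intCast, eval_X, ringForm_symm]

/-- The action of the Weyl group on points. -/
def pointAct (g : P.weylGroup) (v : b.support → A) : b.support → A :=
  fun j => eval v (xPoly b A (g • fundWeight b j))

theorem eval_weylAct (g : P.weylGroup) (v : b.support → A) (f : MvPolynomial b.support A) :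
    eval v (weylAct b A g f) = eval (pointAct b g v) f := by
  induction f using MvPolynomial.induction_on with
  | C a => rw [← algebraMap_eq, AlgHom.commutes, algebraMap_eq, eval_C, eval_C]
  | add f f' h h' => simp only [map_add, h, h']
  | mul_X f j h =>
    rw [map_mul, map_mul, h, map_mul, eval_X, ← xPoly_fundWeight, weylAct_xPoly]
    rfl

theorem pointAct_inv_pointAct (g : P.weylGroup) (v : b.support → A) :
    pointAct b g⁻¹ (pointAct b g v) = v := by
  funext j
  rw [pointAct, ← eval_weylAct, weylAct_xPoly, smul_inv_smul, xPoly_fundWeight, eval_X]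

/-- The action of an element of the Weyl group on points as a permutation. -/
def pointPerm (g : P.weylGroup) : Equiv.Perm (b.support → A) where
  toFun := pointAct b g
  invFun := pointAct b g⁻¹
  left_inv := pointAct_inv_pointAct b g
  right_inv v := by
    have h := pointAct_inv_pointAct b g⁻¹ v
    rwa [inv_inv] at h

theorem pointAct_ringForm (g : P.weylGroup) (v : weightLattice P) :
    pointAct b g (fun j => ringForm P A (fundWeight b j) v)
      = fun j => ringForm P A (fundWeight b j) (g⁻¹ • v) := by
  funext j
  rw [pointAct]
  refine (evalWeight_xPoly b _ v).trans ?_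
  rw [← ringForm_smul P A g⁻¹, inv_smul_smul]

end Sign

/-! ### The sign part of the reduced polynomials -/

section FiniteField

open MvPolynomial

variable {σ : Type*} {p : ℕ} [hpp : Fact p.Prime]

/-- A form in `(x^p)` coincides, as a function, with a form of degree less by `p - 1`. -/
theorem exists_form_eval_eq {f : MvPolynomial σ (ZMod p)} {d : ℕ} (hf : f.IsHomogeneous (d + (p - 1)))
    (hI : f ∈ frobIdeal σ (ZMod p) p) :
    ∃ f' : MvPolynomial σ (ZMod p), f'.IsHomogeneous d ∧ ∀ v, eval v f' = eval v f := by
  have hp1 := hpp.out.one_lt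
  have key : ∀ m ∈ f.support, ∃ m' : σ →₀ ℕ, m'.degree = d ∧
      ∀ v : σ → ZMod p, eval v (monomial m' (1 : ZMod p)) = eval v (monomial m (1 : ZMod p)) := by
    intro m hm
    rw [mem_frobIdeal_iff] at hI
    obtain ⟨i, hi⟩ : ∃ i, p ≤ m i := by
      by_contra! h
      exact mem_support_iff.1 hm (hI m h)
    obtain ⟨r, rfl⟩ := exists_add_of_le (Finsupp.single_le_iff.2 hi)
    -- A factor x_i^p is replaced by x_i, which takes the same values on 𝔽_p.
    refine ⟨Finsupp.single i 1 + r, ?_, fun v => ?_⟩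
    · have h := degree_eq_of_coeff_ne_zero hf (mem_support_iff.1 hm)
      rw [map_add, Finsupp.degree_single] at h ⊢
      omega
    · have h1 : ∀ n : ℕ, monomial (Finsupp.single i n + r) (1 : ZMod p)
          = X i ^ n * monomial r 1 := fun n => by
        rw [X_pow_eq_monomial, monomial_mul, one_mul]
      rw [h1, h1, map_mul, map_mul, map_pow, map_pow, eval_X, ZMod.pow_card, pow_one]
  choose! e he1 he2 using key
  refine ⟨∑ m ∈ f.support, monomial (e m) (coeff m f), IsHomogeneous.sum _ _ _ fun m hm =>
    isHomogeneous_monomial _ (he1 m hm), fun v => ?_⟩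
  conv_rhs => rw [f.as_sum]
  rw [map_sum, map_sum]
  refine Finset.sum_congr rfl fun m hm => ?_
  have h1 : ∀ s : σ →₀ ℕ, monomial s (coeff m f) = C (coeff m f) * monomial s 1 := fun s => by
    rw [C_mul_monomial, mul_one]
  rw [h1, h1, map_mul, map_mul, he2 m hm]

/-- A form of top degree with vanishing sum over all points has no top coefficient. -/
theorem coeff_top_eq_zero [Fintype σ] [DecidableEq σ] {f : MvPolynomial σ (ZMod p)}
    (hf : f.IsHomogeneous (Fintype.card σ * (p - 1)))
    (h0 : ∑ v : σ → ZMod p, eval v f = 0) {t : σ →₀ ℕ} (ht : ∀ i, t i = p - 1) :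
    coeff t f = 0 := by
  have hp1 := hpp.out.one_lt
  -- The sum of a monomial over all points is a product of power sums Σ a^{m_i}, which are zero for
  -- m_i < p - 1 and -1 for m_i = p - 1. In degree n(p - 1) every monomial other than the top one
  -- has an exponent below p - 1.
  have hmon : ∀ m : σ →₀ ℕ, ∑ v : σ → ZMod p, eval v (monomial m (coeff m f))
      = coeff m f * ∏ i, ∑ a : ZMod p, a ^ m i := by
    intro m
    rw [Finset.prod_univ_sum, Fintype.piFinset_univ, Finset.mul_sum]
    refine Finset.sum_congr rfl fun v _ => ?_
    rw [eval_monomial, Finsupp.prod_fintype _ _ fun i => pow_zero _]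
  have hsum : ∑ v : σ → ZMod p, eval v f
      = ∑ m ∈ f.support, coeff m f * ∏ i, ∑ a : ZMod p, a ^ m i := by
    conv_lhs => rw [f.as_sum]
    simp only [map_sum]
    rw [Finset.sum_comm]
    exact Finset.sum_congr rfl fun m _ => hmon m
  by_contra hc
  rw [hsum, Finset.sum_eq_single t] at h0
  · have h1 : ∑ a : ZMod p, a ^ (p - 1) = -1 := by
      have h2 := FiniteField.sum_pow_units (ZMod p) (p - 1)
      rw [ZMod.card, if_pos dvd_rfl] at h2
      rw [← h2, ← Finset.sum_erase Finset.univ (a := (0 : ZMod p))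
        (by rw [zero_pow (by omega)])]
      refine (Finset.sum_bij (fun (u : (ZMod p)ˣ) _ => (u : ZMod p)) ?_ ?_ ?_ ?_).symm
      · intro u _; simp
      · intro u _ v _ h; exact Units.ext h
      · intro a ha; exact ⟨Units.mk0 a (Finset.ne_of_mem_erase ha), Finset.mem_univ _, rfl⟩
      · intro u _; rfl
    simp only [ht, h1, Finset.prod_const] at h0
    exact (mul_eq_zero.1 h0).elim hc (pow_ne_zero _ (neg_ne_zero.2 one_ne_zero))
  · intro m hm hmt
    have hd := degree_eq_of_coeff_ne_zero hf (mem_support_iff.1 hm)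
    obtain ⟨i, hi⟩ : ∃ i, m i < p - 1 := by
      by_contra! h
      apply hmt
      have h1 : ∑ i, m i = ∑ _i : σ, (p - 1) := by
        rw [← Finsupp.degree_eq_sum, hd]; simp
      have h2 := (Finset.sum_eq_sum_iff_of_le (fun i _ => h i)).1 h1.symm
      ext i
      rw [ht, ← h2 i (Finset.mem_univ _)]
    rw [Finset.prod_eq_zero (Finset.mem_univ i), mul_zero]
    exact FiniteField.sum_pow_lt_card_sub_one _ _ (by rwa [ZMod.card])
  · intro h
    exact absurd (mem_support_iff.2 hc) h

end FiniteField

/-! ### Antiinvariants modulo p -/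

section SignPart

open MvPolynomial

variable {ι V N : Type*} [Fintype ι] [AddCommGroup V] [Module ℝ V] [AddCommGroup N] [Module ℝ N]
  {P : RootPairing ι ℝ V N} [P.IsRootSystem] [P.IsCrystallographic] (b : P.Base)
  [P.IsReduced] [P.IsIrreducible] {p : ℕ} [hpp : Fact p.Prime] (hp : 1 + coxeterNumber b = p)

include hp

theorem intCast_two_ne_zero : (2 : ZMod p) ≠ 0 := fun h =>
  not_dvd_two b hp ((ZMod.natCast_eq_zero_iff 2 p).1 (by exact_mod_cast h))

theorem evalWeight_rootWeight (i : ι) (v : weightLattice P) :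
    evalWeight b v (xPoly b (ZMod p) (rootWeight P i))
      = (halfNorm b i : ZMod p) * (corootPairing P i v : ZMod p) := by
  rw [evalWeight_xPoly, ringForm_symm,
    ringForm_rootWeight b (isUnit_latticeDenom b hp (isPLocal_zmod p))]

theorem halfNorm_ne_zero (i : ι) : (halfNorm b i : ZMod p) ≠ 0 :=
  (isUnit_halfNorm b hp (isPLocal_zmod p) i).ne_zero

/-- Up to units the factors are the heights of the positive coroots, which lie between 1 and h - 1 <
p. -/
theorem evalWeight_rho_rootProd_ne_zero :
    evalWeight b (rhoWeight b) (rootProd b (ZMod p)) ≠ 0 := by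
  rw [evalWeight, rootProd, map_prod]
  refine Finset.prod_ne_zero_iff.2 fun i hi => ?_
  refine ne_of_eq_of_ne (evalWeight_rootWeight b hp i _) (mul_ne_zero (halfNorm_ne_zero b hp i) ?_)
  rw [Ne, ZMod.intCast_zmod_eq_zero_iff_dvd]
  intro h
  have h1 := abs_corootPairing_rho_lt b i
  have h2 := corootPairing_rho_pos ((mem_posRoots b).1 hi)
  have h3 := Int.le_of_dvd h2 h
  rw [abs_of_pos h2] at h1
  have h4 : (p : ℤ) = 1 + coxeterNumber b := by rw [← hp]; push_cast; rfl
  omega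

theorem rootProd_ne_zero : rootProd b (ZMod p) ≠ 0 := fun h =>
  evalWeight_rho_rootProd_ne_zero b hp (by rw [h, evalWeight, map_zero])

theorem xPoly_rootWeight_ne_zero (i : ι) : xPoly b (ZMod p) (rootWeight P i) ≠ 0 := by
  intro h
  have h1 := evalWeight_rootWeight b hp i (rootWeight P i)
  rw [h, evalWeight, map_zero, corootPairing_rootWeight_self] at h1
  exact mul_ne_zero (halfNorm_ne_zero b hp i)
    (by exact_mod_cast intCast_two_ne_zero b hp) h1.symm

theorem prime_xPoly_rootWeight (i : ι) : Prime (xPoly b (ZMod p) (rootWeight P i)) := by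
  have h0 := xPoly_rootWeight_ne_zero b hp i
  refine (irreducible_of_totalDegree_eq_one
    ((isHomogeneous_xPoly _).totalDegree h0) fun x hx => ?_).prime
  refine isUnit_iff_ne_zero.2 fun hx0 => h0 ?_
  ext m
  rw [coeff_zero]
  exact zero_dvd_iff.1 (hx0 ▸ hx m)

/-- Evaluate at 2α_j - (α_j, α_i^∨) α_i, which is orthogonal to α_i. There x_{α_j} takes, up to a
unit, the value 4 - (α_i, α_j^∨)(α_j, α_i^∨), which is nonzero modulo p. -/
theorem not_xPoly_rootWeight_dvd {i j : ι} (hi : b.IsPos i) (hj : b.IsPos j) (hij : i ≠ j) :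
    ¬ xPoly b (ZMod p) (rootWeight P i) ∣ xPoly b (ZMod p) (rootWeight P j) := by
  rintro ⟨q, hq⟩
  have h := congrArg (evalWeight b ((2 : ℤ) • rootWeight P j -
    corootPairing P i (rootWeight P j) • rootWeight P i)) hq
  rw [evalWeight_rootWeight b hp] at h
  have h2 : evalWeight b ((2 : ℤ) • rootWeight P j -
      corootPairing P i (rootWeight P j) • rootWeight P i)
      (xPoly b (ZMod p) (rootWeight P i)) = 0 := by
    rw [evalWeight_rootWeight b hp, corootPairing_sub, corootPairing_zsmul, corootPairing_zsmul,
      corootPairing_rootWeight_self, mul_comm 2, sub_self, Int.cast_zero, mul_zero]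
  rw [evalWeight, map_mul] at h
  change _ = evalWeight b _ _ * _ at h
  rw [h2, zero_mul, corootPairing_sub, corootPairing_zsmul, corootPairing_zsmul,
    corootPairing_rootWeight_self, corootPairing_rootWeight, corootPairing_rootWeight] at h
  have h3 := (mul_eq_zero.1 h).resolve_left (halfNorm_ne_zero b hp j)
  rw [ZMod.intCast_zmod_eq_zero_iff_dvd] at h3
  refine not_dvd_det_pairing b hp hi hj hij ?_
  rwa [mul_comm (P.pairingIn ℤ i j)]

/-- Each x_α divides f - s_α f = 2 f, and p is odd. The x_α are primes that do not divide one
another, so their product divides f. -/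
theorem rootProd_dvd {f : MvPolynomial b.support (ZMod p)} (hf : IsAntiinvariant b (ZMod p) f) :
    rootProd b (ZMod p) ∣ f := by
  classical
  have hdvd : ∀ i, xPoly b (ZMod p) (rootWeight P i) ∣ f := by
    intro i
    have h := xPoly_mul_divDiff b (ZMod p) i f
    rw [hf.ofIdx, sub_neg_eq_add, ← two_mul] at h
    have h2 : IsUnit (2 : MvPolynomial b.support (ZMod p)) := by
      have := (isUnit_iff_ne_zero.2 (intCast_two_ne_zero b hp)).map
        (C : ZMod p →+* MvPolynomial b.support (ZMod p))
      rwa [map_ofNat] at this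
    exact h2.dvd_mul_left.1 (Dvd.intro _ h)
  have key : ∀ t : Finset ι, t ⊆ posRoots b →
      ∏ i ∈ t, xPoly b (ZMod p) (rootWeight P i) ∣ f := by
    intro t
    induction t using Finset.induction_on with
    | empty => exact fun _ => by rw [Finset.prod_empty]; exact one_dvd _
    | insert i t hi ih =>
      intro ht
      rw [Finset.insert_subset_iff] at ht
      obtain ⟨q, hq⟩ := ih ht.2
      rw [Finset.prod_insert hi]
      have h := hdvd i
      rw [hq] at h
      rcases (prime_xPoly_rootWeight b hp i).dvd_or_dvd h with h | h
      · obtain ⟨j, hj, h'⟩ := ((prime_xPoly_rootWeight b hp i).dvd_finsetProd_iff _).1 h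
        exact absurd h' (not_xPoly_rootWeight_dvd b hp ((mem_posRoots b).1 ht.1)
          ((mem_posRoots b).1 (ht.2 hj)) fun hij => hi (hij ▸ hj))
      · rw [hq, mul_comm (xPoly b (ZMod p) (rootWeight P i))]
        exact mul_dvd_mul_left _ h
  exact key _ subset_rfl

theorem IsAntiinvariant.eq_zero_of_lt {f : MvPolynomial b.support (ZMod p)}
    (hf : IsAntiinvariant b (ZMod p) f) {d : ℕ} (hd : f.IsHomogeneous d)
    (hlt : d < (posRoots b).card) : f = 0 := by
  by_contra h0
  obtain ⟨q, rfl⟩ := rootProd_dvd b hp hf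
  have hq : q ≠ 0 := right_ne_zero_of_mul h0
  have h1 := totalDegree_mul_of_isDomain (rootProd_ne_zero b hp) hq
  rw [hd.totalDegree h0, (isHomogeneous_rootProd b).totalDegree (rootProd_ne_zero b hp)] at h1
  omega

theorem IsAntiinvariant.eq_smul {f : MvPolynomial b.support (ZMod p)}
    (hf : IsAntiinvariant b (ZMod p) f) (hd : f.IsHomogeneous (posRoots b).card) :
    ∃ c : ZMod p, f = c • rootProd b (ZMod p) := by
  by_cases h0 : f = 0
  · exact ⟨0, by rw [h0, zero_smul]⟩
  obtain ⟨q, rfl⟩ := rootProd_dvd b hp hf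
  have hq : q ≠ 0 := right_ne_zero_of_mul h0
  have h1 := totalDegree_mul_of_isDomain (rootProd_ne_zero b hp) hq
  rw [hd.totalDegree h0, (isHomogeneous_rootProd b).totalDegree (rootProd_ne_zero b hp)] at h1
  have h2 : q.totalDegree = 0 := by omega
  rw [totalDegree_eq_zero_iff_eq_C] at h2
  refine ⟨coeff 0 q, ?_⟩
  conv_lhs => rw [h2]
  rw [smul_eq_C_mul, mul_comm]

theorem sum_eval_weylAct (g : P.weylGroup) (f : MvPolynomial b.support (ZMod p))
    [DecidableEq b.support] :
    ∑ v : b.support → ZMod p, eval v (weylAct b (ZMod p) g f)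
      = ∑ v : b.support → ZMod p, eval v f :=
  Fintype.sum_equiv (pointPerm b g) _ _ fun v => eval_weylAct b g v f

theorem card_weylGroup_ne_zero : (Fintype.card P.weylGroup : ZMod p) ≠ 0 :=
  (isUnit_card_weylGroup b hp (isPLocal_zmod p)).ne_zero

/-- Suppose f has a nonzero coefficient at a reduced monomial, and multiply f by the complementary
monomial, of degree n(p - 1) - d = 2|R₊| - d < |R₊|. The sum of values over all points is
W-invariant, so the complementary monomial may be replaced by its antisymmetrization, which vanishes
for reasons of degree. Hence the top coefficient of the product, which is the given coefficient of
f, is zero. -/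
theorem IsAntiinvariant.mem_frobIdeal {f : MvPolynomial b.support (ZMod p)}
    (hf : IsAntiinvariant b (ZMod p) f) {d : ℕ} (hd : f.IsHomogeneous d)
    (hlt : (posRoots b).card < d) : f ∈ frobIdeal b.support (ZMod p) p := by
  classical
  rw [mem_frobIdeal_iff]
  intro m hm
  by_contra hc
  have hmd := degree_eq_of_coeff_ne_zero hd hc
  have hN := two_mul_card_posRoots b
  have hh : coxeterNumber b = p - 1 := by omega
  let t : b.support →₀ ℕ := Finsupp.equivFunOnFinite.symm fun _ => p - 1
  let s : b.support →₀ ℕ := Finsupp.equivFunOnFinite.symm fun i => p - 1 - m i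
  have hst : m + s = t := by
    ext i
    change m i + (p - 1 - m i) = p - 1
    have := hm i
    omega
  have htd : t.degree = Fintype.card b.support * (p - 1) := by
    rw [Finsupp.degree_eq_sum]
    simp [t]
  have hsd : d + s.degree = Fintype.card b.support * (p - 1) := by
    rw [← htd, ← hst, map_add, hmd]
  have hg : (monomial s (1 : ZMod p)).IsHomogeneous s.degree := isHomogeneous_monomial _ rfl
  have hfg : (f * monomial s 1).IsHomogeneous (Fintype.card b.support * (p - 1)) := by
    rw [← hsd]; exact hd.mul hg
  have h0 : antisymm b (ZMod p) (monomial s 1) = 0 := by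
    refine (isAntiinvariant_antisymm b _).eq_zero_of_lt b hp (isHomogeneous_antisymm b hg) ?_
    rw [hh, mul_comm (p - 1)] at hN
    omega
  have hsum : (Fintype.card P.weylGroup : ZMod p) *
      ∑ v : b.support → ZMod p, eval v (f * monomial s 1) = 0 := by
    have h1 : ∀ g : P.weylGroup, ∑ v : b.support → ZMod p, eval v (f * monomial s 1)
        = ∑ v : b.support → ZMod p, eval v f *
          eval v ((weylSign b g : ZMod p) • weylAct b (ZMod p) g (monomial s 1)) := by
      intro g
      rw [← sum_eval_weylAct b hp g]
      refine Finset.sum_congr rfl fun v _ => ?_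
      rw [map_mul, hf g, map_mul, smul_eval, smul_eval]
      ring
    have h2 : (Fintype.card P.weylGroup : ZMod p) *
        ∑ v : b.support → ZMod p, eval v (f * monomial s 1)
        = ∑ _g : P.weylGroup, ∑ v : b.support → ZMod p, eval v (f * monomial s 1) := by
      rw [Finset.sum_const, Finset.card_univ, nsmul_eq_mul]
    rw [h2, Finset.sum_congr rfl fun g _ => h1 g, Finset.sum_comm]
    refine Finset.sum_eq_zero fun v _ => ?_
    rw [← Finset.mul_sum, ← map_sum, ← antisymm_apply, h0, map_zero, mul_zero]
  have h3 := coeff_top_eq_zero hfg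
    ((mul_eq_zero.1 hsum).resolve_left (card_weylGroup_ne_zero b hp)) (t := t) fun _ => rfl
  rw [← hst, coeff_mul_monomial, mul_one] at h3
  exact hc h3

/-- If δ were in (x^p), it would coincide as a function with a form of smaller degree, whose
antisymmetrization is zero. But antisymmetrizing δ gives |W| δ, which does not vanish at ρ. When
|R₊| < p - 1, all monomials of δ are reduced and δ ≠ 0 is enough. -/
theorem rootProd_notMem_frobIdeal : rootProd b (ZMod p) ∉ frobIdeal b.support (ZMod p) p := by
  intro h
  have hp1 := hpp.out.one_lt
  have hN : p - 1 ≤ (posRoots b).card ∨ (posRoots b).card < p - 1 := le_or_gt _ _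
  rcases hN with hN | hN
  · obtain ⟨f, hf, hev⟩ := exists_form_eval_eq (d := (posRoots b).card - (p - 1))
      (by rw [Nat.sub_add_cancel hN]; exact isHomogeneous_rootProd b) h
    have h0 : antisymm b (ZMod p) f = 0 :=
      (isAntiinvariant_antisymm b _).eq_zero_of_lt b hp (isHomogeneous_antisymm b hf) (by omega)
    have h1 : ∀ v, eval v (antisymm b (ZMod p) f)
        = eval v (antisymm b (ZMod p) (rootProd b (ZMod p))) := by
      intro v
      rw [antisymm_apply, antisymm_apply, map_sum, map_sum]
      refine Finset.sum_congr rfl fun g _ => ?_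
      rw [smul_eval, smul_eval, eval_weylAct, eval_weylAct, hev]
    have h2 := h1 (fun j => ringForm P (ZMod p) (fundWeight b j) (rhoWeight b))
    rw [h0, map_zero, (isAntiinvariant_rootProd b).antisymm_eq, smul_eval] at h2
    exact mul_ne_zero (card_weylGroup_ne_zero b hp) (evalWeight_rho_rootProd_ne_zero b hp) h2.symm
  · rw [mem_frobIdeal_iff] at h
    apply rootProd_ne_zero b hp
    ext m
    rw [coeff_zero]
    by_contra hc
    refine hc (h m fun i => ?_)
    have hd := degree_eq_of_coeff_ne_zero (isHomogeneous_rootProd b) hc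
    have := Finsupp.le_degree i m
    omega

end SignPart

/-! ### The sign component over p-local rings -/

section SignQuotient

open MvPolynomial

variable {ι V N : Type*} [Fintype ι] [AddCommGroup V] [Module ℝ V] [AddCommGroup N] [Module ℝ N]
  {P : RootPairing ι ℝ V N} [P.IsRootSystem] [P.IsCrystallographic] (b : P.Base)
  (A : Type*) [CommRing A]

/-- The class of a polynomial modulo `maxSub`. -/
def mkQuot (k : A) : MvPolynomial b.support A →ₗ[A] (PolyRep b A k ⧸ maxSub b A k) :=
  ((maxSub b A k).mkQ.restrictScalars A).comp (PolyRep.of b A k).toLinearMap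

variable {A} in
theorem mkQuot_eq_zero {k : A} {f : MvPolynomial b.support A} :
    mkQuot b A k f = 0 ↔ f ∈ maxIdeal b A k :=
  Submodule.Quotient.mk_eq_zero (maxSub b A k)

variable [P.IsReduced] [P.IsIrreducible] {p : ℕ} [hpp : Fact p.Prime]
  (hp : 1 + coxeterNumber b = p) {A}

include hp

/-- Modulo p and (x^p), an antisymmetrized form is zero, a multiple of δ, or zero again, according
as its degree is below, equal to or above |R₊|. The discrepancy over ℤ_(p) therefore has reduced
coefficients divisible by p, and Nakayama's lemma applies to the image of the antisymmetrizer in the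
finitely generated quotient. -/
theorem exists_antisymm_sub_mem_zloc (f : MvPolynomial b.support (Zloc p)) :
    ∃ c : Zloc p, antisymm b (Zloc p) f - c • rootProd b (Zloc p)
      ∈ maxIdeal b (Zloc p) (kParam b (Zloc p)) := by
  classical
  let Φ := (mkQuot b (Zloc p) (kParam b (Zloc p))).comp (antisymm b (Zloc p))
  have hfin := finite_quotient_maxSub b hp (isPLocal_zloc p)
  have hW := isUnit_card_weylGroup b hp (isPLocal_zloc p)
  have hle : LinearMap.range Φ ≤
      Submodule.span (Zloc p) {mkQuot b (Zloc p) (kParam b (Zloc p)) (rootProd b (Zloc p))} := by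
    refine Submodule.le_of_le_smul_of_le_jacobson_bot (IsNoetherian.noetherian _)
      natCast_prime_mem_jacobson ?_
    rintro _ ⟨f, rfl⟩
    rw [← sum_homogeneousComponent f, map_sum]
    refine sum_mem fun d _ => ?_
    have hd := homogeneousComponent_isHomogeneous d f
    generalize homogeneousComponent d f = f at hd
    obtain ⟨c, hc⟩ : ∃ c : Zloc p, MvPolynomial.map (zlocRed p)
        (antisymm b (Zloc p) f - c • rootProd b (Zloc p)) ∈ frobIdeal b.support (ZMod p) p := by
      have h1 := isAntiinvariant_antisymm b (MvPolynomial.map (zlocRed p) f)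
      have h2 := isHomogeneous_antisymm b (hd.map (zlocRed p))
      rcases lt_trichotomy d (posRoots b).card with h | h | h
      · refine ⟨0, ?_⟩
        rw [zero_smul, sub_zero, map_antisymm, h1.eq_zero_of_lt b hp h2 h]
        exact zero_mem _
      · obtain ⟨c, hc⟩ := h1.eq_smul b hp (h ▸ h2)
        obtain ⟨c', rfl⟩ := zlocRed_surjective c
        refine ⟨c', ?_⟩
        rw [map_sub, map_antisymm, hc, smul_eq_C_mul, smul_eq_C_mul, map_mul, map_C, map_rootProd,
          sub_self]
        exact zero_mem _
      · refine ⟨0, ?_⟩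
        rw [zero_smul, sub_zero, map_antisymm]
        exact h1.mem_frobIdeal b hp h2 h
    obtain ⟨e, he⟩ := exists_reducedPoly_sub_mem b hp (isPLocal_zloc p)
      (antisymm b (Zloc p) f - c • rootProd b (Zloc p))
    have he' := map_mem_maxIdeal (zlocRed p) (map_ringForm_of_isPLocal b hp (isPLocal_zloc p) _)
      (map_kParam_of_isPLocal b hp (isPLocal_zloc p) (zlocRed p)) he
    rw [map_sub] at he'
    have hr : MvPolynomial.map (zlocRed p) (reducedPoly b.support (Zloc p) p e)
        = reducedPoly b.support (ZMod p) p (fun m => zlocRed p (e m)) := by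
      simp only [reducedPoly_apply, map_sum, map_monomial]
    have he0 := eq_zero_of_reducedPoly_mem b hp (isPLocal_zmod p)
      (c := fun m => zlocRed p (e m)) (by
        rw [← hr]
        rw [← maxIdeal_zmod b hp] at hc
        have := sub_mem hc he'
        rwa [sub_sub_cancel] at this)
    have hdiv : ∀ m, ∃ y, e m = (p : Zloc p) * y := fun m =>
      (zlocRed_eq_zero_iff _).1 (congrFun he0 m)
    choose y hy using hdiv
    have hey : e = (p : Zloc p) • y := funext hy
    set G := reducedPoly b.support (Zloc p) p y
    -- A second antisymmetrization puts the error into the range of Φ, as Nakayama's lemma requires.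
    -- It only multiplies the antiinvariant terms by the unit |W|.
    have h3 : mkQuot b (Zloc p) (kParam b (Zloc p)) (antisymm b (Zloc p)
        (antisymm b (Zloc p) f - c • rootProd b (Zloc p) -
          reducedPoly b.support (Zloc p) p e)) = 0 :=
      (mkQuot_eq_zero b).2 (antisymm_mem_maxIdeal b he)
    rw [hey] at h3
    simp only [map_sub, map_smul, (isAntiinvariant_antisymm b f).antisymm_eq,
      (isAntiinvariant_rootProd b).antisymm_eq] at h3
    rw [sub_sub, sub_eq_zero] at h3
    have h4 : Φ f = c • mkQuot b (Zloc p) (kParam b (Zloc p)) (rootProd b (Zloc p))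
        + (p : Zloc p) • Φ (Ring.inverse (Fintype.card P.weylGroup : Zloc p) • G) := by
      have h5 := congrArg (Ring.inverse (Fintype.card P.weylGroup : Zloc p) • ·) h3
      simp only [smul_add] at h5
      rw [smul_smul, Ring.inverse_mul_cancel _ hW, one_smul, smul_comm c, smul_smul,
        Ring.inverse_mul_cancel _ hW, one_smul, smul_comm _ (p : Zloc p)] at h5
      rw [map_smul]
      exact h5
    rw [h4]
    exact Submodule.add_mem_sup (Submodule.smul_mem _ _ (Submodule.mem_span_singleton_self _))
      (Submodule.smul_mem_smul (Ideal.mem_span_singleton_self _) ⟨_, rfl⟩)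
  obtain ⟨c, hc⟩ := Submodule.mem_span_singleton.1 (hle ⟨f, rfl⟩)
  refine ⟨c, (mkQuot_eq_zero b).1 ?_⟩
  rw [map_sub, map_smul, hc]
  exact sub_self _

/-- The antisymmetric polynomials are multiples of `δ` modulo `maxIdeal`. -/
theorem exists_antisymm_sub_mem (hA : IsPLocal p A) (f : MvPolynomial b.support A) :
    ∃ c : A, antisymm b A f - c • rootProd b A ∈ maxIdeal b A (kParam b A) := by
  induction f using MvPolynomial.induction_on' with
  | add f g hf hg =>
    obtain ⟨c, hc⟩ := hf
    obtain ⟨d, hd⟩ := hg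
    refine ⟨c + d, ?_⟩
    rw [map_add, add_smul, add_sub_add_comm]
    exact add_mem hc hd
  | monomial m a =>
    obtain ⟨c, hc⟩ := exists_antisymm_sub_mem_zloc b hp (monomial m (1 : Zloc p))
    have h := map_mem_maxIdeal (zlocHom hA) (map_ringForm_of_isPLocal b hp (isPLocal_zloc p) _)
      (map_kParam_of_isPLocal b hp (isPLocal_zloc p) (zlocHom hA)) hc
    rw [map_sub, map_antisymm, map_monomial, map_one, smul_eq_C_mul, map_mul, map_C, map_rootProd,
      ← smul_eq_C_mul] at h
    refine ⟨a * zlocHom hA c, ?_⟩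
    have h1 : monomial m a = a • monomial m (1 : A) := by rw [smul_monomial, smul_eq_mul, mul_one]
    rw [h1, map_smul, mul_smul, ← smul_sub]
    exact smul_mem_maxIdeal a h

theorem map_rootProd_sub_mem [DecidableEq b.support] {e : (b.support → Fin p) → Zloc p}
    (he : rootProd b (Zloc p) - reducedPoly b.support (Zloc p) p e ∈
      maxIdeal b (Zloc p) (kParam b (Zloc p))) (φ : Zloc p →+* A) :
    rootProd b A - reducedPoly b.support A p (fun m => φ (e m)) ∈ maxIdeal b A (kParam b A) := by
  have h := map_mem_maxIdeal φ (map_ringForm_of_isPLocal b hp (isPLocal_zloc p) _)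
    (map_kParam_of_isPLocal b hp (isPLocal_zloc p) φ) he
  rw [map_sub, map_rootProd] at h
  convert h using 2
  simp only [reducedPoly_apply, map_sum, map_monomial]

/-- Since δ is outside (x^p) modulo p, one of its reduced coefficients over ℤ_(p) is a unit, and it
remains a unit in A. -/
theorem rootProd_notMem_maxIdeal_of_hom (hA : IsPLocal p A) (c : A)
    (hc : c • rootProd b A ∈ maxIdeal b A (kParam b A)) : c = 0 := by
  classical
  obtain ⟨e, he⟩ := exists_reducedPoly_sub_mem b hp (isPLocal_zloc p) (rootProd b (Zloc p))
  obtain ⟨m, hm⟩ : ∃ m, zlocRed p (e m) ≠ 0 := by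
    by_contra! h
    have h1 := map_rootProd_sub_mem b hp he (zlocRed p)
    have h2 : (fun m => zlocRed p (e m)) = 0 := funext h
    rw [h2, map_zero, sub_zero, maxIdeal_zmod b hp] at h1
    exact rootProd_notMem_frobIdeal b hp h1
  have hu : IsUnit (zlocHom hA (e m)) := (isUnit_of_zlocRed_ne_zero hm).map _
  have h3 : reducedPoly b.support A p (c • fun m => zlocHom hA (e m))
      ∈ maxIdeal b A (kParam b A) := by
    have := sub_mem hc (smul_mem_maxIdeal c (map_rootProd_sub_mem b hp he (zlocHom hA)))
    rwa [← smul_sub, sub_sub_cancel, ← map_smul] at this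
  have h4 := congrFun (eq_zero_of_reducedPoly_mem b hp hA h3) m
  exact hu.mul_left_eq_zero.1 h4

end SignQuotient

/-! ### The polynomials in `x` and in `y` inside the rational double affine Hecke algebra -/

section CommEval

open MvPolynomial
open scoped IsMulCommutative

variable {σ A R : Type*} [CommRing A] [Ring R] [Algebra A R]

/-- The evaluation of polynomials at pairwise commuting elements of an algebra. -/
def commEval (a : σ → R) (h : ∀ i j, a i * a j = a j * a i) : MvPolynomial σ A →ₐ[A] R :=
  haveI := Algebra.isMulCommutative_adjoin A (s := Set.range a) (by
    rintro _ ⟨i, rfl⟩ _ ⟨j, rfl⟩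
    exact h i j)
  (Algebra.adjoin A (Set.range a)).val.comp
    (aeval fun i => (⟨a i, Algebra.subset_adjoin ⟨i, rfl⟩⟩ : Algebra.adjoin A (Set.range a)))

theorem commEval_X (a : σ → R) (h : ∀ i j, a i * a j = a j * a i) (i : σ) :
    commEval (A := A) a h (X i) = a i := by
  have := Algebra.isMulCommutative_adjoin A (s := Set.range a) (by
    rintro _ ⟨i, rfl⟩ _ ⟨j, rfl⟩
    exact h i j)
  exact congrArg Subtype.val (aeval_X (R := A)
    (fun i => (⟨a i, Algebra.subset_adjoin ⟨i, rfl⟩⟩ : Algebra.adjoin A (Set.range a))) i)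

end CommEval

section Maps

open MvPolynomial

variable {ι V N : Type*} [Fintype ι] [AddCommGroup V] [Module ℝ V] [AddCommGroup N] [Module ℝ N]
  {P : RootPairing ι ℝ V N} [P.IsCrystallographic] [P.IsRootSystem] (b : P.Base)
  (A : Type*) [CommRing A] (k : A)

/-- The polynomials in `x` as elements of the algebra. -/
def xMap : MvPolynomial b.support A →ₐ[A] RatDAHA b A k :=
  commEval (fun j => gen b A k (.x (fundWeight b j))) fun _ _ => gen_x_comm b A k _ _

/-- The polynomials in `y` as elements of the algebra. -/
def yMap : MvPolynomial b.support A →ₐ[A] RatDAHA b A k :=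
  commEval (fun j => gen b A k (.y (fundWeight b j))) fun _ _ => gen_y_comm b A k _ _

theorem xMap_X (j : b.support) : xMap b A k (X j) = gen b A k (.x (fundWeight b j)) :=
  commEval_X _ _ _

theorem yMap_X (j : b.support) : yMap b A k (X j) = gen b A k (.y (fundWeight b j)) :=
  commEval_X _ _ _

theorem xMap_xPoly (v : weightLattice P) : xMap b A k (xPoly b A v) = gen b A k (.x v) :=
  addHom_ext b (f := (xMap b A k).toAddMonoidHom.comp (xHom b A))
    (f' := AddMonoidHom.mk' (fun v => gen b A k (.x v)) (gen_x_add b A k)) (fun j => by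
      change xMap b A k (xPoly b A _) = gen b A k _
      rw [xPoly_fundWeight, xMap_X]) v

theorem yMap_xPoly (v : weightLattice P) : yMap b A k (xPoly b A v) = gen b A k (.y v) :=
  addHom_ext b (f := (yMap b A k).toAddMonoidHom.comp (xHom b A))
    (f' := AddMonoidHom.mk' (fun v => gen b A k (.y v)) (gen_y_add b A k)) (fun j => by
      change yMap b A k (xPoly b A _) = gen b A k _
      rw [xPoly_fundWeight, yMap_X]) v

theorem gen_w_mul_xMap (g : P.weylGroup) (f : MvPolynomial b.support A) :
    gen b A k (.w g) * xMap b A k f = xMap b A k (weylAct b A g f) * gen b A k (.w g) := by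
  induction f using poly_induction with
  | hC a =>
    rw [← algebraMap_eq, AlgHom.commutes, AlgHom.commutes, AlgHom.commutes, Algebra.commutes]
  | hadd f f' h h' => simp only [map_add, mul_add, add_mul, h, h']
  | hx v f h =>
    rw [map_mul, ← mul_assoc, xMap_xPoly, gen_w_x, mul_assoc, h, ← mul_assoc, map_mul, map_mul,
      weylAct_xPoly, xMap_xPoly]

theorem gen_w_mul_yMap (g : P.weylGroup) (f : MvPolynomial b.support A) :
    gen b A k (.w g) * yMap b A k f = yMap b A k (weylAct b A g f) * gen b A k (.w g) := by
  induction f using poly_induction with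
  | hC a =>
    rw [← algebraMap_eq, AlgHom.commutes, AlgHom.commutes, AlgHom.commutes, Algebra.commutes]
  | hadd f f' h h' => simp only [map_add, mul_add, add_mul, h, h']
  | hx v f h =>
    rw [map_mul, ← mul_assoc, yMap_xPoly, gen_w_y, mul_assoc, h, ← mul_assoc, map_mul, map_mul,
      weylAct_xPoly, yMap_xPoly]

/-- The formula of the Dunkl operator inside the algebra itself. It serves modules in which the
vector on the right is not the constant 1. -/
theorem gen_y_mul_xMap (u : weightLattice P) (f : MvPolynomial b.support A) :
    gen b A k (.y u) * xMap b A k f = xMap b A k f * gen b A k (.y u) +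
      xMap b A k (deriv b A u f) + ∑ i ∈ posRoots b, (k * ringForm P A u (rootWeight P i)) •
        (xMap b A k (divDiff b A i f) * gen b A k (.w (RootPairing.weylGroup.ofIdx P i))) := by
  induction f using poly_induction with
  | hC a =>
    rw [← algebraMap_eq, AlgHom.commutes, Derivation.map_algebraMap, map_zero, add_zero,
      Algebra.commutes, Finset.sum_eq_zero, add_zero]
    intro i _
    rw [algebraMap_eq, divDiff_C, map_zero, zero_mul, smul_zero]
  | hadd f f' h h' =>
    simp only [map_add, mul_add, add_mul, h, h', smul_add, Finset.sum_add_distrib]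
    abel
  | hx v f h =>
    rw [map_mul, ← mul_assoc, xMap_xPoly, gen_y_x, add_mul, add_mul, mul_assoc, h,
      Derivation.leibniz, deriv_xPoly, smul_eq_mul, smul_eq_mul, mul_add, mul_add, map_add, map_mul,
      map_mul, xMap_xPoly, ← algebraMap_eq, AlgHom.commutes, Finset.sum_mul, Finset.mul_sum]
    have h1 : ∀ i ∈ posRoots b, (k * ringForm P A u (rootWeight P i)) •
        (xMap b A k (divDiff b A i (xPoly b A v * f)) *
          gen b A k (.w (RootPairing.weylGroup.ofIdx P i))) =
        gen b A k (.x v) * ((k * ringForm P A u (rootWeight P i)) •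
          (xMap b A k (divDiff b A i f) * gen b A k (.w (RootPairing.weylGroup.ofIdx P i)))) +
        (k * ringForm P A u (rootWeight P i) * (corootPairing P i v : A)) •
          gen b A k (.w (RootPairing.weylGroup.ofIdx P i)) * xMap b A k f := by
      intro i _
      rw [divDiff_mul, map_add, map_mul, map_smul, xMap_xPoly, add_mul, smul_add, smul_mul_assoc,
        smul_mul_assoc, ← gen_w_mul_xMap, smul_smul, mul_smul_comm, mul_assoc]
    rw [Finset.sum_congr rfl h1, Finset.sum_add_distrib, ← Algebra.commutes (ringForm P A u v)]
    simp only [mul_assoc]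
    abel

theorem xMap_smul (f q : MvPolynomial b.support A) :
    xMap b A k f • PolyRep.of b A k q = PolyRep.of b A k (f * q) := by
  induction f using poly_induction with
  | hC a =>
    rw [← algebraMap_eq, AlgHom.commutes, algebraMap_smul, ← map_smul, Algebra.smul_def]
  | hadd f f' h h' => simp only [map_add, add_smul, h, h', add_mul]
  | hx v f h => rw [map_mul, mul_smul, h, xMap_xPoly, gen_x_smul, ← map_mul, mul_assoc]

end Maps

/-! ### Faithfulness of the group algebra on 𝔽_p[x]/(x^p) -/

section Faithful

open MvPolynomial

variable {ι V N : Type*} [Fintype ι] [AddCommGroup V] [Module ℝ V] [AddCommGroup N] [Module ℝ N]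
  {P : RootPairing ι ℝ V N} [P.IsRootSystem] [P.IsCrystallographic] (b : P.Base)
  [P.IsReduced] [P.IsIrreducible] {p : ℕ} [hpp : Fact p.Prime] (hp : 1 + coxeterNumber b = p)

/-- The point `g ρ` of the space over `𝔽_p`. -/
def orbitPoint (p : ℕ) [Fact p.Prime] (g : P.weylGroup) : b.support → ZMod p :=
  fun j => ringForm P (ZMod p) (fundWeight b j) (g • rhoWeight b)

include hp in
-- A point of the orbit determines the pairings with all simple coroots modulo p, because the form
-- is nondegenerate there, and the stabilizer of ρ modulo p is trivial.
theorem orbitPoint_injective : Function.Injective (orbitPoint b p) := by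
  intro g g' h
  have hA := isPLocal_zmod p
  have key : ∀ u, ringForm P (ZMod p) u (g • rhoWeight b)
      = ringForm P (ZMod p) u (g' • rhoWeight b) := by
    intro u
    rw [ringForm_symm, ringForm_eq_sum, ringForm_symm, ringForm_eq_sum]
    refine Finset.sum_congr rfl fun j _ => ?_
    have := congrFun h j
    simp only [orbitPoint] at this
    rw [ringForm_symm, this, ringForm_symm]
  have h2 : g'⁻¹ * g = 1 := by
    apply eq_one_of_smul_rho_mod b hp
    intro j
    have h3 := key (g' • rootWeight P j)
    rw [ringForm_smul] at h3
    have h4 : ringForm P (ZMod p) (g' • rootWeight P j) (g • rhoWeight b)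
        = ringForm P (ZMod p) (rootWeight P j) ((g'⁻¹ * g) • rhoWeight b) := by
      rw [← ringForm_smul P (ZMod p) g'⁻¹, inv_smul_smul, mul_smul]
    rw [h4, ringForm_symm, ringForm_rootWeight b (isUnit_latticeDenom b hp hA), ringForm_symm,
      ringForm_rootWeight b (isUnit_latticeDenom b hp hA)] at h3
    have h5 := (isUnit_halfNorm b hp hA j).mul_left_cancel h3
    rw [← ZMod.intCast_zmod_eq_zero_iff_dvd, corootPairing_sub, Int.cast_sub, h5, sub_self]
  rw [inv_mul_eq_one] at h2
  exact h2.symm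

theorem eval_orbitPoint_weylAct (g w : P.weylGroup) (f : MvPolynomial b.support (ZMod p)) :
    eval (orbitPoint b p g) (weylAct b (ZMod p) w f) = eval (orbitPoint b p (w⁻¹ * g)) f := by
  rw [eval_weylAct]
  unfold orbitPoint
  rw [pointAct_ringForm, mul_smul]

/-- The values of a polynomial at the points of the orbit of `ρ`. -/
def orbitEval (p : ℕ) [Fact p.Prime] :
    MvPolynomial b.support (ZMod p) →ₗ[ZMod p] (P.weylGroup → ZMod p) :=
  LinearMap.pi fun g => (aeval (R := ZMod p) (orbitPoint b p g)).toLinearMap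

theorem orbitEval_apply (f : MvPolynomial b.support (ZMod p)) (g : P.weylGroup) :
    orbitEval b p f g = eval (orbitPoint b p g) f := by
  rw [← coe_aeval_eq_eval]; rfl

include hp in
theorem orbitEval_surjective : Function.Surjective (orbitEval b p) := by
  classical
  intro φ
  refine ⟨∑ g, φ g • indicator (orbitPoint b p g), ?_⟩
  funext g
  rw [orbitEval_apply, map_sum, Finset.sum_eq_single g]
  · rw [smul_eval, eval_indicator_apply_eq_one, mul_one]
  · intro g' _ hg
    rw [smul_eval, eval_indicator_apply_eq_zero _ _
      fun h => hg (orbitPoint_injective b hp h).symm, mul_zero]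
  · simp

/-- The action of an element of the group algebra on the functions on the orbit of `ρ`. -/
def orbitAct (a : P.weylGroup → ZMod p) :
    (P.weylGroup → ZMod p) →ₗ[ZMod p] (P.weylGroup → ZMod p) :=
  LinearMap.pi fun g => ∑ w, a w • LinearMap.proj (w⁻¹ * g)

theorem orbitAct_apply (a φ : P.weylGroup → ZMod p) (g : P.weylGroup) :
    orbitAct a φ g = ∑ w, a w * φ (w⁻¹ * g) := by
  simp [orbitAct, LinearMap.sum_apply]

theorem orbitAct_orbitEval (a : P.weylGroup → ZMod p) (f : MvPolynomial b.support (ZMod p)) :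
    orbitAct a (orbitEval b p f) = orbitEval b p (∑ w, a w • weylAct b (ZMod p) w f) := by
  funext g
  rw [orbitAct_apply, orbitEval_apply, map_sum]
  refine Finset.sum_congr rfl fun w _ => ?_
  rw [smul_eval, eval_orbitPoint_weylAct, orbitEval_apply]

include hp in
-- The element a maps a form of degree d into (x^p). As a function the result agrees with a form of
-- degree d - (p - 1), and it is zero if d < p - 1. Iteration kills every polynomial function, and
-- on a finite orbit all functions are polynomial.
theorem isNilpotent_orbitAct {a : P.weylGroup → ZMod p}
    (ha : ∀ f, ∑ w, a w • weylAct b (ZMod p) w f ∈ frobIdeal b.support (ZMod p) p) :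
    IsNilpotent (orbitAct a) := by
  have hp1 := hpp.out.one_lt
  have hom : ∀ (d : ℕ) (f : MvPolynomial b.support (ZMod p)), f.IsHomogeneous d →
      ∃ n, (orbitAct a ^ n) (orbitEval b p f) = 0 := by
    intro d
    induction d using Nat.strong_induction_on with
    | _ d ih =>
      intro f hf
      have hh : (∑ w, a w • weylAct b (ZMod p) w f).IsHomogeneous d :=
        IsHomogeneous.sum _ _ _ fun w _ => by
          rw [smul_eq_C_mul]
          exact (isHomogeneous_weylAct w hf).C_mul _
      rcases le_or_gt (p - 1) d with hd | hd
      · obtain ⟨f', hf', he⟩ := exists_form_eval_eq (d := d - (p - 1))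
          (by rwa [Nat.sub_add_cancel hd]) (ha f)
        obtain ⟨n, hn⟩ := ih (d - (p - 1)) (by omega) f' hf'
        refine ⟨n + 1, ?_⟩
        rw [pow_succ, Module.End.mul_apply, orbitAct_orbitEval, ← hn]
        congr 1
        funext g
        rw [orbitEval_apply, orbitEval_apply, he]
      · refine ⟨1, ?_⟩
        rw [pow_one, orbitAct_orbitEval]
        suffices h0 : ∑ w, a w • weylAct b (ZMod p) w f = 0 by rw [h0, map_zero]
        ext m
        rw [coeff_zero]
        by_contra hc
        refine hc ((mem_frobIdeal_iff p _).1 (ha f) m fun i => ?_)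
        have h1 := degree_eq_of_coeff_ne_zero hh hc
        have := Finsupp.le_degree i m
        omega
  rw [Module.End.isNilpotent_iff_of_finite]
  intro φ
  obtain ⟨f, rfl⟩ := orbitEval_surjective b hp φ
  choose n hn using fun d => hom d (homogeneousComponent d f) (homogeneousComponent_isHomogeneous d f)
  refine ⟨∑ d ∈ Finset.range (f.totalDegree + 1), n d, ?_⟩
  have hs := sum_homogeneousComponent f
  generalize f.totalDegree + 1 = r at hs ⊢
  rw [← hs, map_sum, map_sum]
  refine Finset.sum_eq_zero fun d hd => ?_
  rw [← Finset.sum_erase_add _ _ hd, pow_add, Module.End.mul_apply, hn, map_zero]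

include hp in
/-- The group algebra of `W` over `𝔽_p` acts faithfully on `𝔽_p[x] / (x^p)`. -/
theorem eq_zero_of_sum_weylAct_mem {a : P.weylGroup → ZMod p}
    (ha : ∀ f, ∑ w, a w • weylAct b (ZMod p) w f ∈ frobIdeal b.support (ZMod p) p) : a = 0 := by
  classical
  have key : ∀ a : P.weylGroup → ZMod p,
      (∀ f, ∑ w, a w • weylAct b (ZMod p) w f ∈ frobIdeal b.support (ZMod p) p) → a 1 = 0 := by
    intro a ha
    -- The functions on the free orbit form the regular representation, where the trace of a is |W|
    -- a(1).
    have h1 := (LinearMap.isNilpotent_trace_of_isNilpotent (isNilpotent_orbitAct b hp ha)).eq_zero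
    rw [LinearMap.trace_eq_matrix_trace _ (Pi.basisFun (ZMod p) P.weylGroup), Matrix.trace] at h1
    have h2 : ∀ g : P.weylGroup, (LinearMap.toMatrix (Pi.basisFun (ZMod p) P.weylGroup)
        (Pi.basisFun (ZMod p) P.weylGroup) (orbitAct a)).diag g = a 1 := by
      intro g
      rw [Matrix.diag_apply, LinearMap.toMatrix_apply, Pi.basisFun_repr, Pi.basisFun_apply,
        orbitAct_apply, Finset.sum_eq_single 1]
      · simp
      · intro w _ hw
        rw [Pi.single_eq_of_ne, mul_zero]
        intro h
        exact hw (by simpa using h)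
      · simp
    rw [Finset.sum_congr rfl fun g _ => h2 g, Finset.sum_const, nsmul_eq_mul] at h1
    exact (mul_eq_zero.1 h1).resolve_left (card_weylGroup_ne_zero b hp)
  funext g
  -- Translation moves the coefficient at g to the identity.
  have h := key (fun w => a (w * g)) fun f => by
    have h1 := ha (weylAct b (ZMod p) g⁻¹ f)
    rw [← Equiv.sum_comp (Equiv.mulRight g)] at h1
    convert h1 using 2 with w
    rw [Equiv.coe_mulRight, ← AlgHom.comp_apply, ← weylAct_mul, mul_inv_cancel_right]
  simpa using h

end Faithful

/-! ### Modules with nilpotent `y` and without antiinvariants -/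

theorem eq_C_of_isHomogeneous_zero {σ A : Type*} [CommRing A] {f : MvPolynomial σ A}
    (hf : f.IsHomogeneous 0) : f = MvPolynomial.C (MvPolynomial.constantCoeff f) :=
  MvPolynomial.totalDegree_eq_zero_iff_eq_C.1 ((MvPolynomial.totalDegree_zero_iff_isHomogeneous _).2 hf)

theorem degree_wordExp {σ : Type*} (L : List σ) : (wordExp L).degree = L.length := by
  induction L with
  | nil => simp [wordExp]
  | cons i L ih => rw [wordExp, map_add, ih, Finsupp.degree_single, List.length_cons]

section Nilpotent

variable {ι V N : Type*} [Fintype ι] [AddCommGroup V] [Module ℝ V] [AddCommGroup N] [Module ℝ N]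
  {P : RootPairing ι ℝ V N} [P.IsCrystallographic] [P.IsRootSystem] (b : P.Base)
  (A : Type*) [CommRing A] (k : A) (M : Type*) [AddCommGroup M] [Module (RatDAHA b A k) M]

/-- The vectors that are annihilated by all products of `n` elements `y_u`. -/
def yNil : ℕ → AddSubgroup M
  | 0 => ⊥
  | n + 1 => ⨅ u : weightLattice P, (yNil n).comap
      (DistribSMul.toAddMonoidHom M (gen b A k (.y u)))

variable {b A k M}

theorem mem_yNil_zero {z : M} : z ∈ yNil b A k M 0 ↔ z = 0 := AddSubgroup.mem_bot

theorem mem_yNil_succ {z : M} {n : ℕ} :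
    z ∈ yNil b A k M (n + 1) ↔ ∀ u, gen b A k (.y u) • z ∈ yNil b A k M n := by
  simp [yNil, AddSubgroup.mem_iInf]

theorem algebraMap_smul_mem_yNil (a : A) {n : ℕ} {z : M} (hz : z ∈ yNil b A k M n) :
    algebraMap A (RatDAHA b A k) a • z ∈ yNil b A k M n := by
  induction n generalizing z with
  | zero => rw [mem_yNil_zero.1 hz, smul_zero]; exact zero_mem _
  | succ n ih =>
    rw [mem_yNil_succ] at hz ⊢
    intro u
    rw [← mul_smul, ← Algebra.commutes, mul_smul]
    exact ih (hz u)

theorem gen_w_smul_mem_yNil (g : P.weylGroup) {n : ℕ} {z : M} (hz : z ∈ yNil b A k M n) :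
    gen b A k (.w g) • z ∈ yNil b A k M n := by
  induction n generalizing z with
  | zero => rw [mem_yNil_zero.1 hz, smul_zero]; exact zero_mem _
  | succ n ih =>
    rw [mem_yNil_succ] at hz ⊢
    intro u
    have h := gen_w_y b A k g (g⁻¹ • u)
    rw [smul_inv_smul] at h
    rw [← mul_smul, ← h, mul_smul]
    exact ih (hz _)

theorem yNil_le_succ (n : ℕ) : yNil b A k M n ≤ yNil b A k M (n + 1) := by
  induction n with
  | zero => exact bot_le
  | succ n ih =>
    intro z hz
    rw [mem_yNil_succ] at hz ⊢
    exact fun u => ih (hz u)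

theorem yNil_mono {m n : ℕ} (h : m ≤ n) : yNil b A k M m ≤ yNil b A k M n :=
  monotone_nat_of_le_succ yNil_le_succ h

theorem gen_x_smul_mem_yNil (v : weightLattice P) {n : ℕ} {z : M} (hz : z ∈ yNil b A k M n) :
    gen b A k (.x v) • z ∈ yNil b A k M (n + 1) := by
  induction n generalizing z with
  | zero => rw [mem_yNil_zero.1 hz, smul_zero]; exact zero_mem _
  | succ n ih =>
    rw [mem_yNil_succ]
    intro u
    rw [← mul_smul, gen_y_x, add_smul, add_smul, mul_smul, Finset.sum_smul]
    refine add_mem (add_mem (ih (mem_yNil_succ.1 hz u)) (algebraMap_smul_mem_yNil _ hz))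
      (sum_mem fun i _ => ?_)
    rw [Algebra.smul_def, mul_smul]
    exact algebraMap_smul_mem_yNil _ (gen_w_smul_mem_yNil _ hz)

/-- The vectors on which the products of sufficiently many `y_u` vanish form a submodule. -/
theorem exists_smul_mem_yNil (a : RatDAHA b A k) {z : M} (hz : ∃ n, z ∈ yNil b A k M n) :
    ∃ n, a • z ∈ yNil b A k M n := by
  induction a using RatDAHA.induction generalizing z with
  | base c =>
    obtain ⟨n, hn⟩ := hz
    exact ⟨n, algebraMap_smul_mem_yNil c hn⟩
  | gen a =>
    obtain ⟨n, hn⟩ := hz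
    cases a with
    | x v => exact ⟨n + 1, gen_x_smul_mem_yNil v hn⟩
    | y u => exact ⟨n, mem_yNil_succ.1 (yNil_le_succ n hn) u⟩
    | w g => exact ⟨n, gen_w_smul_mem_yNil g hn⟩
  | add a a' h h' =>
    obtain ⟨m, hm⟩ := h hz
    obtain ⟨n, hn⟩ := h' hz
    rw [add_smul]
    exact ⟨max m n, add_mem (yNil_mono (le_max_left _ _) hm) (yNil_mono (le_max_right _ _) hn)⟩
  | mul a a' h h' =>
    rw [mul_smul]
    exact h (h' hz)

theorem eq_zero_of_mem_yNil (h : ∀ z : M, (∀ u, gen b A k (.y u) • z = 0) → z = 0) {n : ℕ} {z : M}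
    (hz : z ∈ yNil b A k M n) : z = 0 := by
  induction n generalizing z with
  | zero => exact mem_yNil_zero.1 hz
  | succ n ih => exact h z fun u => ih (mem_yNil_succ.1 hz u)

theorem of_mem_yNil {f : MvPolynomial b.support A} {d n : ℕ} (hf : f.IsHomogeneous d) (hd : d < n) :
    PolyRep.of b A k f ∈ yNil b A k (PolyRep b A k) n := by
  induction n generalizing f d with
  | zero => omega
  | succ n ih =>
    rw [mem_yNil_succ]
    intro u
    rw [gen_y_smul]
    cases d with
    | zero =>
      rw [eq_C_of_isHomogeneous_zero hf, dunkl_eq_sum_ddl, Finset.sum_eq_zero fun i _ => by rw [ddl_C, smul_zero], map_zero]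
      exact zero_mem _
    | succ d => exact ih (isHomogeneous_dunkl u hf) (by omega)

end Nilpotent

/-! ### Vectors killed by y in modules without antiinvariants -/

section Detection

open MvPolynomial

variable {ι V N : Type*} [Fintype ι] [AddCommGroup V] [Module ℝ V] [AddCommGroup N] [Module ℝ N]
  {P : RootPairing ι ℝ V N} [P.IsRootSystem] [P.IsCrystallographic] (b : P.Base)
  [P.IsReduced] [P.IsIrreducible] {p : ℕ} [hpp : Fact p.Prime] (hp : 1 + coxeterNumber b = p)

include hp in
/-- The matrix coefficients of the action of `W` on `𝔽_p[x] / (x^p)` are all functions on `W`. -/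
theorem span_matrixCoeff : Submodule.span (ZMod p)
    {c : P.weylGroup → ZMod p | ∃ (m : b.support →₀ ℕ) (f : MvPolynomial b.support (ZMod p)),
      (∀ i, m i < p) ∧ f.IsHomogeneous m.degree ∧
        c = fun g => coeff m (weylAct b (ZMod p) g f)} = ⊤ := by
  classical
  by_contra hne
  -- A functional that vanishes on the matrix coefficients is an element of the group algebra acting
  -- by zero on 𝔽_p[x]/(x^p).
  obtain ⟨φ, hφ, hle⟩ := Submodule.exists_le_ker_of_lt_top _ (lt_top_iff_ne_top.2 hne)
  have hexp : ∀ c, φ c = ∑ g, φ (Pi.single g 1) * c g := by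
    intro c
    conv_lhs => rw [← Finset.univ_sum_single c]
    rw [map_sum]
    refine Finset.sum_congr rfl fun g _ => ?_
    rw [mul_comm, ← smul_eq_mul, ← map_smul, ← Pi.single_smul, smul_eq_mul, mul_one]
  apply hφ
  have hhom : ∀ (d : ℕ) (f : MvPolynomial b.support (ZMod p)), f.IsHomogeneous d →
      ∑ g, φ (Pi.single g 1) • weylAct b (ZMod p) g f ∈ frobIdeal b.support (ZMod p) p := by
    intro d f hf
    rw [mem_frobIdeal_iff]
    intro m hm
    rw [coeff_sum]
    by_cases hd : m.degree = d
    · have h := hle (Submodule.subset_span ⟨m, f, hm, by rwa [hd], rfl⟩)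
      rw [LinearMap.mem_ker, hexp] at h
      rw [← h]
      exact Finset.sum_congr rfl fun g _ => by rw [coeff_smul, smul_eq_mul]
    · refine Finset.sum_eq_zero fun g _ => ?_
      rw [coeff_smul, smul_eq_mul]
      by_contra h
      exact hd (degree_eq_of_coeff_ne_zero (isHomogeneous_weylAct g hf) (right_ne_zero_of_mul h))
  have h0 := eq_zero_of_sum_weylAct_mem b hp (a := fun g => φ (Pi.single g 1)) fun f => by
    rw [← sum_homogeneousComponent f]
    simp only [map_sum, Finset.smul_sum]
    rw [Finset.sum_comm]
    exact sum_mem fun d _ => hhom d _ (homogeneousComponent_isHomogeneous d f)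
  refine LinearMap.ext fun c => ?_
  rw [hexp]
  exact Finset.sum_eq_zero fun g _ => by rw [congrFun h0 g, Pi.zero_apply, zero_mul]

variable {M : Type*} [AddCommGroup M] [Module (Hk b (Zloc p)) M]
  [Module (Zloc p) M] [IsScalarTower (Zloc p) (Hk b (Zloc p)) M]

variable (p) in
/-- The span of `q(x) g z` for the forms `q` of degree `e` and `g ∈ W`. -/
def xSpan (z : M) (e : ℕ) : Submodule (Zloc p) M :=
  Submodule.span (Zloc p) {t | ∃ (q : MvPolynomial b.support (Zloc p)) (g : P.weylGroup),
    q.IsHomogeneous e ∧ t = xMap b (Zloc p) (kParam b (Zloc p)) q • genk b (Zloc p) (.w g) • z}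

variable (p) in
/-- The element of the algebra that acts on polynomials by `ddl`. -/
def yDual (i : b.support) : Hk b (Zloc p) :=
  Ring.inverse (halfNorm b i : Zloc p) • genk b (Zloc p) (.y (rootWeight P i))

variable (p) in
/-- The product of the elements `yDual`, the first entry of the list being applied first. -/
def yDualWord : List b.support → Hk b (Zloc p)
  | [] => 1
  | i :: L => yDualWord L * yDual b p i

include hp in
theorem exists_kParam_eq : ∃ c : Zloc p, kParam b (Zloc p) = p * c := by
  obtain ⟨u, hu⟩ := isUnit_coxeterNumber b hp (isPLocal_zloc p)
  refine ⟨-(↑u⁻¹ : Zloc p), ?_⟩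
  have h := coxeterNumber_mul_kParam b hp (isPLocal_zloc p)
  rw [← hu] at h
  rw [← Units.inv_mul_cancel_left u (kParam b (Zloc p)), h]
  ring

include hp in
-- The translates of z are killed by all y, so only the derivative of q and the reflection terms
-- survive. The latter carry the factor k, which is divisible by p.
theorem yDual_smul_sub_mem {z : M} (hz : ∀ u, genk b (Zloc p) (.y u) • z = 0) (i : b.support)
    {q : MvPolynomial b.support (Zloc p)} {e : ℕ} (hq : q.IsHomogeneous (e + 1)) (g : P.weylGroup) :
    ∃ t ∈ xSpan b p z e, yDual b p i • xMap b (Zloc p) (kParam b (Zloc p)) q •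
      genk b (Zloc p) (.w g) • z = xMap b (Zloc p) (kParam b (Zloc p)) (pderiv i q) •
        genk b (Zloc p) (.w g) • z + (p : Zloc p) • t := by
  obtain ⟨c, hc⟩ := exists_kParam_eq b hp
  have hA := isPLocal_zloc p
  have hz' : ∀ u, genk b (Zloc p) (.y u) • genk b (Zloc p) (.w g) • z = 0 := by
    intro u
    have h := gen_w_y b (Zloc p) (kParam b (Zloc p)) g (g⁻¹ • u)
    rw [smul_inv_smul] at h
    rw [← mul_smul, ← h, mul_smul, hz, smul_zero]
  have hd : Ring.inverse (halfNorm b i : Zloc p) • deriv b (Zloc p) (rootWeight P i) q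
      = pderiv i q := by
    rw [← dunkl_zero, ← ddl_eq_smul_dunkl b (isUnit_latticeDenom b hp hA)
      (isUnit_halfNorm b hp hA), ddl_zero]
  refine ⟨Ring.inverse (halfNorm b i : Zloc p) • ∑ l ∈ posRoots b,
    (c * ringForm P (Zloc p) (rootWeight P i) (rootWeight P l)) •
      (xMap b (Zloc p) (kParam b (Zloc p)) (divDiff b (Zloc p) l q) •
        genk b (Zloc p) (.w (RootPairing.weylGroup.ofIdx P l * g)) • z), ?_, ?_⟩
  · exact Submodule.smul_mem _ _ (sum_mem fun l _ => Submodule.smul_mem _ _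
      (Submodule.subset_span ⟨_, _, isHomogeneous_divDiff l hq, rfl⟩))
  · rw [yDual, smul_assoc, ← mul_smul, gen_y_mul_xMap, add_smul, add_smul, mul_smul, hz', smul_zero,
      zero_add, smul_add, ← smul_assoc, ← map_smul, hd, smul_comm (p : Zloc p)]
    congr 2
    rw [Finset.sum_smul, Finset.smul_sum]
    refine Finset.sum_congr rfl fun l _ => ?_
    rw [smul_assoc, mul_smul (xMap b (Zloc p) (kParam b (Zloc p)) _), genk, genk, gen_w_mul,
      mul_smul (gen b (Zloc p) (kParam b (Zloc p)) _), smul_smul (p : Zloc p), ← mul_assoc, ← hc]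

include hp in
theorem yDual_smul_mem {z : M} (hz : ∀ u, genk b (Zloc p) (.y u) • z = 0) (i : b.support)
    {e : ℕ} {t : M} (ht : t ∈ xSpan b p z (e + 1)) : yDual b p i • t ∈ xSpan b p z e := by
  induction ht using Submodule.span_induction with
  | mem t ht =>
    obtain ⟨q, g, hq, rfl⟩ := ht
    obtain ⟨t, ht, h⟩ := yDual_smul_sub_mem b hp hz i hq g
    rw [h]
    exact add_mem (Submodule.subset_span ⟨_, _, hq.pderiv, rfl⟩) (Submodule.smul_mem _ _ ht)
  | zero => rw [smul_zero]; exact zero_mem _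
  | add s t _ _ hs ht => rw [smul_add]; exact add_mem hs ht
  | smul a t _ ht =>
    rw [← algebraMap_smul (Hk b (Zloc p)) a t, ← mul_smul, ← Algebra.commutes, mul_smul,
      algebraMap_smul]
    exact Submodule.smul_mem _ _ ht

include hp in
theorem yDualWord_smul_mem {z : M} (hz : ∀ u, genk b (Zloc p) (.y u) • z = 0) (L : List b.support)
    {e : ℕ} {t : M} (ht : t ∈ xSpan b p z (e + L.length)) : yDualWord b p L • t ∈ xSpan b p z e := by
  induction L generalizing t with
  | nil => rw [yDualWord, one_smul]; exact ht
  | cons i L ih =>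
    rw [yDualWord, mul_smul]
    exact ih (yDual_smul_mem b hp hz i (by rwa [List.length_cons, ← add_assoc] at ht))

include hp in
theorem yDualWord_smul_sub_mem {z : M} (hz : ∀ u, genk b (Zloc p) (.y u) • z = 0)
    (L : List b.support) {q : MvPolynomial b.support (Zloc p)} {e : ℕ}
    (hq : q.IsHomogeneous (e + L.length)) (g : P.weylGroup) :
    ∃ t ∈ xSpan b p z e, yDualWord b p L • xMap b (Zloc p) (kParam b (Zloc p)) q •
      genk b (Zloc p) (.w g) • z =
        xMap b (Zloc p) (kParam b (Zloc p)) (ddlWord b (Zloc p) 0 L q) •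
        genk b (Zloc p) (.w g) • z + (p : Zloc p) • t := by
  induction L generalizing q with
  | nil => exact ⟨0, zero_mem _, by rw [yDualWord, one_smul, smul_zero, add_zero]; rfl⟩
  | cons i L ih =>
    rw [List.length_cons, ← add_assoc] at hq
    obtain ⟨t, ht, h⟩ := yDual_smul_sub_mem b hp hz i hq g
    obtain ⟨s, hs, h'⟩ := ih (hq.pderiv (i := i))
    refine ⟨s + yDualWord b p L • t, add_mem hs (yDualWord_smul_mem b hp hz L ht), ?_⟩
    rw [yDualWord, mul_smul, h, smul_add, h', ddlWord_cons, ddl_zero, smul_add, add_assoc]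
    congr 2
    rw [← algebraMap_smul (Hk b (Zloc p)) (p : Zloc p) t, ← mul_smul, ← Algebra.commutes, mul_smul,
      algebraMap_smul]

include hp in
/-- A vector annihilated by all `y_u` in a module without antiinvariants vanishes. -/
theorem eq_zero_of_singular (hsgn : ∀ x : M, ∑ g, weylSign b g • genk b (Zloc p) (.w g) • x = 0)
    {z : M} (hz : ∀ u, genk b (Zloc p) (.y u) • z = 0) : z = 0 := by
  classical
  set T := xSpan b p z 0 with hT
  have hmemT : ∀ g, genk b (Zloc p) (.w g) • z ∈ T := fun g =>
    Submodule.subset_span ⟨1, g, isHomogeneous_one _ _, by rw [map_one, one_smul]⟩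
  have hle : T ≤ Submodule.span (Zloc p)
      (Set.range fun g : P.weylGroup => genk b (Zloc p) (.w g) • z) := by
    refine Submodule.span_le.2 ?_
    rintro _ ⟨q, g, hq, rfl⟩
    rw [eq_C_of_isHomogeneous_zero hq,
      ← algebraMap_eq, AlgHom.commutes, algebraMap_smul]
    exact Submodule.smul_mem _ _ (Submodule.subset_span ⟨g, rfl⟩)
  have hpT : ∀ t ∈ T, (p : Zloc p) • t ∈ Ideal.span {(p : Zloc p)} • T := fun t ht =>
    Submodule.smul_mem_smul (Ideal.mem_span_singleton_self _) ht
  -- Each function on W lifts to the coefficients of a combination of the sgn(g) g z that lies in p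
  -- T. For a matrix coefficient at x^m this results from applying the word dual to x^m to the
  -- antisymmetrization of F(x) z, which vanishes; the factorials that appear are units.
  have key : ∀ c' ∈ (⊤ : Submodule (ZMod p) (P.weylGroup → ZMod p)), ∃ c : P.weylGroup → Zloc p,
      (∀ g, zlocRed p (c g) = c' g) ∧
      ∑ g, c g • weylSign b g • genk b (Zloc p) (.w g) • z ∈ Ideal.span {(p : Zloc p)} • T := by
    rw [← span_matrixCoeff b hp]
    intro c' hc'
    induction hc' using Submodule.span_induction with
    | mem c' hc' =>
      obtain ⟨m, f, hm, hf, rfl⟩ := hc'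
      obtain ⟨F, hF, rfl⟩ := exists_isHomogeneous_lift hf
      obtain ⟨L, rfl⟩ := exists_wordExp m
      refine ⟨fun g => coeff (wordExp L) (weylAct b (Zloc p) g F), fun g => ?_, ?_⟩
      · rw [← coeff_map, map_weylAct]
      · have hu : IsUnit ((∏ i, (wordExp L i).factorial : ℕ) : Zloc p) := by
          apply isUnit_of_zlocRed_ne_zero
          rw [map_natCast]
          exact prod_factorial_ne_zero hm
        have h1 : ∀ g : P.weylGroup, ∃ t ∈ T, yDualWord b p L •
            genk b (Zloc p) (.w g) • xMap b (Zloc p) (kParam b (Zloc p)) F • z =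
            (((∏ i, (wordExp L i).factorial : ℕ) : Zloc p) *
              coeff (wordExp L) (weylAct b (Zloc p) g F)) • genk b (Zloc p) (.w g) • z +
                (p : Zloc p) • t := by
          intro g
          have hd : (weylAct b (Zloc p) g F).IsHomogeneous (0 + L.length) := by
            rw [zero_add, ← degree_wordExp]
            exact isHomogeneous_weylAct g hF
          obtain ⟨t, ht, h⟩ := yDualWord_smul_sub_mem b hp hz L hd g
          refine ⟨t, ht, ?_⟩
          rw [← mul_smul (genk b _ _), gen_w_mul_xMap, mul_smul, h, ← constantCoeff_ddlWord_zero]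
          congr 1
          rw [eq_C_of_isHomogeneous_zero (isHomogeneous_ddlWord b (Zloc p) 0 L hd), ← algebraMap_eq, AlgHom.commutes, algebraMap_smul,
            algebraMap_eq, constantCoeff_C]
        choose t ht h1 using h1
        have h2 := congrArg (yDualWord b p L • ·)
          (hsgn (xMap b (Zloc p) (kParam b (Zloc p)) F • z))
        simp only [smul_zero, Finset.smul_sum] at h2
        simp only [smul_comm (yDualWord b p L) (weylSign b _), h1] at h2
        rw [← Submodule.smul_mem_iff_of_isUnit _ hu]
        have h3 : ((∏ i, (wordExp L i).factorial : ℕ) : Zloc p) •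
            ∑ g, coeff (wordExp L) (weylAct b (Zloc p) g F) • weylSign b g •
              genk b (Zloc p) (.w g) • z = -∑ g, (p : Zloc p) • weylSign b g • t g := by
          rw [eq_neg_iff_add_eq_zero, ← h2, Finset.smul_sum, ← Finset.sum_add_distrib]
          refine Finset.sum_congr rfl fun g _ => ?_
          rw [smul_add, smul_smul, smul_comm (p : Zloc p) (weylSign b g),
            smul_comm (_ * _ : Zloc p) (weylSign b g)]
        rw [h3]
        exact neg_mem (sum_mem fun g _ => hpT _ (Submodule.smul_of_tower_mem _ _ (ht g)))
    | zero => exact ⟨0, fun g => by simp, by simp⟩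
    | add c c' _ _ h h' =>
      obtain ⟨d, hd, hd'⟩ := h
      obtain ⟨e, he, he'⟩ := h'
      refine ⟨d + e, fun g => by rw [Pi.add_apply, map_add, hd, he, Pi.add_apply], ?_⟩
      simp only [Pi.add_apply, add_smul, Finset.sum_add_distrib]
      exact add_mem hd' he'
    | smul a c _ h =>
      obtain ⟨d, hd, hd'⟩ := h
      obtain ⟨a, rfl⟩ := zlocRed_surjective a
      refine ⟨a • d, fun g => by rw [Pi.smul_apply, smul_eq_mul, map_mul, hd]; rfl, ?_⟩
      simp only [Pi.smul_apply, smul_assoc, ← Finset.smul_sum]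
      exact Submodule.smul_mem _ _ hd'
  -- Delta functions on W isolate the individual translates.
  have hw : ∀ g, genk b (Zloc p) (.w g) • z ∈ Ideal.span {(p : Zloc p)} • T := by
    intro g
    obtain ⟨c, hc, hc'⟩ := key (Pi.single g 1) trivial
    have h1 : ∀ g', ∃ y, Pi.single (M := fun _ => Zloc p) g 1 g' = c g' + (p : Zloc p) * y := by
      intro g'
      have : (p : Zloc p) ∣ Pi.single (M := fun _ => Zloc p) g 1 g' - c g' := by
        rw [← zlocRed_eq_zero_iff, map_sub, hc, sub_eq_zero]
        by_cases h : g' = g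
        · subst h; simp
        · simp [Pi.single_eq_of_ne h]
      obtain ⟨y, hy⟩ := this
      exact ⟨y, by rw [← hy]; ring⟩
    choose y hy using h1
    have h2 : weylSign b g • genk b (Zloc p) (.w g) • z = ∑ g', Pi.single (M := fun _ => Zloc p) g 1 g'
        • weylSign b g' • genk b (Zloc p) (.w g') • z := by
      rw [Finset.sum_eq_single g]
      · rw [Pi.single_eq_same, one_smul]
      · intro g' _ h
        rw [Pi.single_eq_of_ne h, zero_smul]
      · simp
    have h3 : weylSign b g • genk b (Zloc p) (.w g) • z ∈ Ideal.span {(p : Zloc p)} • T := by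
      rw [h2]
      simp only [hy, add_smul, Finset.sum_add_distrib, mul_smul]
      exact add_mem hc' (sum_mem fun g' _ => hpT _ (Submodule.smul_mem _ _
        (Submodule.smul_of_tower_mem _ _ (hmemT g'))))
    have h4 := Submodule.smul_of_tower_mem _ (weylSign b g) h3
    rwa [smul_smul, weylSign_mul_self, one_smul] at h4
  -- The module T is generated by the finitely many g z and equals p T.
  have hbot : T = ⊥ := by
    refine Submodule.eq_bot_of_le_smul_of_le_jacobson_bot _ _ ?_ ?_ natCast_prime_mem_jacobson
    · have : T = Submodule.span (Zloc p)
          (Set.range fun g : P.weylGroup => genk b (Zloc p) (.w g) • z) :=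
        le_antisymm hle (Submodule.span_le.2 (by rintro _ ⟨g, rfl⟩; exact hmemT g))
      rw [this]
      exact Submodule.fg_span (Set.finite_range _)
    · refine hle.trans (Submodule.span_le.2 ?_)
      rintro _ ⟨g, rfl⟩
      exact hw g
  have h := hmemT 1
  rw [hbot, Submodule.mem_bot, genk, gen_w_one, one_smul] at h
  exact h

end Detection

/-! ### The submodules generated by `I_o` -/

section Functorial

variable {ι V N : Type*} [Fintype ι] [AddCommGroup V] [Module ℝ V] [AddCommGroup N] [Module ℝ N]
  {P : RootPairing ι ℝ V N} [P.IsCrystallographic] [P.IsRootSystem] {b : P.Base}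
  {A : Type*} [CommRing A] {k : A} {M M' : Type*} [AddCommGroup M] [Module (RatDAHA b A k) M]
  [AddCommGroup M'] [Module (RatDAHA b A k) M']

theorem map_mem_yNil (φ : M →ₗ[RatDAHA b A k] M') {n : ℕ} {z : M} (hz : z ∈ yNil b A k M n) :
    φ z ∈ yNil b A k M' n := by
  induction n generalizing z with
  | zero => rw [mem_yNil_zero.1 hz, map_zero]; exact zero_mem _
  | succ n ih =>
    rw [mem_yNil_succ] at hz ⊢
    intro u
    rw [← map_smul]
    exact ih (hz u)

theorem mem_yNil_of_map {φ : M →ₗ[RatDAHA b A k] M'} (hφ : Function.Injective φ) {n : ℕ} {z : M}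
    (hz : φ z ∈ yNil b A k M' n) : z ∈ yNil b A k M n := by
  induction n generalizing z with
  | zero => exact mem_yNil_zero.2 (hφ ((mem_yNil_zero.1 hz).trans (map_zero φ).symm))
  | succ n ih =>
    rw [mem_yNil_succ] at hz ⊢
    intro u
    exact ih (by rw [map_smul]; exact hz u)

theorem exists_mem_yNil (f : PolyRep b A k) : ∃ n, f ∈ yNil b A k (PolyRep b A k) n := by
  have h : ∀ (q : MvPolynomial b.support A) (r : ℕ), PolyRep.of b A k
      (∑ d ∈ Finset.range r, MvPolynomial.homogeneousComponent d q) ∈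
        yNil b A k (PolyRep b A k) r := fun q r => by
    rw [map_sum]
    exact sum_mem fun d hd => of_mem_yNil (MvPolynomial.homogeneousComponent_isHomogeneous d q)
      (Finset.mem_range.1 hd)
  have h1 := h ((PolyRep.of b A k).symm f) (((PolyRep.of b A k).symm f).totalDegree + 1)
  rw [MvPolynomial.sum_homogeneousComponent, AlgEquiv.apply_symm_apply] at h1
  exact ⟨_, h1⟩

end Functorial

/-! ### The antisymmetrizer and averages under conjugation by W -/

section Averaging

variable {ι V N : Type*} [Fintype ι] [AddCommGroup V] [Module ℝ V] [AddCommGroup N] [Module ℝ N]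
  {P : RootPairing ι ℝ V N} [P.IsRootSystem] [P.IsCrystallographic] (b : P.Base)
  [P.IsReduced] [P.IsIrreducible] (A : Type*) [CommRing A] (k : A)

/-- The antisymmetrizer in the group algebra of `W`. -/
def antiElt : RatDAHA b A k := ∑ g, weylSign b g • gen b A k (.w g)

variable {A k} in
/-- The average of an element of the algebra under conjugation by `W`. -/
def average (a : RatDAHA b A k) : RatDAHA b A k :=
  ∑ g : P.weylGroup, gen b A k (.w g) * a * gen b A k (.w g⁻¹)

variable {b A k}

theorem gen_w_inv_mul (g : P.weylGroup) : gen b A k (.w g⁻¹) * gen b A k (.w g) = 1 := by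
  rw [← gen_w_mul, inv_mul_cancel, gen_w_one]

theorem average_mem (a : RatDAHA b A k) : average b a ∈ invSubalgebra b A k := by
  rw [invSubalgebra, Subalgebra.mem_centralizer_iff]
  rintro _ ⟨g, rfl⟩
  rw [average, Finset.mul_sum, Finset.sum_mul]
  refine Fintype.sum_equiv (Equiv.mulLeft g) _ _ fun w => ?_
  simp only [Equiv.coe_mulLeft, mul_inv_rev, gen_w_mul, mul_assoc, gen_w_inv_mul, mul_one]

variable {M : Type*} [AddCommGroup M] [Module (RatDAHA b A k) M]

/-- On a sign vector v one has sgn(g) v = g⁻¹ v, so the antisymmetrizer applied to a v becomes the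
sum of the g a g⁻¹ applied to v. This is how arbitrary elements give elements of (H'')^W. -/
theorem antiElt_smul {v : M} (hv : ∀ g, gen b A k (.w g) • v = weylSign b g • v)
    (a : RatDAHA b A k) : antiElt b A k • a • v = average b a • v := by
  rw [antiElt, average, Finset.sum_smul, Finset.sum_smul]
  refine Finset.sum_congr rfl fun g _ => ?_
  rw [mul_smul, hv, weylSign_inv, mul_smul, smul_assoc, smul_comm a (weylSign b g),
    smul_comm (gen b A k _) (weylSign b g)]

theorem gen_w_smul_disc (g : P.weylGroup) :
    gen b A k (.w g) • disc b A k = weylSign b g • disc b A k := by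
  have h : disc b A k = PolyRep.of b A k (rootProd b A) := rfl
  rw [h, gen_w_smul, isAntiinvariant_rootProd b g, map_smul, Int.cast_smul_eq_zsmul]

end Averaging

/-! ### The detection principle over p-local rings and the submodule generated by I_o -/

section Detection

variable {ι V N : Type*} [Fintype ι] [AddCommGroup V] [Module ℝ V] [AddCommGroup N] [Module ℝ N]
  {P : RootPairing ι ℝ V N} [P.IsRootSystem] [P.IsCrystallographic] (b : P.Base)
  [P.IsReduced] [P.IsIrreducible] {p : ℕ} [hpp : Fact p.Prime] (hp : 1 + coxeterNumber b = p)
  {A : Type*} [CommRing A] (hA : IsPLocal p A)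
  {M : Type*} [AddCommGroup M] [Module (Hk b A) M]

include hp hA

/-- Nilpotency reduces the claim to vectors killed by all y. The module is then restricted to the
algebra over ℤ_(p), where the argument with singular vectors is available. -/
theorem eq_zero_of_antiElt_smul (hnil : ∀ z : M, ∃ n, z ∈ yNil b A (kParam b A) M n)
    (hsgn : ∀ z : M, antiElt b A (kParam b A) • z = 0) (z : M) : z = 0 := by
  obtain ⟨n, hn⟩ := hnil z
  refine eq_zero_of_mem_yNil (fun z hz => ?_) hn
  let Φ := RatDAHA.map b (zlocHom hA) (map_ringForm_of_isPLocal b hp (isPLocal_zloc p) _)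
    (map_kParam_of_isPLocal b hp (isPLocal_zloc p) (zlocHom hA))
  let _ : Module (Hk b (Zloc p)) M := Module.compHom M Φ
  let _ : Module (Zloc p) M := Module.compHom M (algebraMap (Zloc p) (Hk b (Zloc p)))
  have : IsScalarTower (Zloc p) (Hk b (Zloc p)) M := ⟨fun c a x => by
    rw [Algebra.smul_def, mul_smul]; rfl⟩
  have hg : ∀ (a : Gen P) (x : M), genk b (Zloc p) a • x = genk b A a • x := fun a x =>
    congrArg (· • x) (RatDAHA.map_gen b (zlocHom hA)
      (map_ringForm_of_isPLocal b hp (isPLocal_zloc p) _)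
      (map_kParam_of_isPLocal b hp (isPLocal_zloc p) (zlocHom hA)) a)
  refine eq_zero_of_singular b hp (fun x => ?_) fun u => (hg _ _).trans (hz u)
  rw [← hsgn x, antiElt, Finset.sum_smul]
  exact Finset.sum_congr rfl fun g _ => by rw [hg, smul_assoc]

/-- The detection principle for the image of S in the quotient by T: containment may be tested after
antisymmetrization. -/
theorem le_of_antiElt_smul_mem (S T : Submodule (Hk b A) M)
    (hnil : ∀ z ∈ S, ∃ n, T.mkQ z ∈ yNil b A (kParam b A) (M ⧸ T) n)
    (hsgn : ∀ z ∈ S, antiElt b A (kParam b A) • z ∈ T) : S ≤ T := by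
  have h := eq_zero_of_antiElt_smul (M := S.map T.mkQ) b hp hA (fun z => by
    obtain ⟨z, hz⟩ := z
    obtain ⟨y, hy, rfl⟩ := hz
    obtain ⟨n, hn⟩ := hnil y hy
    exact ⟨n, mem_yNil_of_map (S.map T.mkQ).injective_subtype hn⟩) (fun z => by
    obtain ⟨z, hz⟩ := z
    obtain ⟨y, hy, rfl⟩ := hz
    refine Subtype.ext ?_
    change _ • T.mkQ y = 0
    rw [← map_smul, Submodule.mkQ_apply, Submodule.Quotient.mk_eq_zero]
    exact hsgn y hy)
  intro z hz
  have := congrArg Subtype.val (h ⟨T.mkQ z, z, hz, rfl⟩)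
  exact (Submodule.Quotient.mk_eq_zero T).1 this

theorem average_mem_idealIo {a : Hk b A} (ha : a • disck b A ∈ Jk b A) :
    average b a ∈ idealIo b A (kParam b A) := by
  refine ⟨average_mem a, ?_⟩
  rw [← map_smul, ← antiElt_smul (gen_w_smul_disc), Submodule.mkQ_apply,
    Submodule.Quotient.mk_eq_zero]
  exact Submodule.smul_mem _ _ ha

/-- If a δ lies in J, its antisymmetrization is the average of a applied to δ, and this average
belongs to I_o. Detection turns this into a containment of the whole intersection. -/
theorem ioDiscSpan_eq : ioDiscSpan b A (kParam b A) = Jk b A ⊓ discSpan b A (kParam b A) := by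
  apply le_antisymm
  · refine Submodule.span_le.2 ?_
    rintro _ ⟨a, ha, rfl⟩
    refine ⟨?_, Submodule.smul_mem _ _ (Submodule.mem_span_singleton_self _)⟩
    have := ha.2
    rwa [← map_smul, Submodule.mkQ_apply, Submodule.Quotient.mk_eq_zero] at this
  · refine le_of_antiElt_smul_mem b hp hA _ _ (fun z _ => ?_) ?_
    · obtain ⟨n, hn⟩ := exists_mem_yNil z
      exact ⟨n, map_mem_yNil _ hn⟩
    · rintro z ⟨hz, hz'⟩
      obtain ⟨a, rfl⟩ := Submodule.mem_span_singleton.1 hz'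
      rw [antiElt_smul gen_w_smul_disc]
      exact Submodule.subset_span ⟨_, average_mem_idealIo b hp hA hz, rfl⟩

end Detection

/-! ### The module induced from the sign character -/

section Poly

open MvPolynomial

theorem homogeneous_induction {σ A : Type*} [CommRing A] {motive : ℕ → MvPolynomial σ A → Prop}
    (zero : ∀ e, motive e 0) (C : ∀ a, motive 0 (C a))
    (add : ∀ e f g, motive e f → motive e g → motive e (f + g))
    (X_mul : ∀ e j f, f.IsHomogeneous e → motive e f → motive (e + 1) (X j * f))
    {e : ℕ} {f : MvPolynomial σ A} (hf : f.IsHomogeneous e) : motive e f := by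
  classical
  have key : ∀ (e : ℕ) (m : σ →₀ ℕ) (a : A), m.degree = e → motive e (monomial m a) := by
    intro e
    induction e with
    | zero =>
      intro m a hm
      rw [Finsupp.degree_eq_zero_iff] at hm
      rw [hm]
      exact C a
    | succ e ih =>
      intro m a hm
      obtain ⟨j, hj⟩ : ∃ j, m j ≠ 0 := by
        by_contra! h
        rw [show m = 0 from Finsupp.ext h, map_zero] at hm
        omega
      obtain ⟨r, rfl⟩ := exists_add_of_le (Finsupp.single_le_iff.2 (Nat.one_le_iff_ne_zero.2 hj))
      have hr : r.degree = e := by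
        rw [map_add, Finsupp.degree_single] at hm
        omega
      have h1 : monomial (Finsupp.single j 1 + r) a = X j * monomial r a := by
        rw [X, monomial_mul, one_mul]
      rw [h1]
      exact X_mul e j _ (isHomogeneous_monomial a hr) (ih r a hr)
  rw [f.as_sum]
  refine Finset.sum_induction _ (motive e) (add e) (zero e) fun m hm => key e m _ ?_
  exact degree_eq_of_coeff_ne_zero hf (mem_support_iff.1 hm)

/-- The coefficients of a product of linear factors are homogeneous. -/
theorem isHomogeneous_coeff_prod {σ A α : Type*} [CommRing A] (s : Finset α)
    (a : α → MvPolynomial σ A) (ha : ∀ i, (a i).IsHomogeneous 1) {i j : ℕ} (hij : i + j = s.card) :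
    ((∏ l ∈ s, (Polynomial.X - Polynomial.C (a l))).coeff i).IsHomogeneous j := by
  classical
  induction s using Finset.induction_on generalizing i j with
  | empty =>
    rw [Finset.card_empty] at hij
    obtain ⟨rfl, rfl⟩ : i = 0 ∧ j = 0 := by omega
    rw [Finset.prod_empty, Polynomial.coeff_one_zero]
    exact isHomogeneous_one _ _
  | insert l s hl ih =>
    rw [Finset.card_insert_of_notMem hl] at hij
    rw [Finset.prod_insert hl, sub_mul, Polynomial.coeff_sub, Polynomial.coeff_C_mul]
    refine IsHomogeneous.sub ?_ ?_
    · cases i with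
      | zero => rw [Polynomial.coeff_X_mul_zero]; exact isHomogeneous_zero _ _ _
      | succ i => rw [Polynomial.coeff_X_mul]; exact ih (by omega)
    · cases j with
      | zero =>
        rw [Polynomial.coeff_eq_zero_of_natDegree_lt, mul_zero]
        · exact isHomogeneous_zero _ _ _
        · rw [Polynomial.natDegree_prod_of_monic _ _ fun l _ => Polynomial.monic_X_sub_C _]
          refine lt_of_le_of_lt (Finset.sum_le_card_nsmul _ _ 1 fun l _ =>
            Polynomial.natDegree_X_sub_C_le _) ?_
          rw [smul_eq_mul, mul_one]
          omega
      | succ j => rw [add_comm j]; exact (ha l).mul (ih (by omega))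

end Poly

/-! ### Invariants in y of positive degree and nilpotency -/

section Integral

open MvPolynomial

variable {ι V N : Type*} [Fintype ι] [AddCommGroup V] [Module ℝ V] [AddCommGroup N] [Module ℝ N]
  {P : RootPairing ι ℝ V N} [P.IsRootSystem] [P.IsCrystallographic] (b : P.Base)
  [P.IsReduced] [P.IsIrreducible] {A : Type*} [CommRing A]

/-- The linear forms are nilpotent modulo the invariants of positive degree. -/
theorem xPoly_pow_mem {I : Ideal (MvPolynomial b.support A)}
    (hI : ∀ (c : MvPolynomial b.support A) (d : ℕ), 0 < d → c.IsHomogeneous d →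
      (∀ g, weylAct b A g c = c) → c ∈ I) (u : weightLattice P) :
    xPoly b A u ^ Fintype.card P.weylGroup ∈ I := by
  nontriviality (MvPolynomial b.support A)
  -- The linear form x_u is a root of this monic polynomial of degree |W|, whose lower coefficients
  -- are invariants of positive degree.
  set Q : Polynomial (MvPolynomial b.support A) :=
    ∏ g : P.weylGroup, (Polynomial.X - Polynomial.C (xPoly b A (g • u))) with hQ
  have hmonic : Q.Monic := Polynomial.monic_prod_of_monic _ _ fun g _ => Polynomial.monic_X_sub_C _
  have hdeg : Q.natDegree = Fintype.card P.weylGroup := by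
    rw [hQ, Polynomial.natDegree_prod_of_monic _ _ fun l _ => Polynomial.monic_X_sub_C _]
    simp
  have hinv : ∀ g, Q.map (weylAct b A g).toRingHom = Q := by
    intro g
    rw [hQ, Polynomial.map_prod]
    refine Fintype.prod_equiv (Equiv.mulLeft g) _ _ fun w => ?_
    rw [Polynomial.map_sub, Polynomial.map_X, Polynomial.map_C, Equiv.coe_mulLeft, mul_smul,
      ← weylAct_xPoly b A g]
    rfl
  have hcoeff : ∀ i < Fintype.card P.weylGroup, Q.coeff i ∈ I := by
    intro i hi
    refine hI _ (Fintype.card P.weylGroup - i) (by omega) (isHomogeneous_coeff_prod _ _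
      (fun g => isHomogeneous_xPoly _) (by rw [Finset.card_univ]; omega)) fun g => ?_
    conv_rhs => rw [← hinv g, Polynomial.coeff_map]
    rfl
  have h0 : Q.eval (xPoly b A u) = 0 := by
    rw [hQ, Polynomial.eval_prod]
    refine Finset.prod_eq_zero (Finset.mem_univ 1) ?_
    simp
  rw [hmonic.as_sum, hdeg, Polynomial.eval_add, Polynomial.eval_pow, Polynomial.eval_X,
    Polynomial.eval_finsetSum] at h0
  rw [eq_neg_of_add_eq_zero_left h0]
  refine neg_mem (sum_mem fun i hi => ?_)
  rw [Polynomial.eval_mul, Polynomial.eval_C]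
  exact Ideal.mul_mem_right _ _ (hcoeff i (Finset.mem_range.1 hi))

variable {k : A} {M : Type*} [AddCommGroup M] [Module (RatDAHA b A k) M]

theorem yMap_C_smul (a : A) (z : M) :
    yMap b A k (C a) • z = algebraMap A (RatDAHA b A k) a • z := by
  rw [← algebraMap_eq, AlgHom.commutes]

theorem yMap_smul_eq_zero {e : ℕ} {f : MvPolynomial b.support A} (hf : f.IsHomogeneous e)
    {z : M} (hz : z ∈ yNil b A k M e) : yMap b A k f • z = 0 := by
  refine homogeneous_induction (motive := fun e f => ∀ z ∈ yNil b A k M e, yMap b A k f • z = 0)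
    (fun e z _ => ?_) (fun a z hz => ?_) (fun e f g hf hg z hz => ?_)
    (fun e j f _ ih z hz => ?_) hf z hz
  · rw [map_zero, zero_smul]
  · rw [mem_yNil_zero.1 hz, smul_zero]
  · rw [map_add, add_smul, hf z hz, hg z hz, add_zero]
  · rw [mul_comm, map_mul, mul_smul, yMap_X]
    exact ih _ (mem_yNil_succ.1 hz _)

theorem mem_yNil_of_yMap {e : ℕ} {z : M}
    (h : ∀ f : MvPolynomial b.support A, f.IsHomogeneous e → yMap b A k f • z = 0) :
    z ∈ yNil b A k M e := by
  induction e generalizing z with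
  | zero =>
    have := h 1 (isHomogeneous_one _ _)
    rw [map_one, one_smul] at this
    exact mem_yNil_zero.2 this
  | succ e ih =>
    rw [mem_yNil_succ]
    intro u
    refine ih fun f hf => ?_
    rw [← mul_smul, ← yMap_xPoly, ← map_mul]
    exact h _ (hf.mul (isHomogeneous_xPoly u))

/-- The polynomials in `y` that annihilate a vector. -/
def yAnn (z : M) : Ideal (MvPolynomial b.support A) where
  carrier := {f | yMap b A k f • z = 0}
  zero_mem' := by rw [Set.mem_ofPred_eq, map_zero, zero_smul]
  add_mem' := fun {f g} hf hg => by
    rw [Set.mem_ofPred_eq] at *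
    rw [map_add, add_smul, hf, hg, add_zero]
  smul_mem' := fun c f hf => by
    rw [Set.mem_ofPred_eq] at *
    rw [smul_eq_mul, map_mul, mul_smul, hf, smul_zero]

/-- A vector that is annihilated by the invariants of positive degree is nilpotent. -/
theorem exists_mem_yNil_of_invariants {z : M} (hz : ∀ (c : MvPolynomial b.support A) (d : ℕ), 0 < d →
    c.IsHomogeneous d → (∀ g, weylAct b A g c = c) → yMap b A k c • z = 0) :
    ∃ n, z ∈ yNil b A k M n := by
  classical
  -- In degree n|W| every monomial has an exponent at least |W|.
  refine ⟨Fintype.card b.support * Fintype.card P.weylGroup, mem_yNil_of_yMap b fun f hf => ?_⟩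
  have hX := fun j => xPoly_pow_mem b (I := yAnn b (k := k) z) hz (fundWeight b j)
  simp only [xPoly_fundWeight] at hX
  change f ∈ yAnn b (k := k) z
  rw [f.as_sum]
  refine sum_mem fun m hm => ?_
  obtain ⟨j, hj⟩ : ∃ j, Fintype.card P.weylGroup ≤ m j := by
    by_contra! h
    have h1 := degree_eq_of_coeff_ne_zero hf (mem_support_iff.1 hm)
    rw [Finsupp.degree_eq_sum] at h1
    have hne := nonempty_support b
    have h2 : ∑ i, m i < ∑ i : b.support, Fintype.card P.weylGroup :=
      Finset.sum_lt_sum_of_nonempty Finset.univ_nonempty fun i _ => h i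
    rw [Finset.sum_const, Finset.card_univ, smul_eq_mul] at h2
    exact h2.ne h1
  obtain ⟨r, hr⟩ := exists_add_of_le (Finsupp.single_le_iff.2 hj)
  have h1 : monomial m (coeff m f) = X j ^ Fintype.card P.weylGroup * monomial r (coeff m f) := by
    generalize coeff m f = c
    rw [hr, X_pow_eq_monomial, monomial_mul, one_mul]
  rw [h1]
  exact Ideal.mul_mem_right _ _ (hX j)

theorem exists_yMap_smul_eq {e d : ℕ} {c q : MvPolynomial b.support A} (hc : c.IsHomogeneous e)
    (hq : q.IsHomogeneous (d + e)) : ∃ q' : MvPolynomial b.support A, q'.IsHomogeneous d ∧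
      yMap b A k c • PolyRep.of b A k q = PolyRep.of b A k q' := by
  refine homogeneous_induction (motive := fun e c => ∀ d, q.IsHomogeneous (d + e) →
      ∃ q' : MvPolynomial b.support A, q'.IsHomogeneous d ∧
        yMap b A k c • PolyRep.of b A k q = PolyRep.of b A k q')
    (fun e d _ => ?_) (fun a d hq => ?_) (fun e f g hf hg d hq => ?_)
    (fun e j f _ ih d hq => ?_) hc d hq
  · exact ⟨0, isHomogeneous_zero _ _ _, by rw [map_zero, zero_smul, map_zero]⟩
  · refine ⟨C a * q, hq.C_mul a, ?_⟩
    rw [yMap_C_smul, algebraMap_smul, ← smul_eq_C_mul, map_smul]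
  · obtain ⟨q1, h1, h1'⟩ := hf d hq
    obtain ⟨q2, h2, h2'⟩ := hg d hq
    exact ⟨q1 + q2, h1.add h2, by rw [map_add, add_smul, h1', h2', map_add]⟩
  · obtain ⟨q', h, h'⟩ := ih (d + 1) (by rwa [add_assoc, add_comm 1])
    refine ⟨_, isHomogeneous_dunkl (b := b) (k := k) (fundWeight b j) h, ?_⟩
    rw [map_mul, mul_smul, h', yMap_X, gen_y_smul]

end Integral

/-! ### Antiinvariants of low degree and the annihilator of δ -/

section Sign

open MvPolynomial

variable {ι V N : Type*} [Fintype ι] [AddCommGroup V] [Module ℝ V] [AddCommGroup N] [Module ℝ N]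
  {P : RootPairing ι ℝ V N} [P.IsRootSystem] [P.IsCrystallographic] (b : P.Base)
  [P.IsReduced] [P.IsIrreducible] {p : ℕ} [hpp : Fact p.Prime] (hp : 1 + coxeterNumber b = p)
  {A : Type*} [CommRing A] (hA : IsPLocal p A)

theorem constantCoeff_dunklWord_of_ne (k : A) (L : List (weightLattice P))
    {f : MvPolynomial b.support A} {d : ℕ} (hf : f.IsHomogeneous d) (hd : d ≠ L.length) :
    constantCoeff (dunklWord b A k L f) = 0 := by
  induction L generalizing f d with
  | nil =>
    change constantCoeff f = 0
    rw [constantCoeff_eq]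
    exact hf.coeff_eq_zero (by simpa using fun h : 0 = d => hd h.symm)
  | cons u L ih =>
    rw [dunklWord_cons]
    cases d with
    | zero =>
      rw [eq_C_of_isHomogeneous_zero hf, dunkl_eq_sum_ddl,
        Finset.sum_eq_zero fun i _ => by rw [ddl_C, smul_zero], map_zero, map_zero]
    | succ d => exact ih (isHomogeneous_dunkl u hf) (by simpa using hd)

include hp hA

/-- Modulo the ideal |W| f is a multiple c δ. The degrees of f and δ differ, and a word of Dunkl
operators detects only the degree equal to its length. So c δ lies in the ideal separately, and then
so does f. -/
theorem IsAntiinvariant.mem_maxIdeal_of_lt {f : MvPolynomial b.support A}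
    (hf : IsAntiinvariant b A f) {d : ℕ} (hd : f.IsHomogeneous d) (hlt : d < (posRoots b).card) :
    f ∈ maxIdeal b A (kParam b A) := by
  obtain ⟨c, hc⟩ := exists_antisymm_sub_mem b hp hA f
  rw [hf.antisymm_eq] at hc
  have h1 : c • rootProd b A ∈ maxIdeal b A (kParam b A) := by
    intro L
    have hδ : (c • rootProd b A).IsHomogeneous (posRoots b).card := by
      rw [smul_eq_C_mul]
      exact (isHomogeneous_rootProd b).C_mul c
    by_cases hL : (posRoots b).card = L.length
    · have h2 := hc L
      rw [map_sub, map_sub, map_smul, smul_eq_C_mul, map_mul,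
        constantCoeff_dunklWord_of_ne b _ L hd (by omega), mul_zero, zero_sub, neg_eq_zero] at h2
      exact h2
    · exact constantCoeff_dunklWord_of_ne b _ L hδ hL
  have h2 := add_mem hc h1
  rw [sub_add_cancel] at h2
  obtain ⟨u, hu⟩ := isUnit_card_weylGroup b hp hA
  have h3 := smul_mem_maxIdeal (↑u⁻¹ : A) h2
  rwa [← hu, smul_smul, Units.inv_mul, one_smul] at h3

variable [IsDomain A] [CharZero A]

theorem kernelJ_eq : Jk b A = maxSub b A (kParam b A) :=
  kernelJ_eq_maxSub b (isUnit_latticeDenom b hp hA) (isUnit_halfNorm b hp hA)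

/-- Applied to δ, such an element gives zero or an antiinvariant of degree less than |R₊|, which
lies in J. Its purpose is to make y nilpotent on the quotient by `signIoIdeal`. -/
theorem yMap_mem_idealIo {c : MvPolynomial b.support A} {e : ℕ} (he : 0 < e)
    (hc : c.IsHomogeneous e) (hinv : ∀ g, weylAct b A g c = c) :
    yMap b A (kParam b A) c ∈ idealIo b A (kParam b A) := by
  have hcomm : ∀ g, genk b A (.w g) * yMap b A (kParam b A) c
      = yMap b A (kParam b A) c * genk b A (.w g) := fun g => by
    rw [genk, gen_w_mul_yMap, hinv]
  constructor
  · rw [invSubalgebra, Subalgebra.mem_centralizer_iff]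
    rintro _ ⟨g, rfl⟩
    exact hcomm g
  · rw [← map_smul, Submodule.mkQ_apply, Submodule.Quotient.mk_eq_zero, ← Jk, kernelJ_eq b hp hA]
    have hδ : disc b A (kParam b A) = PolyRep.of b A _ (rootProd b A) := rfl
    rcases le_or_gt e (posRoots b).card with h | h
    · obtain ⟨d, hd⟩ := Nat.exists_eq_add_of_le' h
      obtain ⟨q, hq, hq'⟩ := exists_yMap_smul_eq b (k := kParam b A) hc
        (hd ▸ isHomogeneous_rootProd b (A := A))
      rw [hδ, hq', of_mem_maxSub]
      refine IsAntiinvariant.mem_maxIdeal_of_lt b hp hA (fun g => ?_) hq (by omega)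
      have h1 := congrArg (genk b A (.w g) • ·) hq'
      simp only [genk] at h1
      rw [← mul_smul, ← genk, hcomm, mul_smul, genk, ← hδ, gen_w_smul_disc, smul_comm _ (weylSign b g), hδ,
        hq', gen_w_smul] at h1
      apply (PolyRep.of b A (kParam b A)).injective
      rw [← h1, map_smul, Int.cast_smul_eq_zsmul]
    · rw [hδ, yMap_smul_eq_zero b hc (of_mem_yNil (isHomogeneous_rootProd b) h)]
      exact zero_mem _

theorem gen_w_sub_mem_signIoIdeal (g : P.weylGroup) :
    genk b A (.w g) - (weylSign b g : Hk b A) ∈ signIoIdeal b A (kParam b A) := by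
  induction g using weylGroup_induction with
  | mem i =>
    rw [weylSign_ofIdx]
    refine Submodule.subset_span (Or.inr ⟨i, ?_⟩)
    simp [genk]
  | one =>
    rw [genk, gen_w_one, map_one, Int.cast_one, sub_self]
    exact zero_mem _
  | mul g g' h h' =>
    have h1 : genk b A (.w (g * g')) - (weylSign b (g * g') : Hk b A)
        = genk b A (.w g) • (genk b A (.w g') - (weylSign b g' : Hk b A))
          + (weylSign b g' : Hk b A) • (genk b A (.w g) - (weylSign b g : Hk b A)) := by
      rw [genk, gen_w_mul, map_mul, Int.cast_mul, smul_eq_mul, smul_eq_mul, mul_sub, mul_sub,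
        (Int.cast_commute (weylSign b g') (genk b A (.w g))).eq,
        (Int.cast_commute (weylSign b g') ((weylSign b g : ℤ) : Hk b A)).eq]
      abel
    rw [h1]
    exact add_mem (Submodule.smul_mem _ _ h') (Submodule.smul_mem _ _ h)

/-- In the quotient by the ideal, the generator is a sign vector killed by the invariants in y of
positive degree, so y is locally nilpotent on the whole quotient. If a annihilates the image of δ,
the antisymmetrization of a is the average of a applied to the generator, and this average belongs
to I_o. Detection finishes the argument. -/
theorem signIoIdeal_eq : signIoIdeal b A (kParam b A)
    = LinearMap.ker (LinearMap.toSpanSingleton (Hk b A) (Vk b A) ((Jk b A).mkQ (disck b A))) := by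
  apply le_antisymm
  · refine Submodule.span_le.2 ?_
    rintro a (ha | ⟨i, rfl⟩)
    · exact ha.2
    · change (genk b A (.w (RootPairing.weylGroup.ofIdx P i)) + 1 : Hk b A) • (Jk b A).mkQ (disck b A) = 0
      rw [← map_smul, add_smul, gen_w_smul_disc, weylSign_ofIdx, one_smul]
      simp
  · refine le_of_antiElt_smul_mem b hp hA _ _ (fun a _ => ?_) fun a ha => ?_
    · have h1 := exists_mem_yNil_of_invariants b (k := kParam b A)
        (z := (signIoIdeal b A (kParam b A)).mkQ 1) fun c d hd hc hinv => by
          rw [← map_smul, smul_eq_mul, mul_one, Submodule.mkQ_apply, Submodule.Quotient.mk_eq_zero]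
          exact Submodule.subset_span (Or.inl (yMap_mem_idealIo b hp hA hd hc hinv))
      have h2 := exists_smul_mem_yNil a h1
      rwa [← map_smul, smul_eq_mul, mul_one] at h2
    · have ha' : a • disck b A ∈ Jk b A := by
        have h1 : a • (Jk b A).mkQ (disck b A) = 0 := ha
        rwa [← map_smul, Submodule.mkQ_apply, Submodule.Quotient.mk_eq_zero] at h1
      have hv : ∀ g, genk b A (.w g) • (signIoIdeal b A (kParam b A)).mkQ 1
          = weylSign b g • (signIoIdeal b A (kParam b A)).mkQ 1 := by
        intro g
        rw [← sub_eq_zero, ← map_smul, ← map_zsmul, ← map_sub, Submodule.mkQ_apply,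
          Submodule.Quotient.mk_eq_zero]
        have := gen_w_sub_mem_signIoIdeal b hp hA g
        simpa [zsmul_one] using this
      have h1 := antiElt_smul hv a
      rw [← map_smul, ← map_smul, ← map_smul, smul_eq_mul (average b a), smul_eq_mul a, mul_one, mul_one,
        ← sub_eq_zero, ← map_sub, Submodule.mkQ_apply, Submodule.Quotient.mk_eq_zero] at h1
      have h2 := add_mem h1 (Submodule.subset_span (Or.inl (average_mem_idealIo b hp hA ha')))
      rwa [sub_add_cancel] at h2

end Sign

/-! ### The perfect representation in characteristic zero -/

section Simple

open MvPolynomial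

variable {ι V N : Type*} [Fintype ι] [AddCommGroup V] [Module ℝ V] [AddCommGroup N] [Module ℝ N]
  {P : RootPairing ι ℝ V N} [P.IsRootSystem] [P.IsCrystallographic] (b : P.Base)
  [P.IsReduced] [P.IsIrreducible] {p : ℕ} [hpp : Fact p.Prime] (hp : 1 + coxeterNumber b = p)

theorem eq_top_of_one_mem {A : Type*} [CommRing A] {k : A}
    {S : Submodule (RatDAHA b A k) (PolyRep b A k)} (h : PolyRep.of b A k 1 ∈ S) : S = ⊤ := by
  rw [eq_top_iff]
  intro f _
  have h1 := S.smul_mem (xMap b A k ((PolyRep.of b A k).symm f)) h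
  rwa [xMap_smul, mul_one] at h1

theorem eq_smul_of_gen_w_smul {A : Type*} [CommRing A] {k : A} {M : Type*} [AddCommGroup M]
    [Module (RatDAHA b A k) M] {u : M}
    (hu : ∀ i, gen b A k (.w (RootPairing.weylGroup.ofIdx P i)) • u = -u) (g : P.weylGroup) :
    gen b A k (.w g) • u = weylSign b g • u := by
  induction g using weylGroup_induction with
  | mem i => rw [hu, weylSign_ofIdx, neg_smul, one_smul]
  | one => rw [gen_w_one, one_smul, map_one, one_smul]
  | mul g g' h h' =>
    rw [gen_w_mul, mul_smul, h', smul_comm, h, map_mul, mul_smul, smul_comm]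

section General

variable {A : Type*} [CommRing A] (hA : IsPLocal p A)
  {J : Submodule (Hk b A) (Polk b A)} (hJ : J = maxSub b A (kParam b A))

include hp hA hJ

/-- The sign character occurs only once. -/
theorem exists_eq_smul_disc {u : Polk b A ⧸ J}
    (hu : ∀ i, genk b A (.w (RootPairing.weylGroup.ofIdx P i)) • u = -u) :
    ∃ c : A, u = c • J.mkQ (disck b A) := by
  subst hJ
  obtain ⟨f, rfl⟩ := Submodule.mkQ_surjective _ u
  obtain ⟨c, hc⟩ := exists_antisymm_sub_mem b hp hA ((PolyRep.of b A _).symm f)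
  obtain ⟨w, hw⟩ := isUnit_card_weylGroup b hp hA
  refine ⟨(↑w⁻¹ : A) * c, ?_⟩
  have h1 : (maxSub b A (kParam b A)).mkQ (PolyRep.of b A _
      (antisymm b A ((PolyRep.of b A (kParam b A)).symm f))) =
      c • (maxSub b A (kParam b A)).mkQ (disck b A) := by
    rw [← sub_eq_zero]
    exact (Submodule.Quotient.mk_eq_zero _).2 hc
  have h2 : (maxSub b A (kParam b A)).mkQ (PolyRep.of b A _
      (antisymm b A ((PolyRep.of b A (kParam b A)).symm f))) =
      (Fintype.card P.weylGroup : A) • (maxSub b A (kParam b A)).mkQ f := by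
    have h3 : PolyRep.of b A (kParam b A) (antisymm b A ((PolyRep.of b A (kParam b A)).symm f))
        = ∑ g, weylSign b g • genk b A (.w g) • f := by
      rw [antisymm_apply, map_sum]
      refine Finset.sum_congr rfl fun g _ => ?_
      rw [Int.cast_smul_eq_zsmul, map_zsmul, ← gen_w_smul, AlgEquiv.apply_symm_apply]
    rw [h3, map_sum, Nat.cast_smul_eq_nsmul, ← Finset.card_univ, ← Finset.sum_const]
    refine Finset.sum_congr rfl fun g _ => ?_
    rw [map_zsmul, map_smul, eq_smul_of_gen_w_smul b hu, smul_smul, weylSign_mul_self, one_smul]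
  rw [mul_smul, ← h1, h2, smul_smul, ← hw, Units.inv_mul, one_smul]

theorem mkQ_disc_ne_zero [Nontrivial A] : J.mkQ (disck b A) ≠ 0 := by
  subst hJ
  intro h
  have h1 := (Submodule.Quotient.mk_eq_zero _).1 h
  refine one_ne_zero (rootProd_notMem_maxIdeal_of_hom b hp hA (1 : A) ?_)
  rw [one_smul]
  exact h1

end General

section Tilde

variable {A : Type*} [CommRing A] (hA : IsPLocal p A)

include hp hA in
/-- If `V''` is generated by the image of `δ`, then `Ṽ''` coincides with it. -/
theorem exists_tilde_equiv (htop : discSpan b A (kParam b A) ⊔ Jk b A = ⊤) :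
    ∃ e : Vtildek b A ≃ₗ[Hk b A] Vk b A, ∀ f : discSpan b A (kParam b A),
      e (Submodule.Quotient.mk f) = Submodule.Quotient.mk (f : Polk b A) := by
  let φ : discSpan b A (kParam b A) →ₗ[Hk b A] Vk b A :=
    (Jk b A).mkQ.comp (discSpan b A (kParam b A)).subtype
  have hker : (ioDiscSpan b A (kParam b A)).comap (discSpan b A (kParam b A)).subtype
      = LinearMap.ker φ := by
    rw [ioDiscSpan_eq b hp hA, Submodule.comap_inf, Submodule.comap_subtype_self, inf_top_eq,
      LinearMap.ker_comp, Submodule.ker_mkQ]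
  have hsurj : Function.Surjective φ := by
    intro u
    obtain ⟨f, rfl⟩ := Submodule.mkQ_surjective _ u
    obtain ⟨d, hd, j, hj, rfl⟩ := Submodule.mem_sup.1 (htop ▸ Submodule.mem_top (x := f))
    refine ⟨⟨d, hd⟩, ?_⟩
    rw [map_add, (Submodule.Quotient.mk_eq_zero (Jk b A)).2 hj |> fun h => (h : (Jk b A).mkQ j = 0),
      add_zero]
    rfl
  exact ⟨(Submodule.quotEquivOfEq _ _ hker).trans (φ.quotKerEquivOfSurjective hsurj), fun f => rfl⟩

end Tilde

section Field

variable (K : Type*) [Field K] [CharZero K]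

/-- A nonzero constant over a field generates the whole polynomial representation, so every proper
submodule is among those whose supremum is J. -/
theorem le_Jk_of_ne_top {S : Submodule (Hk b K) (Polk b K)} (hS : S ≠ ⊤) : S ≤ Jk b K := by
  refine le_sSup fun c hc => ?_
  by_contra h0
  refine hS (eq_top_of_one_mem b ?_)
  have h1 := S.smul_mem (algebraMap K (Hk b K) c⁻¹) hc
  rwa [algebraMap_smul, Algebra.algebraMap_eq_smul_one, smul_smul, inv_mul_cancel₀ h0, one_smul] at h1

include hp

theorem isCoatom_Jk : IsCoatom (Jk b K) := by
  constructor
  · intro h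
    have h1 : PolyRep.of b K (kParam b K) 1 ∈ Jk b K := h ▸ Submodule.mem_top
    rw [kernelJ_eq b hp (isPLocal_of_charZero p K), of_mem_maxSub] at h1
    have := constantCoeff_of_mem_maxIdeal h1
    rw [map_one] at this
    exact one_ne_zero this
  · intro S hS
    by_contra h
    exact (le_Jk_of_ne_top b K h).not_gt hS

theorem eq_Jk_of_isSimpleModule {S : Submodule (Hk b K) (Polk b K)}
    (hS : IsSimpleModule (Hk b K) (Polk b K ⧸ S)) : S = Jk b K := by
  rw [isSimpleModule_iff_isCoatom] at hS
  exact ((hS.le_iff.1 (le_Jk_of_ne_top b K hS.1)).resolve_left (isCoatom_Jk b hp K).1).symm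

theorem discSpan_sup_Jk : discSpan b K (kParam b K) ⊔ Jk b K = ⊤ := by
  have hA := isPLocal_of_charZero p K
  refine (isCoatom_Jk b hp K).2 _ (lt_of_le_of_ne le_sup_right fun h => ?_)
  refine mkQ_disc_ne_zero b hp hA (kernelJ_eq b hp hA) ((Submodule.Quotient.mk_eq_zero _).2 ?_)
  rw [h]
  exact Submodule.mem_sup_left (Submodule.mem_span_singleton_self _)

theorem exists_sign_equiv :
    ∃ e : (Hk b K ⧸ signIoIdeal b K (kParam b K)) ≃ₗ[Hk b K] Vk b K,
      e (Submodule.Quotient.mk 1) = Submodule.Quotient.mk (disck b K) := by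
  have hA := isPLocal_of_charZero p K
  set φ := LinearMap.toSpanSingleton (Hk b K) (Vk b K) ((Jk b K).mkQ (disck b K))
  have hsimple : IsSimpleModule (Hk b K) (Vk b K) :=
    isSimpleModule_iff_isCoatom.2 (isCoatom_Jk b hp K)
  have hsurj : Function.Surjective φ :=
    IsSimpleModule.toSpanSingleton_surjective (Hk b K)
      (mkQ_disc_ne_zero b hp hA (kernelJ_eq b hp hA))
  exact ⟨(Submodule.quotEquivOfEq _ _ (signIoIdeal_eq b hp hA)).trans
    (φ.quotKerEquivOfSurjective hsurj), by
      change (1 : Hk b K) • (Jk b K).mkQ (disck b K) = _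
      rw [one_smul]
      rfl⟩

theorem gordon :
    (IsSimpleModule (Hk b K) (Vk b K) ∧
      (∀ S : Submodule (Hk b K) (Polk b K),
        IsSimpleModule (Hk b K) (Polk b K ⧸ S) → S = Jk b K) ∧
      Module.finrank K (Vk b K) = p ^ Module.finrank ℝ V) ∧
    ((Jk b K).mkQ (disck b K) ≠ 0 ∧ ∀ u : Vk b K,
        (∀ i, genk b K (.w (RootPairing.weylGroup.ofIdx P i)) • u = -u) →
        ∃ c : K, u = c • (Jk b K).mkQ (disck b K)) ∧
    IsSimpleModule (Hk b K) (Vtildek b K) ∧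
    (∃ e : Vtildek b K ≃ₗ[Hk b K] Vk b K, ∀ f : discSpan b K (kParam b K),
        e (Submodule.Quotient.mk f) = Submodule.Quotient.mk (f : Polk b K)) ∧
    (∃ e : (Hk b K ⧸ signIoIdeal b K (kParam b K)) ≃ₗ[Hk b K] Vk b K,
        e (Submodule.Quotient.mk 1) = Submodule.Quotient.mk (disck b K)) := by
  have hA := isPLocal_of_charZero p K
  have hsimple : IsSimpleModule (Hk b K) (Vk b K) :=
    isSimpleModule_iff_isCoatom.2 (isCoatom_Jk b hp K)
  have hJ := kernelJ_eq b hp hA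
  obtain ⟨e, he⟩ := exists_tilde_equiv b hp hA (discSpan_sup_Jk b hp K)
  refine ⟨⟨hsimple, fun S hS => eq_Jk_of_isSimpleModule b hp K hS, ?_⟩,
    ⟨mkQ_disc_ne_zero b hp hA hJ, fun u hu => exists_eq_smul_disc b hp hA hJ hu⟩,
    IsSimpleModule.congr e, ⟨e, he⟩, exists_sign_equiv b hp K⟩
  rw [← finrank_quotient_maxSub b hp hA]
  exact congrArg (fun J : Submodule (Hk b K) (Polk b K) => Module.finrank K (Polk b K ⧸ J)) hJ

end Field

include hp in
theorem mem_Jk_padicInt_iff (f : Polk b ℤ_[p]) : f ∈ Jk b ℤ_[p] ↔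
    PolyRep.map b (algebraMap ℤ_[p] ℚ_[p]) (kParam b ℤ_[p]) (kParam b ℚ_[p]) f ∈ Jk b ℚ_[p] := by
  have hA := isPLocal_padicInt p
  rw [kernelJ_eq b hp hA, kernelJ_eq b hp (isPLocal_of_charZero p ℚ_[p])]
  exact (map_mem_maxIdeal_iff (algebraMap ℤ_[p] ℚ_[p]) (map_ringForm_of_isPLocal b hp hA _)
    (map_kParam_of_isPLocal b hp hA _) (IsFractionRing.injective ℤ_[p] ℚ_[p])).symm

end Simple

/-! ### Base change and differential operators -/

section BaseChange

variable {ι V N : Type*} [Fintype ι] [AddCommGroup V] [Module ℝ V] [AddCommGroup N] [Module ℝ N]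
  {P : RootPairing ι ℝ V N} [P.IsCrystallographic] (b : P.Base)
  {A B : Type*} [CommRing A] [CommRing B] [Algebra A B] {k : A} {k' : B}
  (hφ : ∀ u v, algebraMap A B (ringForm P A u v) = ringForm P B u v) (hk : algebraMap A B k = k')

/-- The homomorphism from `H''_B` to the base change of `H''_A`. -/
def toBaseChange : RatDAHA b B k' →ₐ[B] B ⊗[A] RatDAHA b A k :=
  RatDAHA.lift b B k' (fun a => 1 ⊗ₜ gen b A k a)
    (fun u v => by rw [gen_x_add, TensorProduct.tmul_add])
    (fun u v => by
      rw [Algebra.TensorProduct.tmul_mul_tmul, Algebra.TensorProduct.tmul_mul_tmul, gen_x_comm])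
    (fun u v => by rw [gen_y_add, TensorProduct.tmul_add])
    (fun u v => by
      rw [Algebra.TensorProduct.tmul_mul_tmul, Algebra.TensorProduct.tmul_mul_tmul, gen_y_comm])
    (by rw [gen_w_one]; rfl)
    (fun g g' => by rw [gen_w_mul, Algebra.TensorProduct.tmul_mul_tmul, mul_one])
    (fun g u => by
      rw [Algebra.TensorProduct.tmul_mul_tmul, Algebra.TensorProduct.tmul_mul_tmul, gen_w_x])
    (fun g u => by
      rw [Algebra.TensorProduct.tmul_mul_tmul, Algebra.TensorProduct.tmul_mul_tmul, gen_w_y])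
    (fun u v => by
      rw [Algebra.TensorProduct.tmul_mul_tmul, Algebra.TensorProduct.tmul_mul_tmul, gen_y_x,
        TensorProduct.tmul_add, TensorProduct.tmul_add, TensorProduct.tmul_sum, mul_one]
      congr 1
      · congr 1
        rw [← hφ, Algebra.algebraMap_eq_smul_one, TensorProduct.tmul_smul,
          Algebra.algebraMap_eq_smul_one, algebraMap_smul]
        rfl
      · refine Finset.sum_congr rfl fun i _ => ?_
        rw [TensorProduct.tmul_smul, ← hk, ← hφ, ← map_intCast (algebraMap A B), ← map_mul,
          ← map_mul, algebraMap_smul])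

theorem toBaseChange_gen (a : Gen P) : toBaseChange b hφ hk (gen b B k' a) = 1 ⊗ₜ gen b A k a :=
  RatDAHA.lift_gen b B k' _ _ _ _ _ _ _ _ _ _ a

/-- Both algebras have the same presentation, so maps given on generators are mutually inverse. The
last clause, on all integral elements, is what the comparison of the module structures uses. -/
theorem exists_baseChangeEquiv : ∃ π : (B ⊗[A] RatDAHA b A k) ≃ₐ[B] RatDAHA b B k',
    (∀ a, π (1 ⊗ₜ gen b A k a) = gen b B k' a) ∧
    ∀ a, π (1 ⊗ₜ a) = RatDAHA.map b (algebraMap A B) hφ hk a := by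
  let _ : Algebra A (RatDAHA b B k') := Algebra.compHom _ (algebraMap A B)
  have : IsScalarTower A B (RatDAHA b B k') := IsScalarTower.of_algebraMap_eq fun _ => rfl
  let F : RatDAHA b A k →ₐ[A] RatDAHA b B k' :=
    { RatDAHA.map b (algebraMap A B) hφ hk with
      commutes' := RatDAHA.map_algebraMap b (algebraMap A B) hφ hk }
  let G : B ⊗[A] RatDAHA b A k →ₐ[B] RatDAHA b B k' :=
    Algebra.TensorProduct.lift (Algebra.ofId B _) F fun c a => Algebra.commutes c _
  have hG : ∀ a, G (1 ⊗ₜ a) = RatDAHA.map b (algebraMap A B) hφ hk a := fun a => by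
    have h : G (1 ⊗ₜ a) = Algebra.ofId B (RatDAHA b B k') 1 * F a :=
      Algebra.TensorProduct.lift_tmul _ _ _ _ _
    rw [h, map_one, one_mul]
    rfl
  have hG' : ∀ a, G (1 ⊗ₜ gen b A k a) = gen b B k' a := fun a => by
    rw [hG, RatDAHA.map_gen]
  refine ⟨AlgEquiv.ofAlgHom G (toBaseChange b hφ hk) (RatDAHA.algHom_ext b B k' fun a => ?_) ?_,
    hG', hG⟩
  · rw [AlgHom.comp_apply, toBaseChange_gen, hG']
    rfl
  · refine Algebra.TensorProduct.ext (AlgHom.ext fun c => ?_) (RatDAHA.algHom_ext b A k fun a => ?_)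
    · have h : G (c ⊗ₜ 1) = Algebra.ofId B (RatDAHA b B k') c * F 1 :=
        Algebra.TensorProduct.lift_tmul _ _ _ _ _
      change toBaseChange b hφ hk (G (c ⊗ₜ 1)) = c ⊗ₜ 1
      rw [h, map_one, mul_one, Algebra.ofId_apply, AlgHom.commutes,
        Algebra.TensorProduct.algebraMap_apply, Algebra.algebraMap_self_apply]
    · change toBaseChange b hφ hk (G (1 ⊗ₜ gen b A k a)) = 1 ⊗ₜ gen b A k a
      rw [hG', toBaseChange_gen]

theorem RatDAHA.map_surjective (hs : Function.Surjective (algebraMap A B)) :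
    Function.Surjective (RatDAHA.map b (algebraMap A B) hφ hk) := by
  intro a
  induction a using RatDAHA.induction with
  | base c =>
    obtain ⟨c, rfl⟩ := hs c
    exact ⟨_, RatDAHA.map_algebraMap b _ hφ hk c⟩
  | gen a => exact ⟨_, RatDAHA.map_gen b _ hφ hk a⟩
  | add a a' h h' =>
    obtain ⟨x, rfl⟩ := h
    obtain ⟨y, rfl⟩ := h'
    exact ⟨x + y, map_add _ _ _⟩
  | mul a a' h h' =>
    obtain ⟨x, rfl⟩ := h
    obtain ⟨y, rfl⟩ := h'
    exact ⟨x * y, map_mul _ _ _⟩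

end BaseChange

section DiffOp

variable {σ A : Type*} [CommRing A]

theorem DiffOp.induction {motive : DiffOp σ A → Prop}
    (base : ∀ c : A, motive (algebraMap A _ c)) (x : ∀ i, motive (DiffOp.x A i))
    (d : ∀ i, motive (DiffOp.d A i)) (add : ∀ a a', motive a → motive a' → motive (a + a'))
    (mul : ∀ a a', motive a → motive a' → motive (a * a')) (a : DiffOp σ A) : motive a := by
  obtain ⟨f, rfl⟩ := RingQuot.mkAlgHom_surjective A (WeylRel σ A) a
  induction f using FreeAlgebra.induction with
  | grade0 c => rw [AlgHom.commutes]; exact base c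
  | grade1 i =>
    cases i with
    | inl i => exact x i
    | inr i => exact d i
  | add f g hf hg => rw [map_add]; exact add _ _ hf hg
  | mul f g hf hg => rw [map_mul]; exact mul _ _ hf hg

variable (A) in
theorem DiffOp.x_comm (i j : σ) : DiffOp.x A i * DiffOp.x A j = DiffOp.x A j * DiffOp.x A i :=
  ((map_mul _ _ _).symm.trans (RingQuot.mkAlgHom_rel A (WeylRel.x_comm i j))).trans (map_mul _ _ _)

variable (A) in
theorem DiffOp.d_comm (i j : σ) : DiffOp.d A i * DiffOp.d A j = DiffOp.d A j * DiffOp.d A i :=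
  ((map_mul _ _ _).symm.trans (RingQuot.mkAlgHom_rel A (WeylRel.d_comm i j))).trans (map_mul _ _ _)

open Classical in
variable (A) in
theorem DiffOp.d_mul_x (i j : σ) : DiffOp.d A i * DiffOp.x A j
    = DiffOp.x A j * DiffOp.d A i + if i = j then 1 else 0 := by
  refine ((map_mul _ _ _).symm.trans (RingQuot.mkAlgHom_rel A (WeylRel.d_x i j))).trans ?_
  rw [map_add, map_mul, apply_ite (RingQuot.mkAlgHom A (WeylRel σ A)), map_one, map_zero]
  rfl

open Classical in
/-- An algebra homomorphism out of the differential operators, given on the generators. -/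
def DiffOp.lift {R : Type*} [Ring R] [Algebra A R] (s t : σ → R)
    (x_comm : ∀ i j, s i * s j = s j * s i) (d_comm : ∀ i j, t i * t j = t j * t i)
    (d_x : ∀ i j, t i * s j = s j * t i + if i = j then 1 else 0) : DiffOp σ A →ₐ[A] R :=
  RingQuot.liftAlgHom A ⟨FreeAlgebra.lift A (Sum.elim s t), fun f f' h => by
    cases h with
    | x_comm i j => simpa using x_comm i j
    | d_comm i j => simpa using d_comm i j
    | d_x i j =>
      rw [map_mul, map_add, map_mul, apply_ite (FreeAlgebra.lift A (Sum.elim s t)), map_one,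
        map_zero, FreeAlgebra.lift_ι_apply, FreeAlgebra.lift_ι_apply]
      exact d_x i j⟩

theorem DiffOp.lift_x {R : Type*} [Ring R] [Algebra A R] (s t : σ → R) (h1 h2 h3) (i : σ) :
    DiffOp.lift (A := A) s t h1 h2 h3 (DiffOp.x A i) = s i :=
  (RingQuot.liftAlgHom_mkAlgHom_apply A (FreeAlgebra.lift A (Sum.elim s t)) _ _).trans
    (FreeAlgebra.lift_ι_apply _ _)

theorem DiffOp.lift_d {R : Type*} [Ring R] [Algebra A R] (s t : σ → R) (h1 h2 h3) (i : σ) :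
    DiffOp.lift (A := A) s t h1 h2 h3 (DiffOp.d A i) = t i :=
  (RingQuot.liftAlgHom_mkAlgHom_apply A (FreeAlgebra.lift A (Sum.elim s t)) _ _).trans
    (FreeAlgebra.lift_ι_apply _ _)

theorem DiffOp.x_smul (i : σ) (f : DiffPoly σ A) : DiffOp.x A i • f = MvPolynomial.X i * f := by
  have h : diffEnd σ A (DiffOp.x A i) = diffGenEnd σ A (.inl i) :=
    (RingQuot.liftAlgHom_mkAlgHom_apply A (FreeAlgebra.lift A (diffGenEnd σ A)) _ _).trans
      (FreeAlgebra.lift_ι_apply _ _)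
  rw [diff_smul_def, h]
  rfl

theorem DiffOp.d_smul (i : σ) (f : DiffPoly σ A) :
    DiffOp.d A i • f = MvPolynomial.pderiv i f := by
  have h : diffEnd σ A (DiffOp.d A i) = diffGenEnd σ A (.inr i) :=
    (RingQuot.liftAlgHom_mkAlgHom_apply A (FreeAlgebra.lift A (diffGenEnd σ A)) _ _).trans
      (FreeAlgebra.lift_ι_apply _ _)
  rw [diff_smul_def, h]
  rfl

end DiffOp

/-! ### The algebra at k = 0 and the differential operators -/

section Smash

open MvPolynomial

variable {ι V N : Type*} [Fintype ι] [AddCommGroup V] [Module ℝ V] [AddCommGroup N] [Module ℝ N]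
  {P : RootPairing ι ℝ V N} [P.IsRootSystem] [P.IsCrystallographic] (b : P.Base)
  [P.IsReduced] [P.IsIrreducible] {A : Type*} [CommRing A]
  (hA : IsUnit (latticeDenom P : A)) (hN : ∀ i, IsUnit (halfNorm b i : A)) {k : A} (hk : k = 0)

variable (k) in
/-- The elements dual to the `x_{ω_i}`. -/
def dualY (i : b.support) : RatDAHA b A k :=
  Ring.inverse (halfNorm b i : A) • gen b A k (.y (rootWeight P i))

include hA hN in
theorem inverse_mul_corootPairing (i l : b.support) :
    Ring.inverse (halfNorm b i : A) * (corootPairing P l (rootWeight P i) : A)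
      = Ring.inverse (halfNorm b l : A) * (corootPairing P i (rootWeight P l) : A) := by
  have h := ringForm_symm A (rootWeight P i) (rootWeight P l)
  rw [ringForm_rootWeight b hA, ringForm_rootWeight b hA] at h
  apply (hN i).mul_left_cancel
  apply (hN l).mul_left_cancel
  rw [← mul_assoc (halfNorm b i : A), Ring.mul_inverse_cancel _ (hN i), one_mul, h,
    mul_left_comm (halfNorm b l : A), ← mul_assoc (halfNorm b l : A),
    Ring.mul_inverse_cancel _ (hN l), one_mul]

include hA hN in
-- The simple roots are, up to the units `halfNorm`, dual to the fundamental weights for the form,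
-- so x_u, and with it D_u, is expanded in the simple roots.
theorem gen_y_eq_sum (u : weightLattice P) :
    gen b A k (.y u) = ∑ i, ringForm P A u (fundWeight b i) • dualY b k i := by
  rw [← yMap_xPoly]
  have h : xPoly b A u = ∑ i, (ringForm P A u (fundWeight b i) * Ring.inverse (halfNorm b i : A)) •
      xPoly b A (rootWeight P i) := by
    simp only [xPoly, Finset.smul_sum]
    rw [Finset.sum_comm]
    refine Finset.sum_congr rfl fun l _ => ?_
    have h1 := ringForm_eq_sum b A u (rootWeight P l)
    rw [ringForm_rootWeight b hA] at h1
    have h2 : (corootPairing P l u : A) = ∑ i : b.support, ringForm P A u (fundWeight b i) *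
        Ring.inverse (halfNorm b i : A) * (corootPairing P l (rootWeight P i) : A) := by
      apply (hN l).mul_left_cancel
      rw [h1, Finset.mul_sum]
      refine Finset.sum_congr rfl fun i _ => ?_
      rw [mul_assoc, inverse_mul_corootPairing b hA hN, mul_left_comm,
        ← mul_assoc (halfNorm b l : A), Ring.mul_inverse_cancel _ (hN l), one_mul, mul_comm]
    rw [← map_intCast (C : A →+* MvPolynomial b.support A), h2, map_sum, Finset.sum_mul]
    refine Finset.sum_congr rfl fun i _ => ?_
    rw [← map_intCast (C : A →+* MvPolynomial b.support A), smul_eq_C_mul, ← mul_assoc, ← map_mul]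
  rw [h, map_sum]
  refine Finset.sum_congr rfl fun i _ => ?_
  rw [map_smul, yMap_xPoly, dualY, smul_smul]

open Classical in
include hA hN in
theorem inverse_mul_ringForm (i j : b.support) :
    Ring.inverse (halfNorm b i : A) * ringForm P A (rootWeight P i) (fundWeight b j)
      = if i = j then 1 else 0 := by
  rw [ringForm_symm, ringForm_rootWeight b hA, ← mul_assoc, Ring.inverse_mul_cancel _ (hN i),
    one_mul, corootPairing_fundWeight]
  split_ifs <;> simp

/-- The homomorphism from the differential operators to the algebra at `k = 0`. -/
def ofDiffOp : DiffOp b.support A →ₐ[A] RatDAHA b A k :=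
  DiffOp.lift (fun i => gen b A k (.x (fundWeight b i))) (dualY b k)
    (fun _ _ => gen_x_comm b A k _ _)
    (fun i j => by
      rw [dualY, dualY, smul_mul_smul_comm, smul_mul_smul_comm, gen_y_comm,
        mul_comm (Ring.inverse (halfNorm b i : A))])
    (fun i j => by
      rw [dualY, smul_mul_assoc, gen_y_x, Finset.sum_eq_zero fun i _ => by
        rw [hk, zero_mul, zero_mul, zero_smul], add_zero, smul_add, mul_smul_comm,
        Algebra.algebraMap_eq_smul_one, smul_smul, inverse_mul_ringForm b hA hN, ite_smul, one_smul,
        zero_smul]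
      congr!)

theorem ofDiffOp_x (i : b.support) :
    ofDiffOp b hA hN hk (DiffOp.x A i) = gen b A k (.x (fundWeight b i)) := DiffOp.lift_x _ _ _ _ _ i

theorem ofDiffOp_d (i : b.support) : ofDiffOp b hA hN hk (DiffOp.d A i) = dualY b k i :=
  DiffOp.lift_d _ _ _ _ _ i

theorem gen_y_eq_sum_ofDiffOp (u : weightLattice P) :
    gen b A k (.y u) = ∑ i, ringForm P A u (fundWeight b i) •
      ofDiffOp b hA hN hk (DiffOp.d A i) := by
  simp only [ofDiffOp_d]
  exact gen_y_eq_sum b hA hN u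

theorem gen_x_eq_sum_ofDiffOp (u : weightLattice P) : gen b A k (.x u)
    = ofDiffOp b hA hN hk (∑ i : b.support, (corootPairing P i u : A) • DiffOp.x A i) := by
  rw [← xMap_xPoly, xPoly, map_sum, map_sum]
  refine Finset.sum_congr rfl fun i _ => ?_
  rw [← map_intCast (C : A →+* MvPolynomial b.support A), ← smul_eq_C_mul, map_smul, map_smul,
    xMap_X, ofDiffOp_x]

theorem ofDiffOp_smul (a : DiffOp b.support A) (f : DiffPoly b.support A) :
    ofDiffOp b hA hN hk a • PolyRep.of b A k f = PolyRep.of b A k (a • f) := by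
  induction a using DiffOp.induction generalizing f with
  | base c => rw [AlgHom.commutes, algebraMap_smul, algebraMap_smul, map_smul]
  | x i => rw [ofDiffOp_x, gen_x_smul, ← map_mul, xPoly_fundWeight, DiffOp.x_smul]
  | d i =>
    rw [ofDiffOp_d, dualY, smul_assoc, gen_y_smul, ← map_smul, ← ddl_eq_smul_dunkl b hA hN,
      DiffOp.d_smul, hk, ddl_zero]
  | add a a' h h' => rw [map_add, add_smul, h, h', add_smul, map_add]
  | mul a a' h h' => rw [map_mul, mul_smul, h', h, mul_smul]

theorem exists_gen_w_mul_ofDiffOp (g : P.weylGroup) (a : DiffOp b.support A) :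
    ∃ a', gen b A k (.w g) * ofDiffOp b hA hN hk a = ofDiffOp b hA hN hk a' * gen b A k (.w g) := by
  induction a using DiffOp.induction with
  | base c => exact ⟨algebraMap A _ c, by rw [AlgHom.commutes, Algebra.commutes]⟩
  | x i => exact 
    ⟨∑ j : b.support, (corootPairing P j (g • fundWeight b i) : A) • DiffOp.x A j, by
      rw [ofDiffOp_x, gen_w_x, gen_x_eq_sum_ofDiffOp b hA hN hk]⟩
  | d i =>
    refine ⟨Ring.inverse (halfNorm b i : A) • ∑ j, ringForm P A (g • rootWeight P i)
      (fundWeight b j) • DiffOp.d A j, ?_⟩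
    rw [ofDiffOp_d, dualY, mul_smul_comm, gen_w_y, gen_y_eq_sum_ofDiffOp b hA hN hk]
    simp only [map_smul, map_sum, smul_mul_assoc]
  | add a a' h h' =>
    obtain ⟨c, hc⟩ := h
    obtain ⟨c', hc'⟩ := h'
    exact ⟨c + c', by rw [map_add, mul_add, hc, hc', map_add, add_mul]⟩
  | mul a a' h h' =>
    obtain ⟨c, hc⟩ := h
    obtain ⟨c', hc'⟩ := h'
    exact ⟨c * c', by rw [map_mul, ← mul_assoc, hc, mul_assoc, hc', ← mul_assoc, map_mul]⟩

/-- The linear map from the smash product with `W`. -/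
def smashMap : (P.weylGroup →₀ DiffOp b.support A) →ₗ[A] RatDAHA b A k :=
  Finsupp.lsum A fun g => (LinearMap.mulRight A (gen b A k (.w g))).comp
    (ofDiffOp b hA hN hk).toLinearMap

theorem smashMap_apply (c : P.weylGroup →₀ DiffOp b.support A) : smashMap b hA hN hk c
    = c.sum fun g a => ofDiffOp b hA hN hk a * gen b A k (.w g) := rfl

theorem smashMap_single (g : P.weylGroup) (a : DiffOp b.support A) :
    smashMap b hA hN hk (Finsupp.single g a) = ofDiffOp b hA hN hk a * gen b A k (.w g) := by
  rw [smashMap_apply, Finsupp.sum_single_index]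
  rw [map_zero, zero_mul]

/-- The range contains 1 and is stable under left multiplication by the generators. -/
theorem smashMap_surjective : Function.Surjective (smashMap b hA hN hk) := by
  have hD : ∀ a, ∀ z ∈ LinearMap.range (smashMap b hA hN hk),
      ofDiffOp b hA hN hk a * z ∈ LinearMap.range (smashMap b hA hN hk) := by
    rintro a _ ⟨c, rfl⟩
    induction c using Finsupp.induction_linear with
    | zero => rw [map_zero, mul_zero]; exact zero_mem _
    | add c c' h h' => rw [map_add, mul_add]; exact add_mem h h'
    | single g a' =>
      rw [smashMap_single, ← mul_assoc, ← map_mul, ← smashMap_single]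
      exact ⟨_, rfl⟩
  have key : ∀ h : RatDAHA b A k, ∀ z ∈ LinearMap.range (smashMap b hA hN hk),
      h * z ∈ LinearMap.range (smashMap b hA hN hk) := by
    intro h
    induction h using RatDAHA.induction with
    | base c =>
      intro z hz
      rw [← Algebra.smul_def]
      exact Submodule.smul_mem _ _ hz
    | gen a =>
      cases a with
      | x u => rw [gen_x_eq_sum_ofDiffOp b hA hN hk]; exact hD _
      | y u =>
        rw [gen_y_eq_sum_ofDiffOp b hA hN hk]
        simp only [← map_smul, ← map_sum]
        exact hD _
      | w g =>
        rintro _ ⟨c, rfl⟩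
        induction c using Finsupp.induction_linear with
        | zero => rw [map_zero, mul_zero]; exact zero_mem _
        | add c c' h h' => rw [map_add, mul_add]; exact add_mem h h'
        | single g' a' =>
          obtain ⟨a'', h⟩ := exists_gen_w_mul_ofDiffOp b hA hN hk g a'
          rw [smashMap_single, ← mul_assoc, h, mul_assoc, ← gen_w_mul, ← smashMap_single]
          exact ⟨_, rfl⟩
    | add a a' h h' => intro z hz; rw [add_mul]; exact add_mem (h z hz) (h' z hz)
    | mul a a' h h' => intro z hz; rw [mul_assoc]; exact h _ (h' z hz)
  intro h
  have h1 : (1 : RatDAHA b A k) ∈ LinearMap.range (smashMap b hA hN hk) :=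
    ⟨Finsupp.single 1 1, by rw [smashMap_single, map_one, gen_w_one, one_mul]⟩
  simpa using key h 1 h1

end Smash

/-! ### Independence of the elements of W over the differential operators -/

section SmashInjective

open MvPolynomial

variable {ι V N : Type*} [Fintype ι] [AddCommGroup V] [Module ℝ V] [AddCommGroup N] [Module ℝ N]
  {P : RootPairing ι ℝ V N} [P.IsRootSystem] [P.IsCrystallographic] (b : P.Base)
  [P.IsReduced] [P.IsIrreducible] (A : Type*) [CommRing A]
  (hA : IsUnit (latticeDenom P : A)) (hN : ∀ i, IsUnit (halfNorm b i : A)) {k : A} (hk : k = 0)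

/-- `x_u` as a differential operator. -/
def diffX : weightLattice P →+ DiffOp b.support A where
  toFun u := ∑ j : b.support, (corootPairing P j u : A) • DiffOp.x A j
  map_zero' := by
    refine Finset.sum_eq_zero fun j _ => ?_
    rw [show corootPairing P j 0 = 0 from (corootHom (P := P) j).map_zero, Int.cast_zero, zero_smul]
  map_add' u v := by
    simp only [corootPairing_add, Int.cast_add, add_smul, Finset.sum_add_distrib]

/-- `D_u` as a differential operator. -/
def diffY : weightLattice P →+ DiffOp b.support A where
  toFun u := ∑ j : b.support, ringForm P A u (fundWeight b j) • DiffOp.d A j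
  map_zero' := by
    refine Finset.sum_eq_zero fun j _ => ?_
    rw [ringForm_symm, show ringForm P A (fundWeight b j) 0 = 0 from
      (ringFormHom P A (fundWeight b j)).map_zero, zero_smul]
  map_add' u v := by
    simp only [ringForm_add_left, add_smul, Finset.sum_add_distrib]

variable {A}

theorem diffX_comm (u v : weightLattice P) :
    diffX b A u * diffX b A v = diffX b A v * diffX b A u := by
  change (∑ j, _) * (∑ j, _) = (∑ j, _) * (∑ j, _)
  rw [Finset.sum_mul_sum, Finset.sum_mul_sum, Finset.sum_comm]
  refine Finset.sum_congr rfl fun i _ => Finset.sum_congr rfl fun j _ => ?_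
  rw [smul_mul_smul_comm, smul_mul_smul_comm, DiffOp.x_comm, mul_comm (corootPairing P j u : A)]

theorem diffY_comm (u v : weightLattice P) :
    diffY b A u * diffY b A v = diffY b A v * diffY b A u := by
  change (∑ j, _) * (∑ j, _) = (∑ j, _) * (∑ j, _)
  rw [Finset.sum_mul_sum, Finset.sum_mul_sum, Finset.sum_comm]
  refine Finset.sum_congr rfl fun i _ => Finset.sum_congr rfl fun j _ => ?_
  rw [smul_mul_smul_comm, smul_mul_smul_comm, DiffOp.d_comm, mul_comm (ringForm P A u _)]

theorem diffY_mul_diffX (u v : weightLattice P) : diffY b A u * diffX b A v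
    = diffX b A v * diffY b A u + algebraMap A _ (ringForm P A u v) := by
  classical
  change (∑ j, _) * (∑ j, _) = (∑ j, _) * (∑ j, _) + _
  rw [Finset.sum_mul_sum, Finset.sum_mul_sum, Finset.sum_comm (γ := b.support), ringForm_eq_sum,
    map_sum, ← Finset.sum_add_distrib]
  refine Finset.sum_congr rfl fun i _ => ?_
  have h : ∀ j, ringForm P A u (fundWeight b j) • DiffOp.d A j *
      (corootPairing P i v : A) • DiffOp.x A i = (corootPairing P i v : A) • DiffOp.x A i *
      ringForm P A u (fundWeight b j) • DiffOp.d A j +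
      ((corootPairing P i v : A) * ringForm P A u (fundWeight b j)) • if j = i then 1 else 0 := by
    intro j
    rw [smul_mul_smul_comm, smul_mul_smul_comm, DiffOp.d_mul_x, smul_add,
      mul_comm (ringForm P A u _)]
    congr!
  rw [Finset.sum_congr rfl fun j _ => h j, Finset.sum_add_distrib]
  congr 1
  rw [Finset.sum_eq_single i]
  · rw [if_pos rfl, Algebra.algebraMap_eq_smul_one]
  · intro j _ hj
    rw [if_neg hj, smul_zero]
  · simp

/-- The action of the generators on the functions on `W` with values in the differential
operators. -/
def smashGen : Gen P → Module.End A (P.weylGroup → DiffOp b.support A)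
  | .x u => LinearMap.pi fun g => (LinearMap.mulLeft A (diffX b A (g⁻¹ • u))).comp (LinearMap.proj g)
  | .y u => LinearMap.pi fun g => (LinearMap.mulLeft A (diffY b A (g⁻¹ • u))).comp (LinearMap.proj g)
  | .w h => LinearMap.funLeft A _ fun g => h⁻¹ * g

/-- The module of functions on `W` with values in the differential operators, at `k = 0`. -/
def smashEnd : RatDAHA b A k →ₐ[A] Module.End A (P.weylGroup → DiffOp b.support A) :=
  RatDAHA.lift b A k (smashGen b)
    (fun u v => LinearMap.ext fun c => funext fun g => by
      change diffX b A (g⁻¹ • (u + v)) * c g = diffX b A (g⁻¹ • u) * c g + diffX b A (g⁻¹ • v) * c g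
      rw [smul_add, map_add, add_mul])
    (fun u v => LinearMap.ext fun c => funext fun g => by
      change diffX b A (g⁻¹ • u) * (diffX b A (g⁻¹ • v) * c g)
        = diffX b A (g⁻¹ • v) * (diffX b A (g⁻¹ • u) * c g)
      rw [← mul_assoc, diffX_comm, mul_assoc])
    (fun u v => LinearMap.ext fun c => funext fun g => by
      change diffY b A (g⁻¹ • (u + v)) * c g = diffY b A (g⁻¹ • u) * c g + diffY b A (g⁻¹ • v) * c g
      rw [smul_add, map_add, add_mul])
    (fun u v => LinearMap.ext fun c => funext fun g => by
      change diffY b A (g⁻¹ • u) * (diffY b A (g⁻¹ • v) * c g)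
        = diffY b A (g⁻¹ • v) * (diffY b A (g⁻¹ • u) * c g)
      rw [← mul_assoc, diffY_comm, mul_assoc])
    (LinearMap.ext fun c => funext fun g => by
      change c (1⁻¹ * g) = c g
      rw [inv_one, one_mul])
    (fun h h' => LinearMap.ext fun c => funext fun g => by
      change c ((h * h')⁻¹ * g) = c (h'⁻¹ * (h⁻¹ * g))
      rw [mul_inv_rev, mul_assoc])
    (fun h u => LinearMap.ext fun c => funext fun g => by
      change diffX b A ((h⁻¹ * g)⁻¹ • u) * c (h⁻¹ * g) = diffX b A (g⁻¹ • h • u) * c (h⁻¹ * g)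
      rw [mul_inv_rev, inv_inv, mul_smul])
    (fun h u => LinearMap.ext fun c => funext fun g => by
      change diffY b A ((h⁻¹ * g)⁻¹ • u) * c (h⁻¹ * g) = diffY b A (g⁻¹ • h • u) * c (h⁻¹ * g)
      rw [mul_inv_rev, inv_inv, mul_smul])
    (fun u v => LinearMap.ext fun c => funext fun g => by
      rw [Finset.sum_eq_zero fun i _ => by rw [hk, zero_mul, zero_mul, zero_smul], add_zero]
      change diffY b A (g⁻¹ • u) * (diffX b A (g⁻¹ • v) * c g)
        = diffX b A (g⁻¹ • v) * (diffY b A (g⁻¹ • u) * c g) + ringForm P A u v • c g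
      rw [← mul_assoc, diffY_mul_diffX, add_mul, mul_assoc, ringForm_smul, ← Algebra.smul_def])

theorem smashEnd_gen (a : Gen P) : smashEnd b hk (gen b A k a) = smashGen b a :=
  RatDAHA.lift_gen b A k _ _ _ _ _ _ _ _ _ _ a

theorem smashEnd_ofDiffOp (a : DiffOp b.support A) (c : P.weylGroup → DiffOp b.support A) :
    smashEnd b hk (ofDiffOp b hA hN hk a) c 1 = a * c 1 := by
  classical
  induction a using DiffOp.induction generalizing c with
  | base r =>
    rw [AlgHom.commutes, AlgHom.commutes, ← Algebra.smul_def]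
    rfl
  | x i =>
    rw [ofDiffOp_x, smashEnd_gen]
    change diffX b A ((1 : P.weylGroup)⁻¹ • fundWeight b i) * c 1 = _
    rw [inv_one, one_smul]
    congr 1
    change ∑ j, _ = _
    rw [Finset.sum_eq_single i]
    · rw [corootPairing_fundWeight, if_pos rfl, Int.cast_one, one_smul]
    · intro j _ hj
      rw [corootPairing_fundWeight, if_neg hj, Int.cast_zero, zero_smul]
    · simp
  | d i =>
    rw [ofDiffOp_d, dualY, map_smul, smashEnd_gen]
    change Ring.inverse (halfNorm b i : A) •
      (diffY b A ((1 : P.weylGroup)⁻¹ • rootWeight P i) * c 1) = _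
    rw [inv_one, one_smul, ← smul_mul_assoc]
    congr 1
    change _ • ∑ j, _ = _
    rw [Finset.smul_sum, Finset.sum_eq_single i]
    · rw [smul_smul, inverse_mul_ringForm b hA hN, if_pos rfl, one_smul]
    · intro j _ hj
      rw [smul_smul, inverse_mul_ringForm b hA hN, if_neg hj.symm, zero_smul]
    · simp
  | add a a' h h' => rw [map_add, map_add, LinearMap.add_apply, Pi.add_apply, h, h', add_mul]
  | mul a a' h h' => rw [map_mul, map_mul, Module.End.mul_apply, h, h', mul_assoc]

/-- In the action on functions W → 𝒟, applying Σ a_g g to the delta function at g⁻¹ and evaluating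
at the identity returns the coefficient a_g. -/
theorem smashMap_injective : Function.Injective (smashMap b hA hN hk) := by
  classical
  have key : ∀ (c : P.weylGroup →₀ DiffOp b.support A) (e : P.weylGroup → DiffOp b.support A),
      smashEnd b hk (smashMap b hA hN hk c) e 1 = c.sum fun g a => a * e g⁻¹ := by
    intro c e
    induction c using Finsupp.induction_linear with
    | zero => rw [map_zero, map_zero, Finsupp.sum_zero_index]; rfl
    | add c c' h h' =>
      rw [map_add, map_add, LinearMap.add_apply, Pi.add_apply, h, h', Finsupp.sum_add_index']
      · simp
      · intro g a a'
        rw [add_mul]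
    | single g a =>
      rw [smashMap_single, map_mul, Module.End.mul_apply, smashEnd_ofDiffOp, smashEnd_gen,
        Finsupp.sum_single_index (by rw [zero_mul])]
      change a * e (g⁻¹ * 1) = _
      rw [mul_one]
  rw [← LinearMap.ker_eq_bot, LinearMap.ker_eq_bot']
  intro c hc
  ext g
  have h := key c (Pi.single g⁻¹ 1)
  rw [hc, map_zero, Finsupp.sum_fintype _ _ (by simp), Finset.sum_eq_single g] at h
  · rw [Pi.single_eq_same, mul_one] at h
    exact h.symm
  · intro g' _ hg
    rw [Pi.single_eq_of_ne (fun h => hg (inv_injective h)), mul_zero]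
  · simp

end SmashInjective

/-! ### Irreducibility modulo `p` -/

section Frob

open MvPolynomial

/-- The `𝒟`-submodule `(x^p)` of the polynomials. -/
def frobSub (σ : Type*) (p : ℕ) [Fact p.Prime] :
    Submodule (DiffOp σ (ZMod p)) (DiffPoly σ (ZMod p)) where
  carrier := frobIdeal σ (ZMod p) p
  zero_mem' := zero_mem _
  add_mem' := add_mem
  smul_mem' a f hf := by
    change f ∈ frobIdeal σ (ZMod p) p at hf
    change a • f ∈ frobIdeal σ (ZMod p) p
    induction a using DiffOp.induction generalizing f with
    | base c =>
      rw [algebraMap_smul, smul_eq_C_mul]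
      exact Ideal.mul_mem_left _ _ hf
    | x i => rw [DiffOp.x_smul]; exact Ideal.mul_mem_left _ _ hf
    | d i =>
      classical
      rw [DiffOp.d_smul, mem_frobIdeal_iff]
      rw [mem_frobIdeal_iff] at hf
      intro m hm
      rw [coeff_pderiv]
      by_cases h : m i + 1 < p
      · rw [hf, zero_mul]
        intro j
        by_cases hj : j = i
        · subst hj; simpa using h
        · simpa [Finsupp.single_eq_of_ne hj] using hm j
      -- The only way to leave (x^p) would be to differentiate x_i^p, which brings the factor p = 0.
      · have h1 : m i + 1 = p := by have := hm i; omega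
        have h2 : ((m i : ZMod p) + 1) = 0 := by
          have := congrArg (Nat.cast : ℕ → ZMod p) h1
          rwa [Nat.cast_add, Nat.cast_one, ZMod.natCast_self] at this
        rw [h2, mul_zero]
    | add a a' h h' => rw [add_smul]; exact add_mem (h f hf) (h' f hf)
    | mul a a' h h' => rw [mul_smul]; exact h _ (h' f hf)

theorem mem_frobSub {σ : Type*} {p : ℕ} [Fact p.Prime] {f : DiffPoly σ (ZMod p)} :
    f ∈ frobSub σ p ↔ f ∈ frobIdeal σ (ZMod p) p := Iff.rfl

end Frob

/-! ### Maximal submodules and the 𝒟-modules with nilpotent x and ∂ -/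

section Irreducible

open MvPolynomial

variable {ι V N : Type*} [Fintype ι] [AddCommGroup V] [Module ℝ V] [AddCommGroup N] [Module ℝ N]
  {P : RootPairing ι ℝ V N} [P.IsRootSystem] [P.IsCrystallographic] (b : P.Base)
  [P.IsReduced] [P.IsIrreducible]

/-- A space of polynomials that is closed under the Dunkl operators, contains `maxIdeal` and is
different from it, contains the constants. -/
theorem one_mem_of_notMem_maxIdeal {F : Type*} [Field F] {k : F}
    {T : Submodule F (MvPolynomial b.support F)} (hT : ∀ f ∈ maxIdeal b F k, f ∈ T)
    (hd : ∀ u, ∀ f ∈ T, dunkl b F k u f ∈ T) {f : MvPolynomial b.support F} (hf : f ∈ T)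
    (hf' : f ∉ maxIdeal b F k) : (1 : MvPolynomial b.support F) ∈ T := by
  obtain ⟨n, hn⟩ := exists_mem_yNil (PolyRep.of b F k f)
  induction n generalizing f with
  | zero =>
    rw [mem_yNil_zero, map_eq_zero_iff _ (PolyRep.of b F k).injective] at hn
    rw [hn] at hf'
    exact absurd (zero_mem _) hf'
  | succ n ih =>
    -- If all Dunkl derivatives of f are in the ideal, then f minus its constant term is too, and
    -- the constant term is nonzero. Otherwise one passes to a derivative outside the ideal, which
    -- is killed by shorter words.
    by_cases h : ∀ u, dunkl b F k u f ∈ maxIdeal b F k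
    · have hC : ∀ u, dunkl b F k u (C (constantCoeff f)) = 0 := fun u => by
        rw [dunkl_eq_sum_ddl, Finset.sum_eq_zero fun i _ => by rw [ddl_C, smul_zero]]
      have h1 : f - C (constantCoeff f) ∈ maxIdeal b F k := by
        intro L
        cases L with
        | nil =>
          change constantCoeff (f - C (constantCoeff f)) = 0
          rw [map_sub, constantCoeff_C, sub_self]
        | cons u L => rw [dunklWord_cons, map_sub, hC, sub_zero]; exact h u L
      have h2 : C (constantCoeff f) ∈ T := by
        have := sub_mem hf (hT _ h1)
        rwa [sub_sub_cancel] at this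
      have h3 : constantCoeff f ≠ 0 := fun h0 => by
        rw [h0, map_zero, sub_zero] at h1
        exact hf' h1
      have h4 := T.smul_mem (constantCoeff f)⁻¹ h2
      rwa [smul_eq_C_mul, ← map_mul, inv_mul_cancel₀ h3, map_one] at h4
    · push Not at h
      obtain ⟨u, hu⟩ := h
      exact ih (hd u f hf) hu (by rw [← gen_y_smul]; exact mem_yNil_succ.1 hn u)

theorem one_notMem_maxIdeal {A : Type*} [CommRing A] [Nontrivial A] {k : A} :
    (1 : MvPolynomial b.support A) ∉ maxIdeal b A k := fun h => by
  have := constantCoeff_of_mem_maxIdeal h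
  rw [map_one] at this
  exact one_ne_zero this

theorem isCoatom_maxSub {F : Type*} [Field F] {k : F} : IsCoatom (maxSub b F k) := by
  constructor
  · intro h
    exact one_notMem_maxIdeal b (A := F) (k := k)
      (of_mem_maxSub.1 (h ▸ Submodule.mem_top (x := PolyRep.of b F k 1)))
  · intro T hT
    obtain ⟨f, hf, hf'⟩ := Set.exists_of_ssubset hT
    refine eq_top_of_one_mem b ?_
    let T' : Submodule F (MvPolynomial b.support F) :=
      (T.restrictScalars F).comap (PolyRep.of b F k).toLinearMap
    refine one_mem_of_notMem_maxIdeal b (T := T') (fun g hg => hT.le hg) (fun u g hg => ?_)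
      (f := (PolyRep.of b F k).symm f) hf hf'
    change PolyRep.of b F k (dunkl b F k u g) ∈ T
    rw [← gen_y_smul]
    exact T.smul_mem _ hg

variable {p : ℕ} [hpp : Fact p.Prime] (hp : 1 + coxeterNumber b = p)

include hp

/-- At k = 0 the Dunkl operators are combinations of the ∂_i, so a 𝒟-submodule is closed under them,
and `one_mem_of_notMem_maxIdeal` makes no use of W. -/
theorem isCoatom_frobSub : IsCoatom (frobSub b.support p) := by
  have hk := kParam_zmod b hp
  constructor
  · intro h
    have h1 : (1 : MvPolynomial b.support (ZMod p)) ∈ frobIdeal b.support (ZMod p) p :=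
      mem_frobSub.1 (h ▸ Submodule.mem_top)
    rw [← maxIdeal_zmod b hp] at h1
    exact one_notMem_maxIdeal b h1
  · intro T hT
    obtain ⟨f, hf, hf'⟩ := Set.exists_of_ssubset hT
    have h1 : (1 : MvPolynomial b.support (ZMod p)) ∈ T := by
      refine one_mem_of_notMem_maxIdeal b (T := T.restrictScalars (ZMod p))
        (k := kParam b (ZMod p)) (fun g hg => hT.le ?_) (fun u g hg => ?_) hf fun h => hf' ?_
      · rwa [maxIdeal_zmod b hp] at hg
      · rw [dunkl_eq_sum_ddl, hk]
        refine sum_mem fun i _ => Submodule.smul_mem _ _ ?_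
        rw [ddl_zero, ← DiffOp.d_smul]
        exact T.smul_mem _ hg
      · rwa [maxIdeal_zmod b hp] at h
    rw [eq_top_iff]
    intro g _
    induction g using MvPolynomial.induction_on with
    | C a =>
      have := T.smul_mem (algebraMap (ZMod p) _ a) h1
      rwa [algebraMap_smul, smul_eq_C_mul, mul_one] at this
    | add f g hf hg => exact add_mem (hf trivial) (hg trivial)
    | mul_X f i hf =>
      rw [mul_comm, ← DiffOp.x_smul]
      exact T.smul_mem _ (hf trivial)

theorem finrank_quotient_frobSub :
    finrank (ZMod p) (DiffPoly b.support (ZMod p) ⧸ frobSub b.support p) = p ^ finrank ℝ V := by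
  rw [← finrank_quotient_maxSub b hp (isPLocal_zmod p)]
  refine LinearEquiv.finrank_eq ?_
  have h := Submodule.Quotient.equiv ((frobSub b.support p).restrictScalars (ZMod p))
    ((maxSub b (ZMod p) (kParam b (ZMod p))).restrictScalars (ZMod p))
    (PolyRep.of b (ZMod p) (kParam b (ZMod p))).toLinearEquiv ?_
  · exact (Submodule.Quotient.restrictScalarsEquiv (ZMod p) (frobSub b.support p)).symm.trans
      (h.trans (Submodule.Quotient.restrictScalarsEquiv (ZMod p)
        (maxSub b (ZMod p) (kParam b (ZMod p)))))
  ext f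
  rw [Submodule.mem_map_equiv]
  change f ∈ frobIdeal b.support (ZMod p) p ↔ f ∈ maxIdeal b (ZMod p) (kParam b (ZMod p))
  rw [maxIdeal_zmod b hp]

omit hp in
theorem coeff_pderiv_iterate {σ A : Type*} [CommRing A] (i : σ) (r : ℕ) (f : MvPolynomial σ A)
    (m : σ →₀ ℕ) : coeff m ((pderiv i)^[r] f)
      = coeff (m + Finsupp.single i r) f * ((m i + 1).ascFactorial r : A) := by
  classical
  induction r generalizing m with
  | zero => simp
  | succ r ih =>
    rw [Function.iterate_succ_apply', coeff_pderiv, ih, add_assoc, ← Finsupp.single_add,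
      Finsupp.add_apply, Finsupp.single_eq_same, mul_assoc, add_comm 1 r,
      Nat.ascFactorial_succ, ← Nat.succ_ascFactorial]
    push_cast
    ring

omit hp in
theorem DiffOp.d_pow_smul {σ A : Type*} [CommRing A] (i : σ) (r : ℕ) (f : DiffPoly σ A) :
    DiffOp.d A i ^ r • f = (pderiv i)^[r] f := by
  induction r with
  | zero => simp
  | succ r ih => rw [pow_succ', mul_smul, ih, DiffOp.d_smul, Function.iterate_succ_apply']

omit hp in
theorem DiffOp.x_pow_smul {σ A : Type*} [CommRing A] (i : σ) (r : ℕ) (f : DiffPoly σ A) :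
    DiffOp.x A i ^ r • f = X i ^ r * f := by
  induction r with
  | zero => simp
  | succ r ih => rw [pow_succ', mul_smul, ih, DiffOp.x_smul, pow_succ', mul_assoc]

omit hp in
theorem x_pow_smul_quotient {σ : Type*} (i : σ) (u : DiffPoly σ (ZMod p) ⧸ frobSub σ p) :
    DiffOp.x (ZMod p) i ^ p • u = 0 := by
  obtain ⟨f, rfl⟩ := Submodule.mkQ_surjective _ u
  rw [← map_smul, DiffOp.x_pow_smul, Submodule.mkQ_apply, Submodule.Quotient.mk_eq_zero, mem_frobSub]
  exact Ideal.mul_mem_right _ _ (Ideal.subset_span ⟨i, rfl⟩)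

omit hp in
-- Already on polynomials ∂_i^p = 0: it multiplies coefficients by products of p consecutive
-- integers.
theorem d_pow_smul_quotient {σ : Type*} (i : σ) (u : DiffPoly σ (ZMod p) ⧸ frobSub σ p) :
    DiffOp.d (ZMod p) i ^ p • u = 0 := by
  obtain ⟨f, rfl⟩ := Submodule.mkQ_surjective _ u
  have h : (pderiv i)^[p] f = 0 := by
    ext m
    rw [coeff_pderiv_iterate, coeff_zero, (ZMod.natCast_eq_zero_iff _ p).2, mul_zero]
    exact (Nat.dvd_factorial hpp.out.pos le_rfl).trans (Nat.factorial_dvd_ascFactorial _ _)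
  rw [← map_smul, DiffOp.d_pow_smul, h, map_zero]

omit hp in
-- Finitely many commuting nilpotent operators have a common null vector: take the last nonzero
-- power of each in turn.
theorem exists_killed_by_d {σ A : Type*} [CommRing A] {M : Type*} [AddCommGroup M] [Nontrivial M]
    [Module (DiffOp σ A) M] {m : ℕ} (h : ∀ (i : σ) (u : M), DiffOp.d A i ^ m • u = 0)
    (s : Finset σ) : ∃ v : M, v ≠ 0 ∧ ∀ i ∈ s, DiffOp.d A i • v = 0 := by
  classical
  induction s using Finset.induction_on with
  | empty =>
    obtain ⟨v, hv⟩ := exists_ne (0 : M)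
    exact ⟨v, hv, by simp⟩
  | insert i s _ ih =>
    obtain ⟨v, hv, hs⟩ := ih
    have hex : ∃ r, DiffOp.d A i ^ r • v = 0 := ⟨m, h i v⟩
    have h0 : Nat.find hex ≠ 0 := fun h0 => hv (by
      have := Nat.find_spec hex
      rwa [h0, pow_zero, one_smul] at this)
    obtain ⟨r, hr⟩ := Nat.exists_eq_succ_of_ne_zero h0
    refine ⟨DiffOp.d A i ^ r • v, Nat.find_min hex (by omega), fun j hj => ?_⟩
    rcases Finset.mem_insert.1 hj with rfl | hj
    · rw [← mul_smul, ← pow_succ', ← Nat.succ_eq_add_one, ← hr]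
      exact Nat.find_spec hex
    · have hc : Commute (DiffOp.d A j) (DiffOp.d A i ^ r) :=
        Commute.pow_right (DiffOp.d_comm A j i) r
      rw [← mul_smul, hc.eq, mul_smul, hs j hj, smul_zero]

omit hp in
/-- The map from the polynomials to a `𝒟`-module given by a vector annihilated by all `∂_i`. -/
theorem exists_hom_of_killed {σ A : Type*} [CommRing A] {M : Type*} [AddCommGroup M]
    [Module (DiffOp σ A) M] {v : M} (hv : ∀ i : σ, DiffOp.d A i • v = 0) :
    ∃ φ : DiffPoly σ A →ₗ[DiffOp σ A] M, φ 1 = v := by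
  classical
  let E : MvPolynomial σ A →ₐ[A] DiffOp σ A := commEval (DiffOp.x A) (DiffOp.x_comm A)
  have hE : ∀ i, E (X i) = DiffOp.x A i := commEval_X _ _
  have hEd : ∀ i f, DiffOp.d A i • E f • v = E (pderiv i f) • v := by
    intro i f
    induction f using MvPolynomial.induction_on with
    | C a =>
      rw [pderiv_C, map_zero, zero_smul, ← algebraMap_eq, AlgHom.commutes, ← mul_smul,
        ← Algebra.commutes, mul_smul, hv, smul_zero]
    | add f g hf hg => rw [map_add, map_add, map_add, add_smul, add_smul, smul_add, hf, hg]
    | mul_X f j hf =>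
      rw [mul_comm, map_mul, hE, mul_smul, ← mul_smul, DiffOp.d_mul_x, add_smul, mul_smul, hf,
        pderiv_X_mul, map_add, map_mul, hE, add_smul, mul_smul]
      congr 1
      split_ifs
      · rw [one_smul]
      · rw [map_zero, zero_smul, zero_smul]
  refine ⟨{ toFun := fun f => E f • v
            map_add' := fun f g => by rw [map_add, add_smul]
            map_smul' := fun a f => ?_ }, ?_⟩
  · rw [RingHom.id_apply]
    induction a using DiffOp.induction generalizing f with
    | base c =>
      rw [algebraMap_smul, Algebra.smul_def, map_mul, AlgHom.commutes, mul_smul]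
    | x i => rw [DiffOp.x_smul, map_mul, hE, mul_smul]
    | d i => rw [DiffOp.d_smul, hEd]
    | add a a' h h' => rw [add_smul, map_add, add_smul, h, h', add_smul]
    | mul a a' h h' => rw [mul_smul, h, h', mul_smul]
  · change E 1 • v = v
    rw [map_one, one_smul]

/-- A vector killed by all ∂_i gives a surjection from the polynomials, whose kernel is a maximal
submodule and an ideal. Nilpotency of the x_i puts (x^p) into its radical. If the kernel differed
from (x^p), the two maximal submodules would sum to everything, so the radical would contain 1 and
the vector would be zero. -/
theorem nonempty_equiv_of_nilpotent {M : Type*} [AddCommGroup M]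
    [Module (DiffOp b.support (ZMod p)) M] (hM : IsSimpleModule (DiffOp b.support (ZMod p)) M)
    {m : ℕ} (hm : ∀ (i : b.support) (u : M),
      DiffOp.x (ZMod p) i ^ m • u = 0 ∧ DiffOp.d (ZMod p) i ^ m • u = 0) :
    Nonempty (M ≃ₗ[DiffOp b.support (ZMod p)]
      (DiffPoly b.support (ZMod p) ⧸ frobSub b.support p)) := by
  have := IsSimpleModule.nontrivial (DiffOp b.support (ZMod p)) M
  obtain ⟨v, hv, hd⟩ := exists_killed_by_d (fun i u => (hm i u).2) (Finset.univ : Finset b.support)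
  obtain ⟨φ, hφ⟩ := exists_hom_of_killed fun i => hd i (Finset.mem_univ i)
  have hsurj : Function.Surjective φ := by
    rw [← LinearMap.range_eq_top]
    refine (eq_bot_or_eq_top _).resolve_left fun h => hv ?_
    have h1 := LinearMap.mem_range_self φ 1
    rwa [h, Submodule.mem_bot, hφ] at h1
  have e := φ.quotKerEquivOfSurjective hsurj
  have hK : IsCoatom (LinearMap.ker φ) := by
    rw [← isSimpleModule_iff_isCoatom]
    exact IsSimpleModule.congr e
  have heq : LinearMap.ker φ = frobSub b.support p := by
    by_contra hne
    let I : Ideal (MvPolynomial b.support (ZMod p)) :=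
      { LinearMap.ker φ with
        smul_mem' := fun c f hf => by
          change c * f ∈ LinearMap.ker φ
          change f ∈ LinearMap.ker φ at hf
          induction c using MvPolynomial.induction_on with
          | C a =>
            have := (LinearMap.ker φ).smul_mem (algebraMap (ZMod p) _ a) hf
            rwa [algebraMap_smul, smul_eq_C_mul] at this
          | add c c' h h' => rw [add_mul]; exact add_mem h h'
          | mul_X c i h =>
            have := (LinearMap.ker φ).smul_mem (DiffOp.x (ZMod p) i) h
            rwa [DiffOp.x_smul, ← mul_assoc, mul_comm (X i)] at this }
    have hI : ∀ f, f ∈ I ↔ φ f = 0 := fun f => Iff.rfl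
    have hle : frobIdeal b.support (ZMod p) p ≤ I.radical := by
      refine Ideal.span_le.2 ?_
      rintro _ ⟨i, rfl⟩
      refine Ideal.pow_mem_of_mem _ (Ideal.mem_radical_iff.2 ⟨m, ?_⟩) _ hpp.out.pos
      have h1 := (hm i (φ 1)).1
      rw [← map_smul, DiffOp.x_pow_smul, mul_one] at h1
      exact h1
    have htop := hK.codisjoint_of_ne (isCoatom_frobSub b hp) hne
    obtain ⟨c, hc, d, hd, h1⟩ := Submodule.mem_sup.1
      (htop.eq_top ▸ Submodule.mem_top (x := (1 : DiffPoly b.support (ZMod p))))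
    have h2 : (1 : MvPolynomial b.support (ZMod p)) ∈ I.radical :=
      h1 ▸ add_mem (Ideal.le_radical (show c ∈ I from hc)) (hle hd)
    obtain ⟨r, hr⟩ := h2
    rw [one_pow, hI, hφ] at hr
    exact hv hr
  exact ⟨e.symm.trans (Submodule.quotEquivOfEq _ _ heq)⟩

end Irreducible

/-! ### Modular reduction -/

section Reduction

open MvPolynomial

variable {ι V N : Type*} [Fintype ι] [AddCommGroup V] [Module ℝ V] [AddCommGroup N] [Module ℝ N]
  {P : RootPairing ι ℝ V N} [P.IsRootSystem] [P.IsCrystallographic] (b : P.Base)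
  [P.IsReduced] [P.IsIrreducible] {p : ℕ} [hpp : Fact p.Prime] (hp : 1 + coxeterNumber b = p)

theorem map_disc {A B : Type*} [CommRing A] [CommRing B] (φ : A →+* B) (k : A) (k' : B) :
    PolyRep.map b φ k k' (disc b A k) = disc b B k' := map_rootProd b φ

include hp

theorem isSimpleModule_quotient_maxSub_zmod : IsSimpleModule (Hk b (ZMod p))
    (Polk b (ZMod p) ⧸ maxSub b (ZMod p) (kParam b (ZMod p))) :=
  isSimpleModule_iff_isCoatom.2 (isCoatom_maxSub b)

theorem map_toZMod_ringForm (u v : weightLattice P) :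
    algebraMap ℤ_[p] (ZMod p) (ringForm P ℤ_[p] u v) = ringForm P (ZMod p) u v :=
  map_ringForm_of_isPLocal b hp (isPLocal_padicInt p) _ u v

theorem map_toZMod_kParam : algebraMap ℤ_[p] (ZMod p) (kParam b ℤ_[p]) = kParam b (ZMod p) :=
  map_kParam_of_isPLocal b hp (isPLocal_padicInt p) _

/-- An element of `ℤ_p[x]` whose reduction is in `J` is, modulo `J`, divisible by `p`. -/
theorem mkQ_mem_smul_top {f : Polk b ℤ_[p]} (hf : PolyRep.map b (algebraMap ℤ_[p] (ZMod p))
      (kParam b ℤ_[p]) (kParam b (ZMod p)) f ∈ maxSub b (ZMod p) (kParam b (ZMod p))) :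
    (Jk b ℤ_[p]).mkQ f ∈
      (IsLocalRing.maximalIdeal ℤ_[p] • ⊤ : Submodule ℤ_[p] (Vk b ℤ_[p])) := by
  classical
  have hA := isPLocal_padicInt p
  obtain ⟨c, hc⟩ := exists_reducedPoly_sub_mem b hp hA ((PolyRep.of b ℤ_[p] _).symm f)
  have hJ : (Jk b ℤ_[p]).mkQ f
      = (Jk b ℤ_[p]).mkQ (PolyRep.of b _ _ (reducedPoly b.support ℤ_[p] p c)) := by
    rw [← sub_eq_zero, ← map_sub]
    refine (Submodule.Quotient.mk_eq_zero _).2 ?_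
    rw [kernelJ_eq b hp hA]
    exact hc
  have hmap : MvPolynomial.map (algebraMap ℤ_[p] (ZMod p)) (reducedPoly b.support ℤ_[p] p c)
      = reducedPoly b.support (ZMod p) p fun m => algebraMap ℤ_[p] (ZMod p) (c m) := by
    rw [reducedPoly_apply, reducedPoly_apply, map_sum]
    exact Finset.sum_congr rfl fun m _ => map_monomial _ _ _
  have h1 := map_mem_maxIdeal (algebraMap ℤ_[p] (ZMod p)) (map_toZMod_ringForm b hp)
    (map_toZMod_kParam b hp) hc
  rw [map_sub, hmap] at h1
  have h2 := sub_mem (show MvPolynomial.map (algebraMap ℤ_[p] (ZMod p))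
    ((PolyRep.of b ℤ_[p] (kParam b ℤ_[p])).symm f) ∈ maxIdeal b (ZMod p) (kParam b (ZMod p)) from hf) h1
  rw [sub_sub_cancel] at h2
  have h3 := eq_zero_of_reducedPoly_mem b hp (isPLocal_zmod p) h2
  have h4 : ∀ m, c m ∈ IsLocalRing.maximalIdeal ℤ_[p] := fun m => by
    rw [← PadicInt.ker_toZMod, RingHom.mem_ker]
    exact congrFun h3 m
  rw [hJ, reducedPoly_apply, map_sum, map_sum]
  refine sum_mem fun m _ => ?_
  have h5 : (Jk b ℤ_[p]).mkQ (PolyRep.of b _ _ (monomial (reducedExp m) (c m)))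
      = c m • (Jk b ℤ_[p]).mkQ (PolyRep.of b _ _ (monomial (reducedExp m) 1)) := by
    rw [← mul_one (c m), ← smul_eq_mul, ← smul_monomial, map_smul, smul_eq_mul, mul_one]
    rfl
  rw [h5]
  exact Submodule.smul_mem_smul (h4 m) trivial

/-- The image of δ generates the irreducible fibre modulo p, so Nakayama's lemma over ℤ_p shows that
it generates V''. -/
theorem discSpan_sup_Jk_padicInt : discSpan b ℤ_[p] (kParam b ℤ_[p]) ⊔ Jk b ℤ_[p] = ⊤ := by
  have hA := isPLocal_padicInt p
  have hfin : Module.Finite ℤ_[p] (Vk b ℤ_[p]) := by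
    have h := finite_quotient_maxSub b hp hA
    rwa [← kernelJ_eq b hp hA] at h
  let U : Submodule ℤ_[p] (Vk b ℤ_[p]) :=
    ((discSpan b ℤ_[p] (kParam b ℤ_[p])).map (Jk b ℤ_[p]).mkQ).restrictScalars ℤ_[p]
  have hU : (⊤ : Submodule ℤ_[p] (Vk b ℤ_[p])) ≤ U := by
    refine Submodule.le_of_le_smul_of_le_jacobson_bot (I := IsLocalRing.maximalIdeal ℤ_[p])
      Module.Finite.fg_top (IsLocalRing.maximalIdeal_le_jacobson _) ?_
    intro u _
    obtain ⟨f, rfl⟩ := Submodule.mkQ_surjective _ u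
    have := isSimpleModule_quotient_maxSub_zmod b hp
    obtain ⟨a, ha⟩ := IsSimpleModule.toSpanSingleton_surjective (Hk b (ZMod p))
      (mkQ_disc_ne_zero b hp (isPLocal_zmod p) rfl) ((maxSub b (ZMod p) (kParam b (ZMod p))).mkQ
        (PolyRep.map b (algebraMap ℤ_[p] (ZMod p)) (kParam b ℤ_[p]) (kParam b (ZMod p)) f))
    obtain ⟨a, rfl⟩ := RatDAHA.map_surjective b (map_toZMod_ringForm b hp) (map_toZMod_kParam b hp)
      (ZMod.ringHom_surjective _) a
    rw [LinearMap.toSpanSingleton_apply] at ha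
    have h1 := mkQ_mem_smul_top b hp (f := f - a • disck b ℤ_[p]) (by
      rw [map_sub, PolyRep.map_smul b _ (map_toZMod_ringForm b hp) (map_toZMod_kParam b hp), map_disc]
      rw [← map_smul] at ha
      exact (Submodule.Quotient.eq _).1 ha.symm)
    rw [← sub_add_cancel ((Jk b ℤ_[p]).mkQ f) ((Jk b ℤ_[p]).mkQ (a • disck b ℤ_[p])), add_comm,
      ← map_sub]
    refine Submodule.add_mem_sup ?_ h1
    exact ⟨_, Submodule.smul_mem _ a (Submodule.mem_span_singleton_self _), rfl⟩
  rw [eq_top_iff]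
  intro f _
  obtain ⟨g, hg, hgf⟩ := hU (show (Jk b ℤ_[p]).mkQ f ∈ ⊤ from trivial)
  rw [← sub_add_cancel f g, add_comm]
  exact Submodule.add_mem_sup hg ((Submodule.Quotient.eq _).1 hgf.symm)

/-- The fiber of `V''` over `𝔽_p`. -/
theorem exists_fiber_equiv {π : (ZMod p ⊗[ℤ_[p]] Hk b ℤ_[p]) ≃ₐ[ZMod p] Hk b (ZMod p)}
    (hπ : ∀ a, π (1 ⊗ₜ a) = RatDAHA.map b (algebraMap ℤ_[p] (ZMod p)) (map_toZMod_ringForm b hp)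
      (map_toZMod_kParam b hp) a) :
    ∃ e : (ZMod p ⊗[ℤ_[p]] Vk b ℤ_[p]) ≃ₗ[ZMod p]
        (Polk b (ZMod p) ⧸ maxSub b (ZMod p) (kParam b (ZMod p))),
      (∀ f : Polk b ℤ_[p], e (1 ⊗ₜ Submodule.Quotient.mk f) = Submodule.Quotient.mk
        (PolyRep.map b PadicInt.toZMod (kParam b ℤ_[p]) (kParam b (ZMod p)) f)) ∧
      ∀ (a : Hk b ℤ_[p]) (u : Vk b ℤ_[p]), e (1 ⊗ₜ (a • u)) = π (1 ⊗ₜ a) • e (1 ⊗ₜ u) := by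
  have hA := isPLocal_padicInt p
  set S := maxSub b (ZMod p) (kParam b (ZMod p))
  let _ : Module ℤ_[p] (Polk b (ZMod p) ⧸ S) := Module.compHom _ (algebraMap ℤ_[p] (ZMod p))
  have : IsScalarTower ℤ_[p] (ZMod p) (Polk b (ZMod p) ⧸ S) :=
    IsScalarTower.of_algebraMap_smul fun _ _ => rfl
  let r : Polk b ℤ_[p] →ₗ[ℤ_[p]] Polk b (ZMod p) ⧸ S :=
    { toFun := fun f => Submodule.Quotient.mk (PolyRep.map b PadicInt.toZMod (kParam b ℤ_[p])
        (kParam b (ZMod p)) f)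
      map_add' := fun f g => by rw [map_add]; rfl
      map_smul' := fun c f => by
        rw [PolyRep.map_smul_base]
        rfl }
  have hr : (Jk b ℤ_[p]).restrictScalars ℤ_[p] ≤ LinearMap.ker r := fun f hf => by
    change f ∈ Jk b ℤ_[p] at hf
    rw [kernelJ_eq b hp hA] at hf
    exact (Submodule.Quotient.mk_eq_zero _).2 (map_mem_maxIdeal (algebraMap ℤ_[p] (ZMod p))
      (map_toZMod_ringForm b hp) (map_toZMod_kParam b hp) hf)
  let q : Vk b ℤ_[p] →ₗ[ℤ_[p]] Polk b (ZMod p) ⧸ S := (Submodule.liftQ _ r hr).comp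
    (Submodule.Quotient.restrictScalarsEquiv ℤ_[p] (Jk b ℤ_[p])).symm.toLinearMap
  have hq : ∀ f : Polk b ℤ_[p], q (Submodule.Quotient.mk f) = Submodule.Quotient.mk
      (PolyRep.map b PadicInt.toZMod (kParam b ℤ_[p]) (kParam b (ZMod p)) f) := fun f => rfl
  let E : (ZMod p ⊗[ℤ_[p]] Vk b ℤ_[p]) →ₗ[ZMod p] Polk b (ZMod p) ⧸ S := q.liftBaseChange (ZMod p)
  have hE : ∀ u, E (1 ⊗ₜ u) = q u := fun u => by
    rw [LinearMap.liftBaseChange_tmul, one_smul]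
  have hsurj : Function.Surjective E := by
    intro u
    obtain ⟨f, rfl⟩ := Submodule.mkQ_surjective _ u
    obtain ⟨g, rfl⟩ := MvPolynomial.map_surjective (σ := b.support) (algebraMap ℤ_[p] (ZMod p))
      (ZMod.ringHom_surjective _) f
    exact ⟨1 ⊗ₜ Submodule.Quotient.mk (PolyRep.of b _ _ g), hE _⟩
  have hfree : Module.Free ℤ_[p] (Vk b ℤ_[p]) := by
    have h := free_quotient_maxSub b hp hA
    rwa [← kernelJ_eq b hp hA] at h
  have hfin : Module.Finite ℤ_[p] (Vk b ℤ_[p]) := by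
    have h := finite_quotient_maxSub b hp hA
    rwa [← kernelJ_eq b hp hA] at h
  have hrank : finrank ℤ_[p] (Vk b ℤ_[p]) = p ^ finrank ℝ V := by
    have h := finrank_quotient_maxSub b hp hA
    rwa [← kernelJ_eq b hp hA] at h
  have hfin' : Module.Finite (ZMod p) (Polk b (ZMod p) ⧸ S) :=
    finite_quotient_maxSub b hp (isPLocal_zmod p)
  -- The module V'' is free of rank p^n over ℤ_p and the target has the same dimension, so
  -- surjectivity is enough.
  have hinj : Function.Injective E := by
    rw [LinearMap.injective_iff_surjective_of_finrank_eq_finrank]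
    · exact hsurj
    · rw [Module.finrank_baseChange, hrank, finrank_quotient_maxSub b hp (isPLocal_zmod p)]
  refine ⟨LinearEquiv.ofBijective E ⟨hinj, hsurj⟩, fun f => (hE _).trans (hq f), fun a u => ?_⟩
  obtain ⟨f, rfl⟩ := Submodule.mkQ_surjective _ u
  refine (hE _).trans (Eq.trans ?_ (congrArg (π (1 ⊗ₜ a) • ·) (hE _).symm))
  rw [hπ, ← map_smul]
  refine (hq _).trans ?_
  change _ = RatDAHA.map b _ _ _ a • q (Submodule.Quotient.mk f)
  rw [hq, ← Submodule.Quotient.mk_smul]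
  exact congrArg _ (PolyRep.map_smul b _ (map_toZMod_ringForm b hp) (map_toZMod_kParam b hp) a f)

/-- The fiber of `Ṽ''` over `𝔽_p`. -/
theorem exists_tilde_fiber_equiv {π : (ZMod p ⊗[ℤ_[p]] Hk b ℤ_[p]) ≃ₐ[ZMod p] Hk b (ZMod p)}
    (hπ : ∀ a, π (1 ⊗ₜ a) = RatDAHA.map b (algebraMap ℤ_[p] (ZMod p)) (map_toZMod_ringForm b hp)
      (map_toZMod_kParam b hp) a) :
    ∃ e : (ZMod p ⊗[ℤ_[p]] Vtildek b ℤ_[p]) ≃ₗ[ZMod p]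
        (Polk b (ZMod p) ⧸ maxSub b (ZMod p) (kParam b (ZMod p))),
      (∀ f : discSpan b ℤ_[p] (kParam b ℤ_[p]), e (1 ⊗ₜ Submodule.Quotient.mk f) =
        Submodule.Quotient.mk
          (PolyRep.map b PadicInt.toZMod (kParam b ℤ_[p]) (kParam b (ZMod p)) f)) ∧
      ∀ (a : Hk b ℤ_[p]) (u : Vtildek b ℤ_[p]), e (1 ⊗ₜ (a • u)) = π (1 ⊗ₜ a) • e (1 ⊗ₜ u) := by
  obtain ⟨e, he, hea⟩ := exists_fiber_equiv b hp hπ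
  obtain ⟨t, ht⟩ := exists_tilde_equiv b hp (isPLocal_padicInt p) (discSpan_sup_Jk_padicInt b hp)
  have h1 : ∀ u, (t.restrictScalars ℤ_[p]).baseChange ℤ_[p] (ZMod p) _ _ (1 ⊗ₜ u) = 1 ⊗ₜ t u :=
    fun u => rfl
  refine ⟨((t.restrictScalars ℤ_[p]).baseChange ℤ_[p] (ZMod p) _ _).trans e, fun f => ?_,
    fun a u => ?_⟩
  · rw [LinearEquiv.trans_apply, h1, ht, he]
  · rw [LinearEquiv.trans_apply, LinearEquiv.trans_apply, h1, h1, map_smul, hea]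

end Reduction

/-! ### The filtration by the total degree and diagonal coinvariants -/

section GradedMaps

open MvPolynomial

theorem homogeneousComponent_map {σ A : Type*} [CommRing A]
    (T : MvPolynomial σ A →ₗ[A] MvPolynomial σ A) (s : ℕ)
    (hT : ∀ e f, f.IsHomogeneous e → (T f).IsHomogeneous (e + s)) (d : ℕ) (f : MvPolynomial σ A) :
    homogeneousComponent (d + s) (T f) = T (homogeneousComponent d f) := by
  classical
  have h1 : ∀ e, homogeneousComponent (d + s) (T (homogeneousComponent e f))
      = if e = d then T (homogeneousComponent d f) else 0 := fun e => by
    rw [homogeneousComponent_of_mem (hT e _ (homogeneousComponent_isHomogeneous e f))]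
    by_cases h : e = d
    · subst h; simp
    · rw [if_neg h, if_neg (by omega)]
  conv_lhs => rw [← sum_homogeneousComponent f]
  rw [map_sum, map_sum, Finset.sum_congr rfl fun e _ => h1 e, Finset.sum_ite_eq' _ d]
  split_ifs with h
  · rfl
  · rw [homogeneousComponent_eq_zero _ _ (by simpa using h), map_zero]

theorem prod_X_pow_add_ite {σ A : Type*} [CommRing A] [Fintype σ] [DecidableEq σ] (e : σ → ℕ) (j : σ) :
    ∏ i, (X i : MvPolynomial σ A) ^ (e i + if j = i then 1 else 0) = X j * ∏ i, X i ^ e i := by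
  simp only [pow_add, Finset.prod_mul_distrib, pow_ite, pow_one, pow_zero, Finset.prod_ite_eq,
    Finset.mem_univ, if_true, mul_comm]

end GradedMaps

/-! ### Ordered polynomials in x and D applied to a vector -/

section Ordered

open MvPolynomial

variable {ι V N : Type*} [Fintype ι] [AddCommGroup V] [Module ℝ V] [AddCommGroup N] [Module ℝ N]
  {P : RootPairing ι ℝ V N} [P.IsRootSystem] [P.IsCrystallographic] (b : P.Base)
  {A : Type*} [CommRing A] (k : A)

theorem orderedMonomial_eq (m : b.support ⊕ b.support →₀ ℕ) : orderedMonomial b A k m =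
    xMap b A k (∏ j, X j ^ m (.inl j)) * yMap b A k (∏ j, X j ^ m (.inr j)) := by
  simp only [orderedMonomial, ← xMap_X, ← yMap_X, ← map_pow, ← Finset.prod_map_toList, map_list_prod,
    List.map_map]
  rfl

theorem ordered_monomial (m : b.support ⊕ b.support →₀ ℕ) (c : A) :
    ordered b A k (monomial m c) = c • orderedMonomial b A k m := by
  have h : monomial m c = c • basisMonomials (b.support ⊕ b.support) A m := by
    rw [coe_basisMonomials, smul_monomial, smul_eq_mul, mul_one]
  rw [h, map_smul, ordered, Basis.constr_basis]

theorem ordered_rename_mul_rename (f h : MvPolynomial b.support A) :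
    ordered b A k (rename Sum.inl f * rename Sum.inr h) = xMap b A k f * yMap b A k h := by
  induction f using MvPolynomial.induction_on' with
  | add f f' hf hf' => rw [map_add, add_mul, map_add, hf, hf', map_add, add_mul]
  | monomial u a =>
    induction h using MvPolynomial.induction_on' with
    | add f f' hf hf' => rw [map_add, mul_add, map_add, hf, hf', map_add, mul_add]
    | monomial w c =>
      rw [rename_monomial, rename_monomial, monomial_mul, ordered_monomial, orderedMonomial_eq]
      have hu : monomial u a = a • ∏ j, (X j : MvPolynomial b.support A) ^ u j := by
        rw [monomial_eq, Finsupp.prod_fintype _ _ fun _ => pow_zero _, smul_eq_C_mul]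
      have hw : monomial w c = c • ∏ j, (X j : MvPolynomial b.support A) ^ w j := by
        rw [monomial_eq, Finsupp.prod_fintype _ _ fun _ => pow_zero _, smul_eq_C_mul]
      have h1 : ∀ j, (u.mapDomain Sum.inl + w.mapDomain Sum.inr : b.support ⊕ b.support →₀ ℕ) (.inl j)
          = u j := fun j => by
        rw [Finsupp.add_apply, Finsupp.mapDomain_apply Sum.inl_injective,
          Finsupp.mapDomain_of_notMem_range _ _ (by simp), add_zero]
      have h2 : ∀ j, (u.mapDomain Sum.inl + w.mapDomain Sum.inr : b.support ⊕ b.support →₀ ℕ) (.inr j)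
          = w j := fun j => by
        rw [Finsupp.add_apply, Finsupp.mapDomain_apply Sum.inr_injective,
          Finsupp.mapDomain_of_notMem_range _ _ (by simp), zero_add]
      simp only [h1, h2]
      rw [hu, hw, map_smul, map_smul, smul_mul_smul_comm]

theorem monomial_eq_rename_mul (m : b.support ⊕ b.support →₀ ℕ) (c : A) : monomial m c =
    rename Sum.inl (C c * ∏ j, X j ^ m (.inl j)) * rename Sum.inr (∏ j, X j ^ m (.inr j)) := by
  rw [monomial_eq, Finsupp.prod_fintype _ _ fun _ => pow_zero _, Fintype.prod_sum_type]
  simp only [map_mul, map_prod, map_pow, rename_X, rename_C, mul_assoc]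

theorem doublePoly_induction {motive : DoublePoly b A → Prop}
    (mul : ∀ f h, motive (rename Sum.inl f * rename Sum.inr h))
    (add : ∀ f f', motive f → motive f' → motive (f + f')) (f : DoublePoly b A) : motive f := by
  induction f using MvPolynomial.induction_on' with
  | monomial m c => rw [monomial_eq_rename_mul]; exact mul _ _
  | add f f' hf hf' => exact add f f' hf hf'

theorem diagAct_rename_inl (g : P.weylGroup) (f : MvPolynomial b.support A) :
    diagAct b A g (rename Sum.inl f) = rename Sum.inl (weylAct b A g f) := by
  have h : (diagAct b A g).comp (rename Sum.inl) = (rename Sum.inl).comp (weylAct b A g) := by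
    apply MvPolynomial.algHom_ext
    intro j
    simp [diagAct, weylAct]
  exact DFunLike.congr_fun h f

theorem diagAct_rename_inr (g : P.weylGroup) (f : MvPolynomial b.support A) :
    diagAct b A g (rename Sum.inr f) = rename Sum.inr (weylAct b A g f) := by
  have h : (diagAct b A g).comp (rename Sum.inr) = (rename Sum.inr).comp (weylAct b A g) := by
    apply MvPolynomial.algHom_ext
    intro j
    simp [diagAct, weylAct]
  exact DFunLike.congr_fun h f

theorem gen_w_mul_ordered (g : P.weylGroup) (f : DoublePoly b A) :
    gen b A k (.w g) * ordered b A k f = ordered b A k (diagAct b A g f) * gen b A k (.w g) := by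
  induction f using doublePoly_induction with
  | mul f h =>
    rw [map_mul (diagAct b A g), diagAct_rename_inl, diagAct_rename_inr, ordered_rename_mul_rename,
      ordered_rename_mul_rename, ← mul_assoc, gen_w_mul_xMap, mul_assoc, gen_w_mul_yMap, mul_assoc]
  | add f f' hf hf' => simp only [map_add, mul_add, add_mul, hf, hf']

theorem isHomogeneous_diagAct (g : P.weylGroup) {f : DoublePoly b A} {d : ℕ}
    (hf : f.IsHomogeneous d) : (diagAct b A g f).IsHomogeneous d := by
  have h := hf.aeval (φ := f) (Sum.elim
    (fun j => MvPolynomial.rename Sum.inl (xPoly b A (g • fundWeight b j)))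
    (fun j => MvPolynomial.rename Sum.inr (xPoly b A (g • fundWeight b j)))) (n := 1)
    (fun j => by
      cases j with
      | inl j => exact (isHomogeneous_xPoly _).rename_isHomogeneous
      | inr j => exact (isHomogeneous_xPoly _).rename_isHomogeneous)
  rwa [one_mul] at h

theorem homogeneousComponent_diagAct (g : P.weylGroup) (d : ℕ) (f : DoublePoly b A) :
    homogeneousComponent d (diagAct b A g f) = diagAct b A g (homogeneousComponent d f) :=
  homogeneousComponent_map (diagAct b A g).toLinearMap 0
    (fun _ _ hf => isHomogeneous_diagAct b g hf) d f

/-- The elements `x_{ω_j}` and `D_{ω_j}`. -/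
def letter : b.support ⊕ b.support → RatDAHA b A k :=
  Sum.elim (fun j => gen b A k (.x (fundWeight b j))) fun j => gen b A k (.y (fundWeight b j))

variable {k} {M : Type*} [AddCommGroup M] [Module A M] [Module (RatDAHA b A k) M]
  [IsScalarTower A (RatDAHA b A k) M] {v : M}

theorem orderedMonomial_smul_mem {m : b.support ⊕ b.support →₀ ℕ} {d : ℕ} (h : m.degree < d) :
    orderedMonomial b A k m • v ∈ filtLT b A k v d :=
  Submodule.subset_span ⟨m, h, rfl⟩

theorem filtLT_mono {d d' : ℕ} (h : d ≤ d') : filtLT b A k v d ≤ filtLT b A k v d' :=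
  Submodule.span_mono (Set.image_mono fun _ hm => lt_of_lt_of_le hm h)

theorem filtLT_zero : filtLT b A k v 0 = ⊥ := by
  rw [filtLT, show {m : b.support ⊕ b.support →₀ ℕ | m.degree < 0} = ∅ from
    Set.eq_empty_of_forall_notMem fun m hm => Nat.not_lt_zero _ hm, Set.image_empty,
    Submodule.span_empty]

theorem ordered_smul_mem {f : DoublePoly b A} {d e : ℕ} (hf : f.IsHomogeneous e) (he : e < d) :
    ordered b A k f • v ∈ filtLT b A k v d := by
  rw [f.as_sum, map_sum, Finset.sum_smul]
  refine sum_mem fun m hm => ?_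
  rw [ordered_monomial, smul_assoc]
  refine Submodule.smul_mem _ _ (orderedMonomial_smul_mem b ?_)
  rwa [degree_eq_of_coeff_ne_zero hf (mem_support_iff.1 hm)]

theorem self_mem_filtLT : v ∈ filtLT b A k v 1 := by
  have h := orderedMonomial_smul_mem b (k := k) (v := v) (m := 0) (d := 1) (by simp)
  rwa [orderedMonomial_eq, Finset.prod_eq_one fun j _ => by simp,
    Finset.prod_eq_one fun j _ => by simp, map_one, map_one, one_mul, one_smul] at h

/-- At k = 0, moving D past the x-part produces only a derivative of that part, of smaller total
degree. Up to lower terms the letters act as commuting variables. -/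
theorem letter_smul_orderedMonomial (hk : k = 0) (s : b.support ⊕ b.support)
    (m : b.support ⊕ b.support →₀ ℕ) :
    letter b k s • orderedMonomial b A k m • v
      - orderedMonomial b A k (m + Finsupp.single s 1) • v ∈ filtLT b A k v m.degree := by
  classical
  cases s with
  | inl j =>
    have h : orderedMonomial b A k (m + Finsupp.single (.inl j) 1)
        = letter b k (.inl j) * orderedMonomial b A k m := by
      rw [orderedMonomial_eq, orderedMonomial_eq, letter, Sum.elim_inl, ← xMap_X, ← mul_assoc,
        ← map_mul, ← prod_X_pow_add_ite]
      simp [Finsupp.single_apply]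
    rw [h, mul_smul, sub_self]
    exact zero_mem _
  | inr j =>
    have h1 : orderedMonomial b A k (m + Finsupp.single (.inr j) 1)
        = xMap b A k (∏ j, X j ^ m (.inl j)) * letter b k (.inr j) *
          yMap b A k (∏ j, X j ^ m (.inr j)) := by
      rw [orderedMonomial_eq, letter, Sum.elim_inr, ← yMap_X, mul_assoc, ← map_mul,
        ← prod_X_pow_add_ite]
      simp [Finsupp.single_apply]
    have h2 : letter b k (.inr j) * orderedMonomial b A k m
        - orderedMonomial b A k (m + Finsupp.single (.inr j) 1)
        = ordered b A k (rename Sum.inl (deriv b A (fundWeight b j) (∏ j, X j ^ m (.inl j))) *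
          rename Sum.inr (∏ j, X j ^ m (.inr j))) := by
      rw [h1, ordered_rename_mul_rename, orderedMonomial_eq, ← mul_assoc]
      change gen b A k (.y (fundWeight b j)) * _ * _ - _ * gen b A k (.y (fundWeight b j)) * _ = _
      rw [gen_y_mul_xMap, Finset.sum_eq_zero fun i _ => by rw [hk, zero_mul, zero_smul], add_zero,
        add_mul, add_sub_cancel_left]
    rw [← mul_smul, ← sub_smul, h2]
    have hdeg : m.degree = ∑ j, m (.inl j) + ∑ j, m (.inr j) := by
      rw [Finsupp.degree_eq_sum, Fintype.sum_sum_type]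
    have hx : (∏ j, (X j : MvPolynomial b.support A) ^ m (.inl j)).IsHomogeneous
        (∑ j, m (.inl j)) := IsHomogeneous.prod _ _ _ fun j _ => isHomogeneous_X_pow _ _
    have hy : (∏ j, (X j : MvPolynomial b.support A) ^ m (.inr j)).IsHomogeneous
        (∑ j, m (.inr j)) := IsHomogeneous.prod _ _ _ fun j _ => isHomogeneous_X_pow _ _
    cases h : ∑ j, m (.inl j) with
    | zero =>
      rw [h] at hx
      rw [eq_C_of_isHomogeneous_zero hx, ← algebraMap_eq, Derivation.map_algebraMap, map_zero,
        zero_mul, map_zero, zero_smul]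
      exact zero_mem _
    | succ d =>
      rw [h] at hx
      exact ordered_smul_mem b (((isHomogeneous_deriv _ hx).rename_isHomogeneous).mul
        hy.rename_isHomogeneous) (by omega)

theorem letter_smul_mem (hk : k = 0) (s : b.support ⊕ b.support) {d : ℕ} {u : M}
    (hu : u ∈ filtLT b A k v d) : letter b k s • u ∈ filtLT b A k v (d + 1) := by
  induction hu using Submodule.span_induction with
  | mem u hu =>
    obtain ⟨m, hm, rfl⟩ := hu
    have h := letter_smul_orderedMonomial b hk s m (v := v)
    change m.degree < d at hm
    have h1 := add_mem (filtLT_mono b (by omega) h) (orderedMonomial_smul_mem b (v := v) (k := k)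
      (m := m + Finsupp.single s 1) (d := d + 1) (by rw [map_add, Finsupp.degree_single]; omega))
    rwa [sub_add_cancel] at h1
  | zero => rw [smul_zero]; exact zero_mem _
  | add u u' _ _ h h' => rw [smul_add]; exact add_mem h h'
  | smul c u _ h => rw [smul_algebra_smul_comm]; exact Submodule.smul_mem _ _ h

theorem ordered_X_mul_smul (hk : k = 0) (s : b.support ⊕ b.support) {f : DoublePoly b A} {d : ℕ}
    (hf : f.IsHomogeneous d) :
    letter b k s • ordered b A k f • v - ordered b A k (X s * f) • v ∈ filtLT b A k v d := by
  conv => rw [f.as_sum]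
  rw [Finset.mul_sum, map_sum, map_sum, Finset.sum_smul, Finset.sum_smul, Finset.smul_sum,
    ← Finset.sum_sub_distrib]
  refine sum_mem fun m hm => ?_
  have h := letter_smul_orderedMonomial b hk s m (v := v)
  rw [degree_eq_of_coeff_ne_zero hf (mem_support_iff.1 hm)] at h
  have h1 : X s * monomial m (coeff m f) = monomial (m + Finsupp.single s 1) (coeff m f) := by
    rw [mul_comm, monomial_add_single, pow_one]
  rw [h1, ordered_monomial, ordered_monomial, smul_assoc, smul_assoc, smul_algebra_smul_comm,
    ← smul_sub]
  exact Submodule.smul_mem _ _ h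

theorem gen_w_smul_mem_filtLT {g : P.weylGroup} {c : A} (hv : gen b A k (.w g) • v = c • v) {d : ℕ}
    {u : M} (hu : u ∈ filtLT b A k v d) : gen b A k (.w g) • u ∈ filtLT b A k v d := by
  induction hu using Submodule.span_induction with
  | mem u hu =>
    obtain ⟨m, hm, rfl⟩ := hu
    have h : orderedMonomial b A k m = ordered b A k (monomial m 1) := by
      rw [ordered_monomial, one_smul]
    change gen b A k (.w g) • orderedMonomial b A k m • v ∈ _
    rw [h, ← mul_smul, gen_w_mul_ordered, mul_smul, hv, smul_algebra_smul_comm]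
    exact Submodule.smul_mem _ _ (ordered_smul_mem b
      (isHomogeneous_diagAct b g (isHomogeneous_monomial 1 rfl)) hm)
  | zero => rw [smul_zero]; exact zero_mem _
  | add u u' _ _ h h' => rw [smul_add]; exact add_mem h h'
  | smul c u _ h => rw [smul_algebra_smul_comm]; exact Submodule.smul_mem _ _ h

end Ordered

/-! ### The graded space as a quotient of the diagonal coinvariants -/

section Graded

open MvPolynomial

variable {ι V N : Type*} [Fintype ι] [AddCommGroup V] [Module ℝ V] [AddCommGroup N] [Module ℝ N]
  {P : RootPairing ι ℝ V N} [P.IsRootSystem] [P.IsCrystallographic] [P.IsReduced]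
  [P.IsIrreducible] (b : P.Base) {A : Type*} [CommRing A] {k : A}
  {M : Type*} [AddCommGroup M] [Module A M] [Module (RatDAHA b A k) M]
  [IsScalarTower A (RatDAHA b A k) M] {v : M}

/-- The ideal of the polynomials all of whose homogeneous components `f_d` satisfy
`f_d(x, D) v ∈ F_{<d}`. -/
def symbolIdeal (hk : k = 0) (v : M) : Ideal (DoublePoly b A) where
  carrier := {f | ∀ d, ordered b A k (homogeneousComponent d f) • v ∈ filtLT b A k v d}
  zero_mem' d := by rw [map_zero, map_zero, zero_smul]; exact zero_mem _
  add_mem' hf hg d := by rw [map_add, map_add, add_smul]; exact add_mem (hf d) (hg d)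
  smul_mem' c f hf := by
    simp only [Set.mem_ofPred_eq, smul_eq_mul] at hf ⊢
    induction c using MvPolynomial.induction_on with
    | C a =>
      intro d
      rw [homogeneousComponent_C_mul, ← smul_eq_C_mul, map_smul, smul_assoc]
      exact Submodule.smul_mem _ _ (hf d)
    | add c c' h h' =>
      intro d
      rw [add_mul, map_add, map_add, add_smul]
      exact add_mem (h d) (h' d)
    | mul_X c s h =>
      have hX : ∀ e (f : DoublePoly b A), f.IsHomogeneous e → (X s * f).IsHomogeneous (e + 1) :=
        fun e f hf => by rw [add_comm]; exact (isHomogeneous_X A s).mul hf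
      intro d
      rw [mul_comm c, mul_assoc]
      cases d with
      | zero =>
        rw [homogeneousComponent_zero, ← constantCoeff_eq, map_mul, constantCoeff_X, zero_mul,
          map_zero, map_zero, zero_smul]
        exact zero_mem _
      | succ d =>
        have h1 := homogeneousComponent_map (LinearMap.mulLeft A (X s)) 1 hX d (c * f)
        rw [LinearMap.mulLeft_apply, LinearMap.mulLeft_apply] at h1
        rw [h1]
        have h2 := ordered_X_mul_smul b hk s (v := v) (homogeneousComponent_isHomogeneous d (c * f))
        have h3 := sub_mem (letter_smul_mem b hk s (h d)) (filtLT_mono b (Nat.le_succ d) h2)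
        rwa [sub_sub_cancel] at h3

theorem gen_w_smul_ordered_smul (hv : ∀ g, gen b A k (.w g) • v = (weylSign b g : A) • v)
    (g : P.weylGroup) (f : DoublePoly b A) : gen b A k (.w g) • ordered b A k f • v
      = (weylSign b g : A) • ordered b A k (diagAct b A g f) • v := by
  rw [← mul_smul, gen_w_mul_ordered, mul_smul, hv, smul_algebra_smul_comm]

/-- A homogeneous invariant sends the sign vector v to a sign vector, hence to a multiple of v,
which is already in F_{<1}. In degree zero the component is absent by hypothesis. -/
theorem coinvIdeal_le_symbolIdeal (hk : k = 0)
    (hv : ∀ g, gen b A k (.w g) • v = (weylSign b g : A) • v)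
    (hsgn : ∀ u : M, (∀ i, gen b A k (.w (RootPairing.weylGroup.ofIdx P i)) • u = -u) →
      ∃ c : A, u = c • v) : coinvIdeal b A ≤ symbolIdeal b hk v := by
  refine Ideal.span_le.2 ?_
  rintro f ⟨hf, hf0⟩ d
  rcases Nat.eq_zero_or_pos d with rfl | hd
  · rw [homogeneousComponent_zero, ← constantCoeff_eq, hf0, map_zero, map_zero, zero_smul]
    exact zero_mem _
  · obtain ⟨c, hc⟩ := hsgn (ordered b A k (homogeneousComponent d f) • v) fun i => by
      rw [gen_w_smul_ordered_smul b hv, ← homogeneousComponent_diagAct, hf, weylSign_ofIdx,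
        Int.cast_neg, Int.cast_one, neg_smul, one_smul]
    rw [hc]
    exact Submodule.smul_mem _ _ (filtLT_mono b hd (self_mem_filtLT b))

theorem exists_mem_filtLT (hk : k = 0)
    (hv : ∀ g, gen b A k (.w g) • v = (weylSign b g : A) • v)
    (hgen : Submodule.span (RatDAHA b A k) {v} = ⊤) (u : M) : ∃ d, u ∈ filtLT b A k v d := by
  have key : ∀ (a : RatDAHA b A k) (u : M), (∃ d, u ∈ filtLT b A k v d) →
      ∃ d, a • u ∈ filtLT b A k v d := by
    intro a
    have hadd : ∀ u u' : M, (∃ d, u ∈ filtLT b A k v d) → (∃ d, u' ∈ filtLT b A k v d) →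
        ∃ d, u + u' ∈ filtLT b A k v d := by
      rintro u u' ⟨d, hd⟩ ⟨d', hd'⟩
      exact ⟨max d d', add_mem (filtLT_mono b (le_max_left _ _) hd)
        (filtLT_mono b (le_max_right _ _) hd')⟩
    have hlin : ∀ (s : weightLattice P → RatDAHA b A k) (w : weightLattice P),
        (s w = ∑ j : b.support, (corootPairing P j w : A) • s (fundWeight b j)) →
        (∀ j : b.support, ∀ u : M, (∃ d, u ∈ filtLT b A k v d) →
          ∃ d, s (fundWeight b j) • u ∈ filtLT b A k v d) →
        ∀ u : M, (∃ d, u ∈ filtLT b A k v d) → ∃ d, s w • u ∈ filtLT b A k v d := by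
      intro s w hs hj u hu
      rw [hs, Finset.sum_smul]
      refine Finset.sum_induction _ (fun u => ∃ d, u ∈ filtLT b A k v d) hadd ⟨0, zero_mem _⟩
        fun j _ => ?_
      obtain ⟨d, hd⟩ := hj j u hu
      exact ⟨d, by rw [smul_assoc]; exact Submodule.smul_mem _ _ hd⟩
    have hexp : ∀ w : weightLattice P, xPoly b A w
        = ∑ j : b.support, (corootPairing P j w : A) • X j := fun w => by
      rw [xPoly]
      exact Finset.sum_congr rfl fun j _ => by rw [smul_eq_C_mul, map_intCast]
    induction a using RatDAHA.induction with
    | base c => rintro u ⟨d, hd⟩; exact ⟨d, by rw [algebraMap_smul]; exact Submodule.smul_mem _ _ hd⟩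
    | gen a =>
      intro u hu
      cases a with
      | x w =>
        refine hlin (fun w => gen b A k (.x w)) w ?_ (fun j u hu => ?_) u hu
        · rw [← xMap_xPoly, hexp, map_sum]
          exact Finset.sum_congr rfl fun j _ => by rw [map_smul, xMap_X]
        · obtain ⟨d, hd⟩ := hu
          exact ⟨d + 1, letter_smul_mem b hk (.inl j) hd⟩
      | y w =>
        refine hlin (fun w => gen b A k (.y w)) w ?_ (fun j u hu => ?_) u hu
        · rw [← yMap_xPoly, hexp, map_sum]
          exact Finset.sum_congr rfl fun j _ => by rw [map_smul, yMap_X]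
        · obtain ⟨d, hd⟩ := hu
          exact ⟨d + 1, letter_smul_mem b hk (.inr j) hd⟩
      | w g =>
        obtain ⟨d, hd⟩ := hu
        exact ⟨d, gen_w_smul_mem_filtLT b (hv g) hd⟩
    | add a a' h h' => intro u hu; rw [add_smul]; exact hadd _ _ (h u hu) (h' u hu)
    | mul a a' h h' => intro u hu; rw [mul_smul]; exact h _ (h' u hu)
  obtain ⟨a, rfl⟩ := Submodule.mem_span_singleton.1 (hgen ▸ Submodule.mem_top (x := u))
  exact key a v ⟨1, self_mem_filtLT b⟩

theorem exists_filtLT_eq_top [Module.Finite A M] (hk : k = 0)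
    (hv : ∀ g, gen b A k (.w g) • v = (weylSign b g : A) • v)
    (hgen : Submodule.span (RatDAHA b A k) {v} = ⊤) : ∃ D, filtLT b A k v D = ⊤ := by
  obtain ⟨s, hs⟩ := Module.Finite.fg_top (R := A) (M := M)
  choose d hd using exists_mem_filtLT b hk hv hgen
  refine ⟨s.sup d, ?_⟩
  rw [← top_le_iff, ← hs]
  exact Submodule.span_le.2 fun u hu => filtLT_mono b (Finset.le_sup hu) (hd u)

end Graded

/-! ### An equivariant splitting of the degree filtration -/

section Splitting

open MvPolynomial

variable {ι V N : Type*} [Fintype ι] [AddCommGroup V] [Module ℝ V] [AddCommGroup N] [Module ℝ N]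
  {P : RootPairing ι ℝ V N} [P.IsRootSystem] [P.IsCrystallographic] [P.IsReduced]
  [P.IsIrreducible] (b : P.Base) {F : Type*} [Field F] {k : F}
  {M : Type*} [AddCommGroup M] [Module F M] [Module (RatDAHA b F k) M]
  [IsScalarTower F (RatDAHA b F k) M] {v : M}

/-- Maschke's argument: average a linear projection over W, whose order is invertible. -/
theorem exists_equivariant_projection (hW : (Fintype.card P.weylGroup : F) ≠ 0) (U : Submodule F M)
    (hU : ∀ g, ∀ u ∈ U, gen b F k (.w g) • u ∈ U) :
    ∃ q : M →ₗ[F] M, (∀ u, q u ∈ U) ∧ (∀ u ∈ U, q u = u) ∧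
      ∀ g u, q (gen b F k (.w g) • u) = gen b F k (.w g) • q u := by
  obtain ⟨r, hr⟩ := LinearMap.exists_leftInverse_of_injective U.subtype U.ker_subtype
  have hr' : ∀ u (hu : u ∈ U), r u = ⟨u, hu⟩ := fun u hu => DFunLike.congr_fun hr ⟨u, hu⟩
  have hinv : ∀ g (u : M), gen b F k (.w g) • gen b F k (.w g⁻¹) • u = u := fun g u => by
    rw [← mul_smul, ← gen_w_mul, mul_inv_cancel, gen_w_one, one_smul]
  let q : M →ₗ[F] M := (Fintype.card P.weylGroup : F)⁻¹ • ∑ g : P.weylGroup,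
    (Algebra.lsmul F F M (gen b F k (.w g))).comp (U.subtype.comp (r.comp
      (Algebra.lsmul F F M (gen b F k (.w g⁻¹)))))
  have hq : ∀ u, q u = (Fintype.card P.weylGroup : F)⁻¹ • ∑ g : P.weylGroup,
      gen b F k (.w g) • (r (gen b F k (.w g⁻¹) • u) : M) := fun u => by
    simp [q, LinearMap.sum_apply]
  refine ⟨q, fun u => ?_, fun u hu => ?_, fun g u => ?_⟩
  · rw [hq]
    exact U.smul_mem _ (sum_mem fun g _ => hU g _ (r _).2)
  · rw [hq, Finset.sum_congr rfl fun g _ => by rw [hr' _ (hU g⁻¹ u hu), hinv], Finset.sum_const,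
      Finset.card_univ, ← Nat.cast_smul_eq_nsmul F, smul_smul, inv_mul_cancel₀ hW, one_smul]
  · rw [hq, hq, smul_algebra_smul_comm]
    congr 1
    rw [Finset.smul_sum]
    refine (Fintype.sum_equiv (Equiv.mulLeft g)
      (fun w => gen b F k (.w g) • gen b F k (.w w) • (r (gen b F k (.w w⁻¹) • u) : M))
      (fun w => gen b F k (.w w) • (r (gen b F k (.w w⁻¹) • gen b F k (.w g) • u) : M))
      fun w => ?_).symm
    rw [Equiv.coe_mulLeft, ← mul_smul (gen b F k (.w g)), ← gen_w_mul, ← mul_smul _ _ u, ← gen_w_mul,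
      mul_inv_rev, inv_mul_cancel_right]

variable [Module.Finite F M]

/-- With equivariant projections q_d onto F_{<d}, put T f = Σ_d (1 - q_d) f_d(x, D) v, the sum
ending where the filtration is exhausted. The summand of index d represents the class of f_d(x, D) v
modulo F_{<d} inside M, so the graded space is realized on M itself. The sign in the equivariance is
that of v. -/
theorem exists_symbolMap (hk : k = 0) (hW : (Fintype.card P.weylGroup : F) ≠ 0)
    (hv : ∀ g, gen b F k (.w g) • v = (weylSign b g : F) • v)
    (hgen : Submodule.span (RatDAHA b F k) {v} = ⊤) :
    ∃ T : DoublePoly b F →ₗ[F] M, Function.Surjective T ∧ (∀ f, T f = 0 ↔ f ∈ symbolIdeal b hk v) ∧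
      ∀ g f, T (diagAct b F g f) = (weylSign b g : F) • gen b F k (.w g) • T f := by
  obtain ⟨D, hD⟩ := exists_filtLT_eq_top b hk hv hgen
  choose q hq1 hq2 hq3 using fun d => exists_equivariant_projection b hW (filtLT b F k v d)
    fun g u hu => gen_w_smul_mem_filtLT b (hv g) hu
  let Φ : DoublePoly b F →ₗ[F] M :=
    { toFun := fun f => ordered b F k f • v
      map_add' := fun f f' => by rw [map_add, add_smul]
      map_smul' := fun c f => by rw [map_smul, smul_assoc, RingHom.id_apply] }
  let T : DoublePoly b F →ₗ[F] M := ∑ d ∈ Finset.range D,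
    (LinearMap.id - q d).comp (Φ.comp (homogeneousComponent d))
  have hT : ∀ f, T f = ∑ d ∈ Finset.range D, (ordered b F k (homogeneousComponent d f) • v -
      q d (ordered b F k (homogeneousComponent d f) • v)) := fun f => by
    simp only [T, LinearMap.sum_apply]
    rfl
  have hhom : ∀ d f, ordered b F k (homogeneousComponent d f) • v ∈ filtLT b F k v (d + 1) :=
    fun d f => ordered_smul_mem b (homogeneousComponent_isHomogeneous d f) (Nat.lt_succ_self d)
  have hq0 : ∀ d u, u - q d u ∈ filtLT b F k v d → u ∈ filtLT b F k v d := fun d u h => by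
    have h1 := add_mem h (hq1 d u)
    rwa [sub_add_cancel] at h1
  refine ⟨T, fun u => ?_, fun f => ⟨fun h => ?_, fun h => ?_⟩, fun g f => ?_⟩
  -- On a monomial of degree d the map gives its vector up to an element of F_{<d}, so the steps of
  -- the filtration enter the range one after another.
  · have hle : ∀ d, d ≤ D → filtLT b F k v d ≤ LinearMap.range T := by
      intro d
      induction d with
      | zero => intro _; rw [filtLT_zero]; exact bot_le
      | succ d ih =>
        intro hd
        refine Submodule.span_le.2 ?_
        rintro _ ⟨m, hm, rfl⟩
        change m.degree < d + 1 at hm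
        rcases Nat.lt_succ_iff_lt_or_eq.1 hm with h | h
        · exact ih (by omega) (orderedMonomial_smul_mem b h)
        · have h1 : T (monomial m 1) = orderedMonomial b F k m • v -
              q d (orderedMonomial b F k m • v) := by
            have hm' : (monomial m (1 : F)).IsHomogeneous d := isHomogeneous_monomial 1 h
            rw [hT, Finset.sum_eq_single_of_mem d (Finset.mem_range.2 (by omega)) fun e _ he => by
              rw [homogeneousComponent_of_mem hm', if_neg he, map_zero, zero_smul, map_zero,
                sub_zero]]
            rw [homogeneousComponent_of_mem hm', if_pos rfl, ordered_monomial, one_smul]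
          have h2 := add_mem (LinearMap.mem_range_self T (monomial m 1)) (ih (by omega) (hq1 d
            (orderedMonomial b F k m • v)))
          rwa [h1, sub_add_cancel] at h2
    exact hle D le_rfl (hD ▸ Submodule.mem_top)
  · rw [hT] at h
    -- Triangularity: all summands but the last lie in F_{<n}, so the last vector does too. Its own
    -- summand then vanishes, and one descends.
    have key : ∀ n, n ≤ D → ∑ d ∈ Finset.range n, (ordered b F k (homogeneousComponent d f) • v -
        q d (ordered b F k (homogeneousComponent d f) • v)) = 0 →
        ∀ d < n, ordered b F k (homogeneousComponent d f) • v ∈ filtLT b F k v d := by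
      intro n
      induction n with
      | zero => intro _ _ d hd; omega
      | succ n ih =>
        intro hn h0 d hd
        rw [Finset.sum_range_succ] at h0
        have h1 : ordered b F k (homogeneousComponent n f) • v ∈ filtLT b F k v n := by
          refine hq0 n _ ?_
          rw [eq_neg_of_add_eq_zero_right h0]
          refine neg_mem (sum_mem fun e he => ?_)
          have he' := Finset.mem_range.1 he
          exact filtLT_mono b he' (sub_mem (hhom e f) (filtLT_mono b (Nat.le_succ e) (hq1 e _)))
        rcases Nat.lt_succ_iff_lt_or_eq.1 hd with hd | rfl
        · refine ih (by omega) ?_ d hd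
          rwa [hq2 n _ h1, sub_self, add_zero] at h0
        · exact h1
    intro d
    rcases lt_or_ge d D with hd | hd
    · exact key D le_rfl h d hd
    · exact filtLT_mono b hd (hD ▸ Submodule.mem_top)
  · rw [hT]
    exact Finset.sum_eq_zero fun d _ => by rw [hq2 d _ (h d), sub_self]
  · rw [hT, hT, Finset.smul_sum, Finset.smul_sum]
    refine Finset.sum_congr rfl fun d _ => ?_
    have h1 : ordered b F k (homogeneousComponent d (diagAct b F g f)) • v = (weylSign b g : F) •
        gen b F k (.w g) • ordered b F k (homogeneousComponent d f) • v := by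
      rw [homogeneousComponent_diagAct, gen_w_smul_ordered_smul b hv, smul_smul,
        weylSign_cast_mul_self, one_smul]
    rw [h1, map_smul, hq3, ← smul_sub, ← smul_sub]

theorem exists_graded_quotient (hk : k = 0) (hW : (Fintype.card P.weylGroup : F) ≠ 0)
    (hv : ∀ g, gen b F k (.w g) • v = (weylSign b g : F) • v)
    (hgen : Submodule.span (RatDAHA b F k) {v} = ⊤)
    (hsgn : ∀ u : M, (∀ i, gen b F k (.w (RootPairing.weylGroup.ofIdx P i)) • u = -u) →
      ∃ c : F, u = c • v) :
    ∃ I : Ideal (DiagCoinv b F),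
      (∀ f : DoublePoly b F, Ideal.Quotient.mk _ f ∈ I ↔ ∀ d : ℕ,
        ordered b F k (homogeneousComponent d f) • v ∈ filtLT b F k v d) ∧
      ∃ e : (DiagCoinv b F ⧸ I) ≃ₗ[F] M, ∀ g (f : DoublePoly b F),
        e (Ideal.Quotient.mk I (Ideal.Quotient.mk _ (diagAct b F g f))) = (weylSign b g : F) •
          gen b F k (.w g) • e (Ideal.Quotient.mk I (Ideal.Quotient.mk _ f)) := by
  obtain ⟨T, hsurj, hker, hT⟩ := exists_symbolMap b hk hW hv hgen
  have hle := coinvIdeal_le_symbolIdeal b hk hv hsgn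
  have hI : (symbolIdeal b hk v).restrictScalars F = LinearMap.ker T := by
    ext f
    exact (hker f).symm
  refine ⟨(symbolIdeal b hk v).map (Ideal.Quotient.mk _), fun f => Ideal.mem_quotient_iff_mem hle,
    (DoubleQuot.quotQuotEquivQuotOfLEₐ F hle).toLinearEquiv.trans
      ((Submodule.Quotient.restrictScalarsEquiv F (symbolIdeal b hk v)).symm.trans
        ((Submodule.quotEquivOfEq _ _ hI).trans (T.quotKerEquivOfSurjective hsurj))),
    fun g f => hT g f⟩

end Splitting

end DAHA

end

theorem mainTheorem5 {ι V N : Type*} [Fintype ι] [AddCommGroup V] [Module ℝ V]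
    [AddCommGroup N] [Module ℝ N] (P : RootPairing ι ℝ V N) [P.IsRootSystem]
    [P.IsCrystallographic] [P.IsReduced] [P.IsIrreducible] (b : P.Base)
    (p : ℕ) [Fact p.Prime] (hp : 1 + DAHA.coxeterNumber b = p) :
    -- Gordon's theorem: `V''` is the unique irreducible quotient of the polynomial representation,
    -- its dimension is `p ^ n`, the sign character occurs in it once, and it coincides with `Ṽ''`
    (∀ (K : Type*) [Field K] [CharZero K],
      (IsSimpleModule (DAHA.Hk b K) (DAHA.Vk b K) ∧
        (∀ S : Submodule (DAHA.Hk b K) (DAHA.Polk b K),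
          IsSimpleModule (DAHA.Hk b K) (DAHA.Polk b K ⧸ S) → S = DAHA.Jk b K) ∧
        Module.finrank K (DAHA.Vk b K) = p ^ Module.finrank ℝ V) ∧
      ((DAHA.Jk b K).mkQ (DAHA.disck b K) ≠ 0 ∧
        ∀ u : DAHA.Vk b K,
          (∀ i, DAHA.genk b K (.w (RootPairing.weylGroup.ofIdx P i)) • u = -u) →
          ∃ c : K, u = c • (DAHA.Jk b K).mkQ (DAHA.disck b K)) ∧
      IsSimpleModule (DAHA.Hk b K) (DAHA.Vtildek b K) ∧
      (∃ e : DAHA.Vtildek b K ≃ₗ[DAHA.Hk b K] DAHA.Vk b K,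
          ∀ f : DAHA.discSpan b K (DAHA.kParam b K),
            e (Submodule.Quotient.mk f) = Submodule.Quotient.mk (f : DAHA.Polk b K)) ∧
      (∃ e : (DAHA.Hk b K ⧸ DAHA.signIoIdeal b K (DAHA.kParam b K)) ≃ₗ[DAHA.Hk b K] DAHA.Vk b K,
          e (Submodule.Quotient.mk 1) = Submodule.Quotient.mk (DAHA.disck b K))) ∧
    -- the module `V''` over `ℤ_p` is the image of `ℤ_p[x]` in the module `V''` over `ℚ_p`
    (∀ f : DAHA.Polk b ℤ_[p],
      f ∈ DAHA.Jk b ℤ_[p] ↔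
        DAHA.PolyRep.map b (algebraMap ℤ_[p] ℚ_[p]) (DAHA.kParam b ℤ_[p]) (DAHA.kParam b ℚ_[p]) f ∈
          DAHA.Jk b ℚ_[p]) ∧
    -- the modular reduction: `k = 0` in `𝔽_p`
    DAHA.kParam b (ZMod p) = 0 ∧
    -- the fiber of the rational DAHA over `𝔽_p`
    ∃ π : (ZMod p ⊗[ℤ_[p]] DAHA.Hk b ℤ_[p]) ≃ₐ[ZMod p] DAHA.Hk b (ZMod p),
      (∀ a, π (1 ⊗ₜ DAHA.genk b ℤ_[p] a) = DAHA.genk b (ZMod p) a) ∧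
    -- it is the (semidirect product with `W` of the) algebra of differential operators
    (∃ j : DAHA.DiffOp b.support (ZMod p) →ₐ[ZMod p] DAHA.Hk b (ZMod p),
        (∀ i, j (DAHA.DiffOp.x (ZMod p) i) = DAHA.genk b (ZMod p) (.x (DAHA.fundWeight b i))) ∧
        (∀ u, DAHA.genk b (ZMod p) (.y u) = ∑ i, DAHA.ringForm P (ZMod p) u (DAHA.fundWeight b i) •
          j (DAHA.DiffOp.d (ZMod p) i)) ∧
        Function.Bijective (fun c : P.weylGroup →₀ DAHA.DiffOp b.support (ZMod p) =>
          c.sum fun g a => j a * DAHA.genk b (ZMod p) (.w g)) ∧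
        (∀ (a : DAHA.DiffOp b.support (ZMod p)) (f : DAHA.DiffPoly b.support (ZMod p)),
          j a • DAHA.PolyRep.of b (ZMod p) (DAHA.kParam b (ZMod p)) f =
            DAHA.PolyRep.of b (ZMod p) (DAHA.kParam b (ZMod p)) (a • f))) ∧
    -- the unique irreducible representation of the differential operators with nilpotent `x, ∂`
    (∃ S : Submodule (DAHA.DiffOp b.support (ZMod p)) (DAHA.DiffPoly b.support (ZMod p)),
        (∀ f, f ∈ S ↔ f ∈ DAHA.frobIdeal b.support (ZMod p) p) ∧
        IsSimpleModule (DAHA.DiffOp b.support (ZMod p))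
          (DAHA.DiffPoly b.support (ZMod p) ⧸ S) ∧
        Module.finrank (ZMod p) (DAHA.DiffPoly b.support (ZMod p) ⧸ S) =
          p ^ Module.finrank ℝ V ∧
        (∃ m : ℕ, ∀ (i : b.support) (u : DAHA.DiffPoly b.support (ZMod p) ⧸ S),
          DAHA.DiffOp.x (ZMod p) i ^ m • u = 0 ∧ DAHA.DiffOp.d (ZMod p) i ^ m • u = 0) ∧
        ∀ (M : Type*) [AddCommGroup M] [Module (DAHA.DiffOp b.support (ZMod p)) M],
          IsSimpleModule (DAHA.DiffOp b.support (ZMod p)) M →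
          (∃ m : ℕ, ∀ (i : b.support) (u : M),
            DAHA.DiffOp.x (ZMod p) i ^ m • u = 0 ∧ DAHA.DiffOp.d (ZMod p) i ^ m • u = 0) →
          Nonempty (M ≃ₗ[DAHA.DiffOp b.support (ZMod p)]
            (DAHA.DiffPoly b.support (ZMod p) ⧸ S))) ∧
    -- the fibers of `V''` and `Ṽ''` over `𝔽_p` are `𝔽_p[x] / (x^p)`, irreducible
    ∃ S : Submodule (DAHA.Hk b (ZMod p)) (DAHA.Polk b (ZMod p)),
      (∀ f, DAHA.PolyRep.of b _ _ f ∈ S ↔ f ∈ DAHA.frobIdeal b.support (ZMod p) p) ∧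
      IsSimpleModule (DAHA.Hk b (ZMod p)) (DAHA.Polk b (ZMod p) ⧸ S) ∧
      Module.finrank (ZMod p) (DAHA.Polk b (ZMod p) ⧸ S) =
        p ^ Module.finrank ℝ V ∧
      (S.mkQ (DAHA.disck b (ZMod p)) ≠ 0 ∧
        ∀ u : DAHA.Polk b (ZMod p) ⧸ S,
          (∀ i, DAHA.genk b (ZMod p) (.w (RootPairing.weylGroup.ofIdx P i)) • u = -u) →
          ∃ c : ZMod p, u = c • S.mkQ (DAHA.disck b (ZMod p))) ∧
      (∃ e : (ZMod p ⊗[ℤ_[p]] DAHA.Vk b ℤ_[p]) ≃ₗ[ZMod p] (DAHA.Polk b (ZMod p) ⧸ S),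
          (∀ f : DAHA.Polk b ℤ_[p],
            e (1 ⊗ₜ Submodule.Quotient.mk f) =
              Submodule.Quotient.mk (DAHA.PolyRep.map b PadicInt.toZMod (DAHA.kParam b ℤ_[p])
                (DAHA.kParam b (ZMod p)) f)) ∧
          ∀ (a : DAHA.Hk b ℤ_[p]) (u : DAHA.Vk b ℤ_[p]),
            e (1 ⊗ₜ (a • u)) = π (1 ⊗ₜ a) • e (1 ⊗ₜ u)) ∧
      (∃ e : (ZMod p ⊗[ℤ_[p]] DAHA.Vtildek b ℤ_[p]) ≃ₗ[ZMod p] (DAHA.Polk b (ZMod p) ⧸ S),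
          (∀ f : DAHA.discSpan b ℤ_[p] (DAHA.kParam b ℤ_[p]),
            e (1 ⊗ₜ Submodule.Quotient.mk f) =
              Submodule.Quotient.mk (DAHA.PolyRep.map b PadicInt.toZMod (DAHA.kParam b ℤ_[p])
                (DAHA.kParam b (ZMod p)) f)) ∧
          ∀ (a : DAHA.Hk b ℤ_[p]) (u : DAHA.Vtildek b ℤ_[p]),
            e (1 ⊗ₜ (a • u)) = π (1 ⊗ₜ a) • e (1 ⊗ₜ u)) ∧
      -- the quotient of the diagonal coinvariants modulo `p`, which is the graded space of this
      -- module for the filtration by the total `x, y`-degree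
      ∃ I : Ideal (DAHA.DiagCoinv b (ZMod p)),
        (∀ f : DAHA.DoublePoly b (ZMod p), Ideal.Quotient.mk _ f ∈ I ↔
          ∀ d : ℕ, DAHA.ordered b (ZMod p) (DAHA.kParam b (ZMod p))
              (MvPolynomial.homogeneousComponent d f) •
                S.mkQ (DAHA.disck b (ZMod p)) ∈
            DAHA.filtLT b (ZMod p) (DAHA.kParam b (ZMod p))
              (S.mkQ (DAHA.disck b (ZMod p))) d) ∧
        Module.finrank (ZMod p) (DAHA.DiagCoinv b (ZMod p) ⧸ I) = p ^ Module.finrank ℝ V ∧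
        ∃ e : (DAHA.DiagCoinv b (ZMod p) ⧸ I) ≃ₗ[ZMod p] (DAHA.Polk b (ZMod p) ⧸ S),
          ∀ i (f : DAHA.DoublePoly b (ZMod p)),
            e (Ideal.Quotient.mk I (Ideal.Quotient.mk _
                (DAHA.diagAct b (ZMod p) (RootPairing.weylGroup.ofIdx P i) f))) =
              -(DAHA.genk b (ZMod p) (.w (RootPairing.weylGroup.ofIdx P i)) •
                  e (Ideal.Quotient.mk I (Ideal.Quotient.mk _ f))) := by
  obtain ⟨π, hπ, hπ'⟩ := DAHA.exists_baseChangeEquiv b (DAHA.map_toZMod_ringForm b hp)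
    (DAHA.map_toZMod_kParam b hp)
  have hA := DAHA.isPLocal_zmod p
  have hk := DAHA.kParam_zmod b hp
  have hL := DAHA.isUnit_latticeDenom b hp hA
  have hN := DAHA.isUnit_halfNorm b hp hA
  refine ⟨fun K _ _ => DAHA.gordon b hp K, DAHA.mem_Jk_padicInt_iff b hp, hk, π, hπ,
    ⟨DAHA.ofDiffOp b hL hN hk, DAHA.ofDiffOp_x b hL hN hk, DAHA.gen_y_eq_sum_ofDiffOp b hL hN hk,
      ⟨DAHA.smashMap_injective b hL hN hk, DAHA.smashMap_surjective b hL hN hk⟩,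
      DAHA.ofDiffOp_smul b hL hN hk⟩,
    ⟨DAHA.frobSub b.support p, fun f => Iff.rfl,
      isSimpleModule_iff_isCoatom.2 (DAHA.isCoatom_frobSub b hp),
      DAHA.finrank_quotient_frobSub b hp,
      ⟨p, fun i u => ⟨DAHA.x_pow_smul_quotient i u, DAHA.d_pow_smul_quotient i u⟩⟩,
      fun M _ _ hM ⟨m, hm⟩ => DAHA.nonempty_equiv_of_nilpotent b hp hM hm⟩, ?_⟩
  have hsimple := DAHA.isSimpleModule_quotient_maxSub_zmod b hp
  have hne := DAHA.mkQ_disc_ne_zero b hp hA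
    (J := DAHA.maxSub b (ZMod p) (DAHA.kParam b (ZMod p))) rfl
  have hsgn : ∀ u : DAHA.Polk b (ZMod p) ⧸ DAHA.maxSub b (ZMod p) (DAHA.kParam b (ZMod p)),
      (∀ i, DAHA.genk b (ZMod p) (.w (RootPairing.weylGroup.ofIdx P i)) • u = -u) →
      ∃ c : ZMod p, u = c • (DAHA.maxSub b (ZMod p) (DAHA.kParam b (ZMod p))).mkQ
        (DAHA.disck b (ZMod p)) := fun u hu => DAHA.exists_eq_smul_disc b hp hA rfl hu
  have hfin : Module.Finite (ZMod p)
      (DAHA.Polk b (ZMod p) ⧸ DAHA.maxSub b (ZMod p) (DAHA.kParam b (ZMod p))) :=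
    DAHA.finite_quotient_maxSub b hp hA
  obtain ⟨I, hI, e, he⟩ := DAHA.exists_graded_quotient b hk (DAHA.card_weylGroup_ne_zero b hp)
    (v := (DAHA.maxSub b (ZMod p) (DAHA.kParam b (ZMod p))).mkQ (DAHA.disck b (ZMod p)))
    (fun g => by rw [← map_smul, DAHA.gen_w_smul_disc, map_zsmul, Int.cast_smul_eq_zsmul])
    (by
      -- The sign vector generates the module because the module is irreducible and the vector is
      -- nonzero.
      rw [eq_top_iff]
      intro u _
      obtain ⟨a, rfl⟩ := IsSimpleModule.toSpanSingleton_surjective (DAHA.Hk b (ZMod p)) hne u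
      exact Submodule.smul_mem _ _ (Submodule.mem_span_singleton_self _)) hsgn
  refine ⟨DAHA.maxSub b (ZMod p) (DAHA.kParam b (ZMod p)), fun f => ?_, hsimple,
    DAHA.finrank_quotient_maxSub b hp hA, ⟨hne, hsgn⟩, DAHA.exists_fiber_equiv b hp hπ',
    DAHA.exists_tilde_fiber_equiv b hp hπ', I, hI, ?_, e, fun i f => ?_⟩
  · rw [DAHA.of_mem_maxSub, DAHA.maxIdeal_zmod b hp]
  · rw [e.finrank_eq, DAHA.finrank_quotient_maxSub b hp hA]
  · rw [he, DAHA.weylSign_ofIdx, Int.cast_neg, Int.cast_one, neg_smul, one_smul]
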